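/- Let $\pi\colon E\to M$ be a smooth locally trivial fiber bundle, $\dim M=n\ge 1$, $\dim E=n+m$ (manifolds are Hausdorff and second countable). Let $J^\infty(\pi_{1,0})$ be the space of infinite jets $[\nabla]^\infty_\theta$ of local connections $\nabla$ in $\pi$ (that is, local sections of $\pi_{1,0}\colon J^1(\pi)\to E$) at points $\theta\in E$, and let $C^\infty(J^\infty(\pi_{1,0}))=\bigcup_k C^\infty(J^k(\pi_{1,0}))$. Let $\mathcal{E}_{\mathrm{fc}}\subset J^\infty(\pi_{1,0})$ be the infinitely prolonged equation of flat connections, i.e. the set of all $[\nabla]^\infty_\theta$ such that the curvature of $\nabla$, in adapted coordinates $$\frac{\partial v_j^\alpha}{\partial x_i}+\sum_\beta v_i^\beta\frac{\partial v_j^\alpha}{\partial v^\beta}-\frac{\partial v_i^\alpha}{\partial x_j}-\sum_\beta v_j^\beta\frac{\partial v_i^\alpha}{\partial v^\beta},\qquad \nabla(\partial_{x_i})=\partial_{x_i}+\sum_\alpha v_i^\alpha\partial_{v^\alpha},$$ vanishes to infinite order at $\theta$. Let $C^\infty(\mathcal{E}_{\mathrm{fc}})$ be the algebra of restrictions to $\mathcal{E}_{\mathrm{fc}}$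 of functions in $C^\infty(J^\infty(\pi_{1,0}))$, and let vector fields on $\mathcal{E}_{\mathrm{fc}}$ be its derivations, $\mathrm{D}(\mathcal{E}_{\mathrm{fc}})=\mathrm{Der}\,C^\infty(\mathcal{E}_{\mathrm{fc}})$. The Cartan lift of $v\in T_\theta E$ to the point $[\nabla]^\infty_\theta$ is the tangent vector $f\mapsto d(f\circ j_\infty(\nabla))_\theta(v)$; a vector field on $\mathcal{E}_{\mathrm{fc}}$ lies in the Cartan distribution if at every point it is the Cartan lift of some $v\in T_\theta E$. Let $\tilde\pi\colon\mathcal{E}_{\mathrm{fc}}\to M$ be the projection, and let $\mathcal{C}_{\mathrm{fc}}$ be the connection in $\tilde\pi$ which lifts $w\in T_{\pi(\theta)}M$ to the Cartan lift of $\nabla w\in T_\theta E$ at $[\nabla]^\infty_\theta$. Let $\bar U_{\mathrm{fc}}$ be the associated vector-valued $1$-form, $\bar U_{\mathrm{fc}}(X)=\mathcal{C}_{\mathrm{fc}}(X|_{C^\infty(M)})$ for $X\in\mathrm{D}(\mathcal{E}_{\mathrm{fc}})$, and let $\partial_{\mathrm{fc}}=[\![\bar U_{\mathrm{fc}},\cdot]\!]$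 (Frölicher–Nijenhuis bracket). Let $\mathcal{V}=\mathcal{V}^0$ be the module of $\tilde\pi$-vertical vector fields on $\mathcal{E}_{\mathrm{fc}}$ lying in the Cartan distribution, and let $\mathcal{V}^q=\tilde\pi^*(\Lambda^q(M))\otimes\mathcal{V}$ be the $\mathcal{V}$-valued horizontal $q$-forms. Then $\bar U_{\mathrm{fc}}$ is well defined on $\mathcal{E}_{\mathrm{fc}}$ (it exists and is unique), and the complex $0\to\mathcal{V}\xrightarrow{\partial_{\mathrm{fc}}}\mathcal{V}^1\xrightarrow{\partial_{\mathrm{fc}}}\mathcal{V}^2\to\cdots$ is $0$-acyclic: $$\ker(\partial_{\mathrm{fc}}\colon\mathcal{V}\to\mathcal{V}^1)=0,$$ and, if $n\ge 2$, it is $1$-acyclic: $$\partial_{\mathrm{fc}}(\mathcal{V})=\ker(\partial_{\mathrm{fc}}\colon\mathcal{V}^1\to\mathcal{V}^2).$$ Both hold independently of the topology of $M$ and $E$. -/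

import Mathlib

open scoped Manifold ContDiff

noncomputable section

namespace FlatConn

/-- The model space `ℝ^k`. -/
abbrev Rn (k : ℕ) : Type := EuclideanSpace ℝ (Fin k)

/-- The model with corners of an `n`-dimensional base manifold. -/
abbrev IB (n : ℕ) : ModelWithCorners ℝ (Rn n) (Rn n) := 𝓡 n

/-- The model with corners `ℝ^n × ℝ^m` of the `(n + m)`-dimensional total space. -/
abbrev IT (n m : ℕ) :
    ModelWithCorners ℝ (Rn n × Rn m) (ModelProd (Rn n) (Rn m)) := (𝓡 n).prod (𝓡 m)

/-- `π : E → M` is a smooth locally trivial fiber bundle with typical fiber `F`. -/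
def IsSmoothFiberBundle (n m : ℕ) {M E : Type*} (F : Type*)
    [TopologicalSpace M] [ChartedSpace (Rn n) M]
    [TopologicalSpace E] [ChartedSpace (ModelProd (Rn n) (Rn m)) E]
    [TopologicalSpace F] [ChartedSpace (Rn m) F] (π : E → M) : Prop :=
  ∀ x : M, ∃ T : Bundle.Trivialization F π, x ∈ T.baseSet ∧
    ContMDiffOn (IT n m) ((IB n).prod (𝓡 m)) ∞ T.toOpenPartialHomeomorph T.source ∧
    ContMDiffOn ((IB n).prod (𝓡 m)) (IT n m) ∞ T.toOpenPartialHomeomorph.symm T.target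

section Jets

variable (n m : ℕ) {M E : Type*}
  [TopologicalSpace M] [ChartedSpace (Rn n) M]
  [TopologicalSpace E] [ChartedSpace (ModelProd (Rn n) (Rn m)) E]
  (π : E → M)

/-! ### Adapted coordinates, connections, curvature -/

/-- Adapted coordinates `(x, v)` on an open subset of `E`: a smooth chart `x` of `M` and a smooth
chart `(x, v)` of `E` whose first component is `x ∘ π`. -/
structure AdaptedChart where
  /-- the chart `x` on the base -/
  base : OpenPartialHomeomorph M (Rn n)
  /-- the chart `(x, v)` on the total space -/
  total : OpenPartialHomeomorph E (Rn n × Rn m)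
  base_mem : base ∈ IsManifold.maximalAtlas (IB n) ∞ M
  total_mem : total ∈ IsManifold.maximalAtlas (IT n m) ∞ E
  map_source : ∀ e ∈ total.source, π e ∈ base.source
  fst_total : ∀ e ∈ total.source, (total e).1 = base (π e)

variable {n m π}

/-- The coefficients `v_i^α(x, v)` of a field `L` of linear maps `T_{π e} M → T_e E` in adapted
coordinates: `L (∂/∂x_i) = ∂/∂x_i + ∑ v_i^α ∂/∂v^α`. -/
def AdaptedChart.coef (c : AdaptedChart n m π)
    (L : ∀ e : E, TangentSpace (IB n) (π e) →L[ℝ] TangentSpace (IT n m) e)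
    (z : Rn n × Rn m) : Rn n →L[ℝ] Rn m :=
  let e : E := c.total.symm z
  let dx : Rn n →L[ℝ] Rn n := mfderiv 𝓘(ℝ, Rn n) (IB n) c.base.symm (c.base (π e))
  let l : Rn n →L[ℝ] Rn n × Rn m := L e
  let dz : Rn n × Rn m →L[ℝ] Rn n × Rn m := mfderiv (IT n m) 𝓘(ℝ, Rn n × Rn m) c.total e
  (ContinuousLinearMap.snd ℝ (Rn n) (Rn m)).comp (dz.comp (l.comp dx))

/-- The curvature of the connection with coefficients `V` in coordinates:
`(a, b) ↦ ∑ a_i b_j ((∂v_j/∂x_i + ∑ v_i^β ∂v_j/∂v^β) - (∂v_i/∂x_j + ∑ v_j^β ∂v_i/∂v^β))`,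
i.e. the vertical part of `[∇ ∂_a, ∇ ∂_b]`. -/
def curvature (V : Rn n × Rn m → (Rn n →L[ℝ] Rn m)) (z : Rn n × Rn m) :
    Rn n →L[ℝ] Rn n →L[ℝ] Rn m :=
  let D : Rn n →L[ℝ] Rn n →L[ℝ] Rn m :=
    (fderiv ℝ V z).comp ((ContinuousLinearMap.id ℝ (Rn n)).prod (V z))
  D - D.flip

variable (n m π)

/-- A local connection in `π`, i.e. a local section of `J¹(π) → E` over the open set `dom ⊆ E`: a
smooth field of horizontal lifts `T_{π e} M → T_e E`. The values outside `dom` are irrelevant. -/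
structure LocalConnection where
  /-- the domain of definition -/
  dom : Set E
  isOpen_dom : IsOpen dom
  /-- the horizontal lift -/
  lift : ∀ e : E, TangentSpace (IB n) (π e) →L[ℝ] TangentSpace (IT n m) e
  mfderiv_lift : ∀ e ∈ dom, ∀ w : TangentSpace (IB n) (π e),
    mfderiv (IT n m) (IB n) π e (lift e w) = w
  smooth : ∀ c : AdaptedChart n m π,
    ContDiffOn ℝ ∞ (c.coef lift) (c.total.target ∩ c.total.symm ⁻¹' dom)

/-- A local connection together with a point of its domain. -/
structure PointedConnection extends LocalConnection n m π where
  /-- the base point -/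
  pt : E
  pt_mem : pt ∈ dom

/-- Two local connections have the same infinite jet at a point: all partial derivatives of their
coefficients at that point agree, in all adapted coordinates. -/
instance jetSetoid : Setoid (PointedConnection n m π) where
  r a b := a.pt = b.pt ∧ ∀ c : AdaptedChart n m π, a.pt ∈ c.total.source → ∀ k : ℕ,
    iteratedFDeriv ℝ k (c.coef a.lift) (c.total a.pt) =
      iteratedFDeriv ℝ k (c.coef b.lift) (c.total b.pt)
  iseqv :=
    { refl := fun _ => ⟨rfl, fun _ _ _ => rfl⟩
      symm := fun h => ⟨h.1.symm, fun c hc k => (h.2 c (h.1 ▸ hc) k).symm⟩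
      trans := fun h h' => ⟨h.1.trans h'.1, fun c hc k =>
        (h.2 c hc k).trans (h'.2 c (h.1 ▸ hc) k)⟩ }

/-- The space `J^∞(π_{1,0})` of infinite jets of local connections in `π`. -/
def JetInf : Type _ := Quotient (jetSetoid n m π)

variable {n m π}

/-- The infinite jet `[∇]_θ^∞` of a local connection at a point of its domain. -/
def LocalConnection.jet (A : LocalConnection n m π) (θ : E) (h : θ ∈ A.dom) : JetInf n m π :=
  Quotient.mk _ { A with pt := θ, pt_mem := h }

/-- The projection `J^∞(π_{1,0}) → E`. -/
def JetInf.pt : JetInf n m π → E := Quotient.lift (fun a => a.pt) (fun _ _ h => h.1)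

/-- The function `f ∘ j_∞(∇)` on the domain of `∇` (extended by zero). -/
def LocalConnection.pullFun (A : LocalConnection n m π) (f : JetInf n m π → ℝ) (e : E) : ℝ :=
  open Classical in if h : e ∈ A.dom then f (A.jet e h) else 0

/-- The differential of `f` along the Cartan plane at `[∇]_θ^∞`, the latter being identified with
`T_θ E`: the differential of `f ∘ j_∞(∇)` at `θ`. -/
def LocalConnection.cartanDiff (A : LocalConnection n m π) (f : JetInf n m π → ℝ) (θ : E)
    (v : TangentSpace (IT n m) θ) : ℝ :=
  (mfderiv (IT n m) 𝓘(ℝ, ℝ) (A.pullFun f) θ : TangentSpace (IT n m) θ →L[ℝ] ℝ) v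

variable (n m)

/-- The derivatives up to order `k` of the coefficients of a connection at a point: coordinates on
the fibers of the `k`-jets over `E`. -/
abbrev JetCoord (k : ℕ) : Type :=
  ∀ j : Fin (k + 1),
    ContinuousMultilinearMap ℝ (fun _ : Fin (j : ℕ) => Rn n × Rn m) (Rn n →L[ℝ] Rn m)

variable {n m}

/-- `f` is (the pullback of) a smooth function on the manifold of `k`-jets: in any adapted
coordinates it is a smooth function of `x`, `v` and the derivatives of the `v_i^α` up to
order `k`. -/
def IsSmoothOfOrder (f : JetInf n m π → ℝ) (k : ℕ) : Prop :=
  ∀ c : AdaptedChart n m π, ∃ G : (Rn n × Rn m) × JetCoord n m k → ℝ,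
    ContDiffOn ℝ ∞ G (c.total.target ×ˢ Set.univ) ∧
    ∀ (A : LocalConnection n m π) (θ : E) (h : θ ∈ A.dom), θ ∈ c.total.source →
      f (A.jet θ h) =
        G (c.total θ, fun j => iteratedFDeriv ℝ (j : ℕ) (c.coef A.lift) (c.total θ))

theorem IsSmoothOfOrder.mono {f : JetInf n m π → ℝ} {k l : ℕ} (hf : IsSmoothOfOrder f k)
    (hkl : k ≤ l) : IsSmoothOfOrder f l := by
  intro c
  obtain ⟨G, hG, h⟩ := hf c
  refine ⟨fun p => G (p.1, fun j => p.2 (Fin.castLE (by omega) j)), ?_, ?_⟩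
  · refine hG.comp (ContDiff.contDiffOn ?_) ?_
    · refine contDiff_fst.prodMk (contDiff_pi.2 fun j => ?_)
      have h1 : ContDiff ℝ ∞ (fun u : JetCoord n m l => u (Fin.castLE (by omega) j)) :=
        contDiff_pi.1 contDiff_id _
      exact h1.comp contDiff_snd
    · intro p hp
      exact ⟨hp.1, Set.mem_univ _⟩
  · intro A θ hθ hc
    exact h A θ hθ hc

variable (n m π)

/-- The algebra `C^∞(J^∞(π_{1,0})) = ⋃_k C^∞(J^k(π_{1,0}))`. -/
def smoothJet : Subalgebra ℝ (JetInf n m π → ℝ) where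
  carrier := {f | ∃ k, IsSmoothOfOrder f k}
  mul_mem' := by
    rintro f g ⟨k, hf⟩ ⟨l, hg⟩
    refine ⟨max k l, fun c => ?_⟩
    obtain ⟨G, hG, h⟩ := hf.mono (le_max_left k l) c
    obtain ⟨G', hG', h'⟩ := hg.mono (le_max_right k l) c
    exact ⟨fun p => G p * G' p, hG.mul hG', fun A θ hθ hc => by
      simp only [Pi.mul_apply, h A θ hθ hc, h' A θ hθ hc]⟩
  add_mem' := by
    rintro f g ⟨k, hf⟩ ⟨l, hg⟩
    refine ⟨max k l, fun c => ?_⟩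
    obtain ⟨G, hG, h⟩ := hf.mono (le_max_left k l) c
    obtain ⟨G', hG', h'⟩ := hg.mono (le_max_right k l) c
    exact ⟨fun p => G p + G' p, hG.add hG', fun A θ hθ hc => by
      simp only [Pi.add_apply, h A θ hθ hc, h' A θ hθ hc]⟩
  algebraMap_mem' := fun r => ⟨0, fun _ => ⟨fun _ => r, contDiffOn_const, fun _ _ _ _ => rfl⟩⟩

/-! ### The equation of flat connections -/

/-- The infinite prolongation `E_fc ⊆ J^∞(π_{1,0})` of the equation of flat connections: the jets
`[∇]_θ^∞` such that the curvature of `∇` vanishes at `θ` to infinite order. -/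
def Efc : Set (JetInf n m π) :=
  {p | ∃ (A : LocalConnection n m π) (θ : E) (h : θ ∈ A.dom), p = A.jet θ h ∧
    ∀ c : AdaptedChart n m π, θ ∈ c.total.source → ∀ k : ℕ,
      iteratedFDeriv ℝ k (curvature (c.coef A.lift)) (c.total θ) = 0}

/-- The restriction of functions from `J^∞(π_{1,0})` to `E_fc`. -/
def restrict : (JetInf n m π → ℝ) →ₐ[ℝ] (Efc n m π → ℝ) where
  toFun f := fun p => f p
  map_one' := rfl
  map_mul' _ _ := rfl
  map_zero' := rfl
  map_add' _ _ := rfl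
  commutes' _ := rfl

/-- The algebra `C^∞(E_fc)` of smooth functions on the (closed) submanifold `E_fc`: the
restrictions of smooth functions on `J^∞(π_{1,0})`. -/
def smoothFc : Subalgebra ℝ (Efc n m π → ℝ) := (smoothJet n m π).map (restrict n m π)

/-- The module and Lie algebra `D(E_fc)` of vector fields on `E_fc`: derivations of
`C^∞(E_fc)`. -/
abbrev VF : Type _ := Derivation ℝ (smoothFc n m π) (smoothFc n m π)

variable {n m π}

/-- The restriction `C^∞(J^∞(π_{1,0})) → C^∞(E_fc)`. -/
def res (f : smoothJet n m π) : smoothFc n m π :=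
  ⟨restrict n m π f, ⟨f, f.2, rfl⟩⟩

/-- The pullback of a smooth function on `M` along `π̃ : J^∞(π_{1,0}) → E → M`. -/
def pullM (g : C^∞⟮IB n, M; 𝓘(ℝ, ℝ), ℝ⟯) : smoothJet n m π :=
  ⟨fun p => g (π p.pt), 0, fun c => ⟨fun p => g (c.base.symm p.1.1), by
    have h1 : ContDiffOn ℝ ∞ (fun x : Rn n => g (c.base.symm x)) c.base.target := by
      rw [← contMDiffOn_iff_contDiffOn]
      exact g.contMDiff.comp_contMDiffOn (contMDiffOn_symm_of_mem_maximalAtlas c.base_mem)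
    refine h1.comp (contDiff_fst.comp contDiff_fst).contDiffOn ?_
    intro p hp
    have hs := c.total.map_target hp.1
    have := c.fst_total _ hs
    rw [c.total.right_inv hp.1] at this
    show p.1.1 ∈ c.base.target
    rw [this]
    exact c.base.map_source (c.map_source _ hs), by
    intro A θ h hc
    simp only
    rw [c.fst_total θ hc, c.base.left_inv (c.map_source θ hc)]
    rfl⟩⟩

/-- `X` is `π̃`-vertical. -/
def IsVertical (X : VF n m π) : Prop :=
  ∀ g : C^∞⟮IB n, M; 𝓘(ℝ, ℝ), ℝ⟯, X (res (pullM g)) = 0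

/-- `X` lies in the Cartan distribution of `E_fc`: at each point `[∇]_θ^∞` it is the Cartan lift
of some tangent vector `v ∈ T_θ E`. -/
def IsCartan (X : VF n m π) : Prop :=
  ∀ (A : LocalConnection n m π) (θ : E) (h : θ ∈ A.dom) (hp : A.jet θ h ∈ Efc n m π),
    ∃ v : TangentSpace (IT n m) θ, ∀ f : smoothJet n m π,
      (X (res f)).1 ⟨A.jet θ h, hp⟩ = A.cartanDiff f θ v

/-! ### The connection `C_fc` and the differential `∂_fc` -/

/-- `U` is the element `Ū_fc ∈ D(Λ¹(E_fc))` of the connection `C_fc` in `π̃ : E_fc → M`, i.e.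
`(U X)(f) = (C_fc X_M)(f)`, where `X_M` is the restriction of `X` to `C^∞(M)`. At a point
`[∇]_θ^∞` the vector `X_M` is a tangent vector `w` of `M` at `π θ`, and `C_fc w` is the Cartan
lift of `∇ w ∈ T_θ E`. -/
def IsFcForm (U : VF n m π →ₗ[smoothFc n m π] VF n m π) : Prop :=
  ∀ (X : VF n m π) (A : LocalConnection n m π) (θ : E) (h : θ ∈ A.dom)
    (hp : A.jet θ h ∈ Efc n m π) (w : TangentSpace (IB n) (π θ)),
    (∀ g : C^∞⟮IB n, M; 𝓘(ℝ, ℝ), ℝ⟯,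
      (X (res (pullM g))).1 ⟨A.jet θ h, hp⟩ =
        (mfderiv (IB n) 𝓘(ℝ, ℝ) g (π θ) : TangentSpace (IB n) (π θ) →L[ℝ] ℝ) w) →
    ∀ f : smoothJet n m π,
      (U X (res f)).1 ⟨A.jet θ h, hp⟩ = A.cartanDiff f θ (A.lift θ w)

/-- The Frölicher–Nijenhuis bracket `[[K, Y]]` of a vector-valued `1`-form `K` and a vector field
`Y`, a vector-valued `1`-form: `X ↦ [K X, Y] - K [X, Y]`. -/
def fnBracket₀ {A : Type*} [CommRing A] [Algebra ℝ A]
    (K : Derivation ℝ A A →ₗ[A] Derivation ℝ A A) (Y : Derivation ℝ A A) :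
    Derivation ℝ A A →ₗ[A] Derivation ℝ A A where
  toFun X := ⁅K X, Y⁆ - K ⁅X, Y⁆
  map_add' X X' := by simp only [map_add, add_lie]; abel
  map_smul' a X := by
    have key : ∀ Z : Derivation ℝ A A, ⁅a • Z, Y⁆ = a • ⁅Z, Y⁆ - Y a • Z := by
      intro Z
      ext b
      simp only [Derivation.commutator_apply, Derivation.smul_apply, Derivation.sub_apply,
        Derivation.leibniz, smul_eq_mul]
      ring
    simp only [map_smul, key, map_sub, RingHom.id_apply, smul_sub]
    abel

/-- The Frölicher–Nijenhuis bracket `[[K, L]]` of two vector-valued `1`-forms, evaluated on two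
vector fields. -/
def fnBracket₁ {A : Type*} [CommRing A] [Algebra ℝ A]
    (K L : Derivation ℝ A A →ₗ[A] Derivation ℝ A A) (X Y : Derivation ℝ A A) :
    Derivation ℝ A A :=
  ⁅K X, L Y⁆ - ⁅K Y, L X⁆ - L (⁅K X, Y⁆ - ⁅K Y, X⁆) - K (⁅L X, Y⁆ - ⁅L Y, X⁆)
    + (L (K ⁅X, Y⁆) + K (L ⁅X, Y⁆))

variable (n m π)

/-- The vector-valued form `Ū_fc` of the connection `C_fc`. -/
def fcForm : VF n m π →ₗ[smoothFc n m π] VF n m π :=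
  Classical.epsilon IsFcForm

/-- `𝒱 = 𝒱⁰`: the `π̃`-vertical vector fields lying in the Cartan distribution of `E_fc`. -/
def V0 : Set (VF n m π) := {S | IsCartan S ∧ IsVertical S}

/-- `𝒱¹ = π̃^*(Λ¹(M)) ⊗ 𝒱`: the horizontal `1`-forms on `E_fc` with values in `𝒱`. -/
def V1 : Set (VF n m π →ₗ[smoothFc n m π] VF n m π) :=
  {Ω | (∀ X, Ω X ∈ V0 n m π) ∧ ∀ X, IsVertical X → Ω X = 0}

variable {n m π}

/-- `∂_fc = [[Ū_fc, ·]]` on vector fields. -/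
def dfc₀ (S : VF n m π) : VF n m π →ₗ[smoothFc n m π] VF n m π :=
  fnBracket₀ (fcForm n m π) S

/-- `∂_fc = [[Ū_fc, ·]]` on vector-valued `1`-forms. -/
def dfc₁ (Ω : VF n m π →ₗ[smoothFc n m π] VF n m π) (X Y : VF n m π) : VF n m π :=
  fnBracket₁ (fcForm n m π) Ω X Y

end Jets

end FlatConn

end

/-!
Along a flat connection everything becomes elementary. In adapted coordinates, a flat connection is
given by its leaves, the level sets of a map `Φ` to `ℝ^m` whose derivative along the fiber is
invertible; its coefficients are `flatCoef Φ`. To any finite order, a point of the equation is the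
jet of such a connection (`jet_flatCoef_leaf`, `exists_flatPt`), so identities between functions on
`E_fc` and their differentials along the Cartan planes may be checked after the substitution of
`flatCoef Φ`, where a Cartan field is an ordinary vector field on `ℝ^n × ℝ^m`. In particular the
Cartan distribution is involutive (`IsCartan.lie`) and, locally, the form of the connection is
`X ↦ ∑ X(x_i) X_i` with `X_i` the horizontal lift of `∂/∂x_i` (`LocalFrame.proj`).

*Kernel in degree zero.* A vertical Cartan field `S` is closed if and only if it commutes with the
`X_i`. Then the derivative `vert Φ S` of `Φ` along `S` is constant along the leaves of `Φ`
(`nab_vert`). It depends on the germ of `Φ` only, and `Φ` may be replaced, near another point of the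
leaf `Φ = y`, by `y + ε (Φ - y)`, which has the same connection and multiplies the value by `ε`.
Hence it is zero (`eq_zero_of_const_along_leaves`, `eq_zero_of_commute`).

*Kernel in degree one.* A closed `V`-valued form `W` turns into a family `G(Φ) = vert Φ W` of
`1`-forms closed along the leaves of `Φ`, and natural with respect to reparametrizations of the leaf
space (`IsClosedFamily`). The linearization of `G` at `Φ`, in the directions `μ (Φ - Φ(z))` with `μ`
a polynomial in the base coordinates, is a family of differential operators `μ ↦ P_j μ` along the
leaves with `D_i P_j = D_j P_i`, and `P_j 1 = G_j` by naturality under homotheties (`leafOp`,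
`nab_leafOp_comm`, `leafOp_one`). If `n ≥ 2`, then the commutators of `P` with multiplications by
coordinates give an explicit primitive (`homotopy_formula`, `nab_primitive`); for `n = 1` there is
none, as `1`-forms are of top degree. The primitive is again natural, because the defect of
naturality is constant along the leaves, hence zero (`primitive_comp_tay`). So it is of the form
`vert Φ S` with `S` depending on the jet of the connection only (`exists_vertical_primitive`).

*Globalization.* By the first part, local primitives are unique, so they glue together. Elements of
`C^∞(E_fc)` are of finite order, so that one needs a bound for the orders of the local pieces which
is uniform on `E`, also when `E` is not compact: an unbounded sequence of pieces going to infinity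
would patch together to a single object of infinite order (`exists_uniform_order`). The same
argument gives the existence of the form of the connection on all of `E_fc` (`exists_isFcForm`).
-/


open scoped Manifold ContDiff Topology

noncomputable section

namespace FlatConn


/-! ### Finite jets and their differential operators -/

section JetOps

variable {Z T T' R S : Type*} [NormedAddCommGroup Z] [NormedSpace ℝ Z]
  [NormedAddCommGroup T] [NormedSpace ℝ T] [NormedAddCommGroup T'] [NormedSpace ℝ T']
  [NormedAddCommGroup R] [NormedSpace ℝ R] [NormedAddCommGroup S] [NormedSpace ℝ S]

/-- Values of the derivatives of order at most `k` of a map `Z → T`; the multilinear maps are not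
required to be symmetric. -/
abbrev Jet (k : ℕ) (Z T : Type*) [NormedAddCommGroup Z] [NormedSpace ℝ Z]
    [NormedAddCommGroup T] [NormedSpace ℝ T] : Type _ :=
  ∀ j : Fin (k + 1), ContinuousMultilinearMap ℝ (fun _ : Fin (j : ℕ) => Z) T

/-- The `k`-jet of `f` at `z`. -/
def jet (k : ℕ) (f : Z → T) (z : Z) : Jet k Z T := fun j => iteratedFDeriv ℝ (j : ℕ) f z

/-- Truncation of jets. -/
def Jet.trunc {k l : ℕ} (h : l ≤ k) : Jet k Z T →L[ℝ] Jet l Z T :=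
  ContinuousLinearMap.pi fun j => ContinuousLinearMap.proj (Fin.castLE (by omega) j)

/-- The value of a jet. -/
def Jet.val {k : ℕ} : Jet k Z T →L[ℝ] T :=
  (continuousMultilinearCurryFin0 ℝ Z T).toContinuousLinearEquiv.toContinuousLinearMap.comp
    (ContinuousLinearMap.proj (R := ℝ) (φ := fun j : Fin (k + 1) =>
      ContinuousMultilinearMap ℝ (fun _ : Fin (j : ℕ) => Z) T) 0)

/-- The derivative of the `k`-jet of a map, in terms of its `(k + 1)`-jet. -/
def Jet.shift {k : ℕ} : Jet (k + 1) Z T →L[ℝ] (Z →L[ℝ] Jet k Z T) :=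
  (ContinuousLinearMap.piEquivL ℝ Z (fun j : Fin (k + 1) =>
      ContinuousMultilinearMap ℝ (fun _ : Fin (j : ℕ) => Z) T)).toContinuousLinearMap.comp
    (ContinuousLinearMap.pi fun j : Fin (k + 1) =>
      (continuousMultilinearCurryLeftEquiv ℝ
        (fun _ : Fin ((j : ℕ) + 1) => Z) T).toContinuousLinearEquiv.toContinuousLinearMap.comp
        (ContinuousLinearMap.proj (R := ℝ) (φ := fun j : Fin (k + 1 + 1) =>
          ContinuousMultilinearMap ℝ (fun _ : Fin (j : ℕ) => Z) T) j.succ :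
          Jet (k + 1) Z T →L[ℝ] ContinuousMultilinearMap ℝ (fun _ : Fin ((j : ℕ) + 1) => Z) T))

theorem contDiffAt_clm_snd {Q : Type*} [NormedAddCommGroup Q] [NormedSpace ℝ Q] (B : R →L[ℝ] S)
    (p : Q × R) : ContDiffAt ℝ ∞ (fun p : Q × R => B p.2) p :=
  (B.contDiff.comp contDiff_snd).contDiffAt

theorem _root_.ContDiffAt.clm_prod {Q : Type*} [NormedAddCommGroup Q] [NormedSpace ℝ Q]
    {f : Q → (Z →L[ℝ] R)} {g : Q → (Z →L[ℝ] S)} {q : Q} {n : WithTop ℕ∞}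
    (hf : ContDiffAt ℝ n f q) (hg : ContDiffAt ℝ n g q) :
    ContDiffAt ℝ n (fun q => (f q).prod (g q)) q := by
  have h : (fun q => (f q).prod (g q)) = fun q =>
      (ContinuousLinearMap.inl ℝ R S).comp (f q) + (ContinuousLinearMap.inr ℝ R S).comp (g q) := by
    funext q
    ext z <;> simp
  rw [h]
  exact (contDiffAt_const.clm_comp hf).add (contDiffAt_const.clm_comp hg)

theorem trunc_jet {k l : ℕ} (h : l ≤ k) (f : Z → T) (z : Z) :
    Jet.trunc h (jet k f z) = jet l f z := rfl

theorem val_jet {k : ℕ} (f : Z → T) (z : Z) : Jet.val (jet k f z) = f z := rfl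

theorem jet_congr {k : ℕ} {f g : Z → T} {z : Z} (h : f =ᶠ[𝓝 z] g) : jet k f z = jet k g z :=
  funext fun j => (h.iteratedFDeriv ℝ (j : ℕ)).eq_of_nhds

theorem jet_eq_of_le {k l : ℕ} (h : l ≤ k) {f g : Z → T} {z : Z} (hfg : jet k f z = jet k g z) :
    jet l f z = jet l g z := by
  rw [← trunc_jet h, ← trunc_jet h, hfg]

theorem eventually_contDiffAt_fin {f : Z → T} {z : Z} (hf : ContDiffAt ℝ ∞ f z) (n : ℕ) :
    ∀ᶠ ζ in 𝓝 z, ContDiffAt ℝ n f ζ :=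
  (hf.of_le (by exact_mod_cast le_top)).eventually (by simp)

theorem contDiffAt_iteratedFDeriv {f : Z → T} {z : Z} (hf : ContDiffAt ℝ ∞ f z) (j : ℕ) :
    ContDiffAt ℝ ∞ (iteratedFDeriv ℝ j f) z :=
  hf.iteratedFDeriv_right (by exact_mod_cast le_top)

theorem contDiffAt_fderiv {f : Z → T} {z : Z} (hf : ContDiffAt ℝ ∞ f z) :
    ContDiffAt ℝ ∞ (fderiv ℝ f) z :=
  hf.fderiv_right (by exact_mod_cast le_top)

theorem contDiffAt_jet {k : ℕ} {f : Z → T} {z : Z} (hf : ContDiffAt ℝ ∞ f z) :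
    ContDiffAt ℝ ∞ (jet k f) z :=
  contDiffAt_pi.2 fun j => contDiffAt_iteratedFDeriv hf j

theorem differentiableAt_of_smooth {f : Z → T} {z : Z} (hf : ContDiffAt ℝ ∞ f z) :
    DifferentiableAt ℝ f z := hf.differentiableAt (by simp)

theorem fderiv_jet {k : ℕ} {f : Z → T} {z : Z} (hf : ContDiffAt ℝ ∞ f z) :
    fderiv ℝ (jet k f) z = Jet.shift (k := k) (Z := Z) (T := T) (jet (k + 1) f z) := by
  have h : HasFDerivAt (jet k f) (ContinuousLinearMap.pi fun j : Fin (k + 1) =>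
      fderiv ℝ (iteratedFDeriv ℝ (j : ℕ) f) z) z :=
    hasFDerivAt_pi.2 fun j =>
      (differentiableAt_of_smooth (contDiffAt_iteratedFDeriv hf j)).hasFDerivAt
  rw [h.fderiv]
  rfl

theorem ContDiffAt.iteratedFDeriv_family {Q : Type*} [NormedAddCommGroup Q] [NormedSpace ℝ Q]
    {H : Q → Z → T} {q : Q} {z : Z} (hH : ContDiffAt ℝ ∞ (Function.uncurry H) (q, z)) (j : ℕ) :
    ContDiffAt ℝ ∞ (Function.uncurry fun q ζ => iteratedFDeriv ℝ j (H q) ζ) (q, z) := by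
  induction j with
  | zero =>
    exact (continuousMultilinearCurryFin0 ℝ Z T).symm.toContinuousLinearEquiv.contDiff.contDiffAt.comp (q, z) hH
  | succ j ih =>
    have h1 : ContDiffAt ℝ ∞ (fun p : Q × Z => fderiv ℝ (iteratedFDeriv ℝ j (H p.1)) p.2)
        (q, z) := by
      refine ContDiffAt.fderiv (f := fun (p : Q × Z) ζ => iteratedFDeriv ℝ j (H p.1) ζ)
        (g := Prod.snd) (n := ∞) ?_ contDiffAt_snd (by exact_mod_cast le_top)
      exact ContDiffAt.comp ((q, z), z) (f := fun p : (Q × Z) × Z => (p.1.1, p.2)) ih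
        ((contDiffAt_fst.comp _ contDiffAt_fst).prodMk contDiffAt_snd)
    exact (continuousMultilinearCurryLeftEquiv ℝ
      (fun _ : Fin (j + 1) => Z) T).symm.toContinuousLinearEquiv.contDiff.contDiffAt.comp (q, z) h1

/-- The jets of a smooth family of maps depend smoothly on the parameter. -/
theorem ContDiffAt.jet_family {Q : Type*} [NormedAddCommGroup Q] [NormedSpace ℝ Q] {k : ℕ}
    {H : Q → Z → T} {q : Q} {g : Q → Z} (hH : ContDiffAt ℝ ∞ (Function.uncurry H) (q, g q))
    (hg : ContDiffAt ℝ ∞ g q) : ContDiffAt ℝ ∞ (fun q => jet k (H q) (g q)) q :=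
  contDiffAt_pi.2 fun j => ContDiffAt.comp q (f := fun q => (q, g q))
    (ContDiffAt.iteratedFDeriv_family hH j) (contDiffAt_id.prodMk hg)

/-- `N` is a (nonlinear) differential operator of order `K` on the maps satisfying the local
condition `good`: the value `N Φ z` is a smooth function of `z` and of the `K`-jet of `Φ`. -/
def IsJetOp (K : ℕ) (good : (Z → T) → Z → Prop) (N : (Z → T) → Z → R) : Prop :=
  ∃ G : Z × Jet K Z T → R, ∀ Φ z, good Φ z →
    ContDiffAt ℝ ∞ G (z, jet K Φ z) ∧ N Φ z = G (z, jet K Φ z)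

/-- An open condition on smooth maps at points. -/
structure OpenGood (good : (Z → T) → Z → Prop) : Prop where
  nhds : ∀ {Φ z}, good Φ z → ∀ᶠ ζ in 𝓝 z, good Φ ζ
  smooth : ∀ {Φ z}, good Φ z → ContDiffAt ℝ ∞ Φ z

namespace IsJetOp

variable {K L : ℕ} {good : (Z → T) → Z → Prop} {N : (Z → T) → Z → R} {N' : (Z → T) → Z → S}

theorem mono (hN : IsJetOp K good N) (h : K ≤ L) : IsJetOp L good N := by
  obtain ⟨G, hG⟩ := hN
  refine ⟨fun p => G (p.1, Jet.trunc h p.2), fun Φ z hΦ => ⟨?_, (hG Φ z hΦ).2⟩⟩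
  exact ContDiffAt.comp (z, jet L Φ z) (hG Φ z hΦ).1
    (contDiffAt_fst.prodMk (contDiffAt_clm_snd (Jet.trunc (Z := Z) (T := T) h) _))

theorem congr {N₁ : (Z → T) → Z → R} (hN : IsJetOp K good N)
    (h : ∀ Φ z, good Φ z → N₁ Φ z = N Φ z) : IsJetOp K good N₁ := by
  obtain ⟨G, hG⟩ := hN
  exact ⟨G, fun Φ z hΦ => ⟨(hG Φ z hΦ).1, (h Φ z hΦ).trans (hG Φ z hΦ).2⟩⟩

theorem mono_good {good' : (Z → T) → Z → Prop} (hN : IsJetOp K good N)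
    (h : ∀ Φ z, good' Φ z → good Φ z) : IsJetOp K good' N := by
  obtain ⟨G, hG⟩ := hN
  exact ⟨G, fun Φ z hΦ => hG Φ z (h Φ z hΦ)⟩

theorem val : IsJetOp K good (fun Φ z => Φ z) :=
  ⟨fun p => Jet.val p.2, fun _ _ _ => ⟨contDiffAt_clm_snd (Jet.val (k := K) (Z := Z) (T := T)) _, rfl⟩⟩

theorem base {h : Z → R} (hh : ∀ Φ z, good Φ z → ContDiffAt ℝ ∞ h z) :
    IsJetOp K good (fun _ z => h z) :=
  ⟨fun p => h p.1, fun Φ z hΦ => ⟨(hh Φ z hΦ).comp (z, jet K Φ z) contDiffAt_fst, rfl⟩⟩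

theorem const (r : R) : IsJetOp K good (fun _ _ => r) :=
  base (h := fun _ => r) fun _ _ _ => contDiffAt_const

theorem prodMk (hN : IsJetOp K good N) (hN' : IsJetOp K good N') :
    IsJetOp K good (fun Φ z => (N Φ z, N' Φ z)) := by
  obtain ⟨G, hG⟩ := hN
  obtain ⟨G', hG'⟩ := hN'
  exact ⟨fun p => (G p, G' p), fun Φ z hΦ => ⟨(hG Φ z hΦ).1.prodMk (hG' Φ z hΦ).1,
    Prod.ext (hG Φ z hΦ).2 (hG' Φ z hΦ).2⟩⟩

theorem pi {ι : Type*} [Fintype ι] {R : ι → Type*} [∀ i, NormedAddCommGroup (R i)]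
    [∀ i, NormedSpace ℝ (R i)] {N : (Z → T) → Z → ∀ i, R i}
    (hN : ∀ i, IsJetOp K good (fun Φ z => N Φ z i)) : IsJetOp K good N := by
  choose G hG using hN
  exact ⟨fun p i => G i p, fun Φ z hΦ => ⟨contDiffAt_pi.2 fun i => (hG i Φ z hΦ).1,
    funext fun i => (hG i Φ z hΦ).2⟩⟩

theorem comp {F : R → S} (hN : IsJetOp K good N)
    (hF : ∀ Φ z, good Φ z → ContDiffAt ℝ ∞ F (N Φ z)) : IsJetOp K good (fun Φ z => F (N Φ z)) := by
  obtain ⟨G, hG⟩ := hN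
  refine ⟨fun p => F (G p), fun Φ z hΦ => ⟨?_, congrArg F (hG Φ z hΦ).2⟩⟩
  refine ContDiffAt.comp (z, jet K Φ z) ?_ (hG Φ z hΦ).1
  rw [← (hG Φ z hΦ).2]
  exact hF Φ z hΦ

theorem clm (hN : IsJetOp K good N) (F : R →L[ℝ] S) : IsJetOp K good (fun Φ z => F (N Φ z)) :=
  hN.comp fun _ _ _ => F.contDiff.contDiffAt

theorem bilin {Q : Type*} [NormedAddCommGroup Q] [NormedSpace ℝ Q] (hN : IsJetOp K good N)
    (hN' : IsJetOp K good N') (B : R →L[ℝ] S →L[ℝ] Q) :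
    IsJetOp K good (fun Φ z => B (N Φ z) (N' Φ z)) :=
  (hN.prodMk hN').comp (F := fun p : R × S => B p.1 p.2) fun _ _ _ =>
    B.isBoundedBilinearMap.contDiff.contDiffAt

theorem clm_apply {N : (Z → T) → Z → (S →L[ℝ] R)} (hN : IsJetOp K good N)
    (hN' : IsJetOp K good N') : IsJetOp K good (fun Φ z => N Φ z (N' Φ z)) :=
  hN.bilin hN' (ContinuousLinearMap.id ℝ (S →L[ℝ] R))

theorem add {N₁ : (Z → T) → Z → R} (hN : IsJetOp K good N) (hN₁ : IsJetOp K good N₁) :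
    IsJetOp K good (fun Φ z => N Φ z + N₁ Φ z) :=
  (hN.prodMk hN₁).comp (F := fun p : R × R => p.1 + p.2) fun _ _ _ =>
    (contDiff_fst.add contDiff_snd).contDiffAt

theorem sub {N₁ : (Z → T) → Z → R} (hN : IsJetOp K good N) (hN₁ : IsJetOp K good N₁) :
    IsJetOp K good (fun Φ z => N Φ z - N₁ Φ z) :=
  (hN.prodMk hN₁).comp (F := fun p : R × R => p.1 - p.2) fun _ _ _ =>
    (contDiff_fst.sub contDiff_snd).contDiffAt

theorem sum {ι : Type*} (s : Finset ι) {N : ι → (Z → T) → Z → R}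
    (hN : ∀ i ∈ s, IsJetOp K good (N i)) : IsJetOp K good (fun Φ z => ∑ i ∈ s, N i Φ z) := by
  classical
  induction s using Finset.induction_on with
  | empty => simpa using const (0 : R)
  | insert i s hi ih =>
    simp only [Finset.sum_insert hi]
    exact (hN i (Finset.mem_insert_self i s)).add
      (ih fun j hj => hN j (Finset.mem_insert_of_mem hj))

theorem congr_jet (hN : IsJetOp K good N) {Φ Φ' : Z → T} {z : Z} (h : good Φ z) (h' : good Φ' z)
    (hj : jet K Φ z = jet K Φ' z) : N Φ z = N Φ' z := by
  obtain ⟨G, hG⟩ := hN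
  rw [(hG Φ z h).2, (hG Φ' z h').2, hj]

theorem family (hN : IsJetOp K good N) {Q : Type*} [NormedAddCommGroup Q] [NormedSpace ℝ Q]
    {H : Q → Z → T} {q : Q} {g : Q → Z} (hH : ContDiffAt ℝ ∞ (Function.uncurry H) (q, g q))
    (hg : ContDiffAt ℝ ∞ g q) (hgood : ∀ᶠ q' in 𝓝 q, good (H q') (g q')) :
    ContDiffAt ℝ ∞ (fun q => N (H q) (g q)) q := by
  obtain ⟨G, hG⟩ := hN
  have h1 : ContDiffAt ℝ ∞ (fun q => G (g q, jet K (H q) (g q))) q :=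
    ContDiffAt.comp q (f := fun q => (g q, jet K (H q) (g q))) (hG _ _ hgood.self_of_nhds).1
      (hg.prodMk (ContDiffAt.jet_family hH hg))
  refine h1.congr_of_eventuallyEq ?_
  filter_upwards [hgood] with q' hq' using (hG _ _ hq').2

variable (hgood : OpenGood good)
include hgood

theorem contDiffAt (hN : IsJetOp K good N) {Φ : Z → T} {z : Z} (h : good Φ z) :
    ContDiffAt ℝ ∞ (N Φ) z := by
  obtain ⟨G, hG⟩ := hN
  have h1 : ContDiffAt ℝ ∞ (fun ζ => G (ζ, jet K Φ ζ)) z :=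
    ContDiffAt.comp z (f := fun ζ => (ζ, jet K Φ ζ)) (hG _ _ h).1
      (contDiffAt_id.prodMk (contDiffAt_jet (hgood.smooth h)))
  refine h1.congr_of_eventuallyEq ?_
  filter_upwards [hgood.nhds h] with ζ hζ using (hG _ _ hζ).2

/-- The total derivative of a differential operator is a differential operator. -/
theorem fderiv (hN : IsJetOp K good N) :
    IsJetOp (K + 1) good (fun Φ z => fderiv ℝ (N Φ) z) := by
  obtain ⟨G, hG⟩ := hN
  refine ⟨fun p => (_root_.fderiv ℝ G (p.1, Jet.trunc (Nat.le_succ K) p.2)).comp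
    ((ContinuousLinearMap.id ℝ Z).prod (Jet.shift (k := K) (Z := Z) (T := T) p.2)), fun Φ z h => ⟨?_, ?_⟩⟩
  · have h1 : ContDiffAt ℝ ∞ (fun p : Z × Jet (K + 1) Z T =>
        _root_.fderiv ℝ G (p.1, Jet.trunc (Nat.le_succ K) p.2)) (z, jet (K + 1) Φ z) :=
      ContDiffAt.comp _ (f := fun p : Z × Jet (K + 1) Z T => (p.1, Jet.trunc (Nat.le_succ K) p.2))
        (contDiffAt_fderiv (hG Φ z h).1)
        (contDiffAt_fst.prodMk (contDiffAt_clm_snd (Jet.trunc (Z := Z) (T := T) (Nat.le_succ K)) _))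
    refine h1.clm_comp ?_
    have h2 : ContDiffAt ℝ ∞ (fun p : Z × Jet (K + 1) Z T => Jet.shift (k := K) (Z := Z) (T := T) p.2)
        (z, jet (K + 1) Φ z) := contDiffAt_clm_snd (Q := Z) (R := Jet (K + 1) Z T) (S := Z →L[ℝ] Jet K Z T) Jet.shift _
    exact contDiffAt_const.clm_prod h2
  · have h1 : N Φ =ᶠ[𝓝 z] fun ζ => G (ζ, jet K Φ ζ) := by
      filter_upwards [hgood.nhds h] with ζ hζ using (hG _ _ hζ).2
    have h2 : HasFDerivAt (fun ζ => (ζ, jet K Φ ζ))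
        ((ContinuousLinearMap.id ℝ Z).prod (Jet.shift (k := K) (Z := Z) (T := T) (jet (K + 1) Φ z))) z := by
      refine (hasFDerivAt_id z).prodMk ?_
      rw [← fderiv_jet (hgood.smooth h)]
      exact (differentiableAt_of_smooth (contDiffAt_jet (hgood.smooth h))).hasFDerivAt
    refine h1.fderiv_eq.trans ?_
    exact ((differentiableAt_of_smooth (hG Φ z h).1).hasFDerivAt.comp z h2).fderiv

theorem iteratedFDeriv (hN : IsJetOp K good N) (j : ℕ) :
    IsJetOp (K + j) good (fun Φ z => iteratedFDeriv ℝ j (N Φ) z) := by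
  induction j with
  | zero =>
    exact hN.clm (continuousMultilinearCurryFin0 ℝ Z R).symm.toContinuousLinearEquiv.toContinuousLinearMap
  | succ j ih =>
    exact (ih.fderiv hgood).clm (continuousMultilinearCurryLeftEquiv ℝ
      (fun _ : Fin (j + 1) => Z) R).symm.toContinuousLinearEquiv.toContinuousLinearMap

theorem jet (hN : IsJetOp K good N) (k : ℕ) :
    IsJetOp (K + k) good (fun Φ z => jet k (N Φ) z) :=
  pi fun j => (hN.iteratedFDeriv hgood j).mono (by omega)

/-- Composition of differential operators. -/
theorem comp_op {good' : (Z → T') → Z → Prop} {N' : (Z → T') → Z → S}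
    (hN' : IsJetOp L good' N') {M : (Z → T) → Z → T'} (hM : IsJetOp K good M)
    (h : ∀ Φ z, good Φ z → good' (M Φ) z) : IsJetOp (K + L) good (fun Φ z => N' (M Φ) z) := by
  obtain ⟨G, hG⟩ := hN'
  refine IsJetOp.congr (N := fun Φ z => G (z, FlatConn.jet L (M Φ) z)) ?_
    fun Φ z hΦ => (hG _ _ (h Φ z hΦ)).2
  exact ((base (h := fun z => z) fun _ _ _ => contDiffAt_id).prodMk (hM.jet hgood L)).comp
    fun Φ z hΦ => (hG _ _ (h Φ z hΦ)).1

theorem congr_jet_jet (hN : IsJetOp K good N) {k : ℕ} {Φ Φ' : Z → T} {z : Z} (h : good Φ z)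
    (h' : good Φ' z) (hj : FlatConn.jet (K + k) Φ z = FlatConn.jet (K + k) Φ' z) :
    FlatConn.jet k (N Φ) z = FlatConn.jet k (N Φ') z :=
  (hN.jet hgood k).congr_jet h h' hj

end IsJetOp

end JetOps


/-! ### Taylor polynomials -/

section Taylor

universe u

variable {Z T : Type u} [NormedAddCommGroup Z] [NormedSpace ℝ Z]
  [NormedAddCommGroup T] [NormedSpace ℝ T]

theorem iteratedFDeriv_swap (n : ℕ) : ∀ {T : Type u} [NormedAddCommGroup T] [NormedSpace ℝ T]
    {f : Z → T} {z : Z} (_ : ContDiffAt ℝ ∞ f z) (i : Fin n) (v : Fin (n + 1) → Z),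
    iteratedFDeriv ℝ (n + 1) f z (v ∘ Equiv.swap i.castSucc i.succ) =
      iteratedFDeriv ℝ (n + 1) f z v := by
  induction n with
  | zero => intro T _ _ f z _ i; exact i.elim0
  | succ n ih =>
    intro T _ _ f z hf i v
    have hr : ∀ w, iteratedFDeriv ℝ (n + 1 + 1) f z w =
        iteratedFDeriv ℝ (n + 1) (fderiv ℝ f) z (Fin.init w) (w (Fin.last (n + 1))) :=
      fun w => iteratedFDeriv_succ_apply_right w
    rw [hr, hr]
    induction i using Fin.lastCases with
    | cast j =>
      have h1 : (v ∘ Equiv.swap j.castSucc.castSucc j.castSucc.succ) (Fin.last (n + 1)) =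
          v (Fin.last (n + 1)) := by
        simp only [Function.comp]
        rw [Equiv.swap_apply_of_ne_of_ne]
        · exact (Fin.castSucc_lt_last _).ne'
        · rw [Fin.succ_castSucc]; exact (Fin.castSucc_lt_last _).ne'
      have h2 : Fin.init (v ∘ Equiv.swap j.castSucc.castSucc j.castSucc.succ) =
          Fin.init v ∘ Equiv.swap j.castSucc j.succ := by
        funext l
        simp only [Fin.init, Function.comp, Fin.succ_castSucc]
        congr 1
        exact (Fin.castSucc_injective _).swap_apply _ _ _
      rw [h1, h2, ih (contDiffAt_fderiv hf)]
    | last =>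
      rw [iteratedFDeriv_succ_apply_right, iteratedFDeriv_succ_apply_right]
      let φ : (Z →L[ℝ] Z →L[ℝ] T) →L[ℝ] (Z →L[ℝ] Z →L[ℝ] T) :=
        (ContinuousLinearMap.flipₗᵢ ℝ Z Z T).toContinuousLinearEquiv.toContinuousLinearMap
      have hs : (fun y => fderiv ℝ (fun y => fderiv ℝ f y) y) =ᶠ[𝓝 z]
          φ ∘ fun y => fderiv ℝ (fun y => fderiv ℝ f y) y := by
        filter_upwards [eventually_contDiffAt_fin hf 2] with y hy
        ext a b
        exact hy.isSymmSndFDerivAt (by simp) a b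
      have hc : ContDiffAt ℝ ∞ (fun y => fderiv ℝ (fun y => fderiv ℝ f y) y) z :=
        contDiffAt_fderiv (contDiffAt_fderiv hf)
      have h1 : ∀ w : Fin n → Z, ∀ a b,
          iteratedFDeriv ℝ n (fun y => fderiv ℝ (fun y => fderiv ℝ f y) y) z w a b =
          iteratedFDeriv ℝ n (fun y => fderiv ℝ (fun y => fderiv ℝ f y) y) z w b a := by
        intro w a b
        have h2 := (hs.iteratedFDeriv ℝ n).eq_of_nhds
        have h3 := ContinuousLinearMap.iteratedFDeriv_comp_left (F := Z →L[ℝ] Z →L[ℝ] T)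
          (G := Z →L[ℝ] Z →L[ℝ] T) φ hc (i := n) (by exact_mod_cast le_top)
        exact congrArg (fun M => M w a b) (h2.trans h3)
      have e0 : Fin.init (Fin.init (v ∘ Equiv.swap (Fin.last n).castSucc (Fin.last n).succ)) =
          Fin.init (Fin.init v) := by
        funext l
        simp only [Fin.init, Function.comp]
        rw [Equiv.swap_apply_of_ne_of_ne]
        · intro h
          have := congrArg Fin.val h
          simp at this
          omega
        · intro h
          have := congrArg Fin.val h
          simp at this
          omega
      rw [e0, h1]
      congr 2
      · simp [Fin.init]
      · simp [Fin.init]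

/-- The iterated derivatives of a smooth map are symmetric. -/
theorem iteratedFDeriv_perm {f : Z → T} {z : Z} (hf : ContDiffAt ℝ ∞ f z) (n : ℕ)
    (σ : Equiv.Perm (Fin n)) (v : Fin n → Z) :
    iteratedFDeriv ℝ n f z (v ∘ σ) = iteratedFDeriv ℝ n f z v := by
  cases n with
  | zero => congr 1; exact Subsingleton.elim _ _
  | succ n =>
    have hσ : σ ∈ Submonoid.closure
        (Set.range fun i : Fin n => Equiv.swap i.castSucc i.succ) := by
      rw [Equiv.Perm.mclosure_swap_castSucc_succ]; trivial
    induction hσ using Submonoid.closure_induction generalizing v with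
    | mem x hx => obtain ⟨i, rfl⟩ := hx; exact iteratedFDeriv_swap n hf i v
    | one => rfl
    | mul x y _ _ hx hy => rw [Equiv.Perm.coe_mul, ← Function.comp_assoc, hy, hx]

/-- The polynomial with the given derivatives at `z`. -/
def tay (k : ℕ) (z : Z) (w : Jet k Z T) (ζ : Z) : T :=
  ∑ j : Fin (k + 1), ((j : ℕ).factorial : ℝ)⁻¹ • w j (fun _ => ζ - z)

theorem contDiff_diagonal (j : ℕ) {n : WithTop ℕ∞} :
    ContDiff ℝ n (fun p : ContinuousMultilinearMap ℝ (fun _ : Fin j => Z) T × Z =>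
      p.1 (fun _ => p.2)) := by
  induction j with
  | zero =>
    have h : (fun p : ContinuousMultilinearMap ℝ (fun _ : Fin 0 => Z) T × Z =>
        p.1 (fun _ => p.2)) = fun p => continuousMultilinearCurryFin0 ℝ Z T p.1 := by
      funext p
      exact congrArg p.1 (Subsingleton.elim _ _)
    rw [h]
    exact (continuousMultilinearCurryFin0 ℝ Z T).toContinuousLinearEquiv.contDiff.comp
      contDiff_fst
  | succ j ih =>
    have h : (fun p : ContinuousMultilinearMap ℝ (fun _ : Fin (j + 1) => Z) T × Z =>
        p.1 (fun _ => p.2)) =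
        fun p => (continuousMultilinearCurryLeftEquiv ℝ (fun _ : Fin (j + 1) => Z) T p.1 p.2)
          (fun _ => p.2) := by
      funext p
      refine congrArg p.1 ?_
      funext i
      refine Fin.cases ?_ (fun i => ?_) i <;> simp
    rw [h]
    have h1 : ContDiff ℝ n (fun p : ContinuousMultilinearMap ℝ (fun _ : Fin (j + 1) => Z) T × Z =>
        (continuousMultilinearCurryLeftEquiv ℝ (fun _ : Fin (j + 1) => Z) T p.1 p.2)) :=
      ((continuousMultilinearCurryLeftEquiv ℝ
        (fun _ : Fin (j + 1) => Z) T).toContinuousLinearEquiv.contDiff.comp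
        contDiff_fst).clm_apply contDiff_snd
    exact ih.comp (h1.prodMk contDiff_snd)

theorem contDiff_tay (k : ℕ) {n : WithTop ℕ∞} :
    ContDiff ℝ n (fun p : (Z × Jet k Z T) × Z => tay k p.1.1 p.1.2 p.2) := by
  refine ContDiff.sum fun j _ => contDiff_const.smul ?_
  have h1 : ContDiff ℝ n (fun p : (Z × Jet k Z T) × Z => p.1.2 j) :=
    (ContinuousLinearMap.proj (R := ℝ) (φ := fun j : Fin (k + 1) =>
      ContinuousMultilinearMap ℝ (fun _ : Fin (j : ℕ) => Z) T) j).contDiff.comp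
      (contDiff_snd.comp contDiff_fst)
  exact (contDiff_diagonal (Z := Z) (T := T) (j : ℕ)).comp
    (h1.prodMk (contDiff_snd.sub (contDiff_fst.comp contDiff_fst)))

theorem contDiff_tay_apply (k : ℕ) (z : Z) (w : Jet k Z T) {n : WithTop ℕ∞} :
    ContDiff ℝ n (tay k z w) :=
  (contDiff_tay k).comp (f := fun ζ => ((z, w), ζ)) (contDiff_const.prodMk contDiff_id)

theorem jet_tay_of_symm (k : ℕ) (z : Z) (w : Jet k Z T)
    (hw : ∀ (j : Fin (k + 1)) (σ : Equiv.Perm (Fin j)) (v : Fin j → Z), w j (v ∘ σ) = w j v) :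
    jet k (tay k z w) z = w := by
  let p : FormalMultilinearSeries ℝ Z T := fun n =>
    if h : n < k + 1 then ((n.factorial : ℝ)⁻¹) • w ⟨n, h⟩ else 0
  have hp1 : ∀ j : Fin (k + 1), p j = ((j : ℕ).factorial : ℝ)⁻¹ • w j := fun j => dif_pos j.2
  have hp0 : ∀ j, ¬ j < k + 1 → p j = 0 := fun j hj => dif_neg hj
  have hp : HasFPowerSeriesOnBall (tay k z w) p z ⊤ := by
    refine ⟨?_, by simp, ?_⟩
    · rw [FormalMultilinearSeries.radius_eq_top_of_forall_image_add_eq_zero p (k + 1)]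
      exact fun m => hp0 _ (by omega)
    · intro y _
      have h1 : tay k z w (z + y) = ∑ j ∈ Finset.range (k + 1), p j (fun _ => y) := by
        rw [Finset.sum_range]
        refine Finset.sum_congr rfl fun j _ => ?_
        rw [hp1, add_sub_cancel_left]
        rfl
      rw [h1]
      refine hasSum_sum_of_ne_finset_zero fun j hj => ?_
      rw [hp0 j (by simpa using hj)]
      rfl
  have ha : AnalyticOn ℝ (tay k z w) Set.univ := by
    rw [← contDiffOn_omega_iff_analyticOn uniqueDiffOn_univ, contDiffOn_univ]
    exact contDiff_tay_apply k z w
  funext j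
  ext v
  show iteratedFDeriv ℝ j (tay k z w) z v = w j v
  rw [hp.iteratedFDeriv_eq_sum ha]
  have h2 : ∀ σ : Equiv.Perm (Fin j), p j (fun i => v (σ i)) = ((j : ℕ).factorial : ℝ)⁻¹ • w j v := by
    intro σ
    have h3 := hw j σ v
    rw [hp1, ← h3]
    rfl
  rw [Finset.sum_congr rfl fun σ _ => h2 σ, Finset.sum_const, Finset.card_univ, Fintype.card_perm,
    Fintype.card_fin, ← Nat.cast_smul_eq_nsmul ℝ, smul_smul, mul_inv_cancel₀, one_smul]
  exact_mod_cast Nat.factorial_ne_zero _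

/-- The Taylor polynomial of `f` has the same jet as `f`. -/
theorem jet_tay {k : ℕ} {f : Z → T} {z : Z} (hf : ContDiffAt ℝ ∞ f z) :
    jet k (tay k z (jet k f z)) z = jet k f z :=
  jet_tay_of_symm k z _ fun j σ v => iteratedFDeriv_perm hf j σ v

end Taylor


/-! ### Functions vanishing to finite order -/

section SmoothNear

variable {Z T : Type*} [NormedAddCommGroup Z] [NormedSpace ℝ Z]
  [NormedAddCommGroup T] [NormedSpace ℝ T]

/-- `f` is smooth in a neighbourhood of `z`. (In Mathlib, `ContDiffAt ℝ ∞ f z` only gives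
neighbourhoods depending on the order of differentiability.) -/
def SmoothNear (f : Z → T) (z : Z) : Prop := ∀ᶠ ζ in 𝓝 z, ContDiffAt ℝ ∞ f ζ

theorem openGood_smoothNear : OpenGood (SmoothNear (Z := Z) (T := T)) :=
  ⟨fun h => h.eventually_nhds, fun h => h.self_of_nhds⟩

theorem SmoothNear.contDiffAt {f : Z → T} {z : Z} (h : SmoothNear f z) : ContDiffAt ℝ ∞ f z :=
  h.self_of_nhds

theorem _root_.ContDiff.smoothNear {f : Z → T} (h : ContDiff ℝ ∞ f) (z : Z) : SmoothNear f z :=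
  Filter.Eventually.of_forall fun _ => h.contDiffAt

theorem SmoothNear.fderiv {f : Z → T} {z : Z} (h : SmoothNear f z) :
    SmoothNear (fderiv ℝ f) z := h.mono fun _ h => contDiffAt_fderiv h

end SmoothNear

section Vanishing

universe u

variable {Z T R S : Type u} [NormedAddCommGroup Z] [NormedSpace ℝ Z]
  [NormedAddCommGroup T] [NormedSpace ℝ T]
  [NormedAddCommGroup R] [NormedSpace ℝ R] [NormedAddCommGroup S] [NormedSpace ℝ S]

/-- `f` vanishes at `z` to order `K`: its derivatives of order less than `K` are zero. -/
def Van (K : ℕ) (f : Z → T) (z : Z) : Prop := ∀ j < K, iteratedFDeriv ℝ j f z = 0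

theorem Van.zero (f : Z → T) (z : Z) : Van 0 f z := fun _ h => absurd h (Nat.not_lt_zero _)

theorem Van.mono {K L : ℕ} {f : Z → T} {z : Z} (h : Van K f z) (hL : L ≤ K) : Van L f z :=
  fun j hj => h j (hj.trans_le hL)

theorem Van.congr {K : ℕ} {f g : Z → T} {z : Z} (h : Van K f z) (hfg : g =ᶠ[𝓝 z] f) :
    Van K g z := fun j hj => (hfg.iteratedFDeriv ℝ j).eq_of_nhds.trans (h j hj)

theorem van_succ_iff_jet {K : ℕ} {f : Z → T} {z : Z} : Van (K + 1) f z ↔ jet K f z = 0 :=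
  ⟨fun h => funext fun j => h j j.2, fun h j hj => congrFun h ⟨j, hj⟩⟩

theorem van_succ_iff {K : ℕ} {f : Z → T} {z : Z} :
    Van (K + 1) f z ↔ f z = 0 ∧ Van K (fderiv ℝ f) z := by
  have key : ∀ j, iteratedFDeriv ℝ (j + 1) f z = 0 ↔ iteratedFDeriv ℝ j (fderiv ℝ f) z = 0 := by
    intro j
    rw [← norm_eq_zero, ← norm_iteratedFDeriv_fderiv, norm_eq_zero]
  constructor
  · refine fun h => ⟨?_, fun j hj => (key j).1 (h (j + 1) (by omega))⟩
    have := congrArg (fun M => M 0) (h 0 (by omega))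
    simpa using this
  · rintro ⟨h0, h⟩ j hj
    cases j with
    | zero => ext v; simpa using h0
    | succ j => exact (key j).2 (h j (by omega))

theorem Van.apply_eq_zero {K : ℕ} {f : Z → T} {z : Z} (h : Van K f z) (hK : 0 < K) : f z = 0 := by
  obtain ⟨K, rfl⟩ := Nat.exists_eq_succ_of_ne_zero hK.ne'
  exact (van_succ_iff.1 h).1

theorem Van.fderiv {K : ℕ} {f : Z → T} {z : Z} (h : Van K f z) :
    Van (K - 1) (fderiv ℝ f) z := by
  cases K with
  | zero => exact Van.zero _ _
  | succ K => exact (van_succ_iff.1 h).2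

theorem jet_sub {K : ℕ} {f g : Z → T} {z : Z} (hf : ContDiffAt ℝ ∞ f z)
    (hg : ContDiffAt ℝ ∞ g z) :
    jet K (fun ζ => f ζ - g ζ) z = jet K f z - jet K g z :=
  funext fun j => iteratedFDeriv_sub_apply (hf.of_le (by exact_mod_cast le_top))
    (hg.of_le (by exact_mod_cast le_top))

theorem van_sub_iff {K : ℕ} {f g : Z → T} {z : Z} (hf : ContDiffAt ℝ ∞ f z)
    (hg : ContDiffAt ℝ ∞ g z) :
    Van (K + 1) (fun ζ => f ζ - g ζ) z ↔ jet K f z = jet K g z := by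
  rw [van_succ_iff_jet, jet_sub hf hg, sub_eq_zero]

theorem Van.add {K : ℕ} {f g : Z → T} {z : Z} (h : Van K f z) (h' : Van K g z)
    (hf : ContDiffAt ℝ ∞ f z) (hg : ContDiffAt ℝ ∞ g z) : Van K (fun ζ => f ζ + g ζ) z :=
  fun j hj => (iteratedFDeriv_add_apply (hf.of_le (by exact_mod_cast le_top))
    (hg.of_le (by exact_mod_cast le_top))).trans (by rw [h j hj, h' j hj, add_zero])

theorem Van.sub {K : ℕ} {f g : Z → T} {z : Z} (h : Van K f z) (h' : Van K g z)
    (hf : ContDiffAt ℝ ∞ f z) (hg : ContDiffAt ℝ ∞ g z) : Van K (fun ζ => f ζ - g ζ) z :=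
  fun j hj => (iteratedFDeriv_sub_apply (hf.of_le (by exact_mod_cast le_top))
    (hg.of_le (by exact_mod_cast le_top))).trans (by rw [h j hj, h' j hj, sub_zero])

theorem Van.bilin {K : ℕ} {f : Z → T} {g : Z → S} {z : Z} (h : Van K f z) (hf : SmoothNear f z)
    (hg : SmoothNear g z) (B : T →L[ℝ] S →L[ℝ] R) : Van K (fun ζ => B (f ζ) (g ζ)) z := by
  cases K with
  | zero => exact Van.zero _ _
  | succ K =>
    let good : (Z → T) → Z → Prop := fun Φ ζ => SmoothNear Φ ζ ∧ SmoothNear g ζ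
    have hgood : OpenGood good :=
      ⟨fun h => h.1.eventually_nhds.and h.2.eventually_nhds, fun h => h.1.contDiffAt⟩
    have hop : IsJetOp 0 good (fun Φ ζ => B (Φ ζ) (g ζ)) :=
      IsJetOp.val.bilin (IsJetOp.base fun _ _ h => h.2.contDiffAt) B
    have h0 : good (fun _ => 0) z := ⟨contDiff_const.smoothNear z, hg⟩
    rw [van_succ_iff_jet] at h ⊢
    have hz : jet K (fun _ : Z => (0 : T)) z = 0 :=
      funext fun j => by simp [jet]
    have := hop.congr_jet_jet hgood (k := K) (z := z) ⟨hf, hg⟩ h0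
      (by rw [Nat.zero_add, h, hz])
    rw [this]
    simp only [map_zero, zero_apply]
    exact funext fun j => by simp [jet]

theorem Van.bilin_right {K : ℕ} {f : Z → T} {g : Z → S} {z : Z} (h : Van K f z)
    (hf : SmoothNear f z) (hg : SmoothNear g z) (B : S →L[ℝ] T →L[ℝ] R) :
    Van K (fun ζ => B (g ζ) (f ζ)) z := h.bilin hf hg B.flip

theorem Van.clm {K : ℕ} {f : Z → T} {z : Z} (h : Van K f z) (hf : ContDiffAt ℝ ∞ f z)
    (B : T →L[ℝ] S) : Van K (fun ζ => B (f ζ)) z := fun j hj =>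
  (B.iteratedFDeriv_comp_left hf (by exact_mod_cast le_top)).trans (by rw [h j hj]; ext; simp)

/-- Multiplication by a function vanishing at the point raises the order of vanishing. -/
theorem Van.smul_of_zero {K : ℕ} : ∀ {T : Type u} [NormedAddCommGroup T] [NormedSpace ℝ T]
    {f : Z → T} {ξ : Z → ℝ} {z : Z} (_ : Van K f z)
    (_ : SmoothNear f z) (_ : SmoothNear ξ z) (_ : ξ z = 0), Van (K + 1) (fun ζ => ξ ζ • f ζ) z := by
  induction K with
  | zero =>
    intro T _ _ f ξ z _ _ _ h0
    rw [van_succ_iff]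
    exact ⟨by simp [h0], Van.zero _ _⟩
  | succ K ih =>
    intro T _ _ f ξ z h hf hξ h0
    rw [van_succ_iff]
    refine ⟨by simp [h0], ?_⟩
    have he : _root_.fderiv ℝ (fun ζ => ξ ζ • f ζ) =ᶠ[𝓝 z]
        fun ζ => ξ ζ • _root_.fderiv ℝ f ζ + (_root_.fderiv ℝ ξ ζ).smulRight (f ζ) := by
      filter_upwards [hf, hξ] with ζ h1 h2
      exact fderiv_fun_smul (differentiableAt_of_smooth h2) (differentiableAt_of_smooth h1)
    refine Van.congr ?_ he
    refine Van.add (ih (van_succ_iff.1 h).2 hf.fderiv hξ h0) ?_ ?_ ?_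
    · exact h.bilin_right hf (hξ.fderiv) (ContinuousLinearMap.smulRightL ℝ Z T)
    · exact hξ.contDiffAt.smul hf.fderiv.contDiffAt
    · exact hξ.fderiv.contDiffAt.smulRight hf.contDiffAt

theorem Van.pow_smul {K : ℕ} {f : Z → T} {ξ : Z → ℝ} {z : Z} (h : Van K f z)
    (hf : SmoothNear f z) (hξ : SmoothNear ξ z) (h0 : ξ z = 0) (k : ℕ) :
    Van (K + k) (fun ζ => ξ ζ ^ k • f ζ) z := by
  induction k with
  | zero => simpa using h
  | succ k ih =>
    have h1 := ih.smul_of_zero (ξ := ξ) (by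
      filter_upwards [hf, hξ] with ζ h1 h2 using (h2.pow k).smul h1) hξ h0
    refine h1.congr (Filter.Eventually.of_forall fun ζ => ?_)
    simp only [smul_smul, pow_succ']

end Vanishing


/-! ### Flat connections given by submersions -/

section Submersions

variable {n m : ℕ} {T : Type} [NormedAddCommGroup T] [NormedSpace ℝ T]

/-- The derivative of `f` along the horizontal lift of `a` for the connection with coefficients
`V`. -/
def nab (V : Rn n × Rn m → (Rn n →L[ℝ] Rn m)) (a : Rn n) (f : Rn n × Rn m → T)
    (z : Rn n × Rn m) : T :=
  fderiv ℝ f z (a, V z a)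

theorem curvature_apply (V : Rn n × Rn m → (Rn n →L[ℝ] Rn m)) (z : Rn n × Rn m) (a b : Rn n) :
    curvature V z a b = fderiv ℝ V z (a, V z a) b - fderiv ℝ V z (b, V z b) a := rfl

theorem fderiv_nab {V : Rn n × Rn m → (Rn n →L[ℝ] Rn m)} {f : Rn n × Rn m → T}
    {z : Rn n × Rn m} (hV : ContDiffAt ℝ ∞ V z) (hf : ContDiffAt ℝ ∞ f z) (a : Rn n)
    (h : Rn n × Rn m) :
    fderiv ℝ (nab V a f) z h =
      fderiv ℝ (fderiv ℝ f) z h (a, V z a) + fderiv ℝ f z (0, fderiv ℝ V z h a) := by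
  have h1 : HasFDerivAt (fun ζ => (a, V ζ a))
      (ContinuousLinearMap.prod 0 ((fderiv ℝ V z).flip a)) z :=
    (hasFDerivAt_const a z).prodMk (by
      have := (differentiableAt_of_smooth hV).hasFDerivAt.clm_apply (hasFDerivAt_const a z)
      simpa using this)
  have h2 := (differentiableAt_of_smooth (contDiffAt_fderiv hf)).hasFDerivAt.clm_apply h1
  have h3 : fderiv ℝ (nab V a f) z = _ := h2.fderiv
  rw [h3]
  simp [add_comm]

/-- Horizontal lifts commute up to curvature. -/
theorem nab_nab_sub {V : Rn n × Rn m → (Rn n →L[ℝ] Rn m)} {f : Rn n × Rn m → T}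
    {z : Rn n × Rn m} (hV : ContDiffAt ℝ ∞ V z) (hf : ContDiffAt ℝ ∞ f z) (a b : Rn n) :
    nab V a (nab V b f) z - nab V b (nab V a f) z =
      fderiv ℝ f z (0, curvature V z a b) := by
  have hs : IsSymmSndFDerivAt ℝ f z := (eventually_contDiffAt_fin hf 2).self_of_nhds.isSymmSndFDerivAt (by simp)
  have e : ∀ c (g : Rn n × Rn m → T), nab V c g z = fderiv ℝ g z (c, V z c) := fun _ _ => rfl
  rw [e, e, fderiv_nab hV hf, fderiv_nab hV hf, hs.eq (a, V z a) (b, V z b), add_sub_add_left_eq_sub,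
    ← map_sub, Prod.mk_sub_mk, sub_zero, curvature_apply]

theorem SmoothNear.nab {V : Rn n × Rn m → (Rn n →L[ℝ] Rn m)} {f : Rn n × Rn m → T}
    {z : Rn n × Rn m} (hV : SmoothNear V z) (hf : SmoothNear f z) (a : Rn n) :
    SmoothNear (nab V a f) z := by
  filter_upwards [hV, hf] with ζ h1 h2
  exact (contDiffAt_fderiv h2).clm_apply (contDiffAt_const.prodMk (h1.clm_apply contDiffAt_const))

theorem nab_congr {V V' : Rn n × Rn m → (Rn n →L[ℝ] Rn m)} {f g : Rn n × Rn m → T}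
    {z : Rn n × Rn m} (h : f =ᶠ[𝓝 z] g) (hV : V =ᶠ[𝓝 z] V') (a : Rn n) :
    nab V a f =ᶠ[𝓝 z] nab V' a g := by
  filter_upwards [h.fderiv (𝕜 := ℝ), hV] with ζ h1 h2
  simp only [FlatConn.nab, h1, h2]

/-- The derivative of `Φ` along the fiber. -/
def vert (Φ : Rn n × Rn m → Rn m) (z : Rn n × Rn m) : Rn m →L[ℝ] Rn m :=
  (fderiv ℝ Φ z).comp (ContinuousLinearMap.inr ℝ (Rn n) (Rn m))

/-- The coefficients of the flat connection whose leaves are the level sets of `Φ`. -/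
def flatCoef (Φ : Rn n × Rn m → Rn m) (z : Rn n × Rn m) : Rn n →L[ℝ] Rn m :=
  -((Ring.inverse (vert Φ z)).comp
    ((fderiv ℝ Φ z).comp (ContinuousLinearMap.inl ℝ (Rn n) (Rn m))))

/-- `Φ` is smooth near `z ∈ O` and the restriction of its derivative to the fiber is invertible. -/
def Subm (O : Set (Rn n × Rn m)) (Φ : Rn n × Rn m → Rn m) (z : Rn n × Rn m) : Prop :=
  z ∈ O ∧ SmoothNear Φ z ∧ IsUnit (vert Φ z)

variable {O : Set (Rn n × Rn m)} {Φ : Rn n × Rn m → Rn m} {z : Rn n × Rn m}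

theorem isJetOp_fderiv {Z T : Type*} [NormedAddCommGroup Z] [NormedSpace ℝ Z]
    [NormedAddCommGroup T] [NormedSpace ℝ T] :
    IsJetOp 1 (SmoothNear (Z := Z) (T := T)) (fun Φ z => fderiv ℝ Φ z) :=
  (IsJetOp.val (K := 0)).fderiv openGood_smoothNear

theorem isJetOp_vert : IsJetOp 1 (SmoothNear (Z := Rn n × Rn m) (T := Rn m)) vert :=
  isJetOp_fderiv.clm ((ContinuousLinearMap.compL ℝ (Rn m) (Rn n × Rn m) (Rn m)).flip
    (ContinuousLinearMap.inr ℝ (Rn n) (Rn m)))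

theorem SmoothNear.vert (h : SmoothNear Φ z) : SmoothNear (vert Φ) z :=
  h.eventually_nhds.mono fun _ h => isJetOp_vert.contDiffAt openGood_smoothNear h

theorem openGood_subm (hO : IsOpen O) : OpenGood (Subm O) := by
  refine ⟨fun {Φ z} h => ?_, fun h => h.2.1.contDiffAt⟩
  have h1 : ∀ᶠ ζ in 𝓝 z, IsUnit (FlatConn.vert Φ ζ) :=
    h.2.1.vert.contDiffAt.continuousAt.eventually (Units.isOpen.mem_nhds h.2.2)
  filter_upwards [hO.mem_nhds h.1, h.2.1.eventually_nhds, h1] with ζ a b c using ⟨a, b, c⟩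

theorem isJetOp_flatCoef : IsJetOp 1 (Subm O) flatCoef := by
  have h0 : IsJetOp 1 (Subm O) (fun Φ z => fderiv ℝ Φ z) :=
    isJetOp_fderiv.mono_good fun _ _ h => h.2.1
  have h1 : IsJetOp 1 (Subm O) (fun Φ z => Ring.inverse (vert Φ z)) := by
    refine (isJetOp_vert.mono_good fun _ _ h => h.2.1).comp fun Φ z h => ?_
    obtain ⟨u, hu⟩ := h.2.2
    rw [← hu]
    exact contDiffAt_ringInverse ℝ u
  have h2 := h0.clm ((ContinuousLinearMap.compL ℝ (Rn n) (Rn n × Rn m) (Rn m)).flip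
    (ContinuousLinearMap.inl ℝ (Rn n) (Rn m)))
  exact (h1.bilin h2 (ContinuousLinearMap.compL ℝ (Rn n) (Rn m) (Rn m))).clm
    (-ContinuousLinearMap.id ℝ _)

theorem Subm.smoothNear_flatCoef (hO : IsOpen O) (h : Subm O Φ z) : SmoothNear (flatCoef Φ) z :=
  ((openGood_subm hO).nhds h).mono fun _ h => isJetOp_flatCoef.contDiffAt (openGood_subm hO) h

theorem fderiv_apply_eq (Φ : Rn n × Rn m → Rn m) (z : Rn n × Rn m) (a : Rn n) (y : Rn m) :
    fderiv ℝ Φ z (a, y) = fderiv ℝ Φ z (a, 0) + vert Φ z y := by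
  have : ((a, y) : Rn n × Rn m) = (a, 0) + (0, y) := by simp
  rw [this, map_add]
  rfl

theorem nab_flatCoef (h : IsUnit (vert Φ z)) (a : Rn n) : nab (flatCoef Φ) a Φ z = 0 := by
  have h1 : vert Φ z (Ring.inverse (vert Φ z) (fderiv ℝ Φ z (a, 0))) = fderiv ℝ Φ z (a, 0) := by
    have := congrArg (fun B => B (fderiv ℝ Φ z (a, 0))) (Ring.mul_inverse_cancel _ h)
    exact this
  rw [nab, fderiv_apply_eq]
  simp [flatCoef, h1]

theorem eq_of_vert_eq (h : IsUnit (vert Φ z)) {y y' : Rn m} (hy : vert Φ z y = vert Φ z y') :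
    y = y' := by
  have h1 := congrArg (fun B => B y) (Ring.inverse_mul_cancel _ h)
  have h2 := congrArg (fun B => B y') (Ring.inverse_mul_cancel _ h)
  simp only [mul_apply_eq_comp, one_apply_eq_self] at h1 h2
  rw [← h1, ← h2, hy]

/-- The connection `flatCoef Φ` is the only one along which `Φ` is constant. -/
theorem eq_flatCoef (h : IsUnit (vert Φ z)) {L : Rn n →L[ℝ] Rn m}
    (hL : ∀ a, fderiv ℝ Φ z (a, L a) = 0) : L = flatCoef Φ z := by
  ext1 a
  refine eq_of_vert_eq h ?_
  have h1 := hL a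
  have h2 := nab_flatCoef h a
  rw [nab, fderiv_apply_eq] at h2
  rw [fderiv_apply_eq] at h1
  exact add_left_cancel (h1.trans h2.symm)

/-- The connection `flatCoef Φ` is flat. -/
theorem curvature_flatCoef (hO : IsOpen O) (h : Subm O Φ z) : curvature (flatCoef Φ) z = 0 := by
  have hz : ∀ a, nab (flatCoef Φ) a Φ =ᶠ[𝓝 z] fun _ => 0 := fun a => by
    filter_upwards [(openGood_subm hO).nhds h] with ζ hζ using nab_flatCoef hζ.2.2 a
  ext1 a; ext1 b
  refine eq_of_vert_eq h.2.2 ?_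
  have h1 := nab_nab_sub (h.smoothNear_flatCoef hO).contDiffAt h.2.1.contDiffAt a b
  have h2 : ∀ a b, nab (flatCoef Φ) a (nab (flatCoef Φ) b Φ) z = 0 := fun a b => by
    rw [nab, (hz b).fderiv_eq]
    simp
  rw [h2, h2, sub_zero] at h1
  rw [zero_apply, zero_apply, map_zero]
  exact h1.symm

theorem fderiv_comp_apply {κ : Rn m → Rn m} (hκ : DifferentiableAt ℝ κ (Φ z))
    (hΦ : DifferentiableAt ℝ Φ z) (h : Rn n × Rn m) :
    fderiv ℝ (fun ζ => κ (Φ ζ)) z h = fderiv ℝ κ (Φ z) (fderiv ℝ Φ z h) := by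
  have := (hκ.hasFDerivAt.comp z hΦ.hasFDerivAt).fderiv
  exact congrArg (fun B => B h) this

theorem vert_comp {κ : Rn m → Rn m} (hκ : DifferentiableAt ℝ κ (Φ z))
    (hΦ : DifferentiableAt ℝ Φ z) :
    vert (fun ζ => κ (Φ ζ)) z = fderiv ℝ κ (Φ z) * vert Φ z := by
  ext1 y
  exact fderiv_comp_apply hκ hΦ _

theorem Subm.comp (h : Subm O Φ z) {κ : Rn m → Rn m} (hκ : SmoothNear κ (Φ z))
    (hu : IsUnit (fderiv ℝ κ (Φ z))) : Subm O (fun ζ => κ (Φ ζ)) z := by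
  refine ⟨h.1, ?_, ?_⟩
  · filter_upwards [h.2.1, h.2.1.contDiffAt.continuousAt.eventually hκ] with ζ h1 h2
    exact ContDiffAt.comp ζ h2 h1
  · rw [vert_comp (differentiableAt_of_smooth hκ.contDiffAt)
      (differentiableAt_of_smooth h.2.1.contDiffAt)]
    exact hu.mul h.2.2

/-- Reparametrizing the leaves does not change the connection. -/
theorem flatCoef_comp (h : Subm O Φ z) {κ : Rn m → Rn m} (hκ : SmoothNear κ (Φ z))
    (hu : IsUnit (fderiv ℝ κ (Φ z))) : flatCoef (fun ζ => κ (Φ ζ)) z = flatCoef Φ z := by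
  refine (eq_flatCoef (h.comp hκ hu).2.2 fun a => ?_).symm
  rw [fderiv_comp_apply (differentiableAt_of_smooth hκ.contDiffAt)
    (differentiableAt_of_smooth h.2.1.contDiffAt)]
  have := nab_flatCoef h.2.2 a
  rw [nab] at this
  rw [this, map_zero]

end Submersions


/-! ### Approximate leaf coordinates of connections with vanishing curvature -/

section LeafCoordinates

variable {n m : ℕ} {T : Type} [NormedAddCommGroup T] [NormedSpace ℝ T]

/-- The `i`-th coordinate vector of `ℝ^n`. -/
abbrev ex (i : Fin n) : Rn n := EuclideanSpace.single i 1

/-- The derivative of `f` along horizontal lifts, as an operator-valued function. -/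
def nabL (V : Rn n × Rn m → (Rn n →L[ℝ] Rn m)) (f : Rn n × Rn m → T) (z : Rn n × Rn m) :
    Rn n →L[ℝ] T :=
  (fderiv ℝ f z).comp ((ContinuousLinearMap.id ℝ (Rn n)).prod (V z))

theorem nabL_apply (V : Rn n × Rn m → (Rn n →L[ℝ] Rn m)) (f : Rn n × Rn m → T)
    (z : Rn n × Rn m) (a : Rn n) : nabL V f z a = nab V a f z := rfl

/-- The base coordinate `x_i` on `ℝ^n × ℝ^m`. -/
def cx (i : Fin n) : Rn n × Rn m →L[ℝ] ℝ :=
  (EuclideanSpace.proj i : Rn n →L[ℝ] ℝ).comp (ContinuousLinearMap.fst ℝ (Rn n) (Rn m))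

theorem cx_apply (i : Fin n) (z : Rn n × Rn m) : cx i z = z.1 i := rfl

theorem sum_ex (a : Rn n) : ∑ i, a i • ex i = a := by
  ext j
  simp [ex, Finset.sum_apply, Pi.single_apply]

theorem clm_eq_sum (L : Rn n →L[ℝ] T) :
    L = ∑ i, (EuclideanSpace.proj i : Rn n →L[ℝ] ℝ).smulRight (L (ex i)) := by
  ext a
  conv_lhs => rw [← sum_ex a, map_sum]
  simp

theorem van_sum {Z T ι : Type} [NormedAddCommGroup Z] [NormedSpace ℝ Z] [NormedAddCommGroup T]
    [NormedSpace ℝ T] {K : ℕ} {z : Z} (s : Finset ι) {f : ι → Z → T}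
    (hf : ∀ i ∈ s, ContDiffAt ℝ ∞ (f i) z) (h : ∀ i ∈ s, Van K (f i) z) :
    Van K (fun ζ => ∑ i ∈ s, f i ζ) z := by
  classical
  induction s using Finset.induction_on with
  | empty => intro j _; simp
  | insert i s hi ih =>
    simp only [Finset.sum_insert hi]
    exact Van.add (h i (by simp)) (ih (fun j hj => hf j (by simp [hj])) fun j hj => h j (by simp [hj]))
      (hf i (by simp)) (ContDiffAt.sum fun j hj => hf j (by simp [hj]))

theorem van_of_apply {Z T : Type} [NormedAddCommGroup Z] [NormedSpace ℝ Z] [NormedAddCommGroup T]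
    [NormedSpace ℝ T] {K : ℕ} {z : Z} {f : Z → (Rn n →L[ℝ] T)} (hf : ContDiffAt ℝ ∞ f z)
    (h : ∀ i, Van K (fun ζ => f ζ (ex i)) z) : Van K f z := by
  have h1 : ∀ i, ContDiffAt ℝ ∞ (fun ζ => f ζ (ex i)) z := fun i =>
    hf.clm_apply contDiffAt_const
  have h2 : Van K (fun ζ => ∑ i, ContinuousLinearMap.smulRightL ℝ (Rn n) T
      (EuclideanSpace.proj i : Rn n →L[ℝ] ℝ) (f ζ (ex i))) z :=
    van_sum _ (fun i _ => (ContinuousLinearMap.contDiff _).contDiffAt.comp z (h1 i))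
      fun i _ => (h i).clm (h1 i) _
  exact h2.congr (Filter.Eventually.of_forall fun ζ => clm_eq_sum (f ζ))

theorem SmoothNear.nabL {V : Rn n × Rn m → (Rn n →L[ℝ] Rn m)} {f : Rn n × Rn m → T}
    {z : Rn n × Rn m} (hV : SmoothNear V z) (hf : SmoothNear f z) :
    SmoothNear (nabL V f) z := by
  filter_upwards [hV, hf] with ζ h1 h2
  exact (contDiffAt_fderiv h2).clm_comp (contDiffAt_const.clm_prod h1)

theorem contDiff_nab_family {P : Type*} [NormedAddCommGroup P] [NormedSpace ℝ P]
    {V : P → Rn n × Rn m → (Rn n →L[ℝ] Rn m)} {f : P → Rn n × Rn m → T}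
    (hV : ContDiff ℝ ∞ (Function.uncurry V)) (hf : ContDiff ℝ ∞ (Function.uncurry f)) (a : Rn n) :
    ContDiff ℝ ∞ (Function.uncurry fun p => nab (V p) a (f p)) := by
  have h1 : ContDiff ℝ ∞ (fun q : P × (Rn n × Rn m) => fderiv ℝ (f q.1) q.2) := by
    refine ContDiff.fderiv (f := fun (q : P × (Rn n × Rn m)) ζ => f q.1 ζ) (n := ∞) (m := ∞) ?_
      contDiff_snd (by simp)
    exact hf.comp ((contDiff_fst.comp contDiff_fst).prodMk contDiff_snd)
  exact h1.clm_apply (contDiff_const.prodMk (hV.clm_apply contDiff_const))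

theorem ContDiff.nab {V : Rn n × Rn m → (Rn n →L[ℝ] Rn m)} {f : Rn n × Rn m → T}
    (hV : ContDiff ℝ ∞ V) (hf : ContDiff ℝ ∞ f) (a : Rn n) : ContDiff ℝ ∞ (nab V a f) :=
  (hf.fderiv_right (m := ∞) (by simp)).clm_apply
    (contDiff_const.prodMk (hV.clm_apply contDiff_const))

theorem contDiff_nab_iterate_family {P : Type*} [NormedAddCommGroup P] [NormedSpace ℝ P]
    {V : P → Rn n × Rn m → (Rn n →L[ℝ] Rn m)} {f : P → Rn n × Rn m → T}
    (hV : ContDiff ℝ ∞ (Function.uncurry V)) (hf : ContDiff ℝ ∞ (Function.uncurry f)) (a : Rn n)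
    (k : ℕ) : ContDiff ℝ ∞ (Function.uncurry fun p => (nab (V p) a)^[k] (f p)) := by
  induction k with
  | zero => exact hf
  | succ k ih =>
    simp only [Function.iterate_succ', Function.comp_apply]
    exact contDiff_nab_family hV ih a

theorem ContDiff.nab_iterate {V : Rn n × Rn m → (Rn n →L[ℝ] Rn m)} {f : Rn n × Rn m → T}
    (hV : ContDiff ℝ ∞ V) (hf : ContDiff ℝ ∞ f) (a : Rn n) (k : ℕ) :
    ContDiff ℝ ∞ ((FlatConn.nab V a)^[k] f) := by
  induction k with
  | zero => exact hf
  | succ k ih =>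
    simp only [Function.iterate_succ', Function.comp_apply]
    exact ContDiff.nab hV ih a

theorem nab_smul {V : Rn n × Rn m → (Rn n →L[ℝ] Rn m)} {f : Rn n × Rn m → T}
    {g : Rn n × Rn m → ℝ} {z : Rn n × Rn m} (hg : DifferentiableAt ℝ g z)
    (hf : DifferentiableAt ℝ f z) (a : Rn n) :
    nab V a (fun ζ => g ζ • f ζ) z = g z • nab V a f z + nab V a g z • f z := by
  simp only [nab]
  rw [fderiv_fun_smul hg hf]
  rfl

theorem nab_sum {ι : Type*} {V : Rn n × Rn m → (Rn n →L[ℝ] Rn m)} (s : Finset ι)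
    {f : ι → Rn n × Rn m → T} {z : Rn n × Rn m} (hf : ∀ i ∈ s, DifferentiableAt ℝ (f i) z)
    (a : Rn n) : nab V a (fun ζ => ∑ i ∈ s, f i ζ) z = ∑ i ∈ s, nab V a (f i) z := by
  simp only [nab]
  rw [fderiv_fun_sum hf, sum_apply]

/-- The powers `(x_i - x_i(z))^k`. -/
def cxPow (i : Fin n) (z : Rn n × Rn m) (k : ℕ) (ζ : Rn n × Rn m) : ℝ := (cx i ζ - cx i z) ^ k

theorem contDiff_cxPow (i : Fin n) (z : Rn n × Rn m) (k : ℕ) : ContDiff ℝ ∞ (cxPow i z k) :=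
  ((cx i).contDiff.sub contDiff_const).pow k

theorem nab_cxPow (V : Rn n × Rn m → (Rn n →L[ℝ] Rn m)) (i : Fin n) (z ζ : Rn n × Rn m) (k : ℕ)
    (a : Rn n) : nab V a (cxPow i z k) ζ = k * cxPow i z (k - 1) ζ * a i := by
  have h : HasFDerivAt (cxPow i z k) _ ζ := (((cx i).hasFDerivAt (x := ζ)).sub_const (cx i z)).pow k
  rw [nab, h.fderiv]
  simp [cxPow, cx_apply]

/-- The part of order at most `K` of the Taylor expansion of `f`, along the horizontal lift of
`∂/∂x_i`, transported back to the hyperplane `x_i = x_i(z)`. -/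
def leafStep (K : ℕ) (V : Rn n × Rn m → (Rn n →L[ℝ] Rn m)) (z : Rn n × Rn m) (i : Fin n)
    (f : Rn n × Rn m → T) (ζ : Rn n × Rn m) : T :=
  ∑ k ∈ Finset.range (K + 1), ((-1) ^ k / (k.factorial : ℝ)) •
    (cxPow i z k ζ • (nab V (ex i))^[k] f ζ)

variable {V : Rn n × Rn m → (Rn n →L[ℝ] Rn m)} {f : Rn n × Rn m → T} {z : Rn n × Rn m} {K : ℕ}

theorem contDiff_leafStep_family {P : Type*} [NormedAddCommGroup P] [NormedSpace ℝ P]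
    {V : P → Rn n × Rn m → (Rn n →L[ℝ] Rn m)} {f : P → Rn n × Rn m → T} {z : P → Rn n × Rn m}
    (hV : ContDiff ℝ ∞ (Function.uncurry V)) (hf : ContDiff ℝ ∞ (Function.uncurry f))
    (hz : ContDiff ℝ ∞ z) (i : Fin n) :
    ContDiff ℝ ∞ (Function.uncurry fun p => leafStep K (V p) (z p) i (f p)) := by
  have h0 : (Function.uncurry fun p => leafStep K (V p) (z p) i (f p)) =
      fun q : P × (Rn n × Rn m) => ∑ k ∈ Finset.range (K + 1), ((-1) ^ k / (k.factorial : ℝ)) •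
        (cxPow i (z q.1) k q.2 • (nab (V q.1) (ex i))^[k] (f q.1) q.2) := rfl
  rw [h0]
  refine ContDiff.sum fun k _ => contDiff_const.smul (ContDiff.smul ?_ ?_)
  · exact (((cx i).contDiff.comp contDiff_snd).sub ((cx i).contDiff.comp (hz.comp contDiff_fst))).pow k
  · exact contDiff_nab_iterate_family hV hf (ex i) k

theorem contDiff_leafStep (hV : ContDiff ℝ ∞ V) (hf : ContDiff ℝ ∞ f) (i : Fin n) :
    ContDiff ℝ ∞ (leafStep K V z i f) :=
  ContDiff.sum fun k _ => contDiff_const.smul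
    ((contDiff_cxPow i z k).smul (ContDiff.nab_iterate hV hf (ex i) k))

theorem leafStep_slice (i : Fin n) {ζ : Rn n × Rn m} (h : ζ.1 = z.1) :
    leafStep K V z i f ζ = f ζ := by
  rw [leafStep, Finset.sum_range_succ', Finset.sum_eq_zero]
  · simp [cxPow]
  · intro k _
    simp [cxPow, cx_apply, h]

theorem nab_leafStep (hV : ContDiff ℝ ∞ V) (hf : ContDiff ℝ ∞ f) (i : Fin n) (a : Rn n)
    (ζ : Rn n × Rn m) : nab V a (leafStep K V z i f) ζ =
      ∑ k ∈ Finset.range (K + 1), ((-1) ^ k / (k.factorial : ℝ)) •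
        (cxPow i z k ζ • nab V a ((nab V (ex i))^[k] f) ζ +
          (k * cxPow i z (k - 1) ζ * a i) • (nab V (ex i))^[k] f ζ) := by
  have h1 : ∀ k, DifferentiableAt ℝ ((nab V (ex i))^[k] f) ζ := fun k =>
    differentiableAt_of_smooth (ContDiff.nab_iterate hV hf (ex i) k).contDiffAt
  have h2 : ∀ k, DifferentiableAt ℝ (cxPow i z k) ζ := fun k =>
    differentiableAt_of_smooth (contDiff_cxPow i z k).contDiffAt
  have h0 : leafStep K V z i f = fun ζ => ∑ k ∈ Finset.range (K + 1),
    ((-1) ^ k / (k.factorial : ℝ)) • (cxPow i z k ζ • (nab V (ex i))^[k] f ζ) := rfl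
  rw [h0, nab_sum (f := fun k ζ => ((-1) ^ k / (k.factorial : ℝ)) •
    (cxPow i z k ζ • (nab V (ex i))^[k] f ζ)) _ fun k _ => ((h2 k).smul (h1 k)).const_smul _]
  refine Finset.sum_congr rfl fun k _ => ?_
  have h3 := nab_smul (V := V) (g := fun _ => ((-1 : ℝ) ^ k / (k.factorial : ℝ)))
    (f := fun ζ => cxPow i z k ζ • (nab V (ex i))^[k] f ζ)
    (differentiableAt_const _) ((h2 k).smul (h1 k)) a
  rw [h3, nab_smul (h2 k) (h1 k), nab_cxPow]
  simp [nab]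

/-- The sum telescopes: only the term of order `K + 1` remains. -/
theorem nab_leafStep_self (hV : ContDiff ℝ ∞ V) (hf : ContDiff ℝ ∞ f) (i : Fin n)
    (ζ : Rn n × Rn m) : nab V (ex i) (leafStep K V z i f) ζ =
      ((-1) ^ K / (K.factorial : ℝ)) • (cxPow i z K ζ • (nab V (ex i))^[K + 1] f ζ) := by
  rw [nab_leafStep hV hf]
  simp only [← Function.iterate_succ_apply' (nab V (ex i))]
  induction K with
  | zero => simp
  | succ K ih =>
    rw [Finset.sum_range_succ, ih, smul_add, smul_smul, smul_smul, smul_smul,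
      add_left_comm, ← add_smul]
    convert add_zero _
    rw [smul_eq_zero]
    left
    have : (K.factorial : ℝ) ≠ 0 := by positivity
    have : ((K : ℝ) + 1) ≠ 0 := by positivity
    simp only [Nat.factorial_succ, Nat.add_sub_cancel]
    simp
    field_simp
    ring

theorem smoothNear_curvature (hV : SmoothNear V z) : SmoothNear (curvature V) z := by
  filter_upwards [hV] with ζ h
  have h1 : ContDiffAt ℝ ∞ (nabL V V) ζ :=
    (contDiffAt_fderiv h).clm_comp (contDiffAt_const.clm_prod h)
  refine h1.sub ?_
  have h2 : ContDiffAt ℝ ∞ (fun ζ => ∑ j, (EuclideanSpace.proj j : Rn n →L[ℝ] ℝ).smulRight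
      ((ContinuousLinearMap.apply ℝ (Rn m) (ex j)).comp (nabL V V ζ))) ζ :=
    ContDiffAt.sum fun j _ => contDiffAt_const.smulRight (contDiffAt_const.clm_comp h1)
  exact h2.congr_of_eventuallyEq (Filter.Eventually.of_forall fun ζ =>
    clm_eq_sum (nabL V V ζ).flip)

/-- Up to curvature, derivatives along horizontal lifts commute, so one more of them costs one order
of vanishing. -/
theorem van_nab_nab (hV : ContDiff ℝ ∞ V) (hf : ContDiff ℝ ∞ f) (hc : Van K (curvature V) z)
    (a b : Rn n) (h : Van K (nab V b f) z) : ∀ {L}, L ≤ K - 1 → Van L (nab V b (nab V a f)) z := by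
  intro L hL
  have h1 : Van L (nab V a (nab V b f)) z := by
    have h2 := (h.fderiv.mono hL).bilin ((ContDiff.nab hV hf b).smoothNear z).fderiv
      (g := fun ζ => (a, V ζ a)) ((contDiff_const.prodMk (hV.clm_apply contDiff_const)).smoothNear z)
      (ContinuousLinearMap.id ℝ _)
    exact h2
  have h3 : Van L (fun ζ => fderiv ℝ f ζ ((ContinuousLinearMap.inr ℝ (Rn n) (Rn m)).comp
      (curvature V ζ b) a)) z := by
    have hs := smoothNear_curvature (hV.smoothNear z)
    have h4 : Van L (fun ζ => (ContinuousLinearMap.inr ℝ (Rn n) (Rn m)) (curvature V ζ b a)) z :=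
      (hc.mono (by omega)).clm hs.contDiffAt ((ContinuousLinearMap.inr ℝ (Rn n) (Rn m)).comp
        ((ContinuousLinearMap.apply ℝ (Rn m) a).comp
          (ContinuousLinearMap.apply ℝ (Rn n →L[ℝ] Rn m) b)))
    refine h4.bilin_right ?_ (hf.smoothNear z).fderiv (ContinuousLinearMap.id ℝ _)
    filter_upwards [hs] with ζ hζ
    exact (ContinuousLinearMap.contDiff _).contDiffAt.comp ζ
      ((hζ.clm_apply contDiffAt_const).clm_apply contDiffAt_const)
  have h5 := h1.add h3 ?_ ?_
  · refine h5.congr (Filter.Eventually.of_forall fun ζ => ?_)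
    have := nab_nab_sub hV.contDiffAt hf.contDiffAt b a (z := ζ)
    rw [sub_eq_iff_eq_add] at this
    rw [this, add_comm]
    rfl
  · exact (ContDiff.nab hV (ContDiff.nab hV hf b) a).contDiffAt
  · exact (contDiffAt_fderiv hf.contDiffAt).clm_apply
      (ContDiffAt.comp z (ContinuousLinearMap.inr ℝ (Rn n) (Rn m)).contDiff.contDiffAt
        (((smoothNear_curvature (hV.smoothNear z)).contDiffAt.clm_apply contDiffAt_const).clm_apply
          contDiffAt_const))

theorem van_nab_iterate (hV : ContDiff ℝ ∞ V) (hf : ContDiff ℝ ∞ f) (hc : Van K (curvature V) z)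
    (a b : Rn n) (h : Van K (nab V b f) z) (k : ℕ) :
    Van (K - k) (nab V b ((nab V a)^[k] f)) z := by
  induction k with
  | zero => exact h
  | succ k ih =>
    rw [Function.iterate_succ_apply']
    exact van_nab_nab hV (ContDiff.nab_iterate hV hf a k) (hc.mono (Nat.sub_le K k)) a b ih
      (by omega)

/-- The step in the direction `i` achieves constancy along `∂/∂x_i` to order `K`, and preserves it
along the other directions. -/
theorem van_nab_leafStep (hV : ContDiff ℝ ∞ V) (hf : ContDiff ℝ ∞ f)
    (hc : Van K (curvature V) z) (i j : Fin n) (h : j = i ∨ Van K (nab V (ex j) f) z) :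
    Van K (nab V (ex j) (leafStep K V z i f)) z := by
  have hpow : ∀ {L k} {g : Rn n × Rn m → T}, ContDiff ℝ ∞ g → Van L g z →
      Van (L + k) (fun ζ => cxPow i z k ζ • g ζ) z := fun {L k g} hg h =>
    Van.pow_smul h (hg.smoothNear z) (((cx i).contDiff.sub contDiff_const).smoothNear z)
      (sub_self _) k
  by_cases hij : j = i
  · subst hij
    have h1 := hpow (k := K) (ContDiff.nab_iterate hV hf (ex j) (K + 1)) (Van.zero _ z)
    rw [Nat.zero_add] at h1
    refine (h1.clm ?_ (((-1) ^ K / (K.factorial : ℝ)) • ContinuousLinearMap.id ℝ T)).congr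
      (Filter.Eventually.of_forall fun ζ => nab_leafStep_self hV hf j ζ)
    exact ((contDiff_cxPow j z K).smul (ContDiff.nab_iterate hV hf (ex j) (K + 1))).contDiffAt
  · replace h := h.resolve_left hij
    have hs : ∀ k, ContDiff ℝ ∞ (fun ζ => cxPow i z k ζ • nab V (ex j) ((nab V (ex i))^[k] f) ζ) :=
      fun k => (contDiff_cxPow i z k).smul (ContDiff.nab hV (ContDiff.nab_iterate hV hf (ex i) k) _)
    have h1 : ∀ k ∈ Finset.range (K + 1), Van K (fun ζ =>
        cxPow i z k ζ • nab V (ex j) ((nab V (ex i))^[k] f) ζ) z := fun k hk =>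
      (hpow (ContDiff.nab hV (ContDiff.nab_iterate hV hf (ex i) k) _)
        (van_nab_iterate hV hf hc (ex i) (ex j) h k)).mono (by rw [Finset.mem_range] at hk; omega)
    refine (van_sum (Finset.range (K + 1)) (f := fun k ζ => ((-1) ^ k / (k.factorial : ℝ)) •
      (cxPow i z k ζ • nab V (ex j) ((nab V (ex i))^[k] f) ζ))
      (fun k _ => (contDiff_const.smul (hs k)).contDiffAt) fun k hk =>
      (h1 k hk).clm (hs k).contDiffAt
        (((-1) ^ k / (k.factorial : ℝ)) • ContinuousLinearMap.id ℝ T)).congr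
      (Filter.Eventually.of_forall fun ζ => ?_)
    rw [nab_leafStep hV hf]
    have h0 : (ex j : Rn n) i = 0 := by simp [ex, Ne.symm hij]
    simp only [h0, mul_zero, zero_smul, add_zero]

/-- The map to the fiber through `z` which is the identity there and, if the curvature of `V` vanishes
to order `K` at `z`, is constant along `V` to order `K`. It is obtained from the projection by one
`leafStep` for each coordinate direction. -/
def leafCoord (K : ℕ) (V : Rn n × Rn m → (Rn n →L[ℝ] Rn m)) (z : Rn n × Rn m) :
    Rn n × Rn m → Rn m :=
  (List.finRange n).foldr (leafStep K V z) Prod.snd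

theorem contDiff_leafCoord_family {P : Type*} [NormedAddCommGroup P] [NormedSpace ℝ P]
    {V : P → Rn n × Rn m → (Rn n →L[ℝ] Rn m)} {z : P → Rn n × Rn m}
    (hV : ContDiff ℝ ∞ (Function.uncurry V)) (hz : ContDiff ℝ ∞ z) :
    ContDiff ℝ ∞ (Function.uncurry fun p => leafCoord K (V p) (z p)) := by
  unfold leafCoord
  induction List.finRange n with
  | nil => exact contDiff_snd.comp contDiff_snd
  | cons i l ih => exact contDiff_leafStep_family hV ih hz i

theorem contDiff_leafCoord (hV : ContDiff ℝ ∞ V) : ContDiff ℝ ∞ (leafCoord K V z) := by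
  unfold leafCoord
  induction List.finRange n with
  | nil => exact contDiff_snd
  | cons i l ih => exact contDiff_leafStep hV ih i

theorem leafCoord_slice {ζ : Rn n × Rn m} (h : ζ.1 = z.1) : leafCoord K V z ζ = ζ.2 := by
  unfold leafCoord
  induction List.finRange n with
  | nil => rfl
  | cons i l ih => exact (leafStep_slice i h).trans ih

theorem van_nabL_leafCoord (hV : ContDiff ℝ ∞ V) (hc : Van K (curvature V) z) :
    Van K (nabL V (leafCoord K V z)) z := by
  have h : ∀ l : List (Fin n), ContDiff ℝ ∞ (l.foldr (leafStep K V z) Prod.snd) ∧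
      ∀ j ∈ l, Van K (nab V (ex j) (l.foldr (leafStep K V z) Prod.snd)) z := by
    intro l
    induction l with
    | nil => exact ⟨contDiff_snd, fun j hj => absurd hj (by simp)⟩
    | cons i l ih =>
      refine ⟨contDiff_leafStep hV ih.1 i, fun j hj => van_nab_leafStep hV ih.1 hc i j ?_⟩
      exact (List.mem_cons.1 hj).imp_right (ih.2 j)
  refine van_of_apply ?_ fun i => (h _).2 i (List.mem_finRange i)
  exact (SmoothNear.nabL (hV.smoothNear z) ((contDiff_leafCoord hV).smoothNear z)).contDiffAt

theorem vert_eq_of_slice {Φ : Rn n × Rn m → Rn m} (hΦ : DifferentiableAt ℝ Φ z)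
    (h : ∀ᶠ y in 𝓝 z.2, Φ (z.1, y) = y) : vert Φ z = 1 := by
  have h1 : HasFDerivAt (fun y => Φ (z.1, y)) (vert Φ z) z.2 :=
    HasFDerivAt.comp (x := z.2) (f := fun y => (z.1, y)) (g := Φ) hΦ.hasFDerivAt
      (hasFDerivAt_prodMk_right z.1 z.2)
  exact h1.unique ((hasFDerivAt_id z.2).congr_of_eventuallyEq h)

theorem vert_leafCoord (hV : ContDiff ℝ ∞ V) : vert (leafCoord K V z) z = 1 :=
  vert_eq_of_slice (differentiableAt_of_smooth (contDiff_leafCoord hV).contDiffAt)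
    (Filter.Eventually.of_forall fun _ => leafCoord_slice rfl)

theorem subm_leafCoord {O : Set (Rn n × Rn m)} (hz : z ∈ O) (hV : ContDiff ℝ ∞ V) :
    Subm O (leafCoord K V z) z :=
  ⟨hz, (contDiff_leafCoord hV).smoothNear z, by rw [vert_leafCoord hV]; exact isUnit_one⟩

/-- If `Φ` is constant along `V` to some order, then `V` agrees with the flat connection of `Φ` to
that order. -/
theorem van_sub_flatCoef {O : Set (Rn n × Rn m)} (hO : IsOpen O) {Φ : Rn n × Rn m → Rn m}
    (h : Subm O Φ z) (hV : SmoothNear V z) (hv : Van K (nabL V Φ) z) :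
    Van K (fun ζ => V ζ - flatCoef Φ ζ) z := by
  have hi : SmoothNear (fun ζ => Ring.inverse (vert Φ ζ)) z := by
    filter_upwards [h.2.1.vert, (openGood_subm hO).nhds h] with ζ h1 h2
    obtain ⟨u, hu⟩ := h2.2.2
    exact ContDiffAt.comp (g := Ring.inverse) ζ (hu ▸ contDiffAt_ringInverse ℝ u) h1
  have hv' : Van K (fun ζ => (Ring.inverse (vert Φ ζ)).comp (nabL V Φ ζ)) z :=
    hv.bilin_right (hV.nabL h.2.1) hi (ContinuousLinearMap.compL ℝ (Rn n) (Rn m) (Rn m))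
  refine hv'.congr ?_
  filter_upwards [(openGood_subm hO).nhds h] with ζ hζ
  ext1 a
  refine eq_of_vert_eq hζ.2.2 ?_
  have h1 : vert Φ ζ (Ring.inverse (vert Φ ζ) (nab V a Φ ζ)) = nab V a Φ ζ :=
    congrArg (fun B => B (nab V a Φ ζ)) (Ring.mul_inverse_cancel _ hζ.2.2)
  have h2 := nab_flatCoef hζ.2.2 a
  rw [nab, fderiv_apply_eq] at h2
  rw [sub_apply, map_sub]
  refine Eq.trans ?_ h1.symm
  rw [nab, fderiv_apply_eq, eq_neg_of_add_eq_zero_left h2]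
  abel

end LeafCoordinates


/-! ### Approximation of connections by flat ones -/

section Leaves

variable {n m : ℕ} {V : Rn n × Rn m → (Rn n →L[ℝ] Rn m)} {z : Rn n × Rn m}

/-- The derivative along the fiber of a function with values in a normed space. -/
def vertD {T : Type} [NormedAddCommGroup T] [NormedSpace ℝ T] (f : Rn n × Rn m → T)
    (z : Rn n × Rn m) : Rn m →L[ℝ] T :=
  (fderiv ℝ f z).comp (ContinuousLinearMap.inr ℝ (Rn n) (Rn m))

theorem SmoothNear.vertD {T : Type} [NormedAddCommGroup T] [NormedSpace ℝ T]
    {f : Rn n × Rn m → T} (hf : SmoothNear f z) : SmoothNear (vertD f) z := by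
  filter_upwards [hf] with ζ h
  exact (contDiffAt_fderiv h).clm_comp contDiffAt_const

theorem fderiv_eq_nabL_add {T : Type} [NormedAddCommGroup T] [NormedSpace ℝ T]
    (V : Rn n × Rn m → (Rn n →L[ℝ] Rn m)) (f : Rn n × Rn m → T) (z : Rn n × Rn m) :
    fderiv ℝ f z = (nabL V f z).comp (ContinuousLinearMap.fst ℝ (Rn n) (Rn m)) +
      (vertD f z).comp (ContinuousLinearMap.snd ℝ (Rn n) (Rn m) -
        (V z).comp (ContinuousLinearMap.fst ℝ (Rn n) (Rn m))) := by
  refine ContinuousLinearMap.ext fun h => ?_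
  simp only [nabL, vertD, add_apply, ContinuousLinearMap.comp_apply]
  rw [← map_add]
  congr 1
  ext1 <;> simp

theorem nabL_vertD_apply {T : Type} [NormedAddCommGroup T] [NormedSpace ℝ T]
    {f : Rn n × Rn m → T} (hV : ContDiffAt ℝ ∞ V z) (hf : ContDiffAt ℝ ∞ f z) (a : Rn n) :
    nabL V (vertD f) z a = vertD (nab V a f) z - (vertD f z).comp
      ((ContinuousLinearMap.apply ℝ (Rn m) a).comp (vertD V z)) := by
  have hs : IsSymmSndFDerivAt ℝ f z :=
    (eventually_contDiffAt_fin hf 2).self_of_nhds.isSymmSndFDerivAt (by simp)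
  ext1 y
  have h1 : fderiv ℝ (vertD f) z (a, V z a) y = fderiv ℝ (fderiv ℝ f) z (a, V z a) (0, y) := by
    have h2 : HasFDerivAt (vertD f) _ z :=
      (differentiableAt_of_smooth (contDiffAt_fderiv hf)).hasFDerivAt.clm_comp
        (hasFDerivAt_const (ContinuousLinearMap.inr ℝ (Rn n) (Rn m)) z)
    rw [h2.fderiv]
    simp
  have h3 := fderiv_nab hV hf a (0, y)
  have h4 : nabL V (vertD f) z a y = fderiv ℝ (vertD f) z (a, V z a) y := rfl
  rw [h4, h1, hs.eq (a, V z a) (0, y), sub_apply, eq_sub_iff_add_eq]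
  exact h3.symm

/-- A function which vanishes on the fiber through `z` and is constant along `V` to order `K`
vanishes to order `K + 1`. -/
theorem van_of_slice (hV : SmoothNear V z) (K : ℕ) : ∀ {T : Type} [NormedAddCommGroup T]
    [NormedSpace ℝ T] {f : Rn n × Rn m → T} (_ : SmoothNear f z)
    (_ : ∀ᶠ ζ in 𝓝 z, ζ.1 = z.1 → f ζ = 0) (_ : Van K (nabL V f) z), Van (K + 1) f z := by
  induction K with
  | zero =>
    intro T _ _ f _ h0 _
    exact van_succ_iff.2 ⟨h0.self_of_nhds rfl, Van.zero _ _⟩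
  | succ K ih =>
    intro T _ _ f hf h0 hv
    have h1 : Van (K + 1) f z := ih hf h0 (hv.mono (Nat.le_succ K))
    have hvs : Van K (vertD f) z := (h1.fderiv).clm (contDiffAt_fderiv hf.contDiffAt)
      ((ContinuousLinearMap.compL ℝ (Rn m) (Rn n × Rn m) T).flip
        (ContinuousLinearMap.inr ℝ (Rn n) (Rn m)))
    have h2 : Van (K + 1) (vertD f) z := by
      refine ih hf.vertD ?_ ?_
      · filter_upwards [h0.eventually_nhds, hf] with ζ h3 h4 hζ
        have h5 : HasFDerivAt (fun y => f (ζ.1, y)) (vertD f ζ) ζ.2 :=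
          HasFDerivAt.comp (x := ζ.2) (f := fun y => (ζ.1, y)) (g := f)
            (differentiableAt_of_smooth h4).hasFDerivAt (hasFDerivAt_prodMk_right ζ.1 ζ.2)
        have h6 : Filter.Tendsto (fun y => (ζ.1, y)) (𝓝 ζ.2) (𝓝 ζ) :=
          (Continuous.prodMk_right ζ.1).tendsto ζ.2
        have h7 : (fun y => f (ζ.1, y)) =ᶠ[𝓝 ζ.2] fun _ => 0 := by
          filter_upwards [h6.eventually h3] with y hy using hy hζ
        exact h5.unique ((hasFDerivAt_const 0 ζ.2).congr_of_eventuallyEq h7)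
      · refine van_of_apply (hV.nabL hf.vertD).contDiffAt fun i => ?_
        have h8 : Van K (vertD (nab V (ex i) f)) z := by
          have h9 : Van (K + 1) (nab V (ex i) f) z :=
            hv.clm (hV.nabL hf).contDiffAt (ContinuousLinearMap.apply ℝ T (ex i))
          exact (h9.fderiv).clm (contDiffAt_fderiv (SmoothNear.nab hV hf (ex i)).contDiffAt)
            ((ContinuousLinearMap.compL ℝ (Rn m) (Rn n × Rn m) T).flip
              (ContinuousLinearMap.inr ℝ (Rn n) (Rn m)))
        have hs : SmoothNear (fun ζ => (ContinuousLinearMap.apply ℝ (Rn m) (ex i)).comp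
            (vertD V ζ)) z := by
          filter_upwards [hV.vertD] with ζ h
          exact contDiffAt_const.clm_comp h
        have h9 : Van K (fun ζ => (vertD f ζ).comp
            ((ContinuousLinearMap.apply ℝ (Rn m) (ex i)).comp (vertD V ζ))) z :=
          hvs.bilin hf.vertD hs (ContinuousLinearMap.compL ℝ (Rn m) (Rn m) T)
        refine (h8.sub h9 (SmoothNear.nab hV hf (ex i)).vertD.contDiffAt
          (hf.vertD.contDiffAt.clm_comp hs.contDiffAt)).congr ?_
        filter_upwards [hV, hf] with ζ h3 h4 using nabL_vertD_apply h3 h4 (ex i)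
    rw [van_succ_iff]
    refine ⟨h1.apply_eq_zero (Nat.succ_pos K), ?_⟩
    have hs : SmoothNear (fun ζ => ContinuousLinearMap.snd ℝ (Rn n) (Rn m) -
        (V ζ).comp (ContinuousLinearMap.fst ℝ (Rn n) (Rn m))) z := by
      filter_upwards [hV] with ζ h
      exact contDiffAt_const.sub (h.clm_comp contDiffAt_const)
    have ha : Van (K + 1) (fun ζ => (nabL V f ζ).comp
        (ContinuousLinearMap.fst ℝ (Rn n) (Rn m))) z :=
      hv.clm (hV.nabL hf).contDiffAt ((ContinuousLinearMap.compL ℝ (Rn n × Rn m) (Rn n) T).flip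
        (ContinuousLinearMap.fst ℝ (Rn n) (Rn m)))
    have hb : Van (K + 1) (fun ζ => (vertD f ζ).comp (ContinuousLinearMap.snd ℝ (Rn n) (Rn m) -
        (V ζ).comp (ContinuousLinearMap.fst ℝ (Rn n) (Rn m)))) z :=
      h2.bilin hf.vertD hs (ContinuousLinearMap.compL ℝ (Rn n × Rn m) (Rn m) T)
    refine (ha.add hb ((hV.nabL hf).contDiffAt.clm_comp contDiffAt_const)
      (hf.vertD.contDiffAt.clm_comp hs.contDiffAt)).congr
      (Filter.Eventually.of_forall fun ζ => fderiv_eq_nabL_add V f ζ)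

theorem isJetOp_of_apply {Z T : Type*} [NormedAddCommGroup Z] [NormedSpace ℝ Z]
    [NormedAddCommGroup T] [NormedSpace ℝ T] {R : Type} [NormedAddCommGroup R] [NormedSpace ℝ R]
    {K : ℕ} {good : (Z → T) → Z → Prop} {N : (Z → T) → Z → (Rn n →L[ℝ] R)}
    (h : ∀ i, IsJetOp K good (fun Φ z => N Φ z (ex i))) : IsJetOp K good N :=
  (IsJetOp.sum Finset.univ fun i _ => (h i).clm (ContinuousLinearMap.smulRightL ℝ (Rn n) R
    (EuclideanSpace.proj i : Rn n →L[ℝ] ℝ))).congr fun Φ z _ => clm_eq_sum (N Φ z)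

theorem isJetOp_curvature :
    IsJetOp 1 (SmoothNear (Z := Rn n × Rn m) (T := Rn n →L[ℝ] Rn m)) curvature := by
  have h1 : ∀ i, IsJetOp 1 (SmoothNear (Z := Rn n × Rn m) (T := Rn n →L[ℝ] Rn m))
      (fun V z => fderiv ℝ V z (ex i, V z (ex i))) := fun i =>
    isJetOp_fderiv.clm_apply ((IsJetOp.const (ex i)).prodMk
      (IsJetOp.val.clm (ContinuousLinearMap.apply ℝ (Rn m) (ex i))))
  refine isJetOp_of_apply fun i => isJetOp_of_apply fun j => ?_
  exact ((h1 i).clm (ContinuousLinearMap.apply ℝ (Rn m) (ex j))).sub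
    ((h1 j).clm (ContinuousLinearMap.apply ℝ (Rn m) (ex i)))

/-- The leaf coordinates of the connection whose coefficients have the `(k + 1)`-jet `w`
at `z`. -/
def leaf (k : ℕ) (z : Rn n × Rn m) (w : Jet (k + 1) (Rn n × Rn m) (Rn n →L[ℝ] Rn m)) :
    Rn n × Rn m → Rn m :=
  leafCoord (k + 1) (tay (k + 1) z w) z

theorem contDiff_leaf (k : ℕ) : ContDiff ℝ ∞ (Function.uncurry fun
    q : (Rn n × Rn m) × Jet (k + 1) (Rn n × Rn m) (Rn n →L[ℝ] Rn m) => leaf k q.1 q.2) :=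
  contDiff_leafCoord_family (V := fun q : (Rn n × Rn m) × Jet (k + 1) (Rn n × Rn m)
    (Rn n →L[ℝ] Rn m) => tay (k + 1) q.1 q.2) (contDiff_tay (k + 1)) contDiff_fst

theorem leaf_slice {k : ℕ} {w : Jet (k + 1) (Rn n × Rn m) (Rn n →L[ℝ] Rn m)} {ζ : Rn n × Rn m}
    (h : ζ.1 = z.1) : leaf k z w ζ = ζ.2 := leafCoord_slice h

theorem subm_leaf {O : Set (Rn n × Rn m)} (hz : z ∈ O) (k : ℕ)
    (w : Jet (k + 1) (Rn n × Rn m) (Rn n →L[ℝ] Rn m)) : Subm O (leaf k z w) z :=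
  subm_leafCoord hz (contDiff_tay_apply _ _ _)

/-- The leaf coordinates are constant, to finite order, along `V` as well as along the Taylor
polynomial of `V` from which they are built. -/
theorem van_nabL_leaf {k : ℕ} (hV : SmoothNear V z) (hc : Van (k + 1) (curvature V) z) :
    Van (k + 1) (nabL V (leaf k z (jet (k + 1) V z))) z ∧
    Van (k + 1) (nabL (tay (k + 1) z (jet (k + 1) V z)) (leaf k z (jet (k + 1) V z))) z := by
  have hs : ContDiff ℝ ∞ (tay (k + 1) z (jet (k + 1) V z)) := contDiff_tay_apply _ _ _
  have hj : jet (k + 1) (tay (k + 1) z (jet (k + 1) V z)) z = jet (k + 1) V z :=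
    jet_tay hV.contDiffAt
  have hc' : Van (k + 1) (curvature (tay (k + 1) z (jet (k + 1) V z))) z := by
    rw [van_succ_iff_jet] at hc ⊢
    rw [← hc]
    refine isJetOp_curvature.congr_jet_jet openGood_smoothNear (hs.smoothNear z) hV ?_
    rw [Nat.add_comm 1 k]
    exact hj
  have h1 := van_nabL_leafCoord hs hc'
  refine ⟨?_, h1⟩
  have h2 : Van (k + 1) (fun ζ => V ζ - tay (k + 1) z (jet (k + 1) V z) ζ) z :=
    ((van_sub_iff hV.contDiffAt hs.contDiffAt).2 hj.symm).mono (Nat.le_succ _)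
  have hl : SmoothNear (leaf k z (jet (k + 1) V z)) z := (contDiff_leafCoord hs).smoothNear z
  have hd : SmoothNear (fun ζ => V ζ - tay (k + 1) z (jet (k + 1) V z) ζ) z := by
    filter_upwards [hV] with ζ h using h.sub hs.contDiffAt
  have h3 : Van (k + 1) (fun ζ => (vertD (leaf k z (jet (k + 1) V z)) ζ).comp
      (V ζ - tay (k + 1) z (jet (k + 1) V z) ζ)) z :=
    h2.bilin_right hd hl.vertD (ContinuousLinearMap.compL ℝ (Rn n) (Rn m) (Rn m))
  refine (h1.add h3 ((hs.smoothNear z).nabL hl).contDiffAt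
    (hl.vertD.contDiffAt.clm_comp hd.contDiffAt)).congr (Filter.Eventually.of_forall fun ζ => ?_)
  ext1 a
  simp only [nabL, vertD, leaf, add_apply, ContinuousLinearMap.comp_apply]
  rw [← map_add]
  congr 1
  ext1 <;> simp

/-- A connection whose curvature vanishes to finite order is approximated by flat ones. -/
theorem jet_flatCoef_leaf {k : ℕ} (hV : SmoothNear V z) (hc : Van (k + 1) (curvature V) z) :
    jet k (flatCoef (leaf k z (jet (k + 1) V z))) z = jet k V z := by
  have h := van_sub_flatCoef isOpen_univ (subm_leaf (Set.mem_univ z) k (jet (k + 1) V z)) hV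
    (van_nabL_leaf hV hc).1
  exact ((van_sub_iff hV.contDiffAt ((subm_leaf (Set.mem_univ z) k
    (jet (k + 1) V z)).smoothNear_flatCoef isOpen_univ).contDiffAt).1 h).symm

/-- To finite order, a submersion is a function of the leaf coordinates of its flat connection. -/
theorem jet_comp_leaf {O : Set (Rn n × Rn m)} (hO : IsOpen O) {Φ : Rn n × Rn m → Rn m}
    (h : Subm O Φ z) (k : ℕ) : jet (k + 1) Φ z =
      jet (k + 1) (fun ζ => Φ (z.1, leaf k z (jet (k + 1) (flatCoef Φ) z) ζ)) z := by
  have hV := h.smoothNear_flatCoef hO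
  set Ψ := leaf k z (jet (k + 1) (flatCoef Φ) z) with hΨ
  have hc : Van (k + 1) (curvature (flatCoef Φ)) z := by
    refine Van.congr (f := fun _ => 0) (fun j _ => by simp) ?_
    filter_upwards [(openGood_subm hO).nhds h] with ζ hζ using curvature_flatCoef hO hζ
  have hΨs : ContDiff ℝ ∞ Ψ := contDiff_leafCoord (contDiff_tay_apply _ _ _)
  have hκ : SmoothNear (fun y => Φ (z.1, y)) z.2 := by
    have h6 : Filter.Tendsto (fun y => (z.1, y)) (𝓝 z.2) (𝓝 z) :=
      (Continuous.prodMk_right z.1).tendsto z.2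
    filter_upwards [h6.eventually h.2.1] with y hy
    exact ContDiffAt.comp (g := Φ) y hy (contDiffAt_const.prodMk contDiffAt_id)
  have hΨz : Ψ z = z.2 := leaf_slice rfl
  have hκΨ : ∀ᶠ ζ in 𝓝 z, ContDiffAt ℝ ∞ (fun y => Φ (z.1, y)) (Ψ ζ) := by
    have h7 := hΨs.continuous.tendsto z
    rw [hΨz] at h7
    exact h7.eventually hκ
  have hcomp : SmoothNear (fun ζ => Φ (z.1, Ψ ζ)) z := by
    filter_upwards [hκΨ] with ζ hζ
    exact ContDiffAt.comp (g := fun y => Φ (z.1, y)) ζ hζ hΨs.contDiffAt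
  refine (van_sub_iff h.2.1.contDiffAt hcomp.contDiffAt).1 ?_
  refine van_of_slice hV (k + 1) ?_ ?_ ?_
  · filter_upwards [h.2.1, hcomp] with ζ h1 h2 using h1.sub h2
  · refine Filter.Eventually.of_forall fun ζ hζ => ?_
    have : Ψ ζ = ζ.2 := leaf_slice hζ
    rw [this, ← hζ, sub_self]
  · have hκ' : SmoothNear (fun ζ => fderiv ℝ (fun y => Φ (z.1, y)) (Ψ ζ)) z := by
      filter_upwards [hκΨ] with ζ hζ
      exact ContDiffAt.comp (g := fderiv ℝ fun y => Φ (z.1, y)) ζ (contDiffAt_fderiv hζ)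
        hΨs.contDiffAt
    have h1 : Van (k + 1) (fun ζ => (-fderiv ℝ (fun y => Φ (z.1, y)) (Ψ ζ)).comp
        (nabL (flatCoef Φ) Ψ ζ)) z :=
      (van_nabL_leaf hV hc).1.bilin_right (hV.nabL (hΨs.smoothNear z))
        (hκ'.mono fun _ h => h.neg) (ContinuousLinearMap.compL ℝ (Rn n) (Rn m) (Rn m))
    refine h1.congr ?_
    filter_upwards [(openGood_subm hO).nhds h, hκΨ, hcomp] with ζ h2 h3 h4
    ext1 a
    have h5 : fderiv ℝ (fun ζ => Φ (z.1, Ψ ζ)) ζ = _ :=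
      ((differentiableAt_of_smooth h3).hasFDerivAt.comp ζ
        (differentiableAt_of_smooth hΨs.contDiffAt).hasFDerivAt).fderiv
    have h6 := nab_flatCoef h2.2.2 a
    rw [nab] at h6
    simp only [nabL, ContinuousLinearMap.comp_apply]
    rw [fderiv_fun_sub (differentiableAt_of_smooth h2.2.1.contDiffAt)
      (differentiableAt_of_smooth h4), h5]
    simp [h6]

end Leaves


/-! ### Functionals of submersions which are constant along the leaves -/

section Vanishing

variable {n m : ℕ} {O : Set (Rn n × Rn m)}

theorem hasDerivAt_comp_curve {R : Type*} [NormedAddCommGroup R] [NormedSpace ℝ R]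
    {f : Rn n × Rn m → R} {γ : ℝ → Rn n × Rn m} {t : ℝ} {v : Rn n × Rn m}
    (hf : DifferentiableAt ℝ f (γ t)) (hγ : HasDerivAt γ v t) :
    HasDerivAt (fun t => f (γ t)) (fderiv ℝ f (γ t) v) t :=
  hf.hasFDerivAt.comp_hasDerivAt t hγ

theorem isUnit_smul_clm {A : Rn m →L[ℝ] Rn m} (hA : IsUnit A) {c : ℝ} (hc : c ≠ 0) :
    IsUnit (c • A) := by
  obtain ⟨u, rfl⟩ := hA
  refine ⟨⟨c • u, c⁻¹ • (u⁻¹ : (Rn m →L[ℝ] Rn m)ˣ), ?_, ?_⟩, rfl⟩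
  · have h := u.mul_inv
    refine ContinuousLinearMap.ext fun y => ?_
    have := congrArg (fun B => B y) h
    simp only [mul_apply_eq_comp, one_apply_eq_self] at this
    simp [this, hc]
  · have h := u.inv_mul
    refine ContinuousLinearMap.ext fun y => ?_
    have := congrArg (fun B => B y) h
    simp only [mul_apply_eq_comp, one_apply_eq_self] at this
    simp [this, hc]

/-- Scaling `Φ - y` by a positive function does not change the leaf `Φ = y`. -/
theorem subm_scale {Φ : Rn n × Rn m → Rn m} {z : Rn n × Rn m} (h : Subm O Φ z)
    {χ : Rn n × Rn m → ℝ} (hχ : ContDiff ℝ ∞ χ) (h0 : χ z ≠ 0) :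
    Subm O (fun ζ => Φ z + χ ζ • (Φ ζ - Φ z)) z ∧
      flatCoef (fun ζ => Φ z + χ ζ • (Φ ζ - Φ z)) z = flatCoef Φ z := by
  have hd : fderiv ℝ (fun ζ => Φ z + χ ζ • (Φ ζ - Φ z)) z = χ z • fderiv ℝ Φ z := by
    have h1 := (((differentiableAt_of_smooth hχ.contDiffAt).hasFDerivAt (x := z)).smul
      ((differentiableAt_of_smooth h.2.1.contDiffAt).hasFDerivAt.sub_const (Φ z))).const_add (Φ z)
    have h2 : fderiv ℝ (fun ζ => Φ z + χ ζ • (Φ ζ - Φ z)) z = _ := h1.fderiv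
    rw [h2]
    refine ContinuousLinearMap.ext fun v => ?_
    simp
  have hv : IsUnit (vert (fun ζ => Φ z + χ ζ • (Φ ζ - Φ z)) z) := by
    have : vert (fun ζ => Φ z + χ ζ • (Φ ζ - Φ z)) z = χ z • vert Φ z := by
      rw [vert, hd]
      rfl
    rw [this]
    exact isUnit_smul_clm h.2.2 h0
  refine ⟨⟨h.1, ?_, hv⟩, (eq_flatCoef hv fun a => ?_).symm⟩
  · filter_upwards [h.2.1] with ζ hζ
    exact contDiffAt_const.add (hχ.contDiffAt.smul (hζ.sub contDiffAt_const))
  · have := nab_flatCoef h.2.2 a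
    rw [nab] at this
    rw [hd, smul_apply, this, smul_zero]

/-- A local functional of submersions which is constant along the leaves `Φ = y` vanishes there,
if it is infinitesimal for the submersions `y + ε (Φ - y)`, `ε → 0`. Indeed, moving along the leaf
one can pass from the values of `Φ` near one point of the leaf to those of `y + ε (Φ - y)` near
another. -/
theorem eq_zero_of_const_along_leaves (i : Fin n) (hO : IsOpen O) {R : Type*}
    [NormedAddCommGroup R] [NormedSpace ℝ R] {T : (Rn n × Rn m → Rn m) → Rn n × Rn m → R} {y : Rn m}
    (hloc : ∀ Φ Ψ z, Subm O Φ z → Φ z = y → Φ =ᶠ[𝓝 z] Ψ → T Φ z = T Ψ z)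
    (hdiff : ∀ Φ z, Subm O Φ z → Φ z = y → DifferentiableAt ℝ (T Φ) z)
    (hconst : ∀ Φ z, Subm O Φ z → Φ z = y → fderiv ℝ (T Φ) z (ex i, flatCoef Φ z (ex i)) = 0)
    (hlim : ∀ Φ z, Subm O Φ z → Φ z = y →
      Filter.Tendsto (fun ε : ℝ => T (fun ζ => y + ε • (Φ ζ - y)) z) (𝓝[>] 0) (𝓝 0))
    {Φ : Rn n × Rn m → Rn m} {z : Rn n × Rn m} (h : Subm O Φ z) (hy : Φ z = y) : T Φ z = 0 := by
  -- the lift of a coordinate line to the leaf through `z`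
  have hV := (h.smoothNear_flatCoef hO).contDiffAt
  have hX : ContDiffAt ℝ 1 (fun ζ => ((ex i : Rn n), flatCoef Φ ζ (ex i))) z :=
    (contDiffAt_const.prodMk (hV.clm_apply contDiffAt_const)).of_le (by simp)
  obtain ⟨γ, hγ0, ε, hε, hγ⟩ :=
    hX.exists_forall_mem_closedBall_exists_eq_forall_mem_Ioo_hasDerivAt₀ 0
  simp only [zero_sub, zero_add] at hγ
  have hγc : ContinuousAt γ 0 := (hγ 0 ⟨by linarith, hε⟩).continuousAt
  have hev : ∀ᶠ t in 𝓝 (0 : ℝ), Subm O Φ (γ t) := by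
    refine hγc.eventually ?_
    rw [hγ0]
    exact (openGood_subm hO).nhds h
  obtain ⟨δ, hδ, hball⟩ := Metric.eventually_nhds_iff.1 hev
  obtain ⟨b, hb0, hbε, hbδ⟩ : ∃ b : ℝ, 0 < b ∧ b < ε ∧ b < δ :=
    ⟨min ε δ / 2, by positivity, by linarith [min_le_left ε δ, lt_min hε hδ],
      by linarith [min_le_right ε δ, lt_min hε hδ]⟩
  have hS : ∀ t ∈ Set.Icc 0 b, Subm O Φ (γ t) := fun t ht => hball (by
    rw [Real.dist_eq, sub_zero, abs_of_nonneg ht.1]; linarith [ht.2])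
  have hd : ∀ t ∈ Set.Icc 0 b, HasDerivAt γ (ex i, flatCoef Φ (γ t) (ex i)) t := fun t ht =>
    hγ t ⟨by linarith [ht.1], by linarith [ht.2]⟩
  have hγcont : ContinuousOn γ (Set.Icc 0 b) := fun t ht =>
    (hd t ht).continuousAt.continuousWithinAt
  have hΦ : ∀ t ∈ Set.Icc 0 b, Φ (γ t) = y := by
    intro t ht
    rw [← hy, ← hγ0]
    have h1 : ∀ t ∈ Set.Icc 0 b, HasDerivAt (fun t => Φ (γ t)) 0 t := fun t ht => by
      have := hasDerivAt_comp_curve (differentiableAt_of_smooth (hS t ht).2.1.contDiffAt) (hd t ht)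
      have h0 := nab_flatCoef (hS t ht).2.2 (ex i)
      rw [nab] at h0
      rwa [h0] at this
    exact constant_of_has_deriv_right_zero
      (fun t ht => (h1 t ht).continuousAt.continuousWithinAt)
      (fun t ht => (h1 t (Set.Ico_subset_Icc_self ht)).hasDerivWithinAt) t ht
  have hx : ∀ t ∈ Set.Icc 0 b, cx i (γ t) = cx i z + t := by
    intro t ht
    have h1 : ∀ t ∈ Set.Icc 0 b, HasDerivAt (fun t => cx i (γ t) - t) 0 t := fun t ht => by
      have := (hasDerivAt_comp_curve (cx i).differentiableAt (hd t ht)).sub (hasDerivAt_id t)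
      have e : fderiv ℝ (cx i) (γ t) (ex i, flatCoef Φ (γ t) (ex i)) - 1 = 0 := by
        rw [(cx i).fderiv]
        simp [cx_apply, ex]
      rwa [e] at this
    have := constant_of_has_deriv_right_zero
      (fun t ht => (h1 t ht).continuousAt.continuousWithinAt)
      (fun t ht => (h1 t (Set.Ico_subset_Icc_self ht)).hasDerivWithinAt) t ht
    rw [hγ0] at this
    linarith
  have hbmem : b ∈ Set.Icc 0 b := ⟨hb0.le, le_rfl⟩
  -- the value of the functional is the same for all the rescaled submersions at the other end
  have key : ∀ ε : ℝ, 0 < ε → ε ≤ 1 → T Φ z = T (fun ζ => y + ε • (Φ ζ - y)) (γ b) := by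
    intro c hc0 hc1
    let χ : Rn n × Rn m → ℝ := fun ζ =>
      1 + (c - 1) * Real.smoothTransition (3 * (cx i ζ - cx i z) / b - 1)
    have hχs : ContDiff ℝ ∞ χ := by
      refine contDiff_const.add (contDiff_const.mul (Real.smoothTransition.contDiff.comp ?_))
      exact ((contDiff_const.mul ((cx i).contDiff.sub contDiff_const)).div_const b).sub
        contDiff_const
    have hχ0 : ∀ ζ, χ ζ ≠ 0 := fun ζ => by
      have h1 := Real.smoothTransition.nonneg (3 * (cx i ζ - cx i z) / b - 1)
      have h2 := Real.smoothTransition.le_one (3 * (cx i ζ - cx i z) / b - 1)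
      have : 0 < χ ζ := by
        change 0 < 1 + (c - 1) * _
        nlinarith
      exact this.ne'
    let Ψ : Rn n × Rn m → Rn m := fun ζ => y + χ ζ • (Φ ζ - y)
    have hΨS : ∀ t ∈ Set.Icc 0 b, Subm O Ψ (γ t) ∧ flatCoef Ψ (γ t) = flatCoef Φ (γ t) := by
      intro t ht
      have := subm_scale (hS t ht) hχs (hχ0 (γ t))
      rwa [hΦ t ht] at this
    have hΨy : ∀ t ∈ Set.Icc 0 b, Ψ (γ t) = y := fun t ht => by simp [Ψ, hΦ t ht]
    have h1 : ∀ t ∈ Set.Icc 0 b, HasDerivAt (fun t => T Ψ (γ t)) 0 t := fun t ht => by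
      have := hasDerivAt_comp_curve (hdiff Ψ _ (hΨS t ht).1 (hΨy t ht)) (hd t ht)
      rwa [← (hΨS t ht).2, hconst Ψ _ (hΨS t ht).1 (hΨy t ht)] at this
    have h2 := constant_of_has_deriv_right_zero
      (fun t ht => (h1 t ht).continuousAt.continuousWithinAt)
      (fun t ht => (h1 t (Set.Ico_subset_Icc_self ht)).hasDerivWithinAt) b hbmem
    have h3 : T Φ z = T Ψ z := by
      refine hloc Φ Ψ z h hy ?_
      have : ∀ᶠ ζ in 𝓝 z, cx i ζ < cx i z + b / 3 :=
        (cx i).continuous.continuousAt.eventually_lt continuousAt_const (by linarith)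
      filter_upwards [this] with ζ hζ
      have h4 : 3 * (cx i ζ - cx i z) / b - 1 ≤ 0 := by
        rw [sub_nonpos, div_le_one hb0]
        linarith
      simp [Ψ, χ, Real.smoothTransition.zero_of_nonpos h4]
    have h4 : T Ψ (γ b) = T (fun ζ => y + c • (Φ ζ - y)) (γ b) := by
      refine hloc _ _ _ (hΨS b hbmem).1 (hΨy b hbmem) ?_
      have : ∀ᶠ ζ in 𝓝 (γ b), cx i z + 2 * b / 3 < cx i ζ :=
        continuousAt_const.eventually_lt (cx i).continuous.continuousAt (by
          rw [hx b hbmem]; linarith)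
      filter_upwards [this] with ζ hζ
      have h5 : 1 ≤ 3 * (cx i ζ - cx i z) / b - 1 := by
        rw [le_sub_iff_add_le, le_div_iff₀ hb0]
        linarith
      simp [Ψ, χ, Real.smoothTransition.one_of_one_le h5]
    rw [h3, ← h4, h2, hγ0]
  have hT : Filter.Tendsto (fun _ : ℝ => T Φ z) (𝓝[>] 0) (𝓝 0) := by
    refine (hlim Φ (γ b) (hS b hbmem) (hΦ b hbmem)).congr' ?_
    filter_upwards [Ioc_mem_nhdsGT (zero_lt_one (α := ℝ))] with c hc using (key c hc.1 hc.2).symm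
  exact tendsto_nhds_unique tendsto_const_nhds hT

theorem fderiv_scale (y u : Rn m) (ε : ℝ) :
    fderiv ℝ (fun u => y + ε • (u - y)) u = ε • ContinuousLinearMap.id ℝ (Rn m) := by
  have h1 : HasFDerivAt (fun u : Rn m => u) (ContinuousLinearMap.id ℝ (Rn m)) u := hasFDerivAt_id u
  exact (((h1.sub_const y).const_smul ε).const_add y).fderiv

theorem isUnit_smul_id {ε : ℝ} (hε : ε ≠ 0) : IsUnit (ε • ContinuousLinearMap.id ℝ (Rn m)) :=
  isUnit_smul_clm isUnit_one hε

theorem contDiff_scale (y : Rn m) (ε : ℝ) : ContDiff ℝ ∞ fun u : Rn m => y + ε • (u - y) :=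
  contDiff_const.add ((contDiff_id.sub contDiff_const).const_smul ε)

theorem flatCoef_scale {Φ : Rn n × Rn m → Rn m} {z : Rn n × Rn m} (h : Subm O Φ z) (y : Rn m)
    {ε : ℝ} (hε : ε ≠ 0) : flatCoef (fun ζ => y + ε • (Φ ζ - y)) z = flatCoef Φ z :=
  flatCoef_comp h (κ := fun u => y + ε • (u - y)) ((contDiff_scale y ε).smoothNear _)
    (by rw [fderiv_scale]; exact isUnit_smul_id hε)

/-- The horizontal derivatives of a vertical field, transported to the leaf space. -/
theorem nab_vert (hO : IsOpen O) {Φ : Rn n × Rn m → Rn m} {z : Rn n × Rn m} (h : Subm O Φ z)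
    {s : Rn n × Rn m → Rn m} (hs : DifferentiableAt ℝ s z) (a : Rn n) :
    nab (flatCoef Φ) a (fun ζ => vert Φ ζ (s ζ)) z =
      vert Φ z (fderiv ℝ s z (a, flatCoef Φ z a) - fderiv ℝ (flatCoef Φ) z (0, s z) a) := by
  have hvs := ((differentiableAt_of_smooth h.2.1.vert.contDiffAt).hasFDerivAt.clm_apply
    hs.hasFDerivAt)
  -- differentiate the identity `fderiv Φ (a, V a) = 0` along the fiber
  have h0 : nab (flatCoef Φ) a Φ =ᶠ[𝓝 z] fun _ => 0 := by
    filter_upwards [(openGood_subm hO).nhds h] with ζ hζ using nab_flatCoef hζ.2.2 a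
  have h1 := fderiv_nab (h.smoothNear_flatCoef hO).contDiffAt h.2.1.contDiffAt a (0, s z)
  rw [h0.fderiv_eq] at h1
  have hsym : IsSymmSndFDerivAt ℝ Φ z :=
    (eventually_contDiffAt_fin h.2.1.contDiffAt 2).self_of_nhds.isSymmSndFDerivAt (by simp)
  have h2 : fderiv ℝ (vert Φ) z (a, flatCoef Φ z a) (s z) =
      fderiv ℝ (fderiv ℝ Φ) z (a, flatCoef Φ z a) (0, s z) := by
    have h3 : HasFDerivAt (vert Φ) _ z :=
      (differentiableAt_of_smooth (contDiffAt_fderiv h.2.1.contDiffAt)).hasFDerivAt.clm_comp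
        (hasFDerivAt_const (ContinuousLinearMap.inr ℝ (Rn n) (Rn m)) z)
    rw [h3.fderiv]
    simp
  rw [hsym.eq] at h2
  simp only [fderiv_fun_const, Pi.zero_apply, zero_apply] at h1
  rw [nab, hvs.fderiv]
  simp only [add_apply, ContinuousLinearMap.comp_apply, ContinuousLinearMap.flip_apply]
  have h5 := eq_neg_of_add_eq_zero_left h1.symm
  rw [h2, ContinuousLinearMap.map_sub, h5]
  exact (sub_eq_add_neg (vert Φ z (fderiv ℝ s z (a, flatCoef Φ z a)))
    (vert Φ z (fderiv ℝ (flatCoef Φ) z (0, s z) a))).symm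

/-- A vertical field `S`, depending locally on flat connections, which commutes with the
horizontal lifts is zero. -/
theorem eq_zero_of_commute (i : Fin n) (hO : IsOpen O)
    {S : (Rn n × Rn m → (Rn n →L[ℝ] Rn m)) → Rn n × Rn m → Rn m}
    (hloc : ∀ V W z, V =ᶠ[𝓝 z] W → S V z = S W z)
    (hsmooth : ∀ Φ z, Subm O Φ z → DifferentiableAt ℝ (S (flatCoef Φ)) z)
    (hcomm : ∀ Φ z, Subm O Φ z → ∀ a, fderiv ℝ (S (flatCoef Φ)) z (a, flatCoef Φ z a) =
      fderiv ℝ (flatCoef Φ) z (0, S (flatCoef Φ) z) a)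
    {Φ : Rn n × Rn m → Rn m} {z₀ : Rn n × Rn m} (h : Subm O Φ z₀) : S (flatCoef Φ) z₀ = 0 := by
  have hg := openGood_subm (n := n) (m := m) hO
  have key : (fun ζ => vert Φ ζ (S (flatCoef Φ) ζ)) z₀ = 0 := by
    refine eq_zero_of_const_along_leaves (T := fun Φ ζ => vert Φ ζ (S (flatCoef Φ) ζ)) (y := Φ z₀)
      i hO ?_ ?_ ?_ ?_ h rfl
    · intro Φ Ψ z h _ he
      have h1 : flatCoef Φ =ᶠ[𝓝 z] flatCoef Ψ := by
        filter_upwards [he.fderiv (𝕜 := ℝ)] with ζ hζ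
        simp only [flatCoef, vert, hζ]
      have h2 : vert Φ z = vert Ψ z := by simp only [vert, he.fderiv_eq]
      simp only [hloc _ _ z h1, h2]
    · exact fun Φ z h _ => (differentiableAt_of_smooth h.2.1.vert.contDiffAt).clm_apply
        (hsmooth Φ z h)
    · intro Φ z h _
      have h1 := nab_vert hO h (hsmooth Φ z h) (ex i)
      rw [hcomm Φ z h, sub_self, ContinuousLinearMap.map_zero] at h1
      exact h1
    · intro Ψ z h hy
      have h1 : ∀ ε : ℝ, 0 < ε → vert (fun ζ => Φ z₀ + ε • (Ψ ζ - Φ z₀)) z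
          (S (flatCoef (fun ζ => Φ z₀ + ε • (Ψ ζ - Φ z₀))) z) =
            ε • vert Ψ z (S (flatCoef Ψ) z) := by
        intro ε hε
        have h2 : flatCoef (fun ζ => Φ z₀ + ε • (Ψ ζ - Φ z₀)) =ᶠ[𝓝 z] flatCoef Ψ := by
          filter_upwards [hg.nhds h] with ζ hζ using flatCoef_scale hζ _ hε.ne'
        have h3 := vert_comp (κ := fun u => Φ z₀ + ε • (u - Φ z₀)) (Φ := Ψ) (z := z)
          (differentiableAt_of_smooth (contDiff_scale _ _).contDiffAt)
          (differentiableAt_of_smooth h.2.1.contDiffAt)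
        rw [hloc _ _ z h2, h3, fderiv_scale]
        rfl
      have h2 : Filter.Tendsto (fun ε : ℝ => ε • vert Ψ z (S (flatCoef Ψ) z)) (𝓝[>] 0)
          (𝓝 ((0 : ℝ) • vert Ψ z (S (flatCoef Ψ) z))) :=
        (tendsto_nhdsWithin_of_tendsto_nhds Filter.tendsto_id).smul_const _
      rw [zero_smul] at h2
      refine h2.congr' ?_
      filter_upwards [self_mem_nhdsWithin] with ε hε using (h1 ε hε).symm
  exact eq_of_vert_eq h.2.2 (key.trans (map_zero _).symm)

end Vanishing


/-! ### A homotopy formula for differential operators along the leaves -/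

section Homotopy

variable {A : Type*} [AddCommGroup A] [Module ℝ A]

/-- The homotopy `∑ (-1)^k / (k + 1)! D^k a^{k+1} P`, applied to the family `p k = a^k P`. -/
def homotopySum (D : Module.End ℝ A) (K : ℕ) (p : ℕ → A) : A :=
  ∑ k ∈ Finset.range (K + 1), ((-1) ^ k / ((k + 1).factorial : ℝ)) • (D ^ k) (p (k + 1))

theorem homotopySum_zero (D : Module.End ℝ A) {K : ℕ} {p : ℕ → A} (hp : ∀ k, p k = 0) :
    homotopySum D K p = 0 :=
  Finset.sum_eq_zero fun k _ => by rw [hp, map_zero, smul_zero]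

/-- The homotopy formula in the direction of `D₂`: the sum telescopes by the closedness `h`. -/
theorem map_homotopySum {D₁ D₂ : Module.End ℝ A} (hcomm : Commute D₁ D₂) {K : ℕ}
    {p q : ℕ → ℕ → A} (hq : ∀ k l, K < k + l → q k l = 0)
    (h : ∀ k l, D₁ (q k l) + (k : ℝ) • q (k - 1) l = D₂ (p k l) + (l : ℝ) • p k (l - 1)) (l : ℕ) :
    D₂ (homotopySum D₁ K (p · l)) + (l : ℝ) • homotopySum D₁ K (p · (l - 1)) = q 0 l := by
  have h1 : ∀ k, D₂ ((D₁ ^ k) (p (k + 1) l)) + (l : ℝ) • (D₁ ^ k) (p (k + 1) (l - 1)) =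
      (D₁ ^ (k + 1)) (q (k + 1) l) + ((k : ℝ) + 1) • (D₁ ^ k) (q k l) := by
    intro k
    have h2 : D₂ ((D₁ ^ k) (p (k + 1) l)) = (D₁ ^ k) (D₂ (p (k + 1) l)) :=
      (LinearMap.congr_fun (hcomm.pow_left k).eq (p (k + 1) l)).symm
    have h3 := h (k + 1) l
    rw [h2, ← map_smul, ← map_add, ← h3, map_add, map_smul, pow_succ]
    simp
  have h2 : ∀ k : ℕ, ((-1) ^ k / ((k + 1).factorial : ℝ)) • D₂ ((D₁ ^ k) (p (k + 1) l)) +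
      (l : ℝ) • (((-1) ^ k / ((k + 1).factorial : ℝ)) • (D₁ ^ k) (p (k + 1) (l - 1))) =
      ((-1) ^ k / (k.factorial : ℝ)) • (D₁ ^ k) (q k l) -
        ((-1) ^ (k + 1) / ((k + 1).factorial : ℝ)) • (D₁ ^ (k + 1)) (q (k + 1) l) := by
    intro k
    rw [smul_comm (l : ℝ), ← smul_add, h1, smul_add, smul_smul]
    have h3 : (-1) ^ k / ((k + 1).factorial : ℝ) * ((k : ℝ) + 1) = (-1) ^ k / (k.factorial : ℝ) := by
      have : (k.factorial : ℝ) ≠ 0 := by positivity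
      have : (k : ℝ) + 1 ≠ 0 := by positivity
      rw [Nat.factorial_succ]
      push_cast
      field_simp
    rw [h3, pow_succ (-1 : ℝ), mul_neg_one, neg_div, neg_smul, sub_neg_eq_add, add_comm]
  rw [homotopySum, homotopySum, map_sum, Finset.smul_sum, ← Finset.sum_add_distrib]
  simp only [map_smul, h2]
  rw [Finset.sum_range_sub', hq (K + 1) l (by omega)]
  simp

/-- The abstract form of the homotopy formula: a family of commuting derivatives `D₁, D₂` and a
closed pair `(p 0 0, q 0 0)` whose commutators `p k l`, `q k l` with the coordinates vanish for
large `k + l` is exact. -/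
theorem homotopy_formula {D₁ D₂ : Module.End ℝ A} (hcomm : Commute D₁ D₂) {K : ℕ}
    {p q : ℕ → ℕ → A} (hp : ∀ k l, K < k + l → p k l = 0) (hq : ∀ k l, K < k + l → q k l = 0)
    (h : ∀ k l, D₁ (q k l) + (k : ℝ) • q (k - 1) l = D₂ (p k l) + (l : ℝ) • p k (l - 1)) :
    D₂ (homotopySum D₁ K (p · 0)) = q 0 0 ∧ D₁ (homotopySum D₁ K (p · 0)) = p 0 0 := by
  have hS := map_homotopySum hcomm hq h
  refine ⟨by simpa using hS 0, ?_⟩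
  -- the defect `R l` in the direction of `D₁` satisfies `D₂ (R l) = - l R (l - 1)`, and it is zero for
  -- large `l`; descending induction on `l` gives `R 0 = 0`
  let R : ℕ → A := fun l => p 0 l - D₁ (homotopySum D₁ K (p · l))
  have hR : ∀ l, D₂ (R l) = -((l : ℝ) • R (l - 1)) := by
    intro l
    have h1 := h 0 l
    have h2 : D₂ (D₁ (homotopySum D₁ K (p · l))) = D₁ (D₂ (homotopySum D₁ K (p · l))) :=
      (LinearMap.congr_fun hcomm.eq _).symm
    simp only [R, map_sub, h2, eq_sub_of_add_eq (hS l), map_smul, smul_sub]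
    simp only [Nat.cast_zero, zero_smul, add_zero] at h1
    rw [h1]
    abel
  have h0 : ∀ j l, K + 1 ≤ l + j → R l = 0 := by
    intro j
    induction j with
    | zero =>
      intro l hl
      simp only [R]
      rw [hp 0 l (by omega), homotopySum_zero _ fun k => hp k l (by omega), map_zero, sub_zero]
    | succ j ih =>
      intro l hl
      have h1 := hR (l + 1)
      rw [ih (l + 1) (by omega), map_zero, eq_comm, neg_eq_zero, smul_eq_zero] at h1
      exact h1.resolve_left (by positivity)
  exact (sub_eq_zero.1 (h0 (K + 1) 0 (by omega))).symm

variable {σ : Type*}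

/-- The commutator of an operator on polynomials with the multiplication by the `i`-th
coordinate, the latter acting on the target by `X i`. -/
def coordComm (X : σ → Module.End ℝ A) (i : σ) :
    Module.End ℝ (MvPolynomial σ ℝ →ₗ[ℝ] A) where
  toFun P := P.comp (LinearMap.mulLeft ℝ (MvPolynomial.X i)) - (X i).comp P
  map_add' P Q := by ext; simp; abel
  map_smul' c P := by ext; simp [smul_sub]

theorem coordComm_apply (X : σ → Module.End ℝ A) (i : σ) (P : MvPolynomial σ ℝ →ₗ[ℝ] A)
    (μ : MvPolynomial σ ℝ) : coordComm X i P μ = P (MvPolynomial.X i * μ) - X i (P μ) := rfl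

/-- The Leibniz rule for iterated commutators with `x_i`, as `[D_i, x_i] = 1`. -/
theorem coordComm_comp_self {X : σ → Module.End ℝ A} {i : σ} {D : Module.End ℝ A}
    (hD : ∀ f, D (X i f) = X i (D f) + f) (P : MvPolynomial σ ℝ →ₗ[ℝ] A) (k : ℕ) :
    (coordComm X i ^ k) (D.comp P) =
      D.comp ((coordComm X i ^ k) P) + (k : ℝ) • (coordComm X i ^ (k - 1)) P := by
  induction k with
  | zero => simp
  | succ k ih =>
    have h1 : ∀ Q : MvPolynomial σ ℝ →ₗ[ℝ] A, coordComm X i (D.comp Q) =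
        D.comp (coordComm X i Q) + Q := by
      intro Q
      refine LinearMap.ext fun μ => ?_
      simp only [coordComm_apply, LinearMap.comp_apply, LinearMap.add_apply, map_sub, hD]
      abel
    have h2 : (k : ℝ) • coordComm X i ((coordComm X i ^ (k - 1)) P) =
        (k : ℝ) • (coordComm X i ^ k) P := by
      cases k with
      | zero => simp
      | succ k => rw [Nat.add_sub_cancel, pow_succ' _ k, Module.End.mul_apply]
    rw [pow_succ', Module.End.mul_apply, ih, map_add, h1, map_smul, h2, Module.End.mul_apply,
      Nat.add_sub_cancel, add_assoc]
    push_cast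
    rw [add_smul, one_smul, add_comm ((coordComm X i ^ k) P)]

theorem coordComm_comp_of_comm {X : σ → Module.End ℝ A} {i : σ} {D : Module.End ℝ A}
    (hD : ∀ f, D (X i f) = X i (D f)) (P : MvPolynomial σ ℝ →ₗ[ℝ] A) (k : ℕ) :
    (coordComm X i ^ k) (D.comp P) = D.comp ((coordComm X i ^ k) P) := by
  induction k with
  | zero => rfl
  | succ k ih =>
    rw [pow_succ', Module.End.mul_apply, ih]
    refine LinearMap.ext fun μ => ?_
    simp only [coordComm_apply, LinearMap.comp_apply, map_sub, hD, Module.End.mul_apply]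

/-- The homotopy formula for operators on polynomials: a closed family `P` of differential operators
(the iterated commutators with the coordinates are zero) is exact on constants. A second direction
`i₁ ≠ i₀` is needed to treat `D i₀`. -/
theorem exists_primitive_of_closed {X D : σ → Module.End ℝ A}
    (hD : ∀ i j, Commute (D i) (D j)) (hX : ∀ i f, D i (X i f) = X i (D i f) + f)
    (hXD : ∀ i j, i ≠ j → ∀ f, D i (X j f) = X j (D i f))
    {P : σ → MvPolynomial σ ℝ →ₗ[ℝ] A} (hP : ∀ i j, (D i).comp (P j) = (D j).comp (P i)) {K : ℕ}
    (hK : ∀ i j₁ j₂ k l, K < k + l → (coordComm X j₁ ^ k) ((coordComm X j₂ ^ l) (P i)) = 0)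
    {i₀ i₁ : σ} (h01 : i₀ ≠ i₁) (j : σ) :
    D j (homotopySum (D i₀) K fun k => (coordComm X i₀ ^ k) (P i₀) 1) = P j 1 := by
  have key : ∀ j, i₀ ≠ j →
      D j (homotopySum (D i₀) K fun k => (coordComm X i₀ ^ k) (P i₀) 1) = P j 1 ∧
      D i₀ (homotopySum (D i₀) K fun k => (coordComm X i₀ ^ k) (P i₀) 1) = P i₀ 1 := by
    intro j hj
    refine homotopy_formula (hD i₀ j) (K := K)
      (p := fun k l => (coordComm X i₀ ^ k) ((coordComm X j ^ l) (P i₀)) 1)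
      (q := fun k l => (coordComm X i₀ ^ k) ((coordComm X j ^ l) (P j)) 1)
      (fun k l h => by rw [hK _ _ _ k l h]; rfl) (fun k l h => by rw [hK _ _ _ k l h]; rfl) ?_
    intro k l
    have h1 := congrArg (fun Q => (coordComm X i₀ ^ k) ((coordComm X j ^ l) Q) 1) (hP i₀ j)
    simp only [coordComm_comp_of_comm (hXD i₀ j hj), coordComm_comp_self (hX i₀),
      coordComm_comp_self (hX j), map_add, map_smul,
      coordComm_comp_of_comm (hXD j i₀ hj.symm)] at h1
    exact h1
  by_cases hj : i₀ = j
  · subst hj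
    exact (key i₁ h01).2
  · exact (key j hj).1

end Homotopy

section LeafModule

variable {n m : ℕ} {T : Type} [NormedAddCommGroup T] [NormedSpace ℝ T]

variable (T) in
/-- The functions which are smooth on the open set `N` and zero outside. -/
def smoothOn (N : Set (Rn n × Rn m)) : Submodule ℝ (Rn n × Rn m → T) where
  carrier := {f | (∀ z ∈ N, ContDiffAt ℝ ∞ f z) ∧ ∀ z ∉ N, f z = 0}
  add_mem' hf hg := ⟨fun z hz => (hf.1 z hz).add (hg.1 z hz), fun z hz => by
    simp [hf.2 z hz, hg.2 z hz]⟩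
  zero_mem' := ⟨fun _ _ => contDiffAt_const, fun _ _ => rfl⟩
  smul_mem' c f hf := ⟨fun z hz => (hf.1 z hz).const_smul c, fun z hz => by simp [hf.2 z hz]⟩

theorem smoothOn_ext {N : Set (Rn n × Rn m)} {f g : smoothOn T N}
    (h : ∀ z ∈ N, f.1 z = g.1 z) : f = g := by
  refine Subtype.ext (funext fun z => ?_)
  by_cases hz : z ∈ N
  · exact h z hz
  · rw [f.2.2 z hz, g.2.2 z hz]

/-- Restriction to `N` of a function which is smooth there. -/
def toSmoothOn {N : Set (Rn n × Rn m)} (hN : IsOpen N) (f : Rn n × Rn m → T)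
    (hf : ∀ z ∈ N, ContDiffAt ℝ ∞ f z) : smoothOn T N :=
  ⟨N.indicator f, fun z hz => (hf z hz).congr_of_eventuallyEq (by
    filter_upwards [hN.mem_nhds hz] with ζ hζ using Set.indicator_of_mem hζ f), fun z hz =>
    Set.indicator_of_notMem hz f⟩

theorem toSmoothOn_apply {N : Set (Rn n × Rn m)} (hN : IsOpen N) {f : Rn n × Rn m → T}
    (hf : ∀ z ∈ N, ContDiffAt ℝ ∞ f z) {z : Rn n × Rn m} (hz : z ∈ N) :
    (toSmoothOn hN f hf).1 z = f z := Set.indicator_of_mem hz f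

theorem toSmoothOn_eventuallyEq {N : Set (Rn n × Rn m)} (hN : IsOpen N) {f : Rn n × Rn m → T}
    (hf : ∀ z ∈ N, ContDiffAt ℝ ∞ f z) {z : Rn n × Rn m} (hz : z ∈ N) :
    (toSmoothOn hN f hf).1 =ᶠ[𝓝 z] f := by
  filter_upwards [hN.mem_nhds hz] with ζ hζ using toSmoothOn_apply hN hf hζ

theorem contDiffAt_nab {V : Rn n × Rn m → (Rn n →L[ℝ] Rn m)} {f : Rn n × Rn m → T}
    {z : Rn n × Rn m} (hV : ContDiffAt ℝ ∞ V z) (hf : ContDiffAt ℝ ∞ f z) (a : Rn n) :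
    ContDiffAt ℝ ∞ (nab V a f) z :=
  (contDiffAt_fderiv hf).clm_apply (contDiffAt_const.prodMk (hV.clm_apply contDiffAt_const))

variable {N : Set (Rn n × Rn m)} (hN : IsOpen N) {V : Rn n × Rn m → (Rn n →L[ℝ] Rn m)}
  (hV : ∀ z ∈ N, ContDiffAt ℝ ∞ V z)

variable (T) in
/-- The derivative along horizontal lifts as an operator on the functions smooth on `N`. -/
def nabEnd (a : Rn n) : Module.End ℝ (smoothOn T N) where
  toFun f := toSmoothOn hN (nab V a f.1) fun z hz => contDiffAt_nab (hV z hz) (f.2.1 z hz) a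
  map_add' f g := smoothOn_ext fun z hz => by
    have h := fderiv_add (differentiableAt_of_smooth (f.2.1 z hz))
      (differentiableAt_of_smooth (g.2.1 z hz))
    simp only [Submodule.coe_add, Pi.add_apply, toSmoothOn_apply hN _ hz, nab, h, add_apply]
  map_smul' c f := smoothOn_ext fun z hz => by
    have h := fderiv_const_smul (differentiableAt_of_smooth (f.2.1 z hz)) c
    simp only [Submodule.coe_smul, Pi.smul_apply, toSmoothOn_apply hN _ hz, nab, h, smul_apply,
      RingHom.id_apply]

theorem nabEnd_apply (a : Rn n) (f : smoothOn T N) {z : Rn n × Rn m} (hz : z ∈ N) :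
    (nabEnd T hN hV a f).1 z = nab V a f.1 z :=
  toSmoothOn_apply hN (fun z hz => contDiffAt_nab (hV z hz) (f.2.1 z hz) a) hz

theorem nabEnd_eventuallyEq (a : Rn n) (f : smoothOn T N) {z : Rn n × Rn m} (hz : z ∈ N) :
    (nabEnd T hN hV a f).1 =ᶠ[𝓝 z] nab V a f.1 :=
  toSmoothOn_eventuallyEq hN (fun z hz => contDiffAt_nab (hV z hz) (f.2.1 z hz) a) hz

theorem nabEnd_pow_apply (a : Rn n) (f : smoothOn T N) {g : Rn n × Rn m → T}
    (hg : ∀ z ∈ N, f.1 z = g z) (k : ℕ) : ∀ z ∈ N,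
    ((nabEnd T hN hV a ^ k) f).1 z = (nab V a)^[k] g z := by
  induction k with
  | zero => exact hg
  | succ k ih =>
    intro z hz
    rw [pow_succ', Module.End.mul_apply, nabEnd_apply hN hV a _ hz, Function.iterate_succ_apply']
    have h1 : ((nabEnd T hN hV a ^ k) f).1 =ᶠ[𝓝 z] (nab V a)^[k] g := by
      filter_upwards [hN.mem_nhds hz] with ζ hζ using ih ζ hζ
    exact (nab_congr h1 Filter.EventuallyEq.rfl a).eq_of_nhds

theorem nabEnd_commute (hc : ∀ z ∈ N, curvature V z = 0) (a b : Rn n) :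
    Commute (nabEnd T hN hV a) (nabEnd T hN hV b) := by
  refine LinearMap.ext fun f => smoothOn_ext fun z hz => ?_
  rw [Module.End.mul_apply, Module.End.mul_apply, nabEnd_apply hN hV a _ hz,
    nabEnd_apply hN hV b _ hz,
    (nab_congr (nabEnd_eventuallyEq hN hV b f hz) Filter.EventuallyEq.rfl a).eq_of_nhds,
    (nab_congr (nabEnd_eventuallyEq hN hV a f hz) Filter.EventuallyEq.rfl b).eq_of_nhds,
    ← sub_eq_zero, nab_nab_sub (hV z hz) (f.2.1 z hz), hc z hz]
  exact map_zero _

variable (T N) in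
/-- Multiplication by the coordinate `x_i`. -/
def coordEnd (i : Fin n) : Module.End ℝ (smoothOn T N) where
  toFun f := ⟨fun z => cx i z • f.1 z, fun z hz => (cx i).contDiff.contDiffAt.smul (f.2.1 z hz),
    fun z hz => by simp [f.2.2 z hz]⟩
  map_add' f g := Subtype.ext (funext fun z => smul_add _ _ _)
  map_smul' c f := Subtype.ext (funext fun z => smul_comm _ _ _)

theorem nabEnd_coordEnd (i j : Fin n) (f : smoothOn T N) :
    nabEnd T hN hV (ex i) (coordEnd T N j f) =
      coordEnd T N j (nabEnd T hN hV (ex i) f) + (ex i : Rn n) j • f := by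
  refine smoothOn_ext fun z hz => ?_
  rw [nabEnd_apply hN hV _ _ hz]
  have h1 := nab_smul (V := V) (g := cx j) (f := f.1) (z := z)
    (cx j).differentiableAt (differentiableAt_of_smooth (f.2.1 z hz)) (ex i)
  have h2 : nab V (ex i) (cx j) z = (ex i : Rn n) j := by
    rw [nab, (cx j).fderiv]
    rfl
  rw [h2] at h1
  refine h1.trans ?_
  rw [← nabEnd_apply hN hV _ _ hz]
  rfl

/-- Iterated commutators with `x_i` are given by multiplication with powers of `x_i - x_i(z)`. -/
theorem coordComm_pow_apply (i : Fin n) (P : MvPolynomial (Fin n) ℝ →ₗ[ℝ] smoothOn T N) (k : ℕ)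
    (μ : MvPolynomial (Fin n) ℝ) (z : Rn n × Rn m) :
    ((coordComm (coordEnd T N) i ^ k) P μ).1 z =
      (P ((MvPolynomial.X i - MvPolynomial.C (cx i z)) ^ k * μ)).1 z := by
  induction k generalizing μ with
  | zero => simp
  | succ k ih =>
    rw [pow_succ', Module.End.mul_apply, coordComm_apply]
    have h1 : ∀ f g : smoothOn T N, (f - g).1 z = f.1 z - g.1 z := fun _ _ => rfl
    have h2 : ∀ f : smoothOn T N, (coordEnd T N i f).1 z = cx i z • f.1 z := fun _ => rfl
    have h3 : ∀ (c : ℝ) (f : smoothOn T N), (c • f).1 z = c • f.1 z := fun _ _ => rfl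
    rw [h1, h2, ih, ih, ← h3, ← map_smul, ← h1, ← map_sub, MvPolynomial.smul_eq_C_mul]
    have h4 : (MvPolynomial.X i - MvPolynomial.C (cx i z)) ^ k * (MvPolynomial.X i * μ) -
        MvPolynomial.C (cx i z) * ((MvPolynomial.X i - MvPolynomial.C (cx i z)) ^ k * μ) =
        (MvPolynomial.X i - MvPolynomial.C (cx i z)) ^ (k + 1) * μ := by ring
    rw [h4]

end LeafModule


/-! ### Linearization of families of closed forms -/

section Variation

variable {n m : ℕ}

theorem hasDerivAt_fderiv_family {Z R : Type*} [NormedAddCommGroup Z] [NormedSpace ℝ Z]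
    [NormedAddCommGroup R] [NormedSpace ℝ R] {F : ℝ × Z → R} {z : Z}
    (hF : ContDiffAt ℝ ∞ F (0, z)) (h : Z) :
    HasDerivAt (fun ε => fderiv ℝ (fun ζ => F (ε, ζ)) z h)
      (fderiv ℝ (fun ζ => fderiv ℝ F (0, ζ) (1, 0)) z h) 0 := by
  have h1 : ∀ᶠ q in 𝓝 ((0 : ℝ), z), DifferentiableAt ℝ F q :=
    (eventually_contDiffAt_fin hF 1).mono fun q hq => hq.differentiableAt (by simp)
  have h2 : (fun ε => fderiv ℝ (fun ζ => F (ε, ζ)) z h) =ᶠ[𝓝 0]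
      fun ε => fderiv ℝ F (ε, z) (0, h) := by
    have h3 : Filter.Tendsto (fun ε : ℝ => (ε, z)) (𝓝 0) (𝓝 (0, z)) :=
      (Continuous.prodMk_left z).tendsto 0
    filter_upwards [h3.eventually h1] with ε hε
    have h4 : HasFDerivAt (fun ζ => F (ε, ζ)) _ z :=
      HasFDerivAt.comp (x := z) (f := fun ζ => (ε, ζ)) (g := F) hε.hasFDerivAt
        (hasFDerivAt_prodMk_right ε z)
    rw [h4.fderiv]
    simp
  have hd := (differentiableAt_of_smooth (contDiffAt_fderiv hF)).hasFDerivAt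
  have h5 : HasDerivAt (fun ε : ℝ => fderiv ℝ F (ε, z) (0, h))
      (fderiv ℝ (fderiv ℝ F) (0, z) (1, 0) (0, h)) 0 := by
    have h6 : HasDerivAt (fun ε : ℝ => (ε, z)) ((1 : ℝ), (0 : Z)) 0 :=
      (hasDerivAt_id (0 : ℝ)).prodMk (hasDerivAt_const (0 : ℝ) z)
    have h7 := HasFDerivAt.comp_hasDerivAt (x := (0 : ℝ)) (f := fun ε : ℝ => (ε, z)) hd h6
    exact h7.clm_apply (hasDerivAt_const (0 : ℝ) ((0 : ℝ), h)) |>.congr_deriv (by simp)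
  have h8 : fderiv ℝ (fun ζ => fderiv ℝ F (0, ζ) (1, 0)) z h =
      fderiv ℝ (fderiv ℝ F) (0, z) (0, h) (1, 0) := by
    have h9 : HasFDerivAt (fun ζ => fderiv ℝ F (0, ζ)) _ z :=
      HasFDerivAt.comp (x := z) (f := fun ζ => ((0 : ℝ), ζ)) (g := fderiv ℝ F) hd
        (hasFDerivAt_prodMk_right (0 : ℝ) z)
    have h10 := h9.clm_apply (hasFDerivAt_const ((1 : ℝ), (0 : Z)) z)
    rw [h10.fderiv]
    simp
  have hs : IsSymmSndFDerivAt ℝ F (0, z) :=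
    (eventually_contDiffAt_fin hF 2).self_of_nhds.isSymmSndFDerivAt (by simp)
  rw [h8, hs.eq]
  exact h5.congr_of_eventuallyEq h2

theorem jet_add {Z T : Type*} [NormedAddCommGroup Z] [NormedSpace ℝ Z] [NormedAddCommGroup T]
    [NormedSpace ℝ T] {K : ℕ} {f g : Z → T} {z : Z} (hf : ContDiffAt ℝ ∞ f z)
    (hg : ContDiffAt ℝ ∞ g z) : jet K (fun ζ => f ζ + g ζ) z = jet K f z + jet K g z :=
  funext fun _ => iteratedFDeriv_add_apply (hf.of_le (by exact_mod_cast le_top))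
    (hg.of_le (by exact_mod_cast le_top))

theorem jet_const_smul {Z T : Type*} [NormedAddCommGroup Z] [NormedSpace ℝ Z]
    [NormedAddCommGroup T] [NormedSpace ℝ T] {K : ℕ} {f : Z → T} {z : Z}
    (hf : ContDiffAt ℝ ∞ f z) (c : ℝ) : jet K (fun ζ => c • f ζ) z = c • jet K f z :=
  funext fun _ => iteratedFDeriv_const_smul_apply (hf.of_le (by exact_mod_cast le_top))

/-- The polynomial `μ` in the base coordinates. -/
def polyFun (μ : MvPolynomial (Fin n) ℝ) (ζ : Rn n × Rn m) : ℝ :=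
  MvPolynomial.eval (fun i => cx i ζ) μ

theorem contDiff_polyFun (μ : MvPolynomial (Fin n) ℝ) :
    ContDiff ℝ ∞ (polyFun μ : Rn n × Rn m → ℝ) := by
  induction μ using MvPolynomial.induction_on with
  | C a =>
    have : (polyFun (MvPolynomial.C a) : Rn n × Rn m → ℝ) = fun _ => a := by
      funext ζ; simp [polyFun]
    rw [this]
    exact contDiff_const
  | add p q hp hq =>
    have : (polyFun (p + q) : Rn n × Rn m → ℝ) = fun ζ => polyFun p ζ + polyFun q ζ := by
      funext ζ; simp [polyFun]
    rw [this]
    exact hp.add hq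
  | mul_X p i hp =>
    have : (polyFun (p * MvPolynomial.X i) : Rn n × Rn m → ℝ) = fun ζ => polyFun p ζ * cx i ζ := by
      funext ζ; simp [polyFun]
    rw [this]
    exact hp.mul (cx i).contDiff

/-- The variation `μ (Φ - c)` of `Φ`, where `μ` is a polynomial in the base coordinates. -/
def vary (Φ : Rn n × Rn m → Rn m) (μ : MvPolynomial (Fin n) ℝ) (c : Rn m) (ζ : Rn n × Rn m) :
    Rn m := polyFun μ ζ • (Φ ζ - c)

variable {K : ℕ} {O : Set (Rn n × Rn m)} {Φ : Rn n × Rn m → Rn m} {z : Rn n × Rn m}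
  {G : (Rn n × Rn m) × Jet K (Rn n × Rn m) (Rn m) → (Rn n →L[ℝ] Rn m)}

theorem contDiffAt_vary (h : ContDiffAt ℝ ∞ Φ z) (μ : MvPolynomial (Fin n) ℝ) (c : Rn m) :
    ContDiffAt ℝ ∞ (vary Φ μ c) z :=
  (contDiff_polyFun μ).contDiffAt.smul (h.sub contDiffAt_const)

theorem add_smul_vary (Φ : Rn n × Rn m → Rn m) (μ : MvPolynomial (Fin n) ℝ) (c : Rn m) (ε : ℝ) :
    (fun η => Φ η + ε • vary Φ μ c η) = fun η => c + (1 + ε * polyFun μ η) • (Φ η - c) := by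
  funext η
  rw [vary]
  module

theorem subm_vary (h : Subm O Φ z) (μ : MvPolynomial (Fin n) ℝ) : ∀ᶠ ε in 𝓝 (0 : ℝ),
    Subm O (fun η => Φ η + ε • vary Φ μ (Φ z) η) z ∧
      flatCoef (fun η => Φ η + ε • vary Φ μ (Φ z) η) z = flatCoef Φ z := by
  have h1 : ∀ᶠ ε : ℝ in 𝓝 0, 1 + ε * polyFun μ z ≠ 0 := by
    have h2 : ContinuousAt (fun ε : ℝ => 1 + ε * polyFun μ z) 0 := by fun_prop
    exact h2.eventually_ne (by simp)
  filter_upwards [h1] with ε hε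
  rw [add_smul_vary]
  exact subm_scale h (contDiff_const.add (contDiff_const.mul (contDiff_polyFun μ))) hε

theorem hasDerivAt_vary (hΦ : ContDiffAt ℝ ∞ Φ z) (hG : ContDiffAt ℝ ∞ G (z, jet K Φ z))
    (μ : MvPolynomial (Fin n) ℝ) (c : Rn m) :
    HasDerivAt (fun ε : ℝ => G (z, jet K (fun η => Φ η + ε • vary Φ μ c η) z))
      (fderiv ℝ G (z, jet K Φ z) (0, jet K (vary Φ μ c) z)) 0 := by
  have hu := contDiffAt_vary hΦ μ c
  have h1 : (fun ε : ℝ => G (z, jet K (fun η => Φ η + ε • vary Φ μ c η) z)) =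
      fun ε : ℝ => G (z, jet K Φ z + ε • jet K (vary Φ μ c) z) := by
    funext ε
    rw [jet_add hΦ (hu.const_smul ε), jet_const_smul hu]
  rw [h1]
  have h2 : HasDerivAt (fun ε : ℝ => (z, jet K Φ z + ε • jet K (vary Φ μ c) z))
      (0, jet K (vary Φ μ c) z) 0 := by
    refine (hasDerivAt_const (0 : ℝ) z).prodMk ?_
    have := ((hasDerivAt_id (0 : ℝ)).smul_const (jet K (vary Φ μ c) z)).const_add (jet K Φ z)
    simpa using this
  have h3 : HasFDerivAt G (fderiv ℝ G (z, jet K Φ z))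
      (z, jet K Φ z + (0 : ℝ) • jet K (vary Φ μ c) z) := by
    rw [zero_smul, add_zero]
    exact (differentiableAt_of_smooth hG).hasFDerivAt
  exact h3.comp_hasDerivAt (0 : ℝ) h2

/-- The linearization of the operator `Φ ↦ G (·, jet K Φ)`, applied to variations which are zero
along the leaf through the given point. -/
def leafOp (G : (Rn n × Rn m) × Jet K (Rn n × Rn m) (Rn m) → (Rn n →L[ℝ] Rn m))
    (Φ : Rn n × Rn m → Rn m) (j : Fin n) (μ : MvPolynomial (Fin n) ℝ) (z : Rn n × Rn m) : Rn m :=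
  fderiv ℝ G (z, jet K Φ z) (0, jet K (vary Φ μ (Φ z)) z) (ex j)

theorem contDiffAt_vary_family (hΦ : ContDiffAt ℝ ∞ Φ z)
    (hG : ContDiffAt ℝ ∞ G (z, jet K Φ z)) (μ : MvPolynomial (Fin n) ℝ) (c : Rn m) :
    ContDiffAt ℝ ∞ (fun p : (Rn n × Rn m) × Rn m =>
      fderiv ℝ G (p.1, jet K Φ p.1) (0, jet K (vary Φ μ p.2) p.1)) (z, c) := by
  refine ContDiffAt.clm_apply ?_ (contDiffAt_const.prodMk ?_)
  · exact ContDiffAt.comp (z, c) (f := fun p : (Rn n × Rn m) × Rn m => (p.1, jet K Φ p.1))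
      (contDiffAt_fderiv hG) (contDiffAt_fst.prodMk
        ((contDiffAt_jet hΦ).comp (z, c) contDiffAt_fst))
  · refine ContDiffAt.jet_family (H := fun p : (Rn n × Rn m) × Rn m => vary Φ μ p.2)
      (g := fun p : (Rn n × Rn m) × Rn m => p.1) ?_ contDiffAt_fst
    refine ((contDiff_polyFun μ).comp contDiff_snd).contDiffAt.smul (ContDiffAt.sub ?_ ?_)
    · exact ContDiffAt.comp ((z, c), z) hΦ contDiffAt_snd
    · exact (contDiff_snd.comp contDiff_fst).contDiffAt

theorem contDiffAt_leafOp (hΦ : ContDiffAt ℝ ∞ Φ z) (hG : ContDiffAt ℝ ∞ G (z, jet K Φ z))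
    (j : Fin n) (μ : MvPolynomial (Fin n) ℝ) : ContDiffAt ℝ ∞ (leafOp G Φ j μ) z :=
  (ContDiffAt.comp z (f := fun ζ => (ζ, Φ ζ)) (contDiffAt_vary_family hΦ hG μ (Φ z))
    (contDiffAt_id.prodMk hΦ)).clm_apply contDiffAt_const

/-- The linearization of a family of forms which are closed along the leaves is closed along the
leaves. -/
theorem nab_leafOp_comm (hO : IsOpen O)
    (hG : ∀ Φ z, Subm O Φ z → ContDiffAt ℝ ∞ G (z, jet K Φ z))
    (hcl : ∀ Φ z, Subm O Φ z → ∀ a b, fderiv ℝ (fun ζ => G (ζ, jet K Φ ζ)) z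
      (a, flatCoef Φ z a) b = fderiv ℝ (fun ζ => G (ζ, jet K Φ ζ)) z (b, flatCoef Φ z b) a)
    (h : Subm O Φ z) (i j : Fin n) (μ : MvPolynomial (Fin n) ℝ) :
    nab (flatCoef Φ) (ex i) (leafOp G Φ j μ) z = nab (flatCoef Φ) (ex j) (leafOp G Φ i μ) z := by
  let c := Φ z
  let A : (Rn n × Rn m) × Rn m → (Rn n →L[ℝ] Rn m) := fun p =>
    fderiv ℝ G (p.1, jet K Φ p.1) (0, jet K (vary Φ μ p.2) p.1)
  have hA : ContDiffAt ℝ ∞ A (z, c) := contDiffAt_vary_family h.2.1.contDiffAt (hG Φ z h) μ c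
  let F : ℝ × (Rn n × Rn m) → (Rn n →L[ℝ] Rn m) := fun q =>
    G (q.2, jet K (fun η => Φ η + q.1 • vary Φ μ c η) q.2)
  have hF : ContDiffAt ℝ ∞ F (0, z) := by
    refine ContDiffAt.comp (g := G) (f := fun q : ℝ × (Rn n × Rn m) =>
      (q.2, jet K (fun η => Φ η + q.1 • vary Φ μ c η) q.2)) (0, z) ?_
      (contDiffAt_snd.prodMk ?_)
    · have : (fun η => Φ η + ((0 : ℝ), z).1 • vary Φ μ c η) = Φ := by funext η; simp
      simp only [this]
      exact hG Φ z h
    · refine ContDiffAt.jet_family (H := fun (q : ℝ × (Rn n × Rn m)) η =>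
        Φ η + q.1 • vary Φ μ c η) (g := fun q : ℝ × (Rn n × Rn m) => q.2) ?_ contDiffAt_snd
      have h1 : ContDiffAt ℝ ∞ (fun p : (ℝ × (Rn n × Rn m)) × (Rn n × Rn m) => Φ p.2)
          (((0 : ℝ), z), z) := ContDiffAt.comp (((0 : ℝ), z), z) h.2.1.contDiffAt contDiffAt_snd
      have h2 : ContDiffAt ℝ ∞ (fun p : (ℝ × (Rn n × Rn m)) × (Rn n × Rn m) => vary Φ μ c p.2)
          (((0 : ℝ), z), z) :=
        ContDiffAt.comp (g := vary Φ μ c) (f := fun p : (ℝ × (Rn n × Rn m)) × (Rn n × Rn m) => p.2)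
          (((0 : ℝ), z), z) (contDiffAt_vary h.2.1.contDiffAt μ c) contDiffAt_snd
      have h3 : ContDiffAt ℝ ∞ (fun p : (ℝ × (Rn n × Rn m)) × (Rn n × Rn m) => p.1.1)
          (((0 : ℝ), z), z) := (contDiff_fst.comp contDiff_fst).contDiffAt
      exact h1.add (h3.smul h2)
  have h1 : (fun ζ => fderiv ℝ F (0, ζ) (1, 0)) =ᶠ[𝓝 z] fun ζ => A (ζ, c) := by
    have h2 : ∀ᶠ q in 𝓝 ((0 : ℝ), z), DifferentiableAt ℝ F q :=
      (eventually_contDiffAt_fin hF 1).mono fun q hq => hq.differentiableAt (by simp)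
    have h3 : Filter.Tendsto (fun ζ : Rn n × Rn m => ((0 : ℝ), ζ)) (𝓝 z) (𝓝 (0, z)) :=
      (Continuous.prodMk_right (0 : ℝ)).tendsto z
    filter_upwards [h3.eventually h2, (openGood_subm hO).nhds h] with ζ h4 h5
    have h6 : HasDerivAt (fun ε : ℝ => F (ε, ζ)) (fderiv ℝ F (0, ζ) (1, 0)) 0 :=
      HasFDerivAt.comp_hasDerivAt (f := fun ε : ℝ => (ε, ζ)) (0 : ℝ) h4.hasFDerivAt
        ((hasDerivAt_id (0 : ℝ)).prodMk (hasDerivAt_const (0 : ℝ) ζ))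
    exact h6.unique (hasDerivAt_vary h5.2.1.contDiffAt (hG Φ ζ h5) μ c)
  have h2 : ∀ i j : Fin n, nab (flatCoef Φ) (ex i) (leafOp G Φ j μ) z =
      fderiv ℝ (fun ζ => fderiv ℝ F (0, ζ) (1, 0)) z (ex i, flatCoef Φ z (ex i)) (ex j) := by
    intro i j
    have h3 : HasFDerivAt (fun ζ => A (ζ, Φ ζ)) _ z :=
      HasFDerivAt.comp (x := z) (f := fun ζ => (ζ, Φ ζ)) (g := A)
        (differentiableAt_of_smooth hA).hasFDerivAt
        ((hasFDerivAt_id z).prodMk (differentiableAt_of_smooth h.2.1.contDiffAt).hasFDerivAt)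
    have h4 : HasFDerivAt (leafOp G Φ j μ) _ z := h3.clm_apply (hasFDerivAt_const (ex j) z)
    have h5 : HasFDerivAt (fun ζ => A (ζ, c)) _ z :=
      HasFDerivAt.comp (x := z) (f := fun ζ => (ζ, c)) (g := A)
        (differentiableAt_of_smooth hA).hasFDerivAt (hasFDerivAt_prodMk_left z c)
    have h6 := nab_flatCoef h.2.2 (ex i)
    rw [nab] at h6
    rw [h1.fderiv_eq, h5.fderiv, nab, h4.fderiv]
    simp [h6]
  rw [h2 i j, h2 j i]
  have h3 := fun k l : Fin n => (hasDerivAt_fderiv_family hF (ex k, flatCoef Φ z (ex k))).clm_apply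
    (hasDerivAt_const (0 : ℝ) (ex l : Rn n))
  have h4 : (fun ε : ℝ => fderiv ℝ (fun ζ => F (ε, ζ)) z (ex i, flatCoef Φ z (ex i)) (ex j)) =ᶠ[𝓝 0]
      fun ε : ℝ => fderiv ℝ (fun ζ => F (ε, ζ)) z (ex j, flatCoef Φ z (ex j)) (ex i) := by
    filter_upwards [subm_vary h μ] with ε hε
    have := hcl _ z hε.1 (ex i) (ex j)
    rw [hε.2] at this
    exact this
  have h5 := (h3 i j).unique ((h3 j i).congr_of_eventuallyEq h4)
  simpa using h5

theorem vary_add (Φ : Rn n × Rn m → Rn m) (μ ν : MvPolynomial (Fin n) ℝ) (c : Rn m) :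
    vary Φ (μ + ν) c = fun ζ => vary Φ μ c ζ + vary Φ ν c ζ := by
  funext ζ; simp [vary, polyFun, add_smul]

theorem vary_smul (Φ : Rn n × Rn m → Rn m) (r : ℝ) (μ : MvPolynomial (Fin n) ℝ) (c : Rn m) :
    vary Φ (r • μ) c = fun ζ => r • vary Φ μ c ζ := by
  funext ζ; simp [vary, polyFun, smul_smul]

/-- `leafOp` as an operator from polynomials to the functions which are smooth where `Φ` is a
submersion. -/
def leafOpLin (hO : IsOpen O) (hG : ∀ Φ z, Subm O Φ z → ContDiffAt ℝ ∞ G (z, jet K Φ z))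
    (Φ : Rn n × Rn m → Rn m) (j : Fin n) :
    MvPolynomial (Fin n) ℝ →ₗ[ℝ] smoothOn (Rn m) {z | Subm O Φ z} where
  toFun μ := toSmoothOn (isOpen_iff_mem_nhds.2 fun _ hz => (openGood_subm hO).nhds hz)
    (leafOp G Φ j μ) fun z hz => contDiffAt_leafOp hz.2.1.contDiffAt (hG Φ z hz) j μ
  map_add' μ ν := smoothOn_ext fun z hz => by
    have hz' : Subm O Φ z := hz
    simp only [Submodule.coe_add, Pi.add_apply, toSmoothOn_apply _ _ hz, leafOp, vary_add]
    rw [jet_add (contDiffAt_vary hz'.2.1.contDiffAt _ _) (contDiffAt_vary hz'.2.1.contDiffAt _ _),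
      ← add_apply, ← map_add, Prod.mk_add_mk, add_zero]
  map_smul' r μ := smoothOn_ext fun z hz => by
    have hz' : Subm O Φ z := hz
    simp only [Submodule.coe_smul, Pi.smul_apply, toSmoothOn_apply _ _ hz, leafOp, vary_smul,
      RingHom.id_apply]
    rw [jet_const_smul (contDiffAt_vary hz'.2.1.contDiffAt _ _), ← smul_apply, ← map_smul,
      Prod.smul_mk, smul_zero]

theorem leafOpLin_apply (hO : IsOpen O)
    (hG : ∀ Φ z, Subm O Φ z → ContDiffAt ℝ ∞ G (z, jet K Φ z)) (h : Subm O Φ z) (j : Fin n)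
    (μ : MvPolynomial (Fin n) ℝ) : (leafOpLin hO hG Φ j μ).1 z = leafOp G Φ j μ z :=
  Set.indicator_of_mem (s := {z | Subm O Φ z}) h _

/-- The operator `leafOp` is of order `K`. -/
theorem leafOp_eq_zero (h : Subm O Φ z) (j j₁ j₂ : Fin n) {k l : ℕ} (hkl : K < k + l)
    (μ : MvPolynomial (Fin n) ℝ) :
    leafOp G Φ j ((MvPolynomial.X j₁ - MvPolynomial.C (cx j₁ z)) ^ k *
      ((MvPolynomial.X j₂ - MvPolynomial.C (cx j₂ z)) ^ l * μ)) z = 0 := by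
  have hs : ∀ i : Fin n, SmoothNear (fun ζ : Rn n × Rn m => cx i ζ - cx i z) z := fun i =>
    ((cx i).contDiff.sub contDiff_const).smoothNear z
  have hu : SmoothNear (vary Φ μ (Φ z)) z := h.2.1.mono fun ζ hζ => contDiffAt_vary hζ μ _
  have hu' : SmoothNear (fun ζ => (cx j₂ ζ - cx j₂ z) ^ l • vary Φ μ (Φ z) ζ) z := by
    filter_upwards [hu, hs j₂] with ζ h1 h2 using (h2.pow l).smul h1
  have h1 := ((Van.zero (vary Φ μ (Φ z)) z).pow_smul hu (hs j₂) (sub_self _) l).pow_smul hu'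
    (hs j₁) (sub_self _) k
  have h2 : jet K (vary Φ ((MvPolynomial.X j₁ - MvPolynomial.C (cx j₁ z)) ^ k *
      ((MvPolynomial.X j₂ - MvPolynomial.C (cx j₂ z)) ^ l * μ)) (Φ z)) z = 0 := by
    rw [← van_succ_iff_jet]
    refine (h1.mono (by omega)).congr (Filter.Eventually.of_forall fun ζ => ?_)
    simp [vary, polyFun, mul_smul]
  rw [leafOp, h2]
  exact congrArg (fun L => L (ex j)) (map_zero (fderiv ℝ G (z, jet K Φ z)))

end Variation


/-! ### Primitives along the leaves -/

section Primitive

variable {n m : ℕ} {K : ℕ} {O : Set (Rn n × Rn m)} {Φ : Rn n × Rn m → Rn m} {z : Rn n × Rn m}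
  {G : (Rn n × Rn m) × Jet K (Rn n × Rn m) (Rn m) → (Rn n →L[ℝ] Rn m)}

/-- The jet at `z` of `(x_i - x_i(z))^r (f - f(z))` in terms of the jet of `f`. -/
def shiftJet (K : ℕ) (i : Fin n) (r : ℕ)
    (p : (Rn n × Rn m) × Jet K (Rn n × Rn m) (Rn m)) : Jet K (Rn n × Rn m) (Rn m) :=
  jet K (fun η => cxPow i p.1 r η • (tay K p.1 p.2 η -
    Jet.val (k := K) (Z := Rn n × Rn m) (T := Rn m) p.2)) p.1

theorem contDiff_shiftJet (i : Fin n) (r : ℕ) :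
    ContDiff ℝ ∞ (shiftJet (m := m) K i r) := by
  refine contDiff_iff_contDiffAt.2 fun p => ?_
  refine ContDiffAt.jet_family (H := fun (p : (Rn n × Rn m) × Jet K (Rn n × Rn m) (Rn m)) η =>
    cxPow i p.1 r η • (tay K p.1 p.2 η - Jet.val (k := K) (Z := Rn n × Rn m) (T := Rn m) p.2))
    (g := fun p : (Rn n × Rn m) × Jet K (Rn n × Rn m) (Rn m) => p.1) ?_ contDiffAt_fst
  have h1 : ContDiff ℝ ∞ (fun q : ((Rn n × Rn m) × Jet K (Rn n × Rn m) (Rn m)) × (Rn n × Rn m) =>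
      cxPow i q.1.1 r q.2) :=
    (((cx i).contDiff.comp contDiff_snd).sub
      ((cx i).contDiff.comp (contDiff_fst.comp contDiff_fst))).pow r
  have h2 : ContDiff ℝ ∞ (fun q : ((Rn n × Rn m) × Jet K (Rn n × Rn m) (Rn m)) × (Rn n × Rn m) =>
      Jet.val (k := K) (Z := Rn n × Rn m) (T := Rn m) q.1.2) :=
    (Jet.val (k := K) (Z := Rn n × Rn m) (T := Rn m)).contDiff.comp
      (contDiff_snd.comp contDiff_fst)
  exact (h1.smul ((contDiff_tay K).sub h2)).contDiffAt

theorem shiftJet_jet (h : SmoothNear Φ z) (i : Fin n) (r : ℕ) :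
    shiftJet K i r (z, jet K Φ z) =
      jet K (vary Φ ((MvPolynomial.X i - MvPolynomial.C (cx i z)) ^ r) (Φ z)) z := by
  have ht : ContDiff ℝ ∞ (tay K z (jet K Φ z)) := contDiff_tay_apply _ _ _
  have h1 : Van (K + 1) (fun ζ => tay K z (jet K Φ z) ζ - Φ ζ) z :=
    (van_sub_iff ht.contDiffAt h.contDiffAt).2 (jet_tay h.contDiffAt)
  have h2 : SmoothNear (fun ζ => tay K z (jet K Φ z) ζ - Φ ζ) z := by
    filter_upwards [h] with ζ hζ using ht.contDiffAt.sub hζ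
  have h3 := (h1.pow_smul h2 (((cx i).contDiff.sub contDiff_const).smoothNear z)
    (sub_self (cx i z)) r).mono (Nat.le_add_right (K + 1) r)
  refine (van_sub_iff ?_ ?_).1 (h3.congr (Filter.Eventually.of_forall fun ζ => ?_))
  · exact ((contDiff_cxPow i z r).smul (ht.sub contDiff_const)).contDiffAt
  · exact contDiffAt_vary h.contDiffAt _ _
  · have h4 : Jet.val (k := K) (Z := Rn n × Rn m) (T := Rn m) (jet K Φ z) = Φ z := val_jet Φ z
    simp only [h4, vary, polyFun, cxPow]
    simp
    module

/-- The commutators `a^r P`, applied to `1`, of the linearized operator with a base coordinate. -/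
def primStep (G : (Rn n × Rn m) × Jet K (Rn n × Rn m) (Rn m) → (Rn n →L[ℝ] Rn m)) (i : Fin n)
    (r : ℕ) (Φ : Rn n × Rn m → Rn m) (z : Rn n × Rn m) : Rn m :=
  fderiv ℝ G (z, jet K Φ z) (0, shiftJet K i r (z, jet K Φ z)) (ex i)

/-- The primitive of a closed form given by the homotopy formula. -/
def primitive (G : (Rn n × Rn m) × Jet K (Rn n × Rn m) (Rn m) → (Rn n →L[ℝ] Rn m)) (i : Fin n)
    (Φ : Rn n × Rn m → Rn m) (z : Rn n × Rn m) : Rn m :=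
  ∑ k ∈ Finset.range (K + 1), ((-1) ^ k / ((k + 1).factorial : ℝ)) •
    (nab (flatCoef Φ) (ex i))^[k] (primStep G i (k + 1) Φ) z

theorem primStep_eq (h : SmoothNear Φ z) (i : Fin n) (r : ℕ) : primStep G i r Φ z =
    leafOp G Φ i ((MvPolynomial.X i - MvPolynomial.C (cx i z)) ^ r) z := by
  rw [primStep, shiftJet_jet h, leafOp]

theorem isJetOp_nab (hO : IsOpen O) {T : Type} [NormedAddCommGroup T] [NormedSpace ℝ T] {L : ℕ}
    {N : (Rn n × Rn m → Rn m) → Rn n × Rn m → T} (hN : IsJetOp L (Subm O) N) (a : Rn n) :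
    IsJetOp (L + 1) (Subm O) (fun Φ z => nab (flatCoef Φ) a (N Φ) z) :=
  (hN.fderiv (openGood_subm hO)).clm_apply ((IsJetOp.const a).prodMk
    ((isJetOp_flatCoef.mono (by omega)).clm (ContinuousLinearMap.apply ℝ (Rn m) a)))

theorem isJetOp_primitive (hO : IsOpen O)
    (hG : ∀ Φ z, Subm O Φ z → ContDiffAt ℝ ∞ G (z, jet K Φ z)) (i : Fin n) :
    IsJetOp (K + K) (Subm O) (primitive G i) := by
  have h0 : ∀ r, IsJetOp K (Subm O) (primStep G i r) := fun r =>
    ⟨fun p => fderiv ℝ G p (0, shiftJet K i r p) (ex i), fun Φ z h => ⟨((contDiffAt_fderiv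
      (hG Φ z h)).clm_apply (contDiffAt_const.prodMk (contDiff_shiftJet i r).contDiffAt)).clm_apply
        contDiffAt_const, rfl⟩⟩
  have h1 : ∀ r k, IsJetOp (K + k) (Subm O) (fun Φ z =>
      (nab (flatCoef Φ) (ex i))^[k] (primStep G i r Φ) z) := by
    intro r k
    induction k with
    | zero => exact h0 r
    | succ k ih =>
      simp only [Function.iterate_succ_apply']
      exact isJetOp_nab hO ih (ex i)
  refine IsJetOp.sum _ fun k hk => ?_
  exact ((h1 (k + 1) k).clm (((-1) ^ k / ((k + 1).factorial : ℝ)) •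
    ContinuousLinearMap.id ℝ (Rn m))).mono (by rw [Finset.mem_range] at hk; omega)

/-- A family of `ℝ^m`-valued horizontal `1`-forms `G (z, jet K Φ z)` depending locally on submersions
`Φ`, which are closed along the leaves of `Φ` and natural with respect to reparametrizations `κ` of
the leaf space. -/
structure IsClosedFamily (O : Set (Rn n × Rn m))
    (G : (Rn n × Rn m) × Jet K (Rn n × Rn m) (Rn m) → (Rn n →L[ℝ] Rn m)) : Prop where
  isOpen : IsOpen O
  smooth : ∀ Φ z, Subm O Φ z → ContDiffAt ℝ ∞ G (z, jet K Φ z)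
  closed : ∀ Φ z, Subm O Φ z → ∀ a b, fderiv ℝ (fun ζ => G (ζ, jet K Φ ζ)) z
      (a, flatCoef Φ z a) b = fderiv ℝ (fun ζ => G (ζ, jet K Φ ζ)) z (b, flatCoef Φ z b) a
  comp : ∀ Φ z, Subm O Φ z → ∀ κ : Rn m → Rn m, SmoothNear κ (Φ z) →
    IsUnit (fderiv ℝ κ (Φ z)) → ∀ a, G (z, jet K (fun ζ => κ (Φ ζ)) z) a =
      fderiv ℝ κ (Φ z) (G (z, jet K Φ z) a)

theorem contDiff_affine (b : Rn m) (B : Rn m →L[ℝ] Rn m) : ContDiff ℝ ∞ fun u => b + B u :=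
  contDiff_const.add B.contDiff

theorem fderiv_affine (b u : Rn m) (B : Rn m →L[ℝ] Rn m) :
    fderiv ℝ (fun u => b + B u) u = B := (B.hasFDerivAt.const_add b).fderiv

variable (hG : IsClosedFamily O G)
include hG

/-- The linearized operator is natural with respect to affine reparametrizations: these commute with
the variation of `Φ`. -/
theorem leafOp_affine (h : Subm O Φ z) (b : Rn m) {B : Rn m →L[ℝ] Rn m} (hB : IsUnit B)
    (j : Fin n) (μ : MvPolynomial (Fin n) ℝ) :
    leafOp G (fun ζ => b + B (Φ ζ)) j μ z = B (leafOp G Φ j μ z) := by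
  have hκ : SmoothNear (fun u => b + B u) (Φ z) := (contDiff_affine b B).smoothNear _
  have h' : Subm O (fun ζ => b + B (Φ ζ)) z :=
    h.comp (κ := fun u => b + B u) hκ (by rw [fderiv_affine]; exact hB)
  have h1 := (hasDerivAt_vary h.2.1.contDiffAt (hG.smooth Φ z h) μ (Φ z)).clm_apply
    (hasDerivAt_const (0 : ℝ) (ex j : Rn n))
  have h2 := (hasDerivAt_vary h'.2.1.contDiffAt (hG.smooth _ z h') μ (b + B (Φ z))).clm_apply
    (hasDerivAt_const (0 : ℝ) (ex j : Rn n))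
  have h3 := B.hasFDerivAt.comp_hasDerivAt (0 : ℝ) h1
  have h4 : (fun ε : ℝ => G (z, jet K (fun η => (b + B (Φ η)) +
      ε • vary (fun ζ => b + B (Φ ζ)) μ (b + B (Φ z)) η) z) (ex j)) =ᶠ[𝓝 0]
      fun ε : ℝ => B (G (z, jet K (fun η => Φ η + ε • vary Φ μ (Φ z) η) z) (ex j)) := by
    filter_upwards [subm_vary h μ] with ε hε
    have h5 := hG.comp _ z hε.1 (fun u => b + B u) ((contDiff_affine b B).smoothNear _)
      (by rw [fderiv_affine]; exact hB) (ex j)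
    rw [fderiv_affine] at h5
    rw [← h5]
    congr 4
    funext η
    simp [vary]
    abel
  have h5 := h2.unique (h3.congr_of_eventuallyEq h4)
  simpa [leafOp] using h5

/-- For `μ = 1` the variation `Φ + ε (Φ - Φ(z))` is a homothety of the leaf space, so naturality
gives back the form itself. -/
theorem leafOp_one (h : Subm O Φ z) (j : Fin n) :
    leafOp G Φ j 1 z = G (z, jet K Φ z) (ex j) := by
  have h1 := (hasDerivAt_vary h.2.1.contDiffAt (hG.smooth Φ z h) 1 (Φ z)).clm_apply
    (hasDerivAt_const (0 : ℝ) (ex j : Rn n))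
  have h2 : HasDerivAt (fun ε : ℝ => (1 + ε) • G (z, jet K Φ z) (ex j))
      (G (z, jet K Φ z) (ex j)) 0 := by
    have := ((hasDerivAt_id (0 : ℝ)).const_add 1).smul_const (G (z, jet K Φ z) (ex j))
    simpa using this
  have h3 : ∀ᶠ ε : ℝ in 𝓝 0, 1 + ε ≠ 0 := by
    have h2 : ContinuousAt (fun ε : ℝ => 1 + ε) 0 := by fun_prop
    exact h2.eventually_ne (by simp)
  have h4 : (fun ε : ℝ => G (z, jet K (fun η => Φ η + ε • vary Φ 1 (Φ z) η) z) (ex j)) =ᶠ[𝓝 0]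
      fun ε : ℝ => (1 + ε) • G (z, jet K Φ z) (ex j) := by
    filter_upwards [h3] with ε hε
    have h5 := hG.comp Φ z h (fun u => Φ z + (1 + ε) • (u - Φ z))
      ((contDiff_scale (Φ z) (1 + ε)).smoothNear _)
      (by rw [fderiv_scale]; exact isUnit_smul_id hε) (ex j)
    rw [fderiv_scale] at h5
    refine Eq.trans ?_ h5
    rw [add_smul_vary]
    simp [polyFun]
  have h5 := h1.unique (h2.congr_of_eventuallyEq h4)
  simpa [leafOp] using h5

/-- The homotopy formula gives a primitive along the leaves. -/
theorem nab_primitive {i₀ i₁ : Fin n} (h01 : i₀ ≠ i₁) (h : Subm O Φ z) (j : Fin n) :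
    nab (flatCoef Φ) (ex j) (primitive G i₀ Φ) z = G (z, jet K Φ z) (ex j) := by
  have hO := hG.isOpen
  have hN : IsOpen {z | Subm O Φ z} :=
    isOpen_iff_mem_nhds.2 fun _ hz => (openGood_subm hO).nhds hz
  have hV : ∀ z ∈ {z | Subm O Φ z}, ContDiffAt ℝ ∞ (flatCoef Φ) z := fun z hz =>
    (Subm.smoothNear_flatCoef hO hz).contDiffAt
  have h1 := exists_primitive_of_closed (X := coordEnd (Rn m) {z | Subm O Φ z})
    (D := fun i => nabEnd (Rn m) hN hV (ex i))
    (fun i j => nabEnd_commute hN hV (fun z hz => curvature_flatCoef hO hz) _ _)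
    (fun i f => by rw [nabEnd_coordEnd]; simp [ex])
    (fun i j hij f => by rw [nabEnd_coordEnd]; simp [ex, hij.symm])
    (P := leafOpLin hO hG.smooth Φ) (fun i j => LinearMap.ext fun μ => smoothOn_ext fun z hz => by
      have e : ∀ i j, (nabEnd (Rn m) hN hV (ex i) (leafOpLin hO hG.smooth Φ j μ)).1 z =
          nab (flatCoef Φ) (ex i) (leafOp G Φ j μ) z := fun i j => by
        rw [nabEnd_apply hN hV _ _ hz]
        refine (nab_congr ?_ Filter.EventuallyEq.rfl _).eq_of_nhds
        filter_upwards [hN.mem_nhds hz] with ζ hζ using leafOpLin_apply hO hG.smooth hζ j μ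
      exact (e i j).trans ((nab_leafOp_comm hO hG.smooth hG.closed hz i j μ).trans (e j i).symm))
    (K := K) (fun i j₁ j₂ k l hkl => LinearMap.ext fun μ => smoothOn_ext fun z hz => by
      rw [coordComm_pow_apply, coordComm_pow_apply, leafOpLin_apply hO hG.smooth hz,
        leafOp_eq_zero hz i j₂ j₁ (Nat.add_comm k l ▸ hkl)]
      rfl) h01 j
  have h2 := congrArg (fun f => f.1 z) h1
  rw [nabEnd_apply hN hV _ _ h, leafOpLin_apply hO hG.smooth h, leafOp_one hG h] at h2
  rw [← h2]
  refine (nab_congr ?_ Filter.EventuallyEq.rfl _).eq_of_nhds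
  filter_upwards [hN.mem_nhds h] with ζ hζ
  have hs : ∀ (s : Finset ℕ) (f : ℕ → smoothOn (Rn m) {z | Subm O Φ z}),
      (∑ k ∈ s, f k).1 ζ = ∑ k ∈ s, (f k).1 ζ := fun s f => by
    rw [AddSubmonoidClass.coe_finsetSum, Finset.sum_apply]
  rw [primitive, homotopySum, hs]
  refine Finset.sum_congr rfl fun k _ => ?_
  have h3 : ∀ (c : ℝ) (f : smoothOn (Rn m) {z | Subm O Φ z}), (c • f).1 ζ = c • f.1 ζ :=
    fun _ _ => rfl
  rw [h3, nabEnd_pow_apply hN hV (ex i₀) _ (g := primStep G i₀ (k + 1) Φ) ?_ k ζ hζ]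
  intro η hη
  have hη' : Subm O Φ η := hη
  rw [coordComm_pow_apply, mul_one, leafOpLin_apply hO hG.smooth hη, primStep_eq hη'.2.1]

end Primitive


/-! ### Naturality of the primitives -/

section Reparametrization

theorem Van.comp_right {Z Y : Type} [NormedAddCommGroup Z] [NormedSpace ℝ Z]
    [NormedAddCommGroup Y] [NormedSpace ℝ Y] {Ψ : Z → Y} {z : Z} (hΨ : SmoothNear Ψ z) (K : ℕ) :
    ∀ {T : Type} [NormedAddCommGroup T] [NormedSpace ℝ T] {f : Y → T} (_ : Van K f (Ψ z))
      (_ : SmoothNear f (Ψ z)), Van K (fun ζ => f (Ψ ζ)) z := by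
  induction K with
  | zero => exact fun _ _ => Van.zero _ _
  | succ K ih =>
    intro T _ _ f hv hf
    have h1 := van_succ_iff.1 hv
    refine van_succ_iff.2 ⟨h1.1, ?_⟩
    have hf' : ∀ᶠ ζ in 𝓝 z, ContDiffAt ℝ ∞ f (Ψ ζ) := hΨ.contDiffAt.continuousAt.eventually hf
    have hs : SmoothNear (fun ζ => _root_.fderiv ℝ f (Ψ ζ)) z := by
      filter_upwards [hf', hΨ] with ζ h2 h3
      exact ContDiffAt.comp (g := _root_.fderiv ℝ f) ζ (contDiffAt_fderiv h2) h3
    refine ((ih h1.2 hf.fderiv).bilin hs hΨ.fderiv (ContinuousLinearMap.compL ℝ Z Y T)).congr ?_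
    filter_upwards [hf', hΨ] with ζ h2 h3
    exact ((differentiableAt_of_smooth h2).hasFDerivAt.comp ζ
      (differentiableAt_of_smooth h3).hasFDerivAt).fderiv

variable {n m : ℕ} {K : ℕ} {O : Set (Rn n × Rn m)} {Φ : Rn n × Rn m → Rn m} {z : Rn n × Rn m}
  {G : (Rn n × Rn m) × Jet K (Rn n × Rn m) (Rn m) → (Rn n →L[ℝ] Rn m)}

theorem Subm.congr {Ψ : Rn n × Rn m → Rn m} (h : Subm O Φ z) (he : Φ =ᶠ[𝓝 z] Ψ) :
    Subm O Ψ z := by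
  refine ⟨h.1, ?_, ?_⟩
  · filter_upwards [h.2.1, he.eventuallyEq_nhds] with ζ h1 h2
    exact h1.congr_of_eventuallyEq h2.symm
  · have : vert Φ z = vert Ψ z := by simp only [vert, he.fderiv_eq]
    rw [← this]
    exact h.2.2

/-- The quotient `(κ(y + ε (u - y)) - κ(y)) / ε` for a polynomial `κ`, which is smooth in `ε`
too. -/
def tayQuot (L : ℕ) (y : Rn m) (w : Jet L (Rn m) (Rn m)) (ε : ℝ) (u : Rn m) : Rn m :=
  ∑ j : Fin (L + 1), (if (j : ℕ) = 0 then 0 else ε ^ ((j : ℕ) - 1)) •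
    (((j : ℕ).factorial : ℝ)⁻¹ • w j (fun _ => u - y))

theorem contDiff_tayQuot (L : ℕ) (y : Rn m) (w : Jet L (Rn m) (Rn m)) :
    ContDiff ℝ ∞ (Function.uncurry (tayQuot L y w)) := by
  have h0 : Function.uncurry (tayQuot L y w) = fun p : ℝ × Rn m => ∑ j : Fin (L + 1),
    (if (j : ℕ) = 0 then 0 else p.1 ^ ((j : ℕ) - 1)) •
      (((j : ℕ).factorial : ℝ)⁻¹ • w j (fun _ => p.2 - y)) := rfl
  rw [h0]
  refine ContDiff.sum fun j _ => ?_
  have h1 : ContDiff ℝ ∞ (fun p : ℝ × Rn m => w j (fun _ => p.2 - y)) :=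
    ContDiff.comp (contDiff_diagonal (j : ℕ)) (f := fun p : ℝ × Rn m => (w j, p.2 - y))
      (contDiff_const.prodMk (contDiff_snd.sub contDiff_const))
  have h2 : ContDiff ℝ ∞ (fun p : ℝ × Rn m => if (j : ℕ) = 0 then (0 : ℝ) else
      p.1 ^ ((j : ℕ) - 1)) := by
    split_ifs with h
    · exact contDiff_const
    · exact contDiff_fst.pow _
  have h3 : ContDiff ℝ ∞ (fun p : ℝ × Rn m =>
      ((j : ℕ).factorial : ℝ)⁻¹ • w j (fun _ => p.2 - y)) := h1.const_smul _
  exact h2.smul h3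

theorem tay_scale (L : ℕ) (y : Rn m) (w : Jet L (Rn m) (Rn m)) (ε : ℝ) (u : Rn m) :
    tay L y w (y + ε • (u - y)) = tay L y w y + ε • tayQuot L y w ε u := by
  rw [tay, tay, tayQuot, Finset.smul_sum, ← Finset.sum_add_distrib]
  refine Finset.sum_congr rfl fun j _ => ?_
  rw [add_sub_cancel_left, sub_self, ContinuousMultilinearMap.map_smul_univ (w j) (fun _ => ε)]
  by_cases hj : (j : ℕ) = 0
  · have h1 : IsEmpty (Fin (j : ℕ)) := by rw [hj]; infer_instance
    simp only [hj, if_true, zero_smul, smul_zero, add_zero]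
    congr 1
    rw [Finset.prod_of_isEmpty, one_smul]
    congr 1
    exact Subsingleton.elim _ _
  · have h1 : Nonempty (Fin (j : ℕ)) := ⟨⟨0, Nat.pos_of_ne_zero hj⟩⟩
    have h2 : w j (fun _ => (0 : Rn m)) = 0 := (w j).map_coord_zero (Classical.arbitrary _) rfl
    rw [h2, if_neg hj, smul_zero, zero_add, Finset.prod_const, Finset.card_univ, Fintype.card_fin,
      smul_smul, smul_smul, smul_smul]
    congr 1
    obtain ⟨k, hk⟩ := Nat.exists_eq_succ_of_ne_zero hj
    rw [hk, Nat.succ_sub_one, pow_succ]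
    ring

/-- The derivative of the quotient at `y` does not depend on `ε`, including `ε = 0`. -/
theorem fderiv_tayQuot (L : ℕ) (y : Rn m) (w : Jet L (Rn m) (Rn m)) (ε : ℝ) :
    fderiv ℝ (tayQuot L y w ε) y = fderiv ℝ (tay L y w) y := by
  have hs : ContDiff ℝ ∞ (tay L y w) := contDiff_tay_apply _ _ _
  have hq : ∀ ε, ContDiff ℝ ∞ (tayQuot L y w ε) := fun ε =>
    (contDiff_tayQuot L y w).comp (f := fun u => (ε, u)) (contDiff_const.prodMk contDiff_id)
  have h1 : ∀ ε : ℝ, ε ≠ 0 → fderiv ℝ (tayQuot L y w ε) y = fderiv ℝ (tay L y w) y := by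
    intro ε hε
    have h2 : fderiv ℝ (fun u => tay L y w (y + ε • (u - y))) y =
        ε • fderiv ℝ (tay L y w) y := by
      have h3 : HasFDerivAt (fun u => y + ε • (u - y)) (ε • ContinuousLinearMap.id ℝ (Rn m)) y := by
        rw [← fderiv_scale y y ε]
        exact (differentiableAt_of_smooth (contDiff_scale y ε).contDiffAt).hasFDerivAt
      have h4 : HasFDerivAt (tay L y w) (fderiv ℝ (tay L y w) y) (y + ε • (y - y)) := by
        rw [sub_self, smul_zero, add_zero]
        exact (differentiableAt_of_smooth hs.contDiffAt).hasFDerivAt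
      have h5 : HasFDerivAt (fun u => tay L y w (y + ε • (u - y))) _ y :=
        HasFDerivAt.comp (g := tay L y w) (f := fun u => y + ε • (u - y)) y h4 h3
      rw [h5.fderiv]
      ext1 v
      simp
    have h6 : HasFDerivAt (fun u => tay L y w y + ε • tayQuot L y w ε u)
        (ε • fderiv ℝ (tayQuot L y w ε) y) y :=
      ((differentiableAt_of_smooth (hq ε).contDiffAt).hasFDerivAt.const_smul ε).const_add _
    have h7 : (fun u => tay L y w (y + ε • (u - y))) =
        fun u => tay L y w y + ε • tayQuot L y w ε u := funext fun u => tay_scale L y w ε u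
    rw [h7, h6.fderiv] at h2
    exact smul_right_injective _ hε h2
  have h2 : Continuous (fun ε : ℝ => fderiv ℝ (tayQuot L y w ε) y) := by
    have : ContDiff ℝ ∞ (fun ε : ℝ => fderiv ℝ (tayQuot L y w ε) y) :=
      ContDiff.fderiv (f := tayQuot L y w) (g := fun _ => y) (n := ∞) (m := ∞)
        (contDiff_tayQuot L y w) contDiff_const (by simp)
    exact this.continuous
  have h3 : (fun ε : ℝ => fderiv ℝ (tayQuot L y w ε) y) = fun _ => fderiv ℝ (tay L y w) y :=
    h2.ext_on (dense_compl_singleton (0 : ℝ)) continuous_const fun ε hε => h1 ε hε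
  exact congrFun h3 ε

variable (hG : IsClosedFamily O G)
include hG

theorem nab_primitive_iterate_affine (h : Subm O Φ z) (b : Rn m) {B : Rn m →L[ℝ] Rn m}
    (hB : IsUnit B) (i : Fin n) (r k : ℕ) :
    (nab (flatCoef fun ζ => b + B (Φ ζ)) (ex i))^[k] (primStep G i r fun ζ => b + B (Φ ζ)) z =
      B ((nab (flatCoef Φ) (ex i))^[k] (primStep G i r Φ) z) := by
  have hO := hG.isOpen
  have hN := openGood_subm (n := n) (m := m) hO
  have hκ : ∀ u, SmoothNear (fun u => b + B u) u := fun u => (contDiff_affine b B).smoothNear _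
  have hu : ∀ u, IsUnit (fderiv ℝ (fun u => b + B u) u) := fun u => by
    rw [fderiv_affine]; exact hB
  induction k generalizing z with
  | zero =>
    have h' : Subm O (fun ζ => b + B (Φ ζ)) z := h.comp (κ := fun u => b + B u) (hκ _) (hu _)
    simp only [Function.iterate_zero, id_eq]
    rw [primStep_eq h.2.1, primStep_eq h'.2.1, leafOp_affine hG h b hB]
  | succ k ih =>
    rw [Function.iterate_succ_apply', Function.iterate_succ_apply']
    have h1 : (nab (flatCoef fun ζ => b + B (Φ ζ)) (ex i))^[k]
        (primStep G i r fun ζ => b + B (Φ ζ)) =ᶠ[𝓝 z]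
          fun ζ => B ((nab (flatCoef Φ) (ex i))^[k] (primStep G i r Φ) ζ) := by
      filter_upwards [hN.nhds h] with ζ hζ using ih hζ
    have h2 : flatCoef (fun ζ => b + B (Φ ζ)) z = flatCoef Φ z :=
      flatCoef_comp h (κ := fun u => b + B u) (hκ _) (hu _)
    have hs : ∀ k, ∀ ζ, Subm O Φ ζ →
        ContDiffAt ℝ ∞ ((nab (flatCoef Φ) (ex i))^[k] (primStep G i r Φ)) ζ := by
      intro k
      induction k with
      | zero =>
        intro ζ hζ
        have h3 := contDiffAt_fderiv (hG.smooth Φ ζ hζ)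
        have h4 : ContDiffAt ℝ ∞ (fun η => (η, jet K Φ η)) ζ :=
          contDiffAt_id.prodMk (contDiffAt_jet hζ.2.1.contDiffAt)
        exact ((ContDiffAt.comp (g := fderiv ℝ G) ζ h3 h4).clm_apply (contDiffAt_const.prodMk
          ((contDiff_shiftJet i r).contDiffAt.comp ζ h4))).clm_apply contDiffAt_const
      | succ k ih =>
        intro ζ hζ
        rw [Function.iterate_succ_apply']
        exact contDiffAt_nab (Subm.smoothNear_flatCoef hO hζ).contDiffAt (ih ζ hζ) _
    have h3 : HasFDerivAt (fun ζ => B ((nab (flatCoef Φ) (ex i))^[k] (primStep G i r Φ) ζ)) _ z :=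
      B.hasFDerivAt.comp z (differentiableAt_of_smooth (hs k z h)).hasFDerivAt
    rw [nab, h1.fderiv_eq, h2, h3.fderiv]
    rfl

theorem primitive_affine (h : Subm O Φ z) (b : Rn m) {B : Rn m →L[ℝ] Rn m} (hB : IsUnit B)
    (i : Fin n) : primitive G i (fun ζ => b + B (Φ ζ)) z = B (primitive G i Φ z) := by
  simp only [primitive, map_sum, map_smul, nab_primitive_iterate_affine hG h b hB]

/-- The primitive is compatible with reparametrizations of the leaves. The difference of the two
sides is constant along the leaves, by the corresponding property of `G`. -/
theorem primitive_comp_tay {i₀ i₁ : Fin n} (h01 : i₀ ≠ i₁) (h : Subm O Φ z) (L : ℕ)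
    (w : Jet L (Rn m) (Rn m)) (hw : IsUnit (fderiv ℝ (tay L (Φ z) w) (Φ z))) :
    primitive G i₀ (fun ζ => tay L (Φ z) w (Φ ζ)) z =
      fderiv ℝ (tay L (Φ z) w) (Φ z) (primitive G i₀ Φ z) := by
  have hO := hG.isOpen
  have hg := openGood_subm (n := n) (m := m) hO
  have hop := isJetOp_primitive hO hG.smooth i₀
  obtain ⟨y, hy⟩ : ∃ y, Φ z = y := ⟨_, rfl⟩
  rw [hy] at hw ⊢
  let κ := tay L y w
  have hκ : ContDiff ℝ ∞ κ := contDiff_tay_apply _ _ _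
  have hsub : ∀ Ψ ζ, Subm O Ψ ζ → Ψ ζ = y → Subm O (fun η => κ (Ψ η)) ζ := fun Ψ ζ h1 h2 =>
    h1.comp (hκ.smoothNear _) (by rw [h2]; exact hw)
  have hdκ : ∀ Ψ ζ, Subm O Ψ ζ → HasFDerivAt (fun η => fderiv ℝ κ (Ψ η) (primitive G i₀ Ψ η))
      ((fderiv ℝ κ (Ψ ζ)).comp (fderiv ℝ (primitive G i₀ Ψ) ζ) +
        ((fderiv ℝ (fderiv ℝ κ) (Ψ ζ)).comp (fderiv ℝ Ψ ζ)).flip (primitive G i₀ Ψ ζ)) ζ := by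
    intro Ψ ζ h1
    have h2 : HasFDerivAt (fun η => fderiv ℝ κ (Ψ η)) _ ζ :=
      (differentiableAt_of_smooth (contDiffAt_fderiv hκ.contDiffAt)).hasFDerivAt.comp ζ
        (differentiableAt_of_smooth h1.2.1.contDiffAt).hasFDerivAt
    exact h2.clm_apply (differentiableAt_of_smooth (hop.contDiffAt hg h1)).hasFDerivAt
  have key := eq_zero_of_const_along_leaves i₀ hO (y := y) (T := fun Ψ ζ =>
    primitive G i₀ (fun η => κ (Ψ η)) ζ - fderiv ℝ κ (Ψ ζ) (primitive G i₀ Ψ ζ))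
    ?_ ?_ ?_ ?_ h hy
  · have := sub_eq_zero.1 key
    rwa [hy] at this
  · intro Ψ Ψ' ζ h1 h2 he
    have h3 : (fun η => κ (Ψ η)) =ᶠ[𝓝 ζ] fun η => κ (Ψ' η) := he.fun_comp κ
    have h4 := hsub Ψ ζ h1 h2
    simp only [he.eq_of_nhds, hop.congr_jet h1 (h1.congr he) (jet_congr he),
      hop.congr_jet h4 (h4.congr h3) (jet_congr h3)]
  · intro Ψ ζ h1 h2
    exact (differentiableAt_of_smooth (hop.contDiffAt hg (hsub Ψ ζ h1 h2))).sub
      (hdκ Ψ ζ h1).differentiableAt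
  · intro Ψ ζ h1 h2
    have h3 := hsub Ψ ζ h1 h2
    have hu : IsUnit (fderiv ℝ κ (Ψ ζ)) := by rw [h2]; exact hw
    have h4 := nab_primitive hG h01 h3 i₀
    have h5 := nab_primitive hG h01 h1 i₀
    have h6 := nab_flatCoef h1.2.2 (ex i₀)
    rw [nab, flatCoef_comp h1 (κ := κ) (hκ.smoothNear _) hu] at h4
    rw [nab] at h5 h6
    rw [fderiv_fun_sub (differentiableAt_of_smooth (hop.contDiffAt hg h3))
      (hdκ Ψ ζ h1).differentiableAt, (hdκ Ψ ζ h1).fderiv, sub_apply, h4,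
      hG.comp Ψ ζ h1 κ (hκ.smoothNear _) hu]
    simp [h5, h6]
  · intro Ψ ζ h1 h2
    have hQs := contDiff_tayQuot L y w
    have hq : ∀ ε, ContDiff ℝ ∞ (tayQuot L y w ε) := fun ε =>
      hQs.comp (f := fun u => (ε, u)) (contDiff_const.prodMk contDiff_id)
    have hsq : ∀ ε, Subm O (fun η => tayQuot L y w ε (Ψ η)) ζ := fun ε =>
      h1.comp ((hq ε).smoothNear _) (by rw [h2, fderiv_tayQuot]; exact hw)
    -- the value at `y + ε (Ψ - y)` is `ε` times a quantity which is continuous at `ε = 0`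
    have h3 : ContinuousAt (fun ε : ℝ => primitive G i₀ (fun η => tayQuot L y w ε (Ψ η)) ζ) 0 := by
      refine (hop.family (H := fun (ε : ℝ) η => tayQuot L y w ε (Ψ η)) (g := fun _ => ζ) ?_
        contDiffAt_const (Filter.Eventually.of_forall hsq)).continuousAt
      refine ContDiffAt.comp (g := Function.uncurry (tayQuot L y w))
        (f := fun p : ℝ × (Rn n × Rn m) => (p.1, Ψ p.2)) ((0 : ℝ), ζ) hQs.contDiffAt
        (contDiffAt_fst.prodMk (ContDiffAt.comp ((0 : ℝ), ζ) h1.2.1.contDiffAt contDiffAt_snd))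
    have h4 : ∀ ε : ℝ, 0 < ε → ε • (primitive G i₀ (fun η => tayQuot L y w ε (Ψ η)) ζ -
        fderiv ℝ κ y (primitive G i₀ Ψ ζ)) =
        primitive G i₀ (fun η => κ (y + ε • (Ψ η - y))) ζ -
          fderiv ℝ κ (y + ε • (Ψ ζ - y)) (primitive G i₀ (fun η => y + ε • (Ψ η - y)) ζ) := by
      intro ε hε
      have h5 := primitive_affine hG (hsq ε) (κ y) (isUnit_smul_id hε.ne') i₀
      have h6 := primitive_affine hG h1 (y - ε • y) (isUnit_smul_id hε.ne') i₀
      have h7 : (fun η => κ y + (ε • ContinuousLinearMap.id ℝ (Rn m)) (tayQuot L y w ε (Ψ η))) =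
          fun η => κ (y + ε • (Ψ η - y)) := funext fun η => (tay_scale L y w ε (Ψ η)).symm
      have h8 : (fun η => (y - ε • y) + (ε • ContinuousLinearMap.id ℝ (Rn m)) (Ψ η)) =
          fun η => y + ε • (Ψ η - y) := by
        funext η
        simp only [smul_apply, ContinuousLinearMap.id_apply]
        module
      rw [h7] at h5
      rw [h8] at h6
      rw [h5, h6, h2, sub_self, smul_zero, add_zero, smul_sub]
      simp
    have h5 : Filter.Tendsto (fun ε : ℝ => ε •
        (primitive G i₀ (fun η => tayQuot L y w ε (Ψ η)) ζ -
          fderiv ℝ κ y (primitive G i₀ Ψ ζ))) (𝓝[>] 0) (𝓝 ((0 : ℝ) •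
        (primitive G i₀ (fun η => tayQuot L y w 0 (Ψ η)) ζ -
          fderiv ℝ κ y (primitive G i₀ Ψ ζ)))) :=
      tendsto_nhdsWithin_of_tendsto_nhds
        (Filter.tendsto_id.smul (h3.tendsto.sub tendsto_const_nhds))
    rw [zero_smul] at h5
    refine h5.congr' ?_
    filter_upwards [self_mem_nhdsWithin] with ε hε using h4 ε hε

/-- A closed family of forms is the differential of a vertical field which depends smoothly on the
connection only. -/
theorem exists_vertical_primitive (hn : 2 ≤ n) :
    ∃ S : (Rn n × Rn m) × Jet (K + K + 1) (Rn n × Rn m) (Rn n →L[ℝ] Rn m) → Rn m,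
      (∀ p, p.1 ∈ O → ContDiffAt ℝ ∞ S p) ∧
      ∀ Φ z, Subm O Φ z → ∀ a,
        nab (flatCoef Φ) a (fun ζ => vert Φ ζ (S (ζ, jet (K + K + 1) (flatCoef Φ) ζ))) z =
          G (z, jet K Φ z) a := by
  let i₀ : Fin n := ⟨0, by omega⟩
  let i₁ : Fin n := ⟨1, by omega⟩
  have h01 : i₀ ≠ i₁ := by simp [i₀, i₁]
  have hO := hG.isOpen
  have hg := openGood_subm (n := n) (m := m) hO
  have hop := isJetOp_primitive hO hG.smooth i₀
  let L := K + K
  -- the primitive for the leaf coordinates, which are determined by the jet of the connection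
  refine ⟨fun p => primitive G i₀ (leaf L p.1 p.2) p.1, fun p hp => ?_, ?_⟩
  · refine hop.family (H := fun (p : (Rn n × Rn m) × Jet (L + 1) (Rn n × Rn m)
      (Rn n →L[ℝ] Rn m)) => leaf L p.1 p.2) (g := fun p => p.1) (contDiff_leaf L).contDiffAt
      contDiffAt_fst ?_
    have : ∀ᶠ q : (Rn n × Rn m) × Jet (L + 1) (Rn n × Rn m) (Rn n →L[ℝ] Rn m) in 𝓝 p,
        q.1 ∈ O := continuousAt_fst.eventually (hO.mem_nhds hp)
    filter_upwards [this] with q hq using subm_leaf hq L q.2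
  · intro Φ z h a
    have key : ∀ ζ, Subm O Φ ζ →
        vert Φ ζ (primitive G i₀ (leaf L ζ (jet (L + 1) (flatCoef Φ) ζ)) ζ) =
          primitive G i₀ Φ ζ := by
      intro ζ hζ
      set Ψ := leaf L ζ (jet (L + 1) (flatCoef Φ) ζ) with hΨ
      have hΨS : Subm O Ψ ζ := subm_leaf hζ.1 L _
      have hΨζ : Ψ ζ = ζ.2 := leaf_slice rfl
      -- to finite order, `Φ` is the reparametrization `κ` of the leaf coordinates `Ψ`
      let κ : Rn m → Rn m := fun y => Φ (ζ.1, y)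
      have hκ : SmoothNear κ (Ψ ζ) := by
        rw [hΨζ]
        have h6 : Filter.Tendsto (fun y => (ζ.1, y)) (𝓝 ζ.2) (𝓝 ζ) :=
          (Continuous.prodMk_right ζ.1).tendsto ζ.2
        filter_upwards [h6.eventually hζ.2.1] with y hy
        exact ContDiffAt.comp (g := Φ) y hy (contDiffAt_const.prodMk contDiffAt_id)
      let w := jet (L + 1) κ (Ψ ζ)
      have ht : ContDiff ℝ ∞ (tay (L + 1) (Ψ ζ) w) := contDiff_tay_apply _ _ _
      have hv : Van (L + 1 + 1) (fun y => κ y - tay (L + 1) (Ψ ζ) w y) (Ψ ζ) :=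
        (van_sub_iff hκ.contDiffAt ht.contDiffAt).2 (jet_tay hκ.contDiffAt).symm
      have hκ' : HasFDerivAt κ (vert Φ ζ) (Ψ ζ) := by
        rw [hΨζ]
        exact HasFDerivAt.comp (x := ζ.2) (f := fun y => (ζ.1, y)) (g := Φ)
          (differentiableAt_of_smooth hζ.2.1.contDiffAt).hasFDerivAt
          (hasFDerivAt_prodMk_right ζ.1 ζ.2)
      have hd : fderiv ℝ (tay (L + 1) (Ψ ζ) w) (Ψ ζ) = vert Φ ζ := by
        have h1 := (van_succ_iff.1 hv).2.apply_eq_zero (Nat.succ_pos L)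
        rw [fderiv_fun_sub hκ'.differentiableAt (differentiableAt_of_smooth ht.contDiffAt),
          hκ'.fderiv, sub_eq_zero] at h1
        exact h1.symm
      have hu : IsUnit (fderiv ℝ (tay (L + 1) (Ψ ζ) w) (Ψ ζ)) := by rw [hd]; exact hζ.2.2
      have h1 := primitive_comp_tay hG h01 hΨS (L + 1) w hu
      rw [hd] at h1
      rw [← h1]
      have hsm : SmoothNear (fun η => κ (Ψ η)) ζ := by
        filter_upwards [hΨS.2.1.contDiffAt.continuousAt.eventually hκ, hΨS.2.1] with η h2 h3
        exact ContDiffAt.comp (g := κ) η h2 h3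
      have h2 : jet (L + 1) Φ ζ = jet (L + 1) (fun η => tay (L + 1) (Ψ ζ) w (Ψ η)) ζ := by
        rw [jet_comp_leaf hO hζ L, ← hΨ]
        have hsm' : ContDiffAt ℝ ∞ (fun η => tay (L + 1) (Ψ ζ) w (Ψ η)) ζ :=
          ht.contDiffAt.comp ζ hΨS.2.1.contDiffAt
        refine (van_sub_iff hsm.contDiffAt hsm').1 ?_
        exact Van.comp_right hΨS.2.1 (L + 1 + 1) hv (hκ.mono fun y hy => hy.sub ht.contDiffAt)
      exact (hop.congr_jet hζ (hΨS.comp (ht.smoothNear _) hu)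
        (jet_eq_of_le (Nat.le_succ L) h2)).symm
    have h1 : nab (flatCoef Φ) a (fun ζ => vert Φ ζ (primitive G i₀
        (leaf L ζ (jet (L + 1) (flatCoef Φ) ζ)) ζ)) z = nab (flatCoef Φ) a (primitive G i₀ Φ) z := by
      refine (nab_congr ?_ Filter.EventuallyEq.rfl a).eq_of_nhds
      filter_upwards [hg.nhds h] with ζ hζ using key ζ hζ
    refine h1.trans ?_
    have h2 : nabL (flatCoef Φ) (primitive G i₀ Φ) z = G (z, jet K Φ z) := by
      rw [clm_eq_sum (G (z, jet K Φ z)), clm_eq_sum (nabL (flatCoef Φ) (primitive G i₀ Φ) z)]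
      refine Finset.sum_congr rfl fun j _ => ?_
      rw [nabL_apply, nab_primitive hG h01 h j]
    exact congrArg (fun B => B a) h2

end Reparametrization


/-! ### Adapted charts -/

section Charts

variable {n m : ℕ} {M E : Type*}
  [TopologicalSpace M] [ChartedSpace (Rn n) M]
  [TopologicalSpace E] [ChartedSpace (ModelProd (Rn n) (Rn m)) E]
  {π : E → M}

namespace AdaptedChart

variable (c : AdaptedChart n m π)

theorem contMDiffOn_total :
    ContMDiffOn (IT n m) 𝓘(ℝ, Rn n × Rn m) ∞ c.total c.total.source := by
  have := contMDiffOn_of_mem_maximalAtlas c.total_mem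
  rw [modelWithCornersSelf_prod]
  exact this

theorem contMDiffOn_total_symm :
    ContMDiffOn 𝓘(ℝ, Rn n × Rn m) (IT n m) ∞ c.total.symm c.total.target := by
  have := contMDiffOn_symm_of_mem_maximalAtlas c.total_mem
  rw [modelWithCornersSelf_prod]
  exact this

theorem contMDiffAt_total {e : E} (he : e ∈ c.total.source) :
    ContMDiffAt (IT n m) 𝓘(ℝ, Rn n × Rn m) ∞ c.total e :=
  c.contMDiffOn_total.contMDiffAt (c.total.open_source.mem_nhds he)

theorem contMDiffAt_total_symm {z : Rn n × Rn m} (hz : z ∈ c.total.target) :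
    ContMDiffAt 𝓘(ℝ, Rn n × Rn m) (IT n m) ∞ c.total.symm z :=
  c.contMDiffOn_total_symm.contMDiffAt (c.total.open_target.mem_nhds hz)

theorem contMDiffAt_base {x : M} (hx : x ∈ c.base.source) :
    ContMDiffAt (IB n) 𝓘(ℝ, Rn n) ∞ c.base x :=
  contMDiffAt_of_mem_maximalAtlas c.base_mem hx

theorem contMDiffAt_base_symm {x : Rn n} (hx : x ∈ c.base.target) :
    ContMDiffAt 𝓘(ℝ, Rn n) (IB n) ∞ c.base.symm x :=
  contMDiffAt_symm_of_mem_maximalAtlas c.base_mem hx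

/-- The differential of the chart, as a map of model spaces. -/
def dT (e : E) : Rn n × Rn m →L[ℝ] Rn n × Rn m :=
  (mfderiv (IT n m) 𝓘(ℝ, Rn n × Rn m) c.total e : _ →L[ℝ] _)

/-- The differential of the inverse of the chart at the image of `e`. -/
def dTs (e : E) : Rn n × Rn m →L[ℝ] Rn n × Rn m :=
  (mfderiv 𝓘(ℝ, Rn n × Rn m) (IT n m) c.total.symm (c.total e) : _ →L[ℝ] _)

/-- The differential of the chart of the base. -/
def dB (x : M) : Rn n →L[ℝ] Rn n :=
  (mfderiv (IB n) 𝓘(ℝ, Rn n) c.base x : _ →L[ℝ] _)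

/-- The differential of the inverse of the chart of the base at the image of `x`. -/
def dBs (x : M) : Rn n →L[ℝ] Rn n :=
  (mfderiv 𝓘(ℝ, Rn n) (IB n) c.base.symm (c.base x) : _ →L[ℝ] _)

variable (π) in
/-- The differential of the bundle projection, as a map of model spaces. -/
def dproj (e : E) : Rn n × Rn m →L[ℝ] Rn n := (mfderiv (IT n m) (IB n) π e : _ →L[ℝ] _)

variable {c}

theorem mem_target {e : E} (he : e ∈ c.total.source) : c.total e ∈ c.total.target :=
  c.total.map_source he

theorem dTs_dT {e : E} (he : e ∈ c.total.source) (v : Rn n × Rn m) :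
    c.dTs e (c.dT e v) = v := by
  have h1 : mfderiv (IT n m) (IT n m) (c.total.symm ∘ c.total) e = _ :=
    mfderiv_comp e ((c.contMDiffAt_total_symm (mem_target he)).mdifferentiableAt (by simp))
      ((c.contMDiffAt_total he).mdifferentiableAt (by simp))
  have h2 : c.total.symm ∘ c.total =ᶠ[𝓝 e] id := by
    filter_upwards [c.total.open_source.mem_nhds he] with e' he' using c.total.left_inv he'
  rw [h2.mfderiv_eq, mfderiv_id] at h1
  exact (congrArg (fun B : Rn n × Rn m →L[ℝ] Rn n × Rn m => B v) h1).symm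

theorem dT_dTs {e : E} (he : e ∈ c.total.source) (v : Rn n × Rn m) :
    c.dT e (c.dTs e v) = v := by
  have h0 : MDifferentiableAt (IT n m) 𝓘(ℝ, Rn n × Rn m) c.total (c.total.symm (c.total e)) := by
    rw [c.total.left_inv he]
    exact (c.contMDiffAt_total he).mdifferentiableAt (by simp)
  have h1 : mfderiv 𝓘(ℝ, Rn n × Rn m) 𝓘(ℝ, Rn n × Rn m) (c.total ∘ c.total.symm) (c.total e) = _ :=
    mfderiv_comp (c.total e) h0
      ((c.contMDiffAt_total_symm (mem_target he)).mdifferentiableAt (by simp))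
  have h2 : c.total ∘ c.total.symm =ᶠ[𝓝 (c.total e)] id := by
    filter_upwards [c.total.open_target.mem_nhds (mem_target he)] with e' he'
      using c.total.right_inv he'
  rw [h2.mfderiv_eq, mfderiv_id, c.total.left_inv he] at h1
  exact (congrArg (fun B : Rn n × Rn m →L[ℝ] Rn n × Rn m => B v) h1).symm

theorem dBs_dB {x : M} (hx : x ∈ c.base.source) (v : Rn n) : c.dBs x (c.dB x v) = v := by
  have h1 : mfderiv (IB n) (IB n) (c.base.symm ∘ c.base) x = _ :=
    mfderiv_comp x ((c.contMDiffAt_base_symm (c.base.map_source hx)).mdifferentiableAt (by simp))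
      ((c.contMDiffAt_base hx).mdifferentiableAt (by simp))
  have h2 : c.base.symm ∘ c.base =ᶠ[𝓝 x] id := by
    filter_upwards [c.base.open_source.mem_nhds hx] with e' he' using c.base.left_inv he'
  rw [h2.mfderiv_eq, mfderiv_id] at h1
  exact (congrArg (fun B : Rn n →L[ℝ] Rn n => B v) h1).symm

theorem dB_dBs {x : M} (hx : x ∈ c.base.source) (v : Rn n) : c.dB x (c.dBs x v) = v := by
  have h0 : MDifferentiableAt (IB n) 𝓘(ℝ, Rn n) c.base (c.base.symm (c.base x)) := by
    rw [c.base.left_inv hx]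
    exact (c.contMDiffAt_base hx).mdifferentiableAt (by simp)
  have h1 : mfderiv 𝓘(ℝ, Rn n) 𝓘(ℝ, Rn n) (c.base ∘ c.base.symm) (c.base x) = _ :=
    mfderiv_comp (c.base x) h0
      ((c.contMDiffAt_base_symm (c.base.map_source hx)).mdifferentiableAt (by simp))
  have h2 : c.base ∘ c.base.symm =ᶠ[𝓝 (c.base x)] id := by
    filter_upwards [c.base.open_target.mem_nhds (c.base.map_source hx)] with e' he'
      using c.base.right_inv he'
  rw [h2.mfderiv_eq, mfderiv_id, c.base.left_inv hx] at h1
  exact (congrArg (fun B : Rn n →L[ℝ] Rn n => B v) h1).symm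

theorem contMDiffAt_proj {e : E} (he : e ∈ c.total.source) : ContMDiffAt (IT n m) (IB n) ∞ π e := by
  have h1 : π =ᶠ[𝓝 e] fun e => c.base.symm (c.total e).1 := by
    filter_upwards [c.total.open_source.mem_nhds he] with e' he'
    rw [c.fst_total e' he', c.base.left_inv (c.map_source e' he')]
  refine ContMDiffAt.congr_of_eventuallyEq ?_ h1
  refine ContMDiffAt.comp (I' := 𝓘(ℝ, Rn n)) e (g := c.base.symm) (f := fun e => (c.total e).1) ?_ ?_
  · refine c.contMDiffAt_base_symm ?_
    rw [c.fst_total e he]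
    exact c.base.map_source (c.map_source e he)
  · exact ContMDiffAt.comp (I' := 𝓘(ℝ, Rn n × Rn m)) e (g := Prod.fst) (f := c.total)
      (contDiff_fst.contDiffAt.contMDiffAt) (c.contMDiffAt_total he)

theorem fst_dT {e : E} (he : e ∈ c.total.source) (v : Rn n × Rn m) :
    (c.dT e v).1 = c.dB (π e) (dproj π e v) := by
  have h1 : (fun e => (c.total e).1) =ᶠ[𝓝 e] c.base ∘ π := by
    filter_upwards [c.total.open_source.mem_nhds he] with e' he' using c.fst_total e' he'
  have h2 : mfderiv (IT n m) 𝓘(ℝ, Rn n) (c.base ∘ π) e = _ := mfderiv_comp e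
    ((c.contMDiffAt_base (c.map_source e he)).mdifferentiableAt (by simp))
    ((contMDiffAt_proj he).mdifferentiableAt (by simp))
  have h3 : mfderiv (IT n m) 𝓘(ℝ, Rn n) (Prod.fst ∘ c.total) e = _ := mfderiv_comp e
    (I' := 𝓘(ℝ, Rn n × Rn m)) (g := (Prod.fst : Rn n × Rn m → Rn n))
    (contDiff_fst (n := ∞).contDiffAt.contMDiffAt.mdifferentiableAt (by simp))
    ((c.contMDiffAt_total he).mdifferentiableAt (by simp))
  have h4 : (Prod.fst ∘ c.total : E → Rn n) =ᶠ[𝓝 e] c.base ∘ π := h1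
  rw [h4.mfderiv_eq, h2, mfderiv_eq_fderiv, fderiv_fst] at h3
  exact (congrArg (fun B : Rn n × Rn m →L[ℝ] Rn n => B v) h3).symm

end AdaptedChart

/-- Every point of the total space of a smooth fiber bundle has an adapted chart. -/
theorem exists_adaptedChart [IsManifold (IB n) ∞ M] [IsManifold (IT n m) ∞ E] {F : Type*}
    [TopologicalSpace F] [ChartedSpace (Rn m) F] [IsManifold (IB m) ∞ F]
    (hπ : IsSmoothFiberBundle n m F π) (e : E) :
    ∃ c : AdaptedChart n m π, e ∈ c.total.source := by
  obtain ⟨T, hT, h1, h2⟩ := hπ (π e)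
  have he : e ∈ T.source := T.mem_source.2 hT
  let ψ := chartAt (Rn n) (π e)
  let φ := chartAt (Rn m) (T e).2
  let χ : OpenPartialHomeomorph E (Rn n × Rn m) := T.toOpenPartialHomeomorph ≫ₕ (ψ.prod φ)
  have hχ : ∀ e', e' ∈ χ.source ↔ e' ∈ T.source ∧ (T e').1 ∈ ψ.source ∧ (T e').2 ∈ φ.source := by
    intro e'
    simp [χ]
  have hψm : ψ ∈ IsManifold.maximalAtlas (IB n) ∞ M := IsManifold.chart_mem_maximalAtlas _
  have hφm : φ ∈ IsManifold.maximalAtlas (IB m) ∞ F := IsManifold.chart_mem_maximalAtlas _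
  have hp : ψ.prod φ ∈ IsManifold.maximalAtlas ((IB n).prod (𝓡 m)) ∞ (M × F) :=
    IsManifold.mem_maximalAtlas_prod hψm hφm
  have hmem : (χ : OpenPartialHomeomorph E (ModelProd (Rn n) (Rn m))) ∈
      IsManifold.maximalAtlas (IT n m) ∞ E := by
    refine OpenPartialHomeomorph.mem_maximalAtlas_of_contMDiffOn (I := IT n m) (n := ∞)
      (φ := (χ : OpenPartialHomeomorph E (ModelProd (Rn n) (Rn m)))) ?_ ?_
    · refine (contMDiffOn_of_mem_maximalAtlas hp).comp (h1.mono ?_) ?_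
      · exact fun e' he' => ((hχ e').1 he').1
      · intro e' he'
        exact ((hχ e').1 he').2
    · refine h2.comp ((contMDiffOn_symm_of_mem_maximalAtlas hp).mono ?_) ?_
      · intro z hz
        exact hz.1
      · intro z hz
        exact hz.2
  refine ⟨⟨ψ, χ, hψm, hmem, ?_, ?_⟩, ?_⟩
  · intro e' he'
    have := (hχ e').1 he'
    rw [← T.coe_fst this.1]
    exact this.2.1
  · intro e' he'
    have := (hχ e').1 he'
    show ψ (T e').1 = ψ (π e')
    rw [T.coe_fst this.1]
  · refine (hχ e).2 ⟨he, ?_, mem_chart_source _ _⟩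
    rw [T.coe_fst he]
    exact mem_chart_source _ _

end Charts


/-! ### Change of adapted coordinates -/

section Transition

variable {n m : ℕ} {M E : Type*}
  [TopologicalSpace M] [ChartedSpace (Rn n) M]
  [TopologicalSpace E] [ChartedSpace (ModelProd (Rn n) (Rn m)) E]
  {π : E → M}

namespace AdaptedChart

/-- The change of coordinates from the chart `c'` to the chart `c`. -/
def trans (c c' : AdaptedChart n m π) (z : Rn n × Rn m) : Rn n × Rn m := c.total (c'.total.symm z)

/-- The part of the image of the chart `c'` where the chart `c` is defined as well. -/
def overlap (c c' : AdaptedChart n m π) : Set (Rn n × Rn m) :=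
  c'.total.target ∩ c'.total.symm ⁻¹' c.total.source

theorem isOpen_overlap (c c' : AdaptedChart n m π) : IsOpen (overlap c c') :=
  c'.total.isOpen_inter_preimage_symm c.total.open_source

variable {c c' : AdaptedChart n m π} {e : E} {z : Rn n × Rn m}

theorem mem_overlap (he : e ∈ c.total.source) (he' : e ∈ c'.total.source) :
    c'.total e ∈ overlap c c' :=
  ⟨mem_target he', by rwa [Set.mem_preimage, c'.total.left_inv he']⟩

theorem trans_apply (he' : e ∈ c'.total.source) : trans c c' (c'.total e) = c.total e := by
  rw [trans, c'.total.left_inv he']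

theorem trans_mem_overlap (hz : z ∈ overlap c c') : trans c c' z ∈ overlap c' c := by
  refine mem_overlap ?_ hz.2
  exact c'.total.map_target hz.1

theorem contDiffAt_trans (hz : z ∈ overlap c c') : ContDiffAt ℝ ∞ (trans c c') z := by
  rw [← contMDiffAt_iff_contDiffAt]
  exact ContMDiffAt.comp (I' := IT n m) z (g := c.total) (f := c'.total.symm)
    (c.contMDiffAt_total hz.2) (c'.contMDiffAt_total_symm hz.1)

theorem smoothNear_trans (hz : z ∈ overlap c c') : SmoothNear (trans c c') z := by
  filter_upwards [(isOpen_overlap c c').mem_nhds hz] with ζ hζ using contDiffAt_trans hζ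

theorem fderiv_trans (he : e ∈ c.total.source) (he' : e ∈ c'.total.source)
    (v : Rn n × Rn m) : fderiv ℝ (trans c c') (c'.total e) v = c.dT e (c'.dTs e v) := by
  have h0 : MDifferentiableAt (IT n m) 𝓘(ℝ, Rn n × Rn m) c.total
      (c'.total.symm (c'.total e)) := by
    rw [c'.total.left_inv he']
    exact (c.contMDiffAt_total he).mdifferentiableAt (by simp)
  have h1 : mfderiv 𝓘(ℝ, Rn n × Rn m) 𝓘(ℝ, Rn n × Rn m) (c.total ∘ c'.total.symm) (c'.total e) = _ :=
    mfderiv_comp (c'.total e) h0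
      ((c'.contMDiffAt_total_symm (mem_target he')).mdifferentiableAt (by simp))
  rw [mfderiv_eq_fderiv, c'.total.left_inv he'] at h1
  exact congrArg (fun B : Rn n × Rn m →L[ℝ] Rn n × Rn m => B v) h1

/-- Only the first component of the differential of a coordinate change depends on the base. -/
theorem fst_dT_dTs (he : e ∈ c.total.source) (he' : e ∈ c'.total.source)
    (v : Rn n × Rn m) : (c.dT e (c'.dTs e v)).1 = c.dB (π e) (c'.dBs (π e) v.1) := by
  have h := fst_dT he' (c'.dTs e v)
  rw [dT_dTs he'] at h
  rw [fst_dT he, h, dBs_dB (c'.map_source e he')]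

/-- The transformation rule for the coefficients of connections. -/
def transCoef (c c' : AdaptedChart n m π) (V : Rn n × Rn m → (Rn n →L[ℝ] Rn m))
    (z : Rn n × Rn m) : Rn n →L[ℝ] Rn m :=
  (((ContinuousLinearMap.snd ℝ (Rn n) (Rn m)).comp (fderiv ℝ (trans c' c) (trans c c' z))).comp
    ((ContinuousLinearMap.id ℝ (Rn n)).prod (V (trans c c' z)))).comp
    ((ContinuousLinearMap.fst ℝ (Rn n) (Rn m)).comp
      ((fderiv ℝ (trans c c') z).comp (ContinuousLinearMap.inl ℝ (Rn n) (Rn m))))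

/-- The lift of tangent vectors at `e`, as a map of model spaces. -/
def liftAt (L : ∀ e : E, TangentSpace (IB n) (π e) →L[ℝ] TangentSpace (IT n m) e) (e : E) :
    Rn n →L[ℝ] Rn n × Rn m := L e

theorem coef_apply (L : ∀ e : E, TangentSpace (IB n) (π e) →L[ℝ] TangentSpace (IT n m) e)
    (he : e ∈ c.total.source) (a : Rn n) :
    c.coef L (c.total e) a = (c.dT e (liftAt L e (c.dBs (π e) a))).2 := by
  rw [coef]
  simp only [dT, dBs]
  rw [c.total.left_inv he]
  rfl

theorem lift_eq {L : ∀ e : E, TangentSpace (IB n) (π e) →L[ℝ] TangentSpace (IT n m) e}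
    (hL : ∀ w, dproj π e (liftAt L e w) = w)
    (he : e ∈ c.total.source) (w : Rn n) : c.dT e (liftAt L e w) =
      (c.dB (π e) w, c.coef L (c.total e) (c.dB (π e) w)) := by
  rw [coef_apply L he, dBs_dB (c.map_source e he)]
  refine Prod.ext ?_ rfl
  exact (fst_dT he _).trans (congrArg (c.dB (π e)) (hL w))

theorem coef_eq_transCoef
    {L : ∀ e : E, TangentSpace (IB n) (π e) →L[ℝ] TangentSpace (IT n m) e}
    (hL : ∀ w, dproj π e (liftAt L e w) = w)
    (he : e ∈ c.total.source) (he' : e ∈ c'.total.source) :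
    c'.coef L (c'.total e) = transCoef c c' (c.coef L) (c'.total e) := by
  refine ContinuousLinearMap.ext fun a => ?_
  rw [coef_apply L he', ← dTs_dT he (liftAt L e _), lift_eq hL he,
    ← fderiv_trans he' he]
  simp only [transCoef, ContinuousLinearMap.comp_apply, trans_apply he',
    ContinuousLinearMap.inl_apply, fderiv_trans he he', ContinuousLinearMap.coe_fst',
    ContinuousLinearMap.coe_snd', ContinuousLinearMap.prod_apply, fst_dT_dTs he he',
    ContinuousLinearMap.id_apply]

theorem contDiffAt_transCoef_family {P : Type*} [NormedAddCommGroup P] [NormedSpace ℝ P]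
    {V : P → Rn n × Rn m → (Rn n →L[ℝ] Rn m)} {p : P × (Rn n × Rn m)}
    (hz : p.2 ∈ overlap c c')
    (hV : ContDiffAt ℝ ∞ (Function.uncurry V) (p.1, trans c c' p.2)) :
    ContDiffAt ℝ ∞ (fun p : P × (Rn n × Rn m) => transCoef c c' (V p.1) p.2) p := by
  have h1 : ContDiffAt ℝ ∞ (fun p : P × (Rn n × Rn m) => trans c c' p.2) p :=
    (contDiffAt_trans hz).comp p contDiffAt_snd
  have h2 : ContDiffAt ℝ ∞ (fun p : P × (Rn n × Rn m) =>
      fderiv ℝ (trans c' c) (trans c c' p.2)) p :=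
    ContDiffAt.comp p (contDiffAt_fderiv (contDiffAt_trans (trans_mem_overlap hz))) h1
  have h3 : ContDiffAt ℝ ∞ (fun p : P × (Rn n × Rn m) => fderiv ℝ (trans c c') p.2) p :=
    (contDiffAt_fderiv (contDiffAt_trans hz)).comp p contDiffAt_snd
  have h4 : ContDiffAt ℝ ∞ (fun p : P × (Rn n × Rn m) => V p.1 (trans c c' p.2)) p :=
    ContDiffAt.comp p (f := fun p : P × (Rn n × Rn m) => (p.1, trans c c' p.2)) hV
      (contDiffAt_fst.prodMk h1)
  exact ((contDiffAt_const.clm_comp h2).clm_comp (contDiffAt_const.clm_prod h4)).clm_comp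
    (contDiffAt_const.clm_comp (h3.clm_comp contDiffAt_const))

theorem contDiffAt_transCoef {V : Rn n × Rn m → (Rn n →L[ℝ] Rn m)} (hz : z ∈ overlap c c')
    (hV : ContDiffAt ℝ ∞ V (trans c c' z)) : ContDiffAt ℝ ∞ (transCoef c c' V) z :=
  ContDiffAt.comp z (f := fun z => ((0 : ℝ), z))
    (g := fun p : ℝ × (Rn n × Rn m) => transCoef c c' ((fun _ => V) p.1) p.2)
    (contDiffAt_transCoef_family (V := fun _ => V) hz (hV.comp (0, _) contDiffAt_snd))
    (contDiffAt_const.prodMk contDiffAt_id)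

/-- The jets of the transformed coefficients only depend on the jets of the coefficients. -/
theorem jet_transCoef_congr {k : ℕ} {V W : Rn n × Rn m → (Rn n →L[ℝ] Rn m)}
    (hz : z ∈ overlap c c') (hV : SmoothNear V (trans c c' z)) (hW : SmoothNear W (trans c c' z))
    (h : jet k V (trans c c' z) = jet k W (trans c c' z)) :
    jet k (transCoef c c' V) z = jet k (transCoef c c' W) z := by
  rw [← van_sub_iff (contDiffAt_transCoef hz hV.contDiffAt)
    (contDiffAt_transCoef hz hW.contDiffAt)]
  have h1 := (van_sub_iff hV.contDiffAt hW.contDiffAt).2 h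
  have hVW : SmoothNear (fun ζ => V ζ - W ζ) (trans c c' z) := by
    filter_upwards [hV, hW] with ζ h1 h2 using h1.sub h2
  have hs := smoothNear_trans hz
  have h2 : Van (k + 1) (fun ζ => V (trans c c' ζ) - W (trans c c' ζ)) z :=
    Van.comp_right hs (k + 1) h1 hVW
  have hD : SmoothNear (fun ζ => V (trans c c' ζ) - W (trans c c' ζ)) z := by
    filter_upwards [hs, hs.contDiffAt.continuousAt.eventually hVW] with ζ h1 h2
    exact ContDiffAt.comp ζ (g := fun ζ => V ζ - W ζ) h2 h1
  -- the difference of the transformed coefficients is bilinear in the difference and in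
  -- derivatives of the coordinate changes
  let F : Rn n × Rn m → (Rn m →L[ℝ] Rn m) := fun ζ =>
    ((ContinuousLinearMap.snd ℝ (Rn n) (Rn m)).comp (fderiv ℝ (trans c' c) (trans c c' ζ))).comp
      (ContinuousLinearMap.inr ℝ (Rn n) (Rn m))
  let H : Rn n × Rn m → (Rn n →L[ℝ] Rn n) := fun ζ => (ContinuousLinearMap.fst ℝ (Rn n) (Rn m)).comp
      ((fderiv ℝ (trans c c') ζ).comp (ContinuousLinearMap.inl ℝ (Rn n) (Rn m)))
  have hF : SmoothNear F z := by
    filter_upwards [(isOpen_overlap c c').mem_nhds hz] with ζ hζ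
    have h2 : ContDiffAt ℝ ∞ (fun ζ => fderiv ℝ (trans c' c) (trans c c' ζ)) ζ :=
      ContDiffAt.comp ζ (contDiffAt_fderiv (contDiffAt_trans (trans_mem_overlap hζ)))
        (contDiffAt_trans hζ)
    exact (contDiffAt_const.clm_comp h2).clm_comp contDiffAt_const
  have hH : SmoothNear H z := by
    filter_upwards [hs] with ζ hζ
    exact contDiffAt_const.clm_comp ((contDiffAt_fderiv hζ).clm_comp contDiffAt_const)
  have h3 := h2.bilin_right hD hF (ContinuousLinearMap.compL ℝ (Rn n) (Rn m) (Rn m))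
  have hFD : SmoothNear (fun ζ => (F ζ).comp (V (trans c c' ζ) - W (trans c c' ζ))) z := by
    filter_upwards [hF, hD] with ζ h1 h2 using h1.clm_comp h2
  have h4 := h3.bilin hFD hH (ContinuousLinearMap.compL ℝ (Rn n) (Rn n) (Rn m))
  refine h4.congr (Filter.Eventually.of_forall fun ζ => ?_)
  refine ContinuousLinearMap.ext fun a => ?_
  simp only [transCoef, ContinuousLinearMap.compL_apply, ContinuousLinearMap.comp_apply, F, H,
    sub_apply, ContinuousLinearMap.inr_apply, ContinuousLinearMap.prod_apply,
    ContinuousLinearMap.id_apply, ContinuousLinearMap.coe_snd']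
  rw [← Prod.snd_sub, ← map_sub]
  simp

/-- The transformation rule for jets of coefficients of connections. -/
def transJet (c c' : AdaptedChart n m π) (k : ℕ)
    (p : (Rn n × Rn m) × Jet k (Rn n × Rn m) (Rn n →L[ℝ] Rn m)) :
    Jet k (Rn n × Rn m) (Rn n →L[ℝ] Rn m) :=
  jet k (transCoef c c' (tay k (trans c c' p.1) p.2)) p.1

theorem contDiffAt_transJet {k : ℕ}
    {p : (Rn n × Rn m) × Jet k (Rn n × Rn m) (Rn n →L[ℝ] Rn m)} (hz : p.1 ∈ overlap c c') :
    ContDiffAt ℝ ∞ (transJet c c' k) p := by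
  refine ContDiffAt.jet_family (H := fun (p : (Rn n × Rn m) × Jet k (Rn n × Rn m)
    (Rn n →L[ℝ] Rn m)) => transCoef c c' (tay k (trans c c' p.1) p.2)) (g := Prod.fst) ?_
    contDiffAt_fst
  have h1 : ContDiffAt ℝ ∞ (fun q : ((Rn n × Rn m) × ((Rn n × Rn m) × Jet k (Rn n × Rn m)
      (Rn n →L[ℝ] Rn m))) × (Rn n × Rn m) =>
      transCoef c c' (tay k q.1.1 q.1.2.2) q.2) ((trans c c' p.1, p), p.1) := by
    refine contDiffAt_transCoef_family (V := fun q : (Rn n × Rn m) × ((Rn n × Rn m) ×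
      Jet k (Rn n × Rn m) (Rn n →L[ℝ] Rn m)) => tay k q.1 q.2.2) hz ?_
    exact ((contDiff_tay k).comp (f := fun q : ((Rn n × Rn m) × ((Rn n × Rn m) × Jet k
      (Rn n × Rn m) (Rn n →L[ℝ] Rn m))) × (Rn n × Rn m) => ((q.1.1, q.1.2.2), q.2))
      (((contDiff_fst.comp contDiff_fst).prodMk
        (contDiff_snd.comp (contDiff_snd.comp contDiff_fst))).prodMk contDiff_snd)).contDiffAt
  exact ContDiffAt.comp (p, p.1) (f := fun q : ((Rn n × Rn m) × Jet k (Rn n × Rn m)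
    (Rn n →L[ℝ] Rn m)) × (Rn n × Rn m) => ((trans c c' q.1.1, q.1), q.2)) h1
    (((ContDiffAt.comp (p, p.1) (contDiffAt_trans hz)
      (contDiffAt_fst.comp (p, p.1) contDiffAt_fst)).prodMk contDiffAt_fst).prodMk contDiffAt_snd)

theorem jet_transCoef {k : ℕ} {V : Rn n × Rn m → (Rn n →L[ℝ] Rn m)}
    (hz : z ∈ overlap c c') (hV : SmoothNear V (trans c c' z)) :
    jet k (transCoef c c' V) z = transJet c c' k (z, jet k V (trans c c' z)) :=
  jet_transCoef_congr hz hV ((contDiff_tay_apply k _ _).smoothNear _) (jet_tay hV.contDiffAt).symm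

/-- The flat connections given by submersions are preserved by changes of coordinates. -/
theorem subm_trans {Φ : Rn n × Rn m → Rn m} (hz : z ∈ overlap c c')
    (hΦ : Subm c.total.target Φ (trans c c' z)) :
    Subm c'.total.target (fun ζ => Φ (trans c c' ζ)) z ∧
      transCoef c c' (flatCoef Φ) z = flatCoef (fun ζ => Φ (trans c c' ζ)) z := by
  obtain ⟨e, he', rfl⟩ : ∃ e ∈ c'.total.source, c'.total e = z :=
    ⟨_, c'.total.map_target hz.1, c'.total.right_inv hz.1⟩
  have he : e ∈ c.total.source := by
    have := hz.2
    rwa [Set.mem_preimage, c'.total.left_inv he'] at this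
  have hd : ∀ v, fderiv ℝ (fun ζ => Φ (trans c c' ζ)) (c'.total e) v =
      fderiv ℝ Φ (trans c c' (c'.total e)) (c.dT e (c'.dTs e v)) := by
    intro v
    have := ((differentiableAt_of_smooth hΦ.2.1.contDiffAt).hasFDerivAt.comp (c'.total e)
      (differentiableAt_of_smooth (contDiffAt_trans hz)).hasFDerivAt).fderiv
    rw [← fderiv_trans he he']
    exact congrArg (fun B => B v) this
  have hu : IsUnit (vert (fun ζ => Φ (trans c c' ζ)) (c'.total e)) := by
    -- the differential of the coordinate change along the fiber is invertible
    let P : Rn m →L[ℝ] Rn m := (ContinuousLinearMap.snd ℝ (Rn n) (Rn m)).comp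
      (((c.dT e).comp (c'.dTs e)).comp (ContinuousLinearMap.inr ℝ (Rn n) (Rn m)))
    let Q : Rn m →L[ℝ] Rn m := (ContinuousLinearMap.snd ℝ (Rn n) (Rn m)).comp
      (((c'.dT e).comp (c.dTs e)).comp (ContinuousLinearMap.inr ℝ (Rn n) (Rn m)))
    have hP : ∀ y, c.dT e (c'.dTs e (0, y)) = (0, P y) := fun y => by
      refine Prod.ext ?_ rfl
      rw [fst_dT_dTs he he']
      simp
    have hQ : ∀ y, c'.dT e (c.dTs e (0, y)) = (0, Q y) := fun y => by
      refine Prod.ext ?_ rfl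
      rw [fst_dT_dTs he' he]
      simp
    have hPu : IsUnit P := by
      refine ⟨⟨P, Q, ?_, ?_⟩, rfl⟩ <;> refine ContinuousLinearMap.ext fun y => ?_
      · have : P (Q y) = (c.dT e (c'.dTs e (0, Q y))).2 := rfl
        rw [mul_apply_eq_comp, this, ← hQ, dTs_dT he', dT_dTs he]
        rfl
      · have : Q (P y) = (c'.dT e (c.dTs e (0, P y))).2 := rfl
        rw [mul_apply_eq_comp, this, ← hP, dTs_dT he, dT_dTs he']
        rfl
    have : vert (fun ζ => Φ (trans c c' ζ)) (c'.total e) =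
        vert Φ (trans c c' (c'.total e)) * P := by
      refine ContinuousLinearMap.ext fun y => ?_
      exact (hd (0, y)).trans (congrArg _ (hP y))
    rw [this]
    exact hΦ.2.2.mul hPu
  refine ⟨⟨hz.1, ?_, hu⟩, eq_flatCoef hu fun a => ?_⟩
  · filter_upwards [smoothNear_trans hz,
      (contDiffAt_trans hz).continuousAt.eventually hΦ.2.1] with ζ h1 h2
    exact ContDiffAt.comp ζ h2 h1
  · have h1 : c.dT e (c'.dTs e (a, transCoef c c' (flatCoef Φ) (c'.total e) a)) =
        (c.dB (π e) (c'.dBs (π e) a),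
          flatCoef Φ (trans c c' (c'.total e)) (c.dB (π e) (c'.dBs (π e) a))) := by
      set b := c.dB (π e) (c'.dBs (π e) a) with hb
      set u := flatCoef Φ (trans c c' (c'.total e)) b with hu
      have h2 : c'.dT e (c.dTs e (b, u)) =
          (a, transCoef c c' (flatCoef Φ) (c'.total e) a) := by
        refine Prod.ext ?_ ?_
        · rw [fst_dT_dTs he' he, hb, dBs_dB (c.map_source e he), dB_dBs (c'.map_source e he')]
        · simp only [transCoef, ContinuousLinearMap.comp_apply,
            ContinuousLinearMap.inl_apply, fderiv_trans he he', ContinuousLinearMap.coe_fst',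
            ContinuousLinearMap.coe_snd', ContinuousLinearMap.prod_apply, fst_dT_dTs he he',
            ContinuousLinearMap.id_apply]
          rw [← hb, ← hu, trans_apply he', fderiv_trans he' he]
      rw [← h2, dTs_dT he', dT_dTs he]
    rw [hd, h1]
    exact nab_flatCoef hΦ.2.2 _

end AdaptedChart

end Transition


/-! ### Points of the equation of flat connections -/

section Points

variable {n m : ℕ} {M E : Type*}
  [TopologicalSpace M] [ChartedSpace (Rn n) M]
  [TopologicalSpace E] [ChartedSpace (ModelProd (Rn n) (Rn m)) E]
  {π : E → M}

/-- The jets of the coefficients of a connection, in an adapted chart around the base point. -/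
def JetInf.coefJet (c : AdaptedChart n m π) (k : ℕ) (p : JetInf n m π) :
    Jet k (Rn n × Rn m) (Rn n →L[ℝ] Rn m) :=
  jet k (c.coef (Quotient.out p).lift) (c.total p.pt)

theorem JetInf.exists_eq_jet (p : JetInf n m π) :
    ∃ (A : LocalConnection n m π) (h : p.pt ∈ A.dom), p = A.jet p.pt h := by
  induction p using Quotient.inductionOn with
  | _ a => exact ⟨a.toLocalConnection, a.pt_mem, rfl⟩

/-- The jets of the coefficients may be computed with any representative of the jet. -/
theorem coefJet_jet {c : AdaptedChart n m π} {A : LocalConnection n m π} {θ : E} (h : θ ∈ A.dom)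
    (hc : θ ∈ c.total.source) (k : ℕ) :
    (A.jet θ h).coefJet c k = jet k (c.coef A.lift) (c.total θ) := by
  have h1 : Quotient.out (A.jet θ h) ≈ ({ A with pt := θ, pt_mem := h } : PointedConnection n m π) :=
    Quotient.exact (Quotient.out_eq _)
  have h2 : (Quotient.out (A.jet θ h)).pt = θ := h1.1
  funext j
  have := h1.2 c (by rw [h2]; exact hc) j
  rw [h2] at this
  exact this

theorem trunc_coefJet {c : AdaptedChart n m π} {k l : ℕ} (h : l ≤ k) (p : JetInf n m π) :
    Jet.trunc h (p.coefJet c k) = p.coefJet c l := rfl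

theorem JetInf.coefJet_eq_of_le {c : AdaptedChart n m π} {k l : ℕ} (h : l ≤ k)
    {p q : JetInf n m π} (hpq : p.coefJet c k = q.coefJet c k) : p.coefJet c l = q.coefJet c l := by
  rw [← trunc_coefJet h, ← trunc_coefJet h, hpq]

theorem LocalConnection.smoothNear_coef {c : AdaptedChart n m π} (A : LocalConnection n m π) {θ : E}
    (h : θ ∈ A.dom) (hc : θ ∈ c.total.source) : SmoothNear (c.coef A.lift) (c.total θ) := by
  have ho : IsOpen (c.total.target ∩ c.total.symm ⁻¹' A.dom) :=
    c.total.isOpen_inter_preimage_symm A.isOpen_dom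
  have hm : c.total θ ∈ c.total.target ∩ c.total.symm ⁻¹' A.dom :=
    ⟨c.total.map_source hc, by rwa [Set.mem_preimage, c.total.left_inv hc]⟩
  filter_upwards [ho.mem_nhds hm] with ζ hζ using (A.smooth c).contDiffAt (ho.mem_nhds hζ)

/-- In a chart, a point of the equation is the jet of a connection with infinitesimally vanishing
curvature. -/
theorem exists_coefJet_eq (p : Efc n m π) {c : AdaptedChart n m π} (hc : p.1.pt ∈ c.total.source) :
    ∃ V : Rn n × Rn m → (Rn n →L[ℝ] Rn m), SmoothNear V (c.total p.1.pt) ∧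
      (∀ k, p.1.coefJet c k = jet k V (c.total p.1.pt)) ∧
      ∀ K, Van K (curvature V) (c.total p.1.pt) := by
  obtain ⟨_, A, θ, h, rfl, hA⟩ := p
  exact ⟨c.coef A.lift, A.smoothNear_coef h hc, coefJet_jet h hc, fun K j _ => hA c hc j⟩

theorem transJet_coefJet {c c' : AdaptedChart n m π} {p : JetInf n m π}
    (hc : p.pt ∈ c.total.source) (hc' : p.pt ∈ c'.total.source) (k : ℕ) :
    p.coefJet c' k = AdaptedChart.transJet c c' k (c'.total p.pt, p.coefJet c k) := by
  obtain ⟨A, h, hp⟩ := p.exists_eq_jet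
  have hz := AdaptedChart.mem_overlap hc hc'
  have hs : SmoothNear (c.coef A.lift) (AdaptedChart.trans c c' (c'.total p.pt)) := by
    rw [AdaptedChart.trans_apply hc']
    exact A.smoothNear_coef h hc
  have h1 : c'.coef A.lift =ᶠ[𝓝 (c'.total p.pt)] AdaptedChart.transCoef c c' (c.coef A.lift) := by
    have ho : IsOpen (c'.total.target ∩ c'.total.symm ⁻¹' A.dom) :=
      c'.total.isOpen_inter_preimage_symm A.isOpen_dom
    have hm : c'.total p.pt ∈ c'.total.target ∩ c'.total.symm ⁻¹' A.dom :=
      ⟨c'.total.map_source hc', by rwa [Set.mem_preimage, c'.total.left_inv hc']⟩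
    filter_upwards [ho.mem_nhds hm, (AdaptedChart.isOpen_overlap c c').mem_nhds hz] with ζ h1 h2
    have := AdaptedChart.coef_eq_transCoef (c := c) (c' := c') (L := A.lift)
      (A.mfderiv_lift _ h1.2) h2.2 (c'.total.map_target h1.1)
    rwa [c'.total.right_inv h1.1] at this
  have h2 : p.coefJet c' k = jet k (c'.coef A.lift) (c'.total p.pt) :=
    (congrArg (JetInf.coefJet c' k) hp).trans (coefJet_jet h hc' k)
  have h3 : p.coefJet c k = jet k (c.coef A.lift) (c.total p.pt) :=
    (congrArg (JetInf.coefJet c k) hp).trans (coefJet_jet h hc k)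
  rw [h2, h3, jet_congr h1, AdaptedChart.jet_transCoef hz hs, AdaptedChart.trans_apply hc']

/-- The connection with coefficients `V` over the open subset `O` of the image of a chart. -/
def connOfCoef (c : AdaptedChart n m π) (V : Rn n × Rn m → (Rn n →L[ℝ] Rn m))
    (O : Set (Rn n × Rn m)) (hO : IsOpen O) (hV : ContDiffOn ℝ ∞ V O) : LocalConnection n m π where
  dom := c.total.source ∩ c.total ⁻¹' O
  isOpen_dom := c.total.isOpen_inter_preimage hO
  lift e := (c.dTs e).comp (((ContinuousLinearMap.id ℝ (Rn n)).prod (V (c.total e))).comp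
    (c.dB (π e)))
  mfderiv_lift := by
    rintro e ⟨he, _⟩ (w : Rn n)
    have h := AdaptedChart.fst_dT he (c.dTs e (c.dB (π e) w, V (c.total e) (c.dB (π e) w)))
    rw [AdaptedChart.dT_dTs he] at h
    have h2 := congrArg (c.dBs (π e)) h
    rw [AdaptedChart.dBs_dB (c.map_source e he) (AdaptedChart.dproj π e _)] at h2
    exact h2.symm.trans (AdaptedChart.dBs_dB (c.map_source e he) w)
  smooth := by
    intro c' z' hz'
    set L : ∀ e : E, Rn n →L[ℝ] Rn n × Rn m := fun e =>
      (c.dTs e).comp (((ContinuousLinearMap.id ℝ (Rn n)).prod (V (c.total e))).comp (c.dB (π e)))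
    have ho : IsOpen (c'.total.target ∩ c'.total.symm ⁻¹' (c.total.source ∩ c.total ⁻¹' O)) :=
      c'.total.isOpen_inter_preimage_symm (c.total.isOpen_inter_preimage hO)
    have h1 : c'.coef L =ᶠ[𝓝 z'] AdaptedChart.transCoef c c' V := by
      filter_upwards [ho.mem_nhds hz'] with z hz
      obtain ⟨e, he', rfl⟩ : ∃ e ∈ c'.total.source, c'.total e = z :=
        ⟨_, c'.total.map_target hz.1, c'.total.right_inv hz.1⟩
      have he : e ∈ c.total.source := by
        have := hz.2.1
        rwa [c'.total.left_inv he'] at this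
      refine ContinuousLinearMap.ext fun a => ?_
      rw [AdaptedChart.coef_apply (c := c') L he']
      show (c'.dT e (c.dTs e (c.dB (π e) (c'.dBs (π e) a),
        V (c.total e) (c.dB (π e) (c'.dBs (π e) a))))).2 = _
      simp only [AdaptedChart.transCoef, ContinuousLinearMap.comp_apply,
        AdaptedChart.trans_apply he',
        ContinuousLinearMap.inl_apply, AdaptedChart.fderiv_trans he he',
        AdaptedChart.fderiv_trans he' he, ContinuousLinearMap.coe_fst',
        ContinuousLinearMap.coe_snd', ContinuousLinearMap.prod_apply,
        AdaptedChart.fst_dT_dTs he he', ContinuousLinearMap.id_apply]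
    refine ContDiffAt.contDiffWithinAt (ContDiffAt.congr_of_eventuallyEq ?_ h1)
    exact AdaptedChart.contDiffAt_transCoef ⟨hz'.1, hz'.2.1⟩
      (hV.contDiffAt (hO.mem_nhds hz'.2.2))

theorem coef_connOfCoef {c : AdaptedChart n m π} {V : Rn n × Rn m → (Rn n →L[ℝ] Rn m)}
    {O : Set (Rn n × Rn m)} (hO : IsOpen O) (hV : ContDiffOn ℝ ∞ V O) {z : Rn n × Rn m}
    (hz : z ∈ c.total.target) : c.coef (connOfCoef c V O hO hV).lift z = V z := by
  obtain ⟨e, he, rfl⟩ : ∃ e ∈ c.total.source, c.total e = z :=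
    ⟨_, c.total.map_target hz, c.total.right_inv hz⟩
  refine ContinuousLinearMap.ext fun a => ?_
  rw [AdaptedChart.coef_apply _ he]
  show (c.dT e (c.dTs e (c.dB (π e) (c.dBs (π e) a),
    V (c.total e) (c.dB (π e) (c.dBs (π e) a))))).2 = _
  rw [AdaptedChart.dT_dTs he, AdaptedChart.dB_dBs (c.map_source e he)]

/-- The domain of the flat connection given by the submersion `Φ`. -/
def submSet (c : AdaptedChart n m π) (Φ : Rn n × Rn m → Rn m) : Set (Rn n × Rn m) :=
  {z | Subm c.total.target Φ z}

theorem isOpen_submSet (c : AdaptedChart n m π) (Φ : Rn n × Rn m → Rn m) :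
    IsOpen (submSet c Φ) :=
  isOpen_iff_mem_nhds.2 fun _ h => (openGood_subm c.total.open_target).nhds h

/-- The flat connection given by the submersion `Φ` in a chart. -/
def flatConn (c : AdaptedChart n m π) (Φ : Rn n × Rn m → Rn m) : LocalConnection n m π :=
  connOfCoef c (flatCoef Φ) (submSet c Φ) (isOpen_submSet c Φ) fun _ h =>
    (Subm.smoothNear_flatCoef c.total.open_target h).contDiffAt.contDiffWithinAt

variable {c : AdaptedChart n m π} {Φ : Rn n × Rn m → Rn m} {z : Rn n × Rn m}

theorem symm_mem_dom_flatConn (h : Subm c.total.target Φ z) :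
    c.total.symm z ∈ (flatConn c Φ).dom :=
  ⟨c.total.map_target h.1, by rwa [Set.mem_preimage, c.total.right_inv h.1]⟩

theorem coef_flatConn (h : Subm c.total.target Φ z) :
    c.coef (flatConn c Φ).lift =ᶠ[𝓝 z] flatCoef Φ := by
  filter_upwards [c.total.open_target.mem_nhds h.1] with ζ hζ using coef_connOfCoef _ _ hζ

/-- The connection `flatConn c Φ` is flat, in every adapted chart. -/
theorem jet_flatConn_mem {e : E} (h : e ∈ (flatConn c Φ).dom) :
    (flatConn c Φ).jet e h ∈ Efc n m π := by
  refine ⟨flatConn c Φ, e, h, rfl, fun c' hc' k => ?_⟩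
  have hz := AdaptedChart.mem_overlap h.1 hc'
  have key : curvature (c'.coef (flatConn c Φ).lift) =ᶠ[𝓝 (c'.total e)] fun _ => 0 := by
    have hs : ∀ᶠ z in 𝓝 (c'.total e), z ∈ AdaptedChart.overlap c c' ∧
        Subm c.total.target Φ (AdaptedChart.trans c c' z) := by
      refine ((AdaptedChart.isOpen_overlap c c').eventually_mem hz).and
        ((AdaptedChart.contDiffAt_trans hz).continuousAt.eventually ?_)
      rw [AdaptedChart.trans_apply hc']
      exact (openGood_subm c.total.open_target).nhds h.2
    have h1 : c'.coef (flatConn c Φ).lift =ᶠ[𝓝 (c'.total e)]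
        flatCoef (fun ζ => Φ (AdaptedChart.trans c c' ζ)) := by
      filter_upwards [hs] with z hz
      rw [← (AdaptedChart.subm_trans hz.1 hz.2).2]
      have he := c'.total.map_target hz.1.1
      have h2 := AdaptedChart.coef_eq_transCoef (c := c) (c' := c') (L := (flatConn c Φ).lift)
        ((flatConn c Φ).mfderiv_lift _ ⟨hz.1.2, hz.2⟩) hz.1.2 he
      rw [c'.total.right_inv hz.1.1] at h2
      rw [h2]
      have h3 := (coef_flatConn hz.2).eq_of_nhds
      simp only [AdaptedChart.transCoef, h3]
    filter_upwards [hs, h1.eventuallyEq_nhds] with z hz hz1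
    have h4 : curvature (c'.coef (flatConn c Φ).lift) z =
        curvature (flatCoef (fun ζ => Φ (AdaptedChart.trans c c' ζ))) z := by
      simp only [curvature, hz1.fderiv_eq, hz1.eq_of_nhds]
    rw [h4]
    exact curvature_flatCoef c'.total.open_target (AdaptedChart.subm_trans hz.1 hz.2).1
  rw [(key.iteratedFDeriv ℝ k).eq_of_nhds]
  simp

/-- The jet of `flatConn c Φ` over the point with coordinates `z`. -/
def flatPt (c : AdaptedChart n m π) (Φ : Rn n × Rn m → Rn m) (z : Rn n × Rn m)
    (h : Subm c.total.target Φ z) : Efc n m π :=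
  ⟨_, jet_flatConn_mem (symm_mem_dom_flatConn h)⟩

theorem pt_flatPt (h : Subm c.total.target Φ z) : (flatPt c Φ z h).1.pt = c.total.symm z := rfl

theorem coefJet_flatPt (h : Subm c.total.target Φ z) (k : ℕ) :
    (flatPt c Φ z h).1.coefJet c k = jet k (flatCoef Φ) z := by
  rw [flatPt, coefJet_jet (symm_mem_dom_flatConn h) (c.total.map_target h.1),
    c.total.right_inv h.1, jet_congr (coef_flatConn h)]

/-- Every point of the equation is approximated by jets of flat connections. -/
theorem exists_flatPt (p : Efc n m π) (hc : p.1.pt ∈ c.total.source) (K : ℕ) :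
    ∃ (Φ : Rn n × Rn m → Rn m) (h : Subm c.total.target Φ (c.total p.1.pt)),
      (flatPt c Φ _ h).1.coefJet c K = p.1.coefJet c K := by
  obtain ⟨V, hV, hj, hv⟩ := exists_coefJet_eq p hc
  refine ⟨leaf K (c.total p.1.pt) (jet (K + 1) V (c.total p.1.pt)),
    subm_leaf (c.total.map_source hc) K _, ?_⟩
  rw [coefJet_flatPt, hj, jet_flatCoef_leaf hV (hv _)]

end Points


/-! ### Functions of finite order on the equation -/

section Representations

variable {n m : ℕ} {M E : Type*}
  [TopologicalSpace M] [ChartedSpace (Rn n) M]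
  [TopologicalSpace E] [ChartedSpace (ModelProd (Rn n) (Rn m)) E]
  {π : E → M}

/-- Over the part `O` of a chart, `f` is the smooth function `G` of the coordinates and of the
`k`-jets of the coefficients. -/
def IsRepOn (c : AdaptedChart n m π) (O : Set (Rn n × Rn m)) (k : ℕ)
    (G : (Rn n × Rn m) × Jet k (Rn n × Rn m) (Rn n →L[ℝ] Rn m) → ℝ) (f : Efc n m π → ℝ) : Prop :=
  ContDiffOn ℝ ∞ G (O ×ˢ Set.univ) ∧ ∀ p : Efc n m π, p.1.pt ∈ c.total.source →
    c.total p.1.pt ∈ O → f p = G (c.total p.1.pt, p.1.coefJet c k)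

theorem isRepOn_of_isSmoothOfOrder {f : smoothJet n m π} {k : ℕ} {c : AdaptedChart n m π}
    {G : (Rn n × Rn m) × JetCoord n m k → ℝ}
    (hG : ContDiffOn ℝ ∞ G (c.total.target ×ˢ Set.univ))
    (h : ∀ (A : LocalConnection n m π) (θ : E) (h : θ ∈ A.dom), θ ∈ c.total.source →
      f.1 (A.jet θ h) =
        G (c.total θ, fun j => iteratedFDeriv ℝ (j : ℕ) (c.coef A.lift) (c.total θ))) :
    IsRepOn c c.total.target k G (res f).1 := by
  refine ⟨hG, fun p hp _ => ?_⟩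
  obtain ⟨_, hpm⟩ := p
  obtain ⟨A, θ, hθ, rfl, _⟩ := id hpm
  refine (h A θ hθ hp).trans (congrArg G (Prod.ext rfl ?_))
  exact (coefJet_jet hθ hp k).symm

theorem exists_rep (f : smoothFc n m π) (c : AdaptedChart n m π) :
    ∃ k G, IsRepOn c c.total.target k G f.1 := by
  obtain ⟨_, f, ⟨k, hf⟩, rfl⟩ := f
  obtain ⟨G, hG, h⟩ := hf c
  exact ⟨k, G, isRepOn_of_isSmoothOfOrder (f := ⟨f, k, hf⟩) hG h⟩

/-- `f` is of order `k` near `e`. -/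
def OrdAt (k : ℕ) (f : Efc n m π → ℝ) (e : E) : Prop :=
  ∃ c : AdaptedChart n m π, e ∈ c.total.source ∧ ∃ O, IsOpen O ∧ c.total e ∈ O ∧
    ∃ G, IsRepOn c O k G f

variable {f g : Efc n m π → ℝ} {k l : ℕ} {e : E} {c : AdaptedChart n m π}

theorem IsRepOn.mono {O : Set (Rn n × Rn m)}
    {G : (Rn n × Rn m) × Jet k (Rn n × Rn m) (Rn n →L[ℝ] Rn m) → ℝ} (h : IsRepOn c O k G f)
    (hkl : k ≤ l) : IsRepOn c O l (fun p => G (p.1, Jet.trunc hkl p.2)) f := by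
  refine ⟨h.1.comp (ContDiff.contDiffOn ?_) fun p hp => ⟨hp.1, trivial⟩, fun p hp hO => h.2 p hp hO⟩
  exact contDiff_fst.prodMk ((Jet.trunc (Z := Rn n × Rn m) (T := Rn n →L[ℝ] Rn m)
    hkl).contDiff.comp contDiff_snd)

theorem IsRepOn.subset {O O' : Set (Rn n × Rn m)}
    {G : (Rn n × Rn m) × Jet k (Rn n × Rn m) (Rn n →L[ℝ] Rn m) → ℝ} (h : IsRepOn c O k G f)
    (hO : O' ⊆ O) : IsRepOn c O' k G f :=
  ⟨h.1.mono (Set.prod_mono_left hO), fun p hp hp' => h.2 p hp (hO hp')⟩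

theorem OrdAt.mono (h : OrdAt k f e) (hkl : k ≤ l) : OrdAt l f e := by
  obtain ⟨c, hc, O, hO, he, G, hG⟩ := h
  exact ⟨c, hc, O, hO, he, _, hG.mono hkl⟩

/-- The order does not depend on the chart. -/
theorem OrdAt.chart (h : OrdAt k f e) (hc : e ∈ c.total.source) :
    ∃ O, IsOpen O ∧ c.total e ∈ O ∧ O ⊆ c.total.target ∧ ∃ G, IsRepOn c O k G f := by
  obtain ⟨c', hc', O, hO, he, G, hG⟩ := h
  have hs : ContinuousOn (AdaptedChart.trans c' c) (AdaptedChart.overlap c' c) := fun z hz =>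
    (AdaptedChart.contDiffAt_trans hz).continuousAt.continuousWithinAt
  refine ⟨AdaptedChart.overlap c' c ∩ AdaptedChart.trans c' c ⁻¹' O,
    hs.isOpen_inter_preimage (AdaptedChart.isOpen_overlap c' c) hO,
    ⟨AdaptedChart.mem_overlap hc' hc, by rwa [Set.mem_preimage, AdaptedChart.trans_apply hc]⟩,
    fun z hz => hz.1.1,
    fun p => G (AdaptedChart.trans c' c p.1,
      AdaptedChart.transJet c c' k (AdaptedChart.trans c' c p.1, p.2)), ?_, ?_⟩
  · rintro ⟨z, w⟩ ⟨⟨hz, hzO⟩, _⟩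
    have h1 : ContDiffAt ℝ ∞ (fun p : (Rn n × Rn m) × Jet k (Rn n × Rn m) (Rn n →L[ℝ] Rn m) =>
        AdaptedChart.trans c' c p.1) (z, w) :=
      (AdaptedChart.contDiffAt_trans hz).comp (z, w) contDiffAt_fst
    refine ContDiffAt.contDiffWithinAt (ContDiffAt.comp (z, w)
      (f := fun p : (Rn n × Rn m) × Jet k (Rn n × Rn m) (Rn n →L[ℝ] Rn m) =>
      (AdaptedChart.trans c' c p.1, AdaptedChart.transJet c c' k (AdaptedChart.trans c' c p.1, p.2)))
      (hG.1.contDiffAt ((hO.prod isOpen_univ).mem_nhds ⟨hzO, trivial⟩)) (h1.prodMk ?_))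
    exact ContDiffAt.comp (z, w) (AdaptedChart.contDiffAt_transJet (c := c) (c' := c')
      (p := (AdaptedChart.trans c' c z, w)) (AdaptedChart.trans_mem_overlap hz))
      (h1.prodMk contDiffAt_snd)
  · rintro p hp ⟨hp1, hp2⟩
    have hp' : p.1.pt ∈ c'.total.source := by
      have := hp1.2
      rwa [Set.mem_preimage, c.total.left_inv hp] at this
    rw [Set.mem_preimage, AdaptedChart.trans_apply hp] at hp2
    simp only []
    rw [hG.2 p hp' hp2, AdaptedChart.trans_apply hp, transJet_coefJet hp hp']

theorem OrdAt.congr {N : Set E} (h : OrdAt k f e) (hN : N ∈ 𝓝 e)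
    (hfg : ∀ p : Efc n m π, p.1.pt ∈ N → g p = f p) : OrdAt k g e := by
  obtain ⟨c, hc, O, hO, he, G, hG⟩ := h
  obtain ⟨N', hN', ho, heN⟩ := mem_nhds_iff.1 hN
  refine ⟨c, hc, O ∩ (c.total.target ∩ c.total.symm ⁻¹' N'),
    hO.inter (c.total.isOpen_inter_preimage_symm ho),
    ⟨he, c.total.map_source hc, by rwa [Set.mem_preimage, c.total.left_inv hc]⟩, G,
    hG.1.mono (Set.prod_mono_left Set.inter_subset_left), fun p hp hpO => ?_⟩
  rw [hfg p (hN' ?_), hG.2 p hp hpO.1]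
  have := hpO.2.2
  rwa [Set.mem_preimage, c.total.left_inv hp] at this

theorem ordAt_const (hc : e ∈ c.total.source) (r : ℝ) :
    OrdAt k (fun _ : Efc n m π => r) e :=
  ⟨c, hc, Set.univ, isOpen_univ, trivial, fun _ => r, contDiffOn_const, fun _ _ _ => rfl⟩

theorem OrdAt.add (hf : OrdAt k f e) (hg : OrdAt k g e) : OrdAt k (fun p => f p + g p) e := by
  obtain ⟨c, hc, O, hO, he, G, hG⟩ := hf
  obtain ⟨O', hO', he', -, G', hG'⟩ := hg.chart hc
  refine ⟨c, hc, O ∩ O', hO.inter hO', ⟨he, he'⟩, fun p => G p + G' p,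
    (hG.subset Set.inter_subset_left).1.add (hG'.subset Set.inter_subset_right).1, fun p hp h => ?_⟩
  simp only [hG.2 p hp h.1, hG'.2 p hp h.2]

theorem OrdAt.mul (hf : OrdAt k f e) (hg : OrdAt k g e) : OrdAt k (fun p => f p * g p) e := by
  obtain ⟨c, hc, O, hO, he, G, hG⟩ := hf
  obtain ⟨O', hO', he', -, G', hG'⟩ := hg.chart hc
  refine ⟨c, hc, O ∩ O', hO.inter hO', ⟨he, he'⟩, fun p => G p * G' p,
    (hG.subset Set.inter_subset_left).1.mul (hG'.subset Set.inter_subset_right).1, fun p hp h => ?_⟩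
  simp only [hG.2 p hp h.1, hG'.2 p hp h.2]

theorem OrdAt.sum {ι : Type*} (s : Finset ι) {f : ι → Efc n m π → ℝ} (hc : e ∈ c.total.source)
    (hf : ∀ i ∈ s, OrdAt k (f i) e) : OrdAt k (fun p => ∑ i ∈ s, f i p) e := by
  classical
  induction s using Finset.induction_on with
  | empty => simpa using ordAt_const hc 0
  | insert i s hi ih =>
    simp only [Finset.sum_insert hi]
    exact (hf i (Finset.mem_insert_self i s)).add
      (ih fun j hj => hf j (Finset.mem_insert_of_mem hj))

theorem exists_ordAt (hch : ∀ e : E, ∃ c : AdaptedChart n m π, e ∈ c.total.source)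
    (f : smoothFc n m π) : ∃ k, ∀ e, OrdAt k f.1 e := by
  obtain ⟨_, f, ⟨k, hf⟩, rfl⟩ := f
  refine ⟨k, fun e => ?_⟩
  obtain ⟨c, hc⟩ := hch e
  obtain ⟨G, hG, h⟩ := hf c
  exact ⟨c, hc, c.total.target, c.total.open_target, c.total.map_source hc, G,
    isRepOn_of_isSmoothOfOrder (f := ⟨f, k, hf⟩) hG h⟩

/-- A function on the equation which is locally smooth, of uniformly bounded order, is the
restriction of a smooth function on the jet space. -/
theorem mem_smoothFc [IsManifold (IT n m) ∞ E] [T2Space E] [SecondCountableTopology E]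
    (h : ∀ e, OrdAt k f e) : f ∈ smoothFc n m π := by
  have : LocallyCompactSpace E := Manifold.locallyCompact_of_finiteDimensional (IT n m)
  choose c hc O hO he G hG using h
  let U : E → Set E := fun e => (c e).total.source ∩ (c e).total ⁻¹' O e
  have hU : ∀ e, IsOpen (U e) := fun e => (c e).total.isOpen_inter_preimage (hO e)
  obtain ⟨ρ, hρ⟩ := SmoothPartitionOfUnity.exists_isSubordinate (IT n m) (s := Set.univ)
    isClosed_univ U hU fun e _ => Set.mem_iUnion.2 ⟨e, hc e, he e⟩
  have hρU : ∀ e θ, ρ e θ ≠ 0 → θ ∈ U e := fun e θ h => hρ e (subset_closure h)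
  refine ⟨fun q => ∑ᶠ e, ρ e q.pt * G e ((c e).total q.pt, q.coefJet (c e) k), ⟨k, fun c' => ?_⟩, ?_⟩
  · refine ⟨fun p => ∑ᶠ e, ρ e (c'.total.symm p.1) * G e (AdaptedChart.trans (c e) c' p.1,
      AdaptedChart.transJet c' (c e) k (AdaptedChart.trans (c e) c' p.1, p.2)), ?_, ?_⟩
    · rintro ⟨z, w⟩ ⟨hz, _⟩
      refine ContDiffAt.contDiffWithinAt ?_
      obtain ⟨s, hs⟩ := ρ.toPartitionOfUnity.exists_finset_nhds (c'.total.symm z)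
      have hcont : ContinuousAt (fun p : (Rn n × Rn m) × JetCoord n m k => c'.total.symm p.1)
          (z, w) := ContinuousAt.comp (f := Prod.fst) (g := c'.total.symm)
            (c'.total.continuousAt_symm hz) continuousAt_fst
      have h1 : (fun p : (Rn n × Rn m) × JetCoord n m k => ∑ᶠ e, ρ e (c'.total.symm p.1) *
          G e (AdaptedChart.trans (c e) c' p.1,
          AdaptedChart.transJet c' (c e) k (AdaptedChart.trans (c e) c' p.1, p.2))) =ᶠ[𝓝 (z, w)]
          fun p => ∑ e ∈ s, ρ e (c'.total.symm p.1) * G e (AdaptedChart.trans (c e) c' p.1,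
          AdaptedChart.transJet c' (c e) k (AdaptedChart.trans (c e) c' p.1, p.2)) := by
        filter_upwards [hcont.eventually hs] with p hp
        refine finsum_eq_sum_of_support_subset _ fun i hi => hp.2 ?_
        exact left_ne_zero_of_mul hi
      refine ContDiffAt.congr_of_eventuallyEq (ContDiffAt.sum fun i _ => ?_) h1
      by_cases hi : c'.total.symm z ∈ tsupport (ρ i)
      · have hzU := hρ i hi
        have hzo : z ∈ AdaptedChart.overlap (c i) c' := ⟨hz, hzU.1⟩
        have h2 : ContDiffAt ℝ ∞ (fun p : (Rn n × Rn m) × JetCoord n m k =>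
            AdaptedChart.trans (c i) c' p.1) (z, w) :=
          ContDiffAt.comp (z, w) (g := AdaptedChart.trans (c i) c')
            (AdaptedChart.contDiffAt_trans hzo) contDiffAt_fst
        refine ContDiffAt.mul ?_ ?_
        · have h3 : ContDiffAt ℝ ∞ (fun z => ρ i (c'.total.symm z)) z := by
            rw [← contMDiffAt_iff_contDiffAt]
            exact (ρ i).contMDiff.contMDiffAt.comp z (c'.contMDiffAt_total_symm hz)
          have h4 : ContDiffAt ℝ ∞ ((fun z => ρ i (c'.total.symm z)) ∘ Prod.fst)
              ((z, w) : (Rn n × Rn m) × JetCoord n m k) := h3.comp (z, w) contDiffAt_fst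
          exact h4
        · refine ContDiffAt.comp (z, w) (g := G i) ((hG i).1.contDiffAt
            (((hO i).prod isOpen_univ).mem_nhds ⟨hzU.2, trivial⟩)) (h2.prodMk ?_)
          exact ContDiffAt.comp (z, w) (AdaptedChart.contDiffAt_transJet (c := c') (c' := c i)
            (p := (AdaptedChart.trans (c i) c' z, w)) (AdaptedChart.trans_mem_overlap hzo))
            (h2.prodMk contDiffAt_snd)
      · refine contDiffAt_const (c := (0 : ℝ)).congr_of_eventuallyEq ?_
        filter_upwards [hcont.eventually ((isClosed_tsupport _).isOpen_compl.mem_nhds hi)]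
          with p hp
        rw [image_eq_zero_of_notMem_tsupport hp, zero_mul]
    · intro A θ hθ hc'
      refine finsum_congr fun e => ?_
      show ρ e θ * _ = ρ e (c'.total.symm (c'.total θ)) * _
      rw [c'.total.left_inv hc']
      by_cases h0 : ρ e θ = 0
      · rw [h0, zero_mul, zero_mul]
      · have hce := (hρU e θ h0).1
        congr 2
        show ((c e).total θ, (A.jet θ hθ).coefJet (c e) k) = _
        rw [AdaptedChart.trans_apply hc', transJet_coefJet (c := c') (p := A.jet θ hθ) hc' hce,
          coefJet_jet hθ hc']
        rfl
  · funext p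
    show ∑ᶠ e, ρ e p.1.pt * G e ((c e).total p.1.pt, p.1.coefJet (c e) k) = f p
    have h1 : ∀ e, ρ e p.1.pt * G e ((c e).total p.1.pt, p.1.coefJet (c e) k) =
        ρ e p.1.pt • f p := by
      intro e
      by_cases h0 : ρ e p.1.pt = 0
      · rw [h0, zero_mul, zero_smul]
      · rw [(hG e).2 p (hρU e _ h0).1 (hρU e _ h0).2, smul_eq_mul]
    rw [finsum_congr h1, ← finsum_smul, ρ.sum_eq_one (Set.mem_univ _), one_smul]

end Representations


/-! ### Total derivatives on the equation -/

section JetDerivative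

variable {Z T R : Type*} [NormedAddCommGroup Z] [NormedSpace ℝ Z] [NormedAddCommGroup T]
  [NormedSpace ℝ T] [NormedAddCommGroup R] [NormedSpace ℝ R] {k : ℕ}

/-- The total derivative of a function of finite jets. -/
def tder (G : Z × Jet k Z T → R) (p : Z × Jet (k + 1) Z T) : Z →L[ℝ] R :=
  (fderiv ℝ G (p.1, Jet.trunc (Nat.le_succ k) p.2)).comp
    ((ContinuousLinearMap.id ℝ Z).prod (Jet.shift (k := k) (Z := Z) (T := T) p.2))

theorem fderiv_comp_jet {G : Z × Jet k Z T → R} {V : Z → T} {z : Z} (hV : ContDiffAt ℝ ∞ V z)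
    (hG : ContDiffAt ℝ ∞ G (z, jet k V z)) :
    fderiv ℝ (fun ζ => G (ζ, jet k V ζ)) z = tder G (z, jet (k + 1) V z) := by
  have h2 : HasFDerivAt (fun ζ => (ζ, jet k V ζ)) ((ContinuousLinearMap.id ℝ Z).prod
      (Jet.shift (k := k) (Z := Z) (T := T) (jet (k + 1) V z))) z := by
    refine (hasFDerivAt_id z).prodMk ?_
    rw [← fderiv_jet hV]
    exact (differentiableAt_of_smooth (contDiffAt_jet hV)).hasFDerivAt
  exact ((differentiableAt_of_smooth hG).hasFDerivAt.comp z h2).fderiv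

theorem contDiffOn_tder {O : Set Z} (hO : IsOpen O) {G : Z × Jet k Z T → R}
    (hG : ContDiffOn ℝ ∞ G (O ×ˢ Set.univ)) : ContDiffOn ℝ ∞ (tder G) (O ×ˢ Set.univ) := by
  rintro ⟨z, w⟩ ⟨hz, _⟩
  refine ContDiffAt.contDiffWithinAt ?_
  have h0 : ContDiffAt ℝ ∞ G (z, Jet.trunc (Nat.le_succ k) w) :=
    hG.contDiffAt ((hO.prod isOpen_univ).mem_nhds ⟨hz, trivial⟩)
  have h1 : ContDiffAt ℝ ∞ (fun p : Z × Jet (k + 1) Z T =>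
      fderiv ℝ G (p.1, Jet.trunc (Nat.le_succ k) p.2)) (z, w) :=
    ContDiffAt.comp _ (f := fun p : Z × Jet (k + 1) Z T =>
      (p.1, Jet.trunc (Nat.le_succ k) p.2)) (contDiffAt_fderiv h0)
      (contDiffAt_fst.prodMk (contDiffAt_clm_snd (Jet.trunc (Z := Z) (T := T) (Nat.le_succ k)) _))
  refine h1.clm_comp ?_
  have h2 : ContDiffAt ℝ ∞ (fun p : Z × Jet (k + 1) Z T =>
      Jet.shift (k := k) (Z := Z) (T := T) p.2) (z, w) :=
    contDiffAt_clm_snd (Q := Z) (R := Jet (k + 1) Z T) (S := Z →L[ℝ] Jet k Z T) Jet.shift _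
  exact contDiffAt_const.clm_prod h2

end JetDerivative

section TotalDerivative

variable {n m : ℕ} {M E : Type*}
  [TopologicalSpace M] [ChartedSpace (Rn n) M]
  [TopologicalSpace E] [ChartedSpace (ModelProd (Rn n) (Rn m)) E]
  {π : E → M}

variable {c : AdaptedChart n m π}

/-- The order of the chosen representative of `f` in the chart `c`. -/
def repOrd (c : AdaptedChart n m π) (f : smoothFc n m π) : ℕ := (exists_rep f c).choose

/-- The chosen representative of `f` in the chart `c`. -/
def rep (c : AdaptedChart n m π) (f : smoothFc n m π) :
    (Rn n × Rn m) × Jet (repOrd c f) (Rn n × Rn m) (Rn n →L[ℝ] Rn m) → ℝ :=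
  (exists_rep f c).choose_spec.choose

theorem isRepOn_rep (c : AdaptedChart n m π) (f : smoothFc n m π) :
    IsRepOn c c.total.target (repOrd c f) (rep c f) f.1 :=
  (exists_rep f c).choose_spec.choose_spec

/-- The function `f` along the connection with coefficients `V`. -/
def along (c : AdaptedChart n m π) (f : smoothFc n m π) (V : Rn n × Rn m → (Rn n →L[ℝ] Rn m))
    (z : Rn n × Rn m) : ℝ := rep c f (z, jet (repOrd c f) V z)

/-- The function `f` along the flat connection given by the submersion `Φ`. -/
def ev (c : AdaptedChart n m π) (Φ : Rn n × Rn m → Rn m) (f : smoothFc n m π)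
    (z : Rn n × Rn m) : ℝ := along c f (flatCoef Φ) z

/-- The differential of `f` along the Cartan plane at `p`, in the chart `c`. -/
def cd (c : AdaptedChart n m π) (p : Efc n m π) (f : smoothFc n m π) : Rn n × Rn m →L[ℝ] ℝ :=
  tder (rep c f) (c.total p.1.pt, p.1.coefJet c (repOrd c f + 1))

variable {Φ : Rn n × Rn m → Rn m} {z : Rn n × Rn m} {p q : Efc n m π}

theorem IsRepOn.contDiffAt {O : Set (Rn n × Rn m)} {k : ℕ} {f : Efc n m π → ℝ}
    {G : (Rn n × Rn m) × Jet k (Rn n × Rn m) (Rn n →L[ℝ] Rn m) → ℝ} (h : IsRepOn c O k G f)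
    (hO : IsOpen O) (hz : z ∈ O) (w : Jet k (Rn n × Rn m) (Rn n →L[ℝ] Rn m)) :
    ContDiffAt ℝ ∞ G (z, w) :=
  h.1.contDiffAt ((hO.prod isOpen_univ).mem_nhds ⟨hz, trivial⟩)

theorem IsRepOn.apply_flatPt {O : Set (Rn n × Rn m)} {k : ℕ} {f : Efc n m π → ℝ}
    {G : (Rn n × Rn m) × Jet k (Rn n × Rn m) (Rn n →L[ℝ] Rn m) → ℝ} (h : IsRepOn c O k G f)
    (hΦ : Subm c.total.target Φ z) (hz : z ∈ O) :
    f (flatPt c Φ z hΦ) = G (z, jet k (flatCoef Φ) z) := by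
  have h1 := h.2 (flatPt c Φ z hΦ) (c.total.map_target hΦ.1)
    (by rw [pt_flatPt, c.total.right_inv hΦ.1]; exact hz)
  rw [h1, coefJet_flatPt, pt_flatPt, c.total.right_inv hΦ.1]

theorem ev_eq (f : smoothFc n m π) (h : Subm c.total.target Φ z) :
    ev c Φ f z = f.1 (flatPt c Φ z h) :=
  ((isRepOn_rep c f).apply_flatPt h h.1).symm

theorem contDiffAt_along (f : smoothFc n m π) {V : Rn n × Rn m → (Rn n →L[ℝ] Rn m)}
    (hz : z ∈ c.total.target) (hV : ContDiffAt ℝ ∞ V z) : ContDiffAt ℝ ∞ (along c f V) z :=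
  ContDiffAt.comp z (g := rep c f) (f := fun z => (z, jet (repOrd c f) V z))
    ((isRepOn_rep c f).contDiffAt c.total.open_target hz _)
    (contDiffAt_id.prodMk (contDiffAt_jet hV))

theorem contDiffAt_ev (f : smoothFc n m π) (h : Subm c.total.target Φ z) :
    ContDiffAt ℝ ∞ (ev c Φ f) z :=
  contDiffAt_along f h.1 (h.smoothNear_flatCoef c.total.open_target).contDiffAt

theorem eventually_subm (h : Subm c.total.target Φ z) :
    ∀ᶠ ζ in 𝓝 z, Subm c.total.target Φ ζ := (openGood_subm c.total.open_target).nhds h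

/-- The differential along the Cartan plane at the jet of a flat connection. -/
theorem cd_flatPt (f : smoothFc n m π) (h : Subm c.total.target Φ z) :
    cd c (flatPt c Φ z h) f = fderiv ℝ (ev c Φ f) z := by
  rw [cd, coefJet_flatPt, pt_flatPt, c.total.right_inv h.1]
  exact (fderiv_comp_jet (h.smoothNear_flatCoef c.total.open_target).contDiffAt
    ((isRepOn_rep c f).contDiffAt c.total.open_target h.1 _)).symm

/-- Two points with the same coordinates and the same jets of order `k`. -/
def SameJet (c : AdaptedChart n m π) (k : ℕ) (p q : Efc n m π) : Prop :=
  p.1.pt = q.1.pt ∧ p.1.coefJet c k = q.1.coefJet c k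

theorem exists_sameJet (p : Efc n m π) (hc : p.1.pt ∈ c.total.source) (K : ℕ) :
    ∃ (Φ : Rn n × Rn m → Rn m) (h : Subm c.total.target Φ (c.total p.1.pt)),
      SameJet c K p (flatPt c Φ _ h) := by
  obtain ⟨Φ, h, hj⟩ := exists_flatPt p hc K
  exact ⟨Φ, h, (c.total.left_inv hc).symm, hj.symm⟩

theorem SameJet.rep_eq {O : Set (Rn n × Rn m)} {k K : ℕ} {f : Efc n m π → ℝ}
    {G : (Rn n × Rn m) × Jet k (Rn n × Rn m) (Rn n →L[ℝ] Rn m) → ℝ} (h : IsRepOn c O k G f)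
    (hpq : SameJet c K p q) (hk : k ≤ K) (hc : p.1.pt ∈ c.total.source)
    (hO : c.total p.1.pt ∈ O) : f p = f q := by
  rw [h.2 p hc hO, h.2 q (by rw [← hpq.1]; exact hc) (by rw [← hpq.1]; exact hO), hpq.1,
    JetInf.coefJet_eq_of_le hk hpq.2]

theorem SameJet.apply_eq {f : smoothFc n m π} {K : ℕ} (hpq : SameJet c K p q)
    (hk : repOrd c f ≤ K) (hc : p.1.pt ∈ c.total.source) : f.1 p = f.1 q :=
  hpq.rep_eq (isRepOn_rep c f) hk hc (c.total.map_source hc)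

theorem SameJet.cd_eq {f : smoothFc n m π} {K : ℕ} (hpq : SameJet c K p q)
    (hk : repOrd c f + 1 ≤ K) : cd c p f = cd c q f := by
  rw [cd, cd, hpq.1, JetInf.coefJet_eq_of_le hk hpq.2]

/-- The differential along the Cartan plane may be computed with any representative. -/
theorem cd_eq_tder {O : Set (Rn n × Rn m)} {k : ℕ} {f : smoothFc n m π}
    {G : (Rn n × Rn m) × Jet k (Rn n × Rn m) (Rn n →L[ℝ] Rn m) → ℝ} (h : IsRepOn c O k G f.1)
    (hO : IsOpen O) (hc : p.1.pt ∈ c.total.source) (hp : c.total p.1.pt ∈ O) :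
    cd c p f = tder G (c.total p.1.pt, p.1.coefJet c (k + 1)) := by
  obtain ⟨Φ, hΦ, hj⟩ := exists_sameJet p hc (max (repOrd c f) k + 1)
  rw [hj.cd_eq (f := f) (by omega), cd_flatPt, JetInf.coefJet_eq_of_le (by omega) hj.2,
    coefJet_flatPt,
    ← fderiv_comp_jet (hΦ.smoothNear_flatCoef c.total.open_target).contDiffAt
      (h.contDiffAt hO hp _)]
  refine Filter.EventuallyEq.fderiv_eq ?_
  filter_upwards [eventually_subm hΦ, hO.mem_nhds hp] with ζ hζ hζO
  rw [ev_eq f hζ, h.apply_flatPt hζ hζO]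

/-- Finitely many identities between values and differentials may be checked at jets of flat
connections. -/
theorem exists_flatPt_agree (p : Efc n m π) (hc : p.1.pt ∈ c.total.source)
    (s : Finset (smoothFc n m π)) :
    ∃ Φ : Rn n × Rn m → Rn m, Subm c.total.target Φ (c.total p.1.pt) ∧
      ∀ f ∈ s, f.1 p = ev c Φ f (c.total p.1.pt) ∧
        cd c p f = fderiv ℝ (ev c Φ f) (c.total p.1.pt) := by
  obtain ⟨Φ, h, hj⟩ := exists_sameJet p hc (s.sup (repOrd c) + 1)
  refine ⟨Φ, h, fun f hf => ?_⟩
  have hle := Finset.le_sup (f := repOrd c) hf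
  rw [← cd_flatPt f h, ev_eq f h]
  exact ⟨hj.apply_eq (by omega) hc, hj.cd_eq (by omega)⟩

theorem ev_add (f g : smoothFc n m π) (h : Subm c.total.target Φ z) :
    ev c Φ (f + g) z = ev c Φ f z + ev c Φ g z := by
  rw [ev_eq _ h, ev_eq _ h, ev_eq _ h]; rfl

theorem ev_sub (f g : smoothFc n m π) (h : Subm c.total.target Φ z) :
    ev c Φ (f - g) z = ev c Φ f z - ev c Φ g z := by
  rw [ev_eq _ h, ev_eq _ h, ev_eq _ h]; rfl

theorem ev_mul (f g : smoothFc n m π) (h : Subm c.total.target Φ z) :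
    ev c Φ (f * g) z = ev c Φ f z * ev c Φ g z := by
  rw [ev_eq _ h, ev_eq _ h, ev_eq _ h]; rfl

theorem ev_smul (r : ℝ) (f : smoothFc n m π) (h : Subm c.total.target Φ z) :
    ev c Φ (r • f) z = r * ev c Φ f z := by
  rw [ev_eq _ h, ev_eq _ h]; rfl

theorem cd_add (f g : smoothFc n m π) (hc : p.1.pt ∈ c.total.source) :
    cd c p (f + g) = cd c p f + cd c p g := by
  classical
  obtain ⟨Φ, h, H⟩ := exists_flatPt_agree p hc {f, g, f + g}
  rw [(H f (by simp)).2, (H g (by simp)).2, (H (f + g) (by simp)).2]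
  have h1 : ev c Φ (f + g) =ᶠ[𝓝 (c.total p.1.pt)] fun ζ => ev c Φ f ζ + ev c Φ g ζ := by
    filter_upwards [eventually_subm h] with ζ hζ using ev_add f g hζ
  rw [h1.fderiv_eq]
  exact fderiv_fun_add (differentiableAt_of_smooth (contDiffAt_ev f h))
    (differentiableAt_of_smooth (contDiffAt_ev g h))

theorem cd_mul (f g : smoothFc n m π) (hc : p.1.pt ∈ c.total.source) :
    cd c p (f * g) = f.1 p • cd c p g + g.1 p • cd c p f := by
  classical
  obtain ⟨Φ, h, H⟩ := exists_flatPt_agree p hc {f, g, f * g}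
  rw [(H f (by simp)).2, (H g (by simp)).2, (H (f * g) (by simp)).2, (H f (by simp)).1,
    (H g (by simp)).1]
  have h1 : ev c Φ (f * g) =ᶠ[𝓝 (c.total p.1.pt)] fun ζ => ev c Φ f ζ * ev c Φ g ζ := by
    filter_upwards [eventually_subm h] with ζ hζ using ev_mul f g hζ
  rw [h1.fderiv_eq]
  exact fderiv_fun_mul (differentiableAt_of_smooth (contDiffAt_ev f h))
    (differentiableAt_of_smooth (contDiffAt_ev g h))

theorem cd_smul (r : ℝ) (f : smoothFc n m π) (hc : p.1.pt ∈ c.total.source) :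
    cd c p (r • f) = r • cd c p f := by
  classical
  obtain ⟨Φ, h, H⟩ := exists_flatPt_agree p hc {f, r • f}
  rw [(H f (by simp)).2, (H (r • f) (by simp)).2]
  have h1 : ev c Φ (r • f) =ᶠ[𝓝 (c.total p.1.pt)] fun ζ => r * ev c Φ f ζ := by
    filter_upwards [eventually_subm h] with ζ hζ using ev_smul r f hζ
  rw [h1.fderiv_eq]
  exact fderiv_const_mul (differentiableAt_of_smooth (contDiffAt_ev f h)) r

/-- `cartanDiff` in a chart. -/
theorem cartanDiff_eq_cd {A : LocalConnection n m π} {θ : E} (h : θ ∈ A.dom)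
    (hp : A.jet θ h ∈ Efc n m π) (hc : θ ∈ c.total.source) (f : smoothJet n m π)
    (v : TangentSpace (IT n m) θ) :
    A.cartanDiff f θ v = cd c ⟨A.jet θ h, hp⟩ (res f) (c.dT θ v) := by
  obtain ⟨k, hf⟩ := f.2
  obtain ⟨G, hG, hfG⟩ := hf c
  have hr := isRepOn_of_isSmoothOfOrder hG hfG
  have hA := A.smoothNear_coef h hc
  have hz := c.total.map_source hc
  have hGz := hr.contDiffAt c.total.open_target hz (jet k (c.coef A.lift) (c.total θ))
  rw [cd_eq_tder (p := ⟨A.jet θ h, hp⟩) hr c.total.open_target hc hz,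
    coefJet_jet (c := c) h hc (k + 1)]
  show _ = tder G (c.total θ, jet (k + 1) (c.coef A.lift) (c.total θ)) (c.dT θ v)
  rw [← fderiv_comp_jet hA.contDiffAt hGz, LocalConnection.cartanDiff]
  have h1 : A.pullFun f =ᶠ[𝓝 θ]
      (fun ζ => G (ζ, jet k (c.coef A.lift) ζ)) ∘ c.total := by
    filter_upwards [A.isOpen_dom.mem_nhds h, c.total.open_source.mem_nhds hc] with e he hce
    rw [LocalConnection.pullFun, dif_pos he]
    exact hfG A e he hce
  have hd : ContDiffAt ℝ ∞ (fun ζ => G (ζ, jet k (c.coef A.lift) ζ)) (c.total θ) :=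
    ContDiffAt.comp (c.total θ) (g := G) (f := fun z => (z, jet k (c.coef A.lift) z))
      hGz (contDiffAt_id.prodMk (contDiffAt_jet hA.contDiffAt))
  have h2 : mfderiv (IT n m) 𝓘(ℝ, ℝ) ((fun ζ => G (ζ, jet k (c.coef A.lift) ζ)) ∘ c.total) θ = _ :=
    mfderiv_comp θ (hd.contMDiffAt.mdifferentiableAt (by simp))
      ((c.contMDiffAt_total hc).mdifferentiableAt (by simp))
  rw [h1.mfderiv_eq, h2, mfderiv_eq_fderiv]
  rfl

end TotalDerivative


/-! ### Derivations of smooth functions on the base -/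

section Hadamard

variable {X : Type*} [NormedAddCommGroup X] [NormedSpace ℝ X]

theorem contDiff_segment_integral {R : Type*} [NormedAddCommGroup R] [NormedSpace ℝ R]
    [CompleteSpace R] {f : X → R} (hf : ContDiff ℝ ∞ f) (x₀ : X) :
    ContDiff ℝ ∞ fun x => ∫ t in (0 : ℝ)..1, f (x₀ + t • (x - x₀)) := by
  -- the integral is the value at `0` of a convolution with the indicator function of `[0, 1]`
  let χ : ContDiffBump (0 : ℝ) := ⟨2, 3, by norm_num, by norm_num⟩
  let F : ℝ → ℝ := Set.indicator (Set.Ioc 0 1) 1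
  let g : X → ℝ → R := fun x s => χ s • f (x₀ + (-s) • (x - x₀))
  have hg : ContDiffOn ℝ ∞ (Function.uncurry g) (Set.univ ×ˢ Set.univ) := by
    refine ContDiff.contDiffOn ((χ.contDiff.comp contDiff_snd).smul (hf.comp ?_))
    exact contDiff_const.add (contDiff_snd.neg.smul (contDiff_fst.sub contDiff_const))
  have hF : MeasureTheory.LocallyIntegrable F := by
    have : MeasureTheory.Integrable F :=
      (MeasureTheory.integrable_indicator_iff measurableSet_Ioc).2
        (MeasureTheory.integrableOn_const (by simp))
    exact this.locallyIntegrable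
  have h := MeasureTheory.contDiffOn_convolution_right_with_param (n := (⊤ : ℕ∞)) (μ := MeasureTheory.volume)
    (ContinuousLinearMap.lsmul ℝ ℝ) (s := Set.univ) (k := Metric.closedBall (0 : ℝ) 3) (g := g)
    (f := F) isOpen_univ (isCompact_closedBall _ _) (fun x s _ hs => by
      have : χ s = 0 := χ.zero_of_le_dist (by
        simp only [Metric.mem_closedBall, not_le] at hs
        exact hs.le)
      simp only [g, this, zero_smul]) hF hg
  rw [Set.univ_prod_univ, contDiffOn_univ] at h
  have h2 := h.comp (contDiff_id.prodMk (contDiff_const (c := (0 : ℝ))))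
  convert h2 using 1
  funext x
  symm
  simp only [Function.comp, MeasureTheory.convolution, id]
  rw [intervalIntegral.integral_of_le zero_le_one, ← MeasureTheory.integral_indicator
    measurableSet_Ioc]
  refine MeasureTheory.integral_congr_ae (Filter.Eventually.of_forall fun t => ?_)
  by_cases ht : t ∈ Set.Ioc (0 : ℝ) 1
  · have : χ (0 - t) = 1 := χ.one_of_mem_closedBall (by
      simp only [Metric.mem_closedBall, Real.dist_eq, zero_sub, sub_zero, abs_neg]
      rw [abs_of_pos ht.1]
      exact ht.2.trans (by norm_num))
    simp only [F, Set.indicator_of_mem ht, g, this]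
    simp
  · simp only [F, Set.indicator_of_notMem ht]
    simp

/-- Hadamard's lemma. -/
theorem exists_hadamard {f : X → ℝ} (hf : ContDiff ℝ ∞ f) (x₀ : X) :
    ∃ h : X → (X →L[ℝ] ℝ), ContDiff ℝ ∞ h ∧ h x₀ = fderiv ℝ f x₀ ∧
      ∀ x, f x = f x₀ + h x (x - x₀) := by
  have hf' : ContDiff ℝ ∞ (fderiv ℝ f) := hf.fderiv_right (by exact_mod_cast le_top)
  refine ⟨fun x => ∫ t in (0 : ℝ)..1, fderiv ℝ f (x₀ + t • (x - x₀)),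
    contDiff_segment_integral hf' x₀, ?_, fun x => ?_⟩
  · simp
  · have hc : Continuous fun t : ℝ => fderiv ℝ f (x₀ + t • (x - x₀)) :=
      hf'.continuous.comp (continuous_const.add (continuous_id.smul continuous_const))
    rw [ContinuousLinearMap.intervalIntegral_apply (hc.intervalIntegrable _ _)]
    have h1 : ∀ t ∈ Set.uIcc (0 : ℝ) 1, HasDerivAt (fun t : ℝ => f (x₀ + t • (x - x₀)))
        (fderiv ℝ f (x₀ + t • (x - x₀)) (x - x₀)) t := fun t _ => by
      have h2 : HasDerivAt (fun t : ℝ => x₀ + t • (x - x₀)) (x - x₀) t := by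
        simpa using ((hasDerivAt_id t).smul_const (x - x₀)).const_add x₀
      exact (hf.differentiable (by simp) _).hasFDerivAt.comp_hasDerivAt t h2
    rw [intervalIntegral.integral_eq_sub_of_hasDerivAt h1
      ((hc.clm_apply continuous_const).intervalIntegrable _ _)]
    simp

end Hadamard

section Extension

variable {V H B : Type*} [NormedAddCommGroup V] [NormedSpace ℝ V] [FiniteDimensional ℝ V]
  [TopologicalSpace H] (I : ModelWithCorners ℝ V H) [TopologicalSpace B] [ChartedSpace H B]
  [IsManifold I ∞ B] [T2Space B] [SecondCountableTopology B]

/-- Bump functions. -/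
theorem exists_bump {x : B} {N : Set B} (hN : N ∈ 𝓝 x) :
    ∃ χ : C^∞⟮I, B; 𝓘(ℝ, ℝ), ℝ⟯, χ =ᶠ[𝓝 x] 1 ∧ tsupport χ ⊆ N := by
  have : LocallyCompactSpace B := Manifold.locallyCompact_of_finiteDimensional I
  have : NormalSpace B := inferInstance
  obtain ⟨C, hC, hCc, hCN⟩ := exists_mem_nhds_isClosed_subset hN
  obtain ⟨χ, h1, h0, -⟩ := exists_contMDiffMap_one_nhds_of_subset_interior I (n := (⊤ : ℕ∞))
    (isClosed_singleton (x := x)) (t := C) (by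
      rw [Set.singleton_subset_iff]; exact mem_interior_iff_mem_nhds.2 hC)
  refine ⟨χ, ?_, (closure_minimal (fun y hy => ?_) hCc).trans hCN⟩
  · rwa [nhdsSet_singleton] at h1
  · by_contra h
    exact hy (h0 y h)

/-- Extension of germs of smooth functions. -/
theorem exists_smooth_ext {x : B} {u : B → ℝ} (hu : ∀ᶠ y in 𝓝 x, ContMDiffAt I 𝓘(ℝ, ℝ) ∞ u y) :
    ∃ g : C^∞⟮I, B; 𝓘(ℝ, ℝ), ℝ⟯, g =ᶠ[𝓝 x] u := by
  obtain ⟨χ, h1, h0⟩ := exists_bump I hu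
  have hs : ContMDiff I 𝓘(ℝ, ℝ) ∞ fun y => χ y • u y :=
    contMDiff_of_tsupport fun y hy =>
      χ.contMDiff.contMDiffAt.smul (h0 (closure_mono (fun z hz => left_ne_zero_of_mul hz) hy))
  refine ⟨⟨_, hs⟩, ?_⟩
  filter_upwards [h1] with y hy
  simp [hy]

variable {I}

/-- A derivation of smooth functions at a point only depends on germs. -/
theorem derivation_congr {x : B} (D : C^∞⟮I, B; 𝓘(ℝ, ℝ), ℝ⟯ →ₗ[ℝ] ℝ)
    (hD : ∀ f g, D (f * g) = f x * D g + g x * D f) {f g : C^∞⟮I, B; 𝓘(ℝ, ℝ), ℝ⟯}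
    (h : f =ᶠ[𝓝 x] g) : D f = D g := by
  rw [← sub_eq_zero, ← map_sub]
  obtain ⟨χ, h1, h0⟩ := exists_bump I h
  have h2 : χ * (f - g) = 0 := by
    ext y
    by_cases hy : y ∈ tsupport χ
    · have : f y = g y := h0 hy
      simp [this]
    · simp [image_eq_zero_of_notMem_tsupport hy]
  have h3 := hD χ (f - g)
  have h4 : χ x = 1 := h1.eq_of_nhds
  have h5 : (f - g) x = 0 := by simp [h.eq_of_nhds]
  rw [h2, map_zero, h4, h5] at h3
  linarith

/-- A derivation of smooth functions at a point of a manifold is a tangent vector. -/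
theorem exists_tangent_vector {n : ℕ} {B : Type*} [TopologicalSpace B] [ChartedSpace (Rn n) B]
    [IsManifold (IB n) ∞ B] [T2Space B] [SecondCountableTopology B] {x : B}
    (D : C^∞⟮IB n, B; 𝓘(ℝ, ℝ), ℝ⟯ →ₗ[ℝ] ℝ) (hD : ∀ f g, D (f * g) = f x * D g + g x * D f)
    {ψ : OpenPartialHomeomorph B (Rn n)} (hψ : ψ ∈ IsManifold.maximalAtlas (IB n) ∞ B)
    (hx : x ∈ ψ.source) :
    ∃ a : Rn n, ∀ g, D g = fderiv ℝ (fun y => g (ψ.symm y)) (ψ x) a := by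
  have hsrc := ψ.open_source.mem_nhds hx
  have hcoord : ∀ v : Rn n → ℝ, ContDiff ℝ ∞ v →
      ∃ b : C^∞⟮IB n, B; 𝓘(ℝ, ℝ), ℝ⟯, b =ᶠ[𝓝 x] fun y => v (ψ y) := fun v hv => by
    refine exists_smooth_ext (IB n) ?_
    filter_upwards [hsrc] with y hy
    exact hv.contDiffAt.contMDiffAt.comp y (contMDiffAt_of_mem_maximalAtlas hψ hy)
  choose b hb using fun i : Fin n => hcoord (fun y => y i - ψ x i)
    ((contDiff_euclidean.1 contDiff_id i).sub contDiff_const)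
  refine ⟨WithLp.toLp 2 fun i => D (b i), fun g => ?_⟩
  -- a globally smooth function with the germ of `g` in the chart
  obtain ⟨f, hf⟩ := exists_smooth_ext 𝓘(ℝ, Rn n) (x := ψ x) (u := fun y => g (ψ.symm y)) (by
    filter_upwards [ψ.open_target.mem_nhds (ψ.map_source hx)] with y hy
    exact g.contMDiff.contMDiffAt.comp y (contMDiffAt_symm_of_mem_maximalAtlas hψ hy))
  obtain ⟨h, hh, hh0, hfh⟩ := exists_hadamard f.contMDiff.contDiff (ψ x)
  choose η hη using fun i : Fin n => hcoord (fun y => h y (ex i)) (hh.clm_apply contDiff_const)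
  have hc : Filter.Tendsto ψ (𝓝 x) (𝓝 (ψ x)) := ψ.continuousAt hx
  have hg : g =ᶠ[𝓝 x] (algebraMap ℝ _ (g x) + ∑ i, b i * η i : C^∞⟮IB n, B; 𝓘(ℝ, ℝ), ℝ⟯) := by
    have h1 : ∀ᶠ y in 𝓝 x, ∀ i, b i y = ψ y i - ψ x i := Filter.eventually_all.2 hb
    have h2 : ∀ᶠ y in 𝓝 x, ∀ i, η i y = h (ψ y) (ex i) := Filter.eventually_all.2 hη
    filter_upwards [h1, h2, hsrc, hc.eventually hf] with y h1 h2 hy hfy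
    have hs : (∑ i, b i * η i : C^∞⟮IB n, B; 𝓘(ℝ, ℝ), ℝ⟯) y = ∑ i, b i y * η i y := by
      have := congrFun (map_sum (ContMDiffMap.coeFnRingHom (I := IB n) (N := B) (n := ∞)
        (I' := 𝓘(ℝ, ℝ)) (R := ℝ)) (fun i => b i * η i) Finset.univ) y
      simpa using this
    have h3 : h (ψ y) (ψ y - ψ x) = ∑ i, b i y * η i y := by
      rw [← sum_ex (ψ y - ψ x), map_sum]
      refine Finset.sum_congr rfl fun i _ => ?_
      rw [map_smul, smul_eq_mul, h1, h2]
      rfl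
    have h4 : f (ψ x) = g x := by rw [hf.eq_of_nhds, ψ.left_inv hx]
    have h5 := hfh (ψ y)
    rw [hfy, ψ.left_inv hy, h4, h3] at h5
    rw [h5, ← hs]
    rfl
  have h1 : D (algebraMap ℝ _ (g x)) = 0 := by
    have e : ∀ r : ℝ, algebraMap ℝ C^∞⟮IB n, B; 𝓘(ℝ, ℝ), ℝ⟯ r = r • 1 :=
      fun r => Algebra.algebraMap_eq_smul_one r
    have : D 1 = 0 := by
      have := hD 1 1
      simp only [mul_one] at this
      have h1 : (1 : C^∞⟮IB n, B; 𝓘(ℝ, ℝ), ℝ⟯) x = 1 := rfl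
      rw [h1] at this
      linarith
    rw [e, map_smul, this, smul_zero]
  rw [derivation_congr D hD hg, map_add, h1, zero_add, map_sum, ← hf.fderiv_eq, ← hh0,
    ← sum_ex (WithLp.toLp 2 fun i => D (b i)), map_sum]
  refine Finset.sum_congr rfl fun i _ => ?_
  have h2 : b i x = 0 := by rw [(hb i).eq_of_nhds]; simp
  have h3 : η i x = h (ψ x) (ex i) := (hη i).eq_of_nhds
  rw [hD, h2, h3, zero_mul, zero_add, map_smul, smul_eq_mul, mul_comm]

end Extension


/-! ### Vector fields on the equation -/

set_option linter.unusedSectionVars false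

/-- The total space is covered by adapted charts. -/
class HasAdaptedCharts (n m : ℕ) {M E : Type*}
    [TopologicalSpace M] [ChartedSpace (Rn n) M]
    [TopologicalSpace E] [ChartedSpace (ModelProd (Rn n) (Rn m)) E] (π : E → M) : Prop where
  exists_chart : ∀ e : E, ∃ c : AdaptedChart n m π, e ∈ c.total.source

section VectorFields

variable {n m : ℕ} {M E : Type*}
  [TopologicalSpace M] [ChartedSpace (Rn n) M] [IsManifold (IB n) ∞ M]
  [T2Space M] [SecondCountableTopology M]
  [TopologicalSpace E] [ChartedSpace (ModelProd (Rn n) (Rn m)) E]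
  [IsManifold (IT n m) ∞ E] [T2Space E] [SecondCountableTopology E]
  {π : E → M}

/-- Smooth functions on the base, as functions on the equation. -/
def pM (g : C^∞⟮IB n, M; 𝓘(ℝ, ℝ), ℝ⟯) : smoothFc n m π := res (pullM g)

theorem pM_apply (g : C^∞⟮IB n, M; 𝓘(ℝ, ℝ), ℝ⟯) (p : Efc n m π) :
    (pM g : smoothFc n m π).1 p = g (π p.1.pt) := rfl

section Germs

variable [hch : HasAdaptedCharts n m π]

theorem ordAt_pullE (g : C^∞⟮IT n m, E; 𝓘(ℝ, ℝ), ℝ⟯) (k : ℕ) (e : E) :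
    OrdAt k (fun p : Efc n m π => g p.1.pt) e := by
  obtain ⟨c, hc⟩ := hch.exists_chart e
  refine ⟨c, hc, c.total.target, c.total.open_target, c.total.map_source hc,
    fun p => g (c.total.symm p.1), ?_, fun p hp _ => ?_⟩
  · rintro ⟨z, w⟩ ⟨hz, _⟩
    have h1 : ContDiffAt ℝ ∞ (fun z => g (c.total.symm z)) z := by
      rw [← contMDiffAt_iff_contDiffAt]
      exact g.contMDiff.contMDiffAt.comp z (c.contMDiffAt_total_symm hz)
    exact (ContDiffAt.comp (z, w) (g := fun z => g (c.total.symm z)) h1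
      contDiffAt_fst).contDiffWithinAt
  · exact congrArg g (c.total.left_inv hp).symm

/-- Smooth functions on the total space, as functions on the equation. -/
def pullE (g : C^∞⟮IT n m, E; 𝓘(ℝ, ℝ), ℝ⟯) : smoothFc n m π :=
  ⟨fun p => g p.1.pt, mem_smoothFc (ordAt_pullE g 0)⟩

theorem pullE_apply (g : C^∞⟮IT n m, E; 𝓘(ℝ, ℝ), ℝ⟯) (p : Efc n m π) :
    (pullE g : smoothFc n m π).1 p = g p.1.pt := rfl

theorem leibniz_apply (X : VF n m π) (f g : smoothFc n m π) (p : Efc n m π) :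
    (X (f * g)).1 p = f.1 p * (X g).1 p + g.1 p * (X f).1 p := by
  rw [X.leibniz]
  rfl

/-- Vector fields are local operators. -/
theorem VF.congr_nhds (X : VF n m π) {f g : smoothFc n m π} {p : Efc n m π} {N : Set E}
    (hN : N ∈ 𝓝 p.1.pt) (h : ∀ q : Efc n m π, q.1.pt ∈ N → f.1 q = g.1 q) :
    (X f).1 p = (X g).1 p := by
  obtain ⟨χ, h1, h0⟩ := exists_bump (IT n m) hN
  have h2 : pullE χ * (f - g) = 0 := by
    refine Subtype.ext (funext fun q => ?_)
    show χ q.1.pt * (f.1 q - g.1 q) = 0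
    by_cases hq : q.1.pt ∈ tsupport χ
    · rw [h q (h0 hq), sub_self, mul_zero]
    · rw [image_eq_zero_of_notMem_tsupport hq, zero_mul]
  have h3 := leibniz_apply X (pullE χ) (f - g) p
  have h4 : (f - g).1 p = 0 := sub_eq_zero.2 (h p (mem_of_mem_nhds hN))
  rw [h2, map_zero, h4, zero_mul, add_zero, pullE_apply, h1.eq_of_nhds, map_sub] at h3
  have h5 : (0 : ℝ) = 1 * ((X f).1 p - (X g).1 p) := h3
  linarith

end Germs

variable {c : AdaptedChart n m π} {p : Efc n m π}

/-- The differential along the Cartan plane of a function coming from the total space. -/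
theorem cd_of_base {f : smoothFc n m π} {u : Rn n × Rn m → ℝ} {N : Set (Rn n × Rn m)}
    (hc : p.1.pt ∈ c.total.source) (hN : N ∈ 𝓝 (c.total p.1.pt))
    (h : ∀ q : Efc n m π, q.1.pt ∈ c.total.source → c.total q.1.pt ∈ N →
      f.1 q = u (c.total q.1.pt)) : cd c p f = fderiv ℝ u (c.total p.1.pt) := by
  obtain ⟨Φ, hΦ, H⟩ := exists_flatPt_agree p hc {f}
  rw [(H f (by simp)).2]
  refine Filter.EventuallyEq.fderiv_eq ?_
  filter_upwards [eventually_subm hΦ, hN] with ζ hζ hζN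
  rw [ev_eq f hζ, h (flatPt c Φ ζ hζ) (c.total.map_target hζ.1)]
  · rw [pt_flatPt, c.total.right_inv hζ.1]
  · rw [pt_flatPt, c.total.right_inv hζ.1]
    exact hζN

theorem cd_pM (g : C^∞⟮IB n, M; 𝓘(ℝ, ℝ), ℝ⟯) (hc : p.1.pt ∈ c.total.source)
    (ν : Rn n × Rn m) : cd c p (pM g) ν =
      fderiv ℝ (fun x => g (c.base.symm x)) (c.base (π p.1.pt)) ν.1 := by
  have hb := c.map_source _ hc
  have h1 : cd c p (pM g) = _ := cd_of_base (u := fun z => g (c.base.symm z.1)) hc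
    Filter.univ_mem fun q hq _ => by
      rw [pM_apply, c.fst_total _ hq, c.base.left_inv (c.map_source _ hq)]
  have h2 : ContDiffAt ℝ ∞ (fun x => g (c.base.symm x)) (c.base (π p.1.pt)) := by
    rw [← contMDiffAt_iff_contDiffAt]
    exact g.contMDiff.contMDiffAt.comp _ (c.contMDiffAt_base_symm (c.base.map_source hb))
  have h3 : fderiv ℝ (fun z : Rn n × Rn m => g (c.base.symm z.1)) (c.total p.1.pt) = _ :=
    fderiv_comp (c.total p.1.pt) (g := fun x => g (c.base.symm x)) (f := Prod.fst)
      (by rw [c.fst_total _ hc]; exact differentiableAt_of_smooth h2) differentiableAt_fst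
  rw [h1, h3, fderiv_fst, c.fst_total _ hc]
  rfl

theorem Efc.exists_eq_jet (p : Efc n m π) : ∃ (A : LocalConnection n m π) (h : p.1.pt ∈ A.dom)
    (hp : A.jet p.1.pt h ∈ Efc n m π), p = ⟨A.jet p.1.pt h, hp⟩ := by
  obtain ⟨A, h, hA⟩ := p.1.exists_eq_jet
  exact ⟨A, h, hA ▸ p.2, Subtype.ext hA⟩

theorem exists_res (f : smoothFc n m π) : ∃ f' : smoothJet n m π, res f' = f := by
  obtain ⟨_, f, hf, rfl⟩ := f
  exact ⟨⟨f, hf⟩, rfl⟩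

theorem IsCartan.exists_vec {X : VF n m π} (hX : IsCartan X) (hc : p.1.pt ∈ c.total.source) :
    ∃ ν, ∀ f, (X f).1 p = cd c p f ν := by
  obtain ⟨A, h, hp, hpA⟩ := Efc.exists_eq_jet p
  obtain ⟨v, hv⟩ := hX A _ h hp
  refine ⟨c.dT p.1.pt v, fun f => ?_⟩
  obtain ⟨f, rfl⟩ := exists_res f
  have := hv f
  rw [cartanDiff_eq_cd h hp hc] at this
  rwa [← hpA] at this

theorem isCartan_of_exists_vec {X : VF n m π} (hX : ∀ p : Efc n m π, ∃ c : AdaptedChart n m π,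
    p.1.pt ∈ c.total.source ∧ ∃ ν, ∀ f, (X f).1 p = cd c p f ν) : IsCartan X := by
  intro A θ h hp
  obtain ⟨c, hc, ν, hν⟩ := hX ⟨A.jet θ h, hp⟩
  have hc' : θ ∈ c.total.source := hc
  refine ⟨c.dTs θ ν, fun f => ?_⟩
  have h1 := cartanDiff_eq_cd h hp hc' f (c.dTs θ ν)
  refine (hν (res f)).trans (Eq.trans ?_ h1.symm)
  exact congrArg (cd c ⟨A.jet θ h, hp⟩ (res f)) (AdaptedChart.dT_dTs hc' ν).symm

/-- The horizontal lift of `a`, in a chart. -/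
def hvec (c : AdaptedChart n m π) (p : Efc n m π) (a : Rn n) : Rn n × Rn m :=
  (a, Jet.val (k := 0) (Z := Rn n × Rn m) (T := Rn n →L[ℝ] Rn m) (p.1.coefJet c 0) a)

theorem dT_lift {A : LocalConnection n m π} {θ : E} (h : θ ∈ A.dom) (hp : A.jet θ h ∈ Efc n m π)
    (hc : θ ∈ c.total.source) (w : TangentSpace (IB n) (π θ)) :
    c.dT θ (A.lift θ w) = hvec c ⟨A.jet θ h, hp⟩ (c.dB (π θ) w) := by
  have h1 := AdaptedChart.lift_eq (L := A.lift) (A.mfderiv_lift θ h) hc w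
  refine h1.trans ?_
  rw [hvec]
  simp only []
  rw [coefJet_jet h hc, val_jet]

/-- `a` represents the restriction of `X` to functions on the base, in a chart. -/
def IsBaseVec (c : AdaptedChart n m π) (X : VF n m π) (p : Efc n m π) (a : Rn n) : Prop :=
  ∀ g : C^∞⟮IB n, M; 𝓘(ℝ, ℝ), ℝ⟯, (X (pM g)).1 p =
    fderiv ℝ (fun x => g (c.base.symm x)) (c.base (π p.1.pt)) a

/-- A vector field on the equation restricts to tangent vectors of the base. -/
theorem exists_baseVec [HasAdaptedCharts n m π] (X : VF n m π) (p : Efc n m π)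
    {ψ : OpenPartialHomeomorph M (Rn n)} (hψ : ψ ∈ IsManifold.maximalAtlas (IB n) ∞ M)
    (hp : π p.1.pt ∈ ψ.source) : ∃ a : Rn n, ∀ g : C^∞⟮IB n, M; 𝓘(ℝ, ℝ), ℝ⟯,
      (X (pM g)).1 p = fderiv ℝ (fun x => g (ψ.symm x)) (ψ (π p.1.pt)) a := by
  have hadd : ∀ f g : C^∞⟮IB n, M; 𝓘(ℝ, ℝ), ℝ⟯,
      (pM (f + g) : smoothFc n m π) = pM f + pM g := fun _ _ => rfl
  have hmul : ∀ f g : C^∞⟮IB n, M; 𝓘(ℝ, ℝ), ℝ⟯,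
      (pM (f * g) : smoothFc n m π) = pM f * pM g := fun _ _ => rfl
  have hsmul : ∀ (r : ℝ) (g : C^∞⟮IB n, M; 𝓘(ℝ, ℝ), ℝ⟯),
      (pM (r • g) : smoothFc n m π) = r • pM g := fun _ _ => rfl
  let D : C^∞⟮IB n, M; 𝓘(ℝ, ℝ), ℝ⟯ →ₗ[ℝ] ℝ :=
    { toFun := fun g => (X (pM g)).1 p
      map_add' := fun f g => by rw [hadd, map_add]; rfl
      map_smul' := fun r g => by rw [hsmul, Derivation.map_smul]; rfl }
  exact exists_tangent_vector D (x := π p.1.pt) (fun f g => by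
    show (X (pM (f * g))).1 p = _
    rw [hmul, leibniz_apply]
    rfl) hψ hp

theorem exists_isBaseVec [HasAdaptedCharts n m π] (X : VF n m π) (hc : p.1.pt ∈ c.total.source) :
    ∃ a, IsBaseVec c X p a :=
  exists_baseVec X p c.base_mem (c.map_source _ hc)

theorem mfderiv_eq_fderiv_base (g : C^∞⟮IB n, M; 𝓘(ℝ, ℝ), ℝ⟯) {x : M} (hx : x ∈ c.base.source)
    (w : Rn n) : (mfderiv (IB n) 𝓘(ℝ, ℝ) g x : Rn n →L[ℝ] ℝ) w =
      fderiv ℝ (fun y => g (c.base.symm y)) (c.base x) (c.dB x w) := by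
  have h2 : ContDiffAt ℝ ∞ (fun x => g (c.base.symm x)) (c.base x) := by
    rw [← contMDiffAt_iff_contDiffAt]
    exact g.contMDiff.contMDiffAt.comp _ (c.contMDiffAt_base_symm (c.base.map_source hx))
  have h1 : mfderiv (IB n) 𝓘(ℝ, ℝ) ((fun y => g (c.base.symm y)) ∘ c.base) x = _ :=
    mfderiv_comp x (h2.contMDiffAt.mdifferentiableAt (by simp))
      ((c.contMDiffAt_base hx).mdifferentiableAt (by simp))
  have h3 : (g : M → ℝ) =ᶠ[𝓝 x] (fun y => g (c.base.symm y)) ∘ c.base := by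
    filter_upwards [c.base.open_source.mem_nhds hx] with y hy
    exact congrArg g (c.base.left_inv hy).symm
  rw [h3.mfderiv_eq, h1, mfderiv_eq_fderiv]
  rfl

/-- The defining property of the form of the connection, in charts. -/
theorem IsFcForm.apply {U : VF n m π →ₗ[smoothFc n m π] VF n m π} (hU : IsFcForm U)
    {X : VF n m π} (hc : p.1.pt ∈ c.total.source) {a : Rn n} (ha : IsBaseVec c X p a)
    (f : smoothFc n m π) : (U X f).1 p = cd c p f (hvec c p a) := by
  obtain ⟨A, h, hp, hpA⟩ := Efc.exists_eq_jet p
  have hb := c.map_source _ hc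
  obtain ⟨f, rfl⟩ := exists_res f
  have h1 := hU X A _ h hp (c.dBs (π p.1.pt) a) (fun g => by
    rw [← hpA]
    refine (ha g).trans ?_
    have := mfderiv_eq_fderiv_base (c := c) g hb (c.dBs (π p.1.pt) a)
    rw [AdaptedChart.dB_dBs hb] at this
    exact this.symm) f
  have h2 := cartanDiff_eq_cd h hp hc f (A.lift p.1.pt (c.dBs (π p.1.pt) a))
  have h3 := dT_lift h hp hc (c.dBs (π p.1.pt) a)
  have h4 := h1.trans (h2.trans (congrArg (cd c _ (res f)) h3))
  rwa [AdaptedChart.dB_dBs hb, ← hpA] at h4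

end VectorFields


/-! ### Construction of Cartan vector fields -/

section Construction

set_option linter.unusedSectionVars false

variable {n m : ℕ} {M E : Type*}
  [TopologicalSpace M] [ChartedSpace (Rn n) M] [IsManifold (IB n) ∞ M]
  [T2Space M] [SecondCountableTopology M]
  [TopologicalSpace E] [ChartedSpace (ModelProd (Rn n) (Rn m)) E]
  [IsManifold (IT n m) ∞ E] [T2Space E] [SecondCountableTopology E]
  {π : E → M} [hch : HasAdaptedCharts n m π]

/-- The data of a field of Cartan vectors `ν`, depending on the `K`-jets, over the part `O` of a
chart, together with a cutoff function `χ`. -/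
structure CartanField (n m : ℕ) {M E : Type*}
    [TopologicalSpace M] [ChartedSpace (Rn n) M]
    [TopologicalSpace E] [ChartedSpace (ModelProd (Rn n) (Rn m)) E] (π : E → M) where
  /-- the chart -/
  c : AdaptedChart n m π
  /-- the domain in the chart -/
  O : Set (Rn n × Rn m)
  isOpen : IsOpen O
  /-- the cutoff function -/
  χ : C^∞⟮IT n m, E; 𝓘(ℝ, ℝ), ℝ⟯
  tsupport_subset : tsupport χ ⊆ c.total.source ∩ c.total ⁻¹' O
  /-- the order of the coefficients -/
  K : ℕ
  /-- the coefficients -/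
  ν : (Rn n × Rn m) × Jet K (Rn n × Rn m) (Rn n →L[ℝ] Rn m) → Rn n × Rn m
  smooth : ContDiffOn ℝ ∞ ν (O ×ˢ Set.univ)

namespace CartanField

variable (D : CartanField n m π)

theorem mem_source {p : Efc n m π} (h : D.χ p.1.pt ≠ 0) : p.1.pt ∈ D.c.total.source :=
  (D.tsupport_subset (subset_tsupport _ h)).1

/-- The derivative of a function along the field. -/
def der (f : smoothFc n m π) (p : Efc n m π) : ℝ :=
  D.χ p.1.pt * cd D.c p f (D.ν (D.c.total p.1.pt, p.1.coefJet D.c D.K))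

theorem ordAt_der {f : smoothFc n m π} {k : ℕ} {e : E} (hf : OrdAt k f.1 e) :
    OrdAt (max D.K (k + 1)) (D.der f) e := by
  by_cases he : e ∈ tsupport D.χ
  · obtain ⟨hc, hO⟩ := D.tsupport_subset he
    obtain ⟨O', hO', he', -, G, hG⟩ := hf.chart hc
    have h1 : OrdAt (max D.K (k + 1)) (fun p : Efc n m π => D.χ p.1.pt) e := ordAt_pullE D.χ _ e
    refine h1.mul ⟨D.c, hc, D.O ∩ O', D.isOpen.inter hO', ⟨hO, he'⟩,
      fun p => tder G (p.1, Jet.trunc (le_max_right _ _) p.2)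
        (D.ν (p.1, Jet.trunc (le_max_left _ _) p.2)), ?_, fun p hp hpO => ?_⟩
    · refine ContDiffOn.clm_apply ?_ ?_
      · refine (contDiffOn_tder hO' hG.1).comp (ContDiff.contDiffOn ?_)
          fun p hp => ⟨hp.1.2, trivial⟩
        exact contDiff_fst.prodMk ((Jet.trunc (Z := Rn n × Rn m) (T := Rn n →L[ℝ] Rn m)
          _).contDiff.comp contDiff_snd)
      · refine D.smooth.comp (ContDiff.contDiffOn ?_) fun p hp => ⟨hp.1.1, trivial⟩
        exact contDiff_fst.prodMk ((Jet.trunc (Z := Rn n × Rn m) (T := Rn n →L[ℝ] Rn m)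
          _).contDiff.comp contDiff_snd)
    · exact congrArg (fun L : Rn n × Rn m →L[ℝ] ℝ => L (D.ν (D.c.total p.1.pt, p.1.coefJet D.c D.K)))
        (cd_eq_tder hG hO' hp hpO.2)
  · obtain ⟨c, hc⟩ := hch.exists_chart e
    refine (ordAt_const hc (0 : ℝ)).congr
      ((isClosed_tsupport D.χ).isOpen_compl.mem_nhds he) fun p hp => ?_
    rw [der, image_eq_zero_of_notMem_tsupport hp, zero_mul]

/-- The vector field on the equation. -/
def toVF : VF n m π :=
  Derivation.mk'
    { toFun := fun f => ⟨D.der f, by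
        obtain ⟨k, hk⟩ := exists_ordAt hch.exists_chart f
        exact mem_smoothFc fun e => D.ordAt_der (hk e)⟩
      map_add' := fun f g => Subtype.ext (funext fun p => by
        show D.der (f + g) p = D.der f p + D.der g p
        by_cases h : D.χ p.1.pt = 0
        · simp [der, h]
        · rw [der, der, der, cd_add f g (D.mem_source h), add_apply, mul_add])
      map_smul' := fun r f => Subtype.ext (funext fun p => by
        show D.der (r • f) p = r * D.der f p
        by_cases h : D.χ p.1.pt = 0
        · simp [der, h]
        · rw [der, der, cd_smul r f (D.mem_source h), smul_apply, smul_eq_mul]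
          ring) }
    fun f g => Subtype.ext (funext fun p => by
      show D.der (f * g) p = f.1 p * D.der g p + g.1 p * D.der f p
      by_cases h : D.χ p.1.pt = 0
      · simp [der, h]
      · rw [der, der, der, cd_mul f g (D.mem_source h), add_apply, smul_apply, smul_apply,
          smul_eq_mul, smul_eq_mul]
        ring)

theorem coe_toVF (f : smoothFc n m π) : (D.toVF f).1 = D.der f := rfl

theorem toVF_apply (f : smoothFc n m π) (p : Efc n m π) : (D.toVF f).1 p =
    D.χ p.1.pt * cd D.c p f (D.ν (D.c.total p.1.pt, p.1.coefJet D.c D.K)) := by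
  rw [coe_toVF]
  rfl

theorem isCartan : IsCartan D.toVF := by
  refine isCartan_of_exists_vec fun p => ?_
  by_cases h : D.χ p.1.pt = 0
  · obtain ⟨c, hc⟩ := hch.exists_chart p.1.pt
    refine ⟨c, hc, 0, fun f => ?_⟩
    rw [toVF_apply, h, zero_mul, (cd c p f).map_zero]
  · exact ⟨D.c, D.mem_source h, D.χ p.1.pt • D.ν (D.c.total p.1.pt, p.1.coefJet D.c D.K),
      fun f => (D.toVF_apply f p).trans ((cd D.c p f).map_smul _ _).symm⟩

theorem ordAt_toVF {f : smoothFc n m π} {k : ℕ} {e : E} (hf : OrdAt k f.1 e) :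
    OrdAt (max D.K (k + 1)) (D.toVF f).1 e := by
  rw [coe_toVF]
  exact D.ordAt_der hf

end CartanField

/-- A family of vector fields, given near each point of the total space, which agree on overlaps
and are locally of uniformly bounded order. -/
structure CompatibleFamily (n m : ℕ) {M E : Type*}
    [TopologicalSpace M] [ChartedSpace (Rn n) M]
    [TopologicalSpace E] [ChartedSpace (ModelProd (Rn n) (Rn m)) E] (π : E → M) where
  /-- the vector fields -/
  S : E → VF n m π
  /-- the neighbourhoods -/
  N : E → Set E
  mem_nhds : ∀ e, N e ∈ 𝓝 e
  agree : ∀ e e' f (p : Efc n m π), p.1.pt ∈ N e → p.1.pt ∈ N e' → (S e f).1 p = (S e' f).1 p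
  ord : ∀ f, ∃ k, ∀ e, OrdAt k (S e f).1 e

namespace CompatibleFamily

variable (D : CompatibleFamily n m π)

theorem agree_pt {e : E} {p : Efc n m π} (h : p.1.pt ∈ D.N e) (f : smoothFc n m π) :
    (D.S p.1.pt f).1 p = (D.S e f).1 p :=
  D.agree _ _ f p (mem_of_mem_nhds (D.mem_nhds _)) h

theorem ordAt_glue {f : smoothFc n m π} {k : ℕ} {e : E} (h : OrdAt k (D.S e f).1 e) :
    OrdAt k (fun p => (D.S p.1.pt f).1 p) e :=
  h.congr (D.mem_nhds e) fun _ hp => D.agree_pt hp f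

/-- The glued vector field. -/
def glue : VF n m π :=
  Derivation.mk'
    { toFun := fun f => ⟨fun p => (D.S p.1.pt f).1 p, by
        obtain ⟨k, hk⟩ := D.ord f
        exact mem_smoothFc fun e => D.ordAt_glue (hk e)⟩
      map_add' := fun f g => Subtype.ext (funext fun p => by
        show (D.S p.1.pt (f + g)).1 p = _
        rw [map_add]
        rfl)
      map_smul' := fun r f => Subtype.ext (funext fun p => by
        show (D.S p.1.pt (r • f)).1 p = _
        rw [Derivation.map_smul]
        rfl) }
    fun f g => Subtype.ext (funext fun p => leibniz_apply (D.S p.1.pt) f g p)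

theorem glue_apply_pt (f : smoothFc n m π) (p : Efc n m π) :
    (D.glue f).1 p = (D.S p.1.pt f).1 p := rfl

theorem glue_apply {e : E} {p : Efc n m π} (h : p.1.pt ∈ D.N e) (f : smoothFc n m π) :
    (D.glue f).1 p = (D.S e f).1 p := D.agree_pt h f

theorem ordAt_glue_apply {f : smoothFc n m π} {k : ℕ} {e : E} (h : OrdAt k (D.S e f).1 e) :
    OrdAt k (D.glue f).1 e := D.ordAt_glue h

theorem isCartan_glue (h : ∀ e, IsCartan (D.S e)) : IsCartan D.glue := by
  refine isCartan_of_exists_vec fun p => ?_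
  obtain ⟨c, hc⟩ := hch.exists_chart p.1.pt
  obtain ⟨ν, hν⟩ := (h p.1.pt).exists_vec hc
  exact ⟨c, hc, ν, hν⟩

end CompatibleFamily

/-! ### Frames of the horizontal distribution -/

/-- An adapted chart near a point, with its coordinate functions extended to `M` and `E`, and the
horizontal lifts of the coordinate fields extended to the equation. -/
structure LocalFrame (n m : ℕ) {M E : Type*}
    [TopologicalSpace M] [ChartedSpace (Rn n) M]
    [TopologicalSpace E] [ChartedSpace (ModelProd (Rn n) (Rn m)) E] (π : E → M) where
  /-- the chart -/
  c : AdaptedChart n m π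
  /-- the domain -/
  N : Set E
  isOpen : IsOpen N
  subset : N ⊆ c.total.source
  /-- the coordinates on the base -/
  b : Fin n → C^∞⟮IB n, M; 𝓘(ℝ, ℝ), ℝ⟯
  b_eq : ∀ e ∈ N, ∀ i, b i =ᶠ[𝓝 (π e)] fun x => c.base x i
  /-- the coordinates on the fibers -/
  v : Fin m → C^∞⟮IT n m, E; 𝓘(ℝ, ℝ), ℝ⟯
  v_eq : ∀ e ∈ N, ∀ α, v α e = (c.total e).2 α
  /-- the horizontal lifts of the coordinate fields -/
  X : Fin n → VF n m π
  X_apply : ∀ i f (p : Efc n m π), p.1.pt ∈ N → (X i f).1 p = cd c p f (hvec c p (ex i))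
  isCartan_X : ∀ i, IsCartan (X i)
  ordAt_X : ∀ i (f : smoothFc n m π) k e, OrdAt k f.1 e → OrdAt (k + 1) (X i f).1 e

theorem exists_localFrame (e : E) : ∃ F : LocalFrame n m π, e ∈ F.N := by
  obtain ⟨c, hc⟩ := hch.exists_chart e
  have hs := c.total.open_source.mem_nhds hc
  have hb := c.map_source e hc
  have h1 : ∀ i : Fin n, ∃ b : C^∞⟮IB n, M; 𝓘(ℝ, ℝ), ℝ⟯, b =ᶠ[𝓝 (π e)] fun x => c.base x i := by
    intro i
    refine exists_smooth_ext (IB n) ?_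
    filter_upwards [c.base.open_source.mem_nhds hb] with x hx
    exact (contDiff_piLp_apply (p := 2) (i := i)).contDiffAt.contMDiffAt.comp x (c.contMDiffAt_base hx)
  have h2 : ∀ α : Fin m, ∃ v : C^∞⟮IT n m, E; 𝓘(ℝ, ℝ), ℝ⟯,
      v =ᶠ[𝓝 e] fun e => (c.total e).2 α := by
    intro α
    refine exists_smooth_ext (IT n m) ?_
    filter_upwards [hs] with e' he'
    exact ((contDiff_piLp_apply (p := 2) (i := α)).comp (contDiff_snd (E := Rn n))).contDiffAt.contMDiffAt.comp e'
      (c.contMDiffAt_total he')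
  choose b hb' using h1
  choose v hv using h2
  obtain ⟨χ, hχ, hχs⟩ := exists_bump (IT n m) hs
  let D : Fin n → CartanField n m π := fun i =>
    { c := c
      O := Set.univ
      isOpen := isOpen_univ
      χ := χ
      tsupport_subset := fun x hx => ⟨hχs hx, trivial⟩
      K := 0
      ν := fun p => (ex i, Jet.val (k := 0) (Z := Rn n × Rn m) (T := Rn n →L[ℝ] Rn m) p.2 (ex i))
      smooth := by
        refine (contDiff_const.prodMk ?_).contDiffOn
        exact ((Jet.val (k := 0) (Z := Rn n × Rn m) (T := Rn n →L[ℝ] Rn m)).contDiff.comp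
          contDiff_snd).clm_apply contDiff_const }
  have hπ : ContinuousAt π e := (c.contMDiffAt_proj hc).continuousAt
  have h3 : ∀ᶠ e' in 𝓝 e, (∀ i, b i =ᶠ[𝓝 (π e')] fun x => c.base x i) ∧
      (∀ α, v α e' = (c.total e').2 α) ∧ χ e' = 1 ∧ e' ∈ c.total.source :=
    (Filter.eventually_all.2 fun i => hπ.eventually (hb' i).eventuallyEq_nhds).and
      ((Filter.eventually_all.2 hv).and (hχ.and hs))
  obtain ⟨N, hN, hNo, heN⟩ := eventually_nhds_iff.1 h3
  exact ⟨{
    c := c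
    N := N
    isOpen := hNo
    subset := fun e' he' => (hN e' he').2.2.2
    b := b
    b_eq := fun e' he' => (hN e' he').1
    v := v
    v_eq := fun e' he' => (hN e' he').2.1
    X := fun i => (D i).toVF
    X_apply := fun i f p hp => by
      rw [CartanField.toVF_apply]
      show χ p.1.pt * _ = _
      rw [(hN _ hp).2.2.1, one_mul]
      rfl
    isCartan_X := fun i => (D i).isCartan
    ordAt_X := fun i f k e hf => ((D i).ordAt_toVF hf).mono (by simp [D]) }, heN⟩

namespace LocalFrame

variable (F : LocalFrame n m π) {p : Efc n m π} {X : VF n m π}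

theorem mem_nhds {e : E} (h : e ∈ F.N) : F.N ∈ 𝓝 e := F.isOpen.mem_nhds h

theorem N_nhds_total {e : E} (h : e ∈ F.N) :
    {z | z ∈ F.c.total.target ∧ F.c.total.symm z ∈ F.N} ∈ 𝓝 (F.c.total e) :=
  (F.c.total.isOpen_inter_preimage_symm F.isOpen).mem_nhds
    ⟨F.c.total.map_source (F.subset h), by
      rw [Set.mem_preimage, F.c.total.left_inv (F.subset h)]; exact h⟩

theorem b_apply (hp : p.1.pt ∈ F.N) (i : Fin n) :
    (pM (F.b i) : smoothFc n m π).1 p = (F.c.total p.1.pt).1 i := by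
  rw [pM_apply, (F.b_eq _ hp i).eq_of_nhds, F.c.fst_total _ (F.subset hp)]

theorem cd_b (hp : p.1.pt ∈ F.N) (i : Fin n) (ν : Rn n × Rn m) :
    cd F.c p (pM (F.b i)) ν = ν.1 i := by
  have h := cd_of_base (c := F.c) (f := pM (F.b i)) (u := fun z => z.1 i) (F.subset hp)
    (F.N_nhds_total hp) fun q hq hqN => by
      have : q.1.pt ∈ F.N := by
        have := hqN.2
        rwa [F.c.total.left_inv hq] at this
      exact F.b_apply this i
  rw [h]
  have h2 : HasFDerivAt (fun z : Rn n × Rn m => z.1 i) ((EuclideanSpace.proj i : Rn n →L[ℝ] ℝ).comp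
    (ContinuousLinearMap.fst ℝ (Rn n) (Rn m))) (F.c.total p.1.pt) := ContinuousLinearMap.hasFDerivAt
      ((EuclideanSpace.proj i : Rn n →L[ℝ] ℝ).comp (ContinuousLinearMap.fst ℝ (Rn n) (Rn m)))
  rw [h2.fderiv]
  rfl

theorem cd_v (hp : p.1.pt ∈ F.N) (α : Fin m) (ν : Rn n × Rn m) :
    cd F.c p (pullE (F.v α)) ν = ν.2 α := by
  have h := cd_of_base (c := F.c) (f := pullE (F.v α)) (u := fun z => z.2 α) (F.subset hp)
    (F.N_nhds_total hp) fun q hq hqN => by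
      have : q.1.pt ∈ F.N := by
        have := hqN.2
        rwa [F.c.total.left_inv hq] at this
      exact F.v_eq _ this α
  rw [h]
  have h2 : HasFDerivAt (fun z : Rn n × Rn m => z.2 α) ((EuclideanSpace.proj α : Rn m →L[ℝ] ℝ).comp
    (ContinuousLinearMap.snd ℝ (Rn n) (Rn m))) (F.c.total p.1.pt) := ContinuousLinearMap.hasFDerivAt
      ((EuclideanSpace.proj α : Rn m →L[ℝ] ℝ).comp (ContinuousLinearMap.snd ℝ (Rn n) (Rn m)))
  rw [h2.fderiv]
  rfl

/-- The components of a vector field on the total space, in the frame. -/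
def vec (X : VF n m π) (p : Efc n m π) : Rn n × Rn m :=
  (∑ i, (X (pM (F.b i))).1 p • ex i, ∑ α, (X (pullE (F.v α))).1 p • ex α)

theorem vec_eq (hp : p.1.pt ∈ F.N) {ν : Rn n × Rn m} (h : ∀ f, (X f).1 p = cd F.c p f ν) :
    F.vec X p = ν := by
  refine Prod.ext ?_ ?_
  · show ∑ i, (X (pM (F.b i))).1 p • ex i = ν.1
    simp only [h, F.cd_b hp]
    exact sum_ex ν.1
  · show ∑ α, (X (pullE (F.v α))).1 p • ex α = ν.2
    simp only [h, F.cd_v hp]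
    exact sum_ex ν.2

/-- A vector field in the Cartan distribution is determined by its projection to `E`. -/
theorem apply_eq_vec (hX : IsCartan X) (hp : p.1.pt ∈ F.N) (f : smoothFc n m π) :
    (X f).1 p = cd F.c p f (F.vec X p) := by
  obtain ⟨ν, hν⟩ := hX.exists_vec (F.subset hp)
  rw [F.vec_eq hp hν, hν]

theorem X_b (hp : p.1.pt ∈ F.N) (i j : Fin n) :
    (F.X i (pM (F.b j))).1 p = (ex i : Rn n) j := by
  rw [F.X_apply i _ p hp, F.cd_b hp]
  rfl

/-- The restriction of a vector field to functions on the base, in a frame. -/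
theorem isBaseVec (hp : p.1.pt ∈ F.N) (X : VF n m π) : IsBaseVec F.c X p (F.vec X p).1 := by
  obtain ⟨a, ha⟩ := exists_isBaseVec X (F.subset hp)
  suffices h : (F.vec X p).1 = a by rwa [h]
  show ∑ i, (X (pM (F.b i))).1 p • ex i = a
  have h1 : ∀ i, (X (pM (F.b i))).1 p = a i := by
    intro i
    have h2 := cd_pM (F.b i) (F.subset hp) (a, 0)
    rw [F.cd_b hp] at h2
    rw [ha (F.b i)]
    exact h2.symm
  simp only [h1]
  exact sum_ex a

theorem hvec_eq_sum (p : Efc n m π) (a : Rn n) : hvec F.c p a = ∑ i, a i • hvec F.c p (ex i) := by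
  rw [hvec]
  conv_lhs => rw [← sum_ex a, map_sum]
  refine Prod.ext ?_ ?_
  · simp [hvec, Prod.fst_sum]
  · simp [hvec, Prod.snd_sum]

/-- The local expression of the form of the connection. -/
def proj (X : VF n m π) : VF n m π := ∑ i, X (pM (F.b i)) • F.X i

theorem sum_vf_apply {ι : Type*} (s : Finset ι) (Y : ι → VF n m π) (f : smoothFc n m π)
    (p : Efc n m π) : ((∑ i ∈ s, Y i) f).1 p = ∑ i ∈ s, (Y i f).1 p := by
  classical
  induction s using Finset.induction_on with
  | empty => rfl
  | insert i s hi ih =>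
    rw [Finset.sum_insert hi, Finset.sum_insert hi, ← ih]
    rfl

theorem proj_apply' (X : VF n m π) (f : smoothFc n m π) (p : Efc n m π) :
    (F.proj X f).1 p = ∑ i, (X (pM (F.b i))).1 p * (F.X i f).1 p := sum_vf_apply _ _ f p

theorem proj_apply (hp : p.1.pt ∈ F.N) (X : VF n m π) (f : smoothFc n m π) :
    (F.proj X f).1 p = cd F.c p f (hvec F.c p (F.vec X p).1) := by
  rw [proj_apply', F.hvec_eq_sum, map_sum]
  refine Finset.sum_congr rfl fun i _ => ?_
  rw [F.X_apply i f p hp, map_smul, smul_eq_mul]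
  congr 1
  show _ = (∑ j, (X (pM (F.b j))).1 p • (ex j : Rn n)) i
  simp [ex, Finset.sum_apply, Pi.single_apply]

end LocalFrame

end Construction


/-! ### Uniform bounds on orders -/

section Uniform

/-- A locally bounded order is globally bounded, if data escaping to infinity can be patched
together: the bound for the patched datum contradicts the unboundedness of the pieces. -/
theorem exists_uniform_order {B D : Type*} [TopologicalSpace B] [T2Space B]
    [LocallyCompactSpace B] [SigmaCompactSpace B] (Ord : ℕ → D → B → Prop)
    (hmono : ∀ k l d x, k ≤ l → Ord k d x → Ord l d x)
    (hfin : ∀ d, ∃ k, ∀ x, Ord k d x)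
    (hloc : ∀ x, ∃ k, ∀ᶠ y in 𝓝 x, ∀ d, Ord k d y)
    (hpatch : ∀ (x : ℕ → B) (N : ℕ → Set B) (d : ℕ → D), (∀ l, IsOpen (N l)) → (∀ l, x l ∈ N l) →
      Pairwise (fun l l' => Disjoint (N l) (N l')) → LocallyFinite N →
      ∃ d', ∀ l k, Ord k d' (x l) → Ord k (d l) (x l)) :
    ∃ k, ∀ d x, Ord k d x := by
  by_contra! hcon
  let K := CompactExhaustion.choice B
  have h1 : ∀ j, ∃ k, ∀ y ∈ K j, ∀ d, Ord k d y := by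
    intro j
    refine (K.isCompact j).induction_on (p := fun s => ∃ k, ∀ y ∈ s, ∀ d, Ord k d y)
      ⟨0, by simp⟩ (fun s t hst ⟨k, hk⟩ => ⟨k, fun y hy => hk y (hst hy)⟩) ?_ ?_
    · rintro s t ⟨k, hk⟩ ⟨l, hl⟩
      refine ⟨max k l, fun y hy d => ?_⟩
      rcases hy with hy | hy
      · exact hmono _ _ _ _ (le_max_left k l) (hk y hy d)
      · exact hmono _ _ _ _ (le_max_right k l) (hl y hy d)
    · intro x _
      obtain ⟨k, hk⟩ := hloc x
      exact ⟨_, mem_nhdsWithin_of_mem_nhds hk, k, fun y hy => hy⟩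
  choose k hk using h1
  choose d x hdx using fun l => hcon (max l (k l))
  have hx : ∀ l, x l ∉ K l := fun l h =>
    hdx l (hmono _ _ _ _ (le_max_right _ _) (hk l _ h (d l)))
  have h2 : ∀ l, ∃ j, l < j ∧ x l ∈ K j := fun l => by
    obtain ⟨j, hj⟩ := K.exists_mem (x l)
    exact ⟨max j (l + 1), by omega, K.subset (le_max_left _ _) hj⟩
  choose s hs hxs using h2
  -- the indices `φ l` are such that `x (φ l)` lies between `K (φ l)` and `K (φ (l + 1))`
  let φ : ℕ → ℕ := fun l => Nat.rec 0 (fun _ i => s i + 1) l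
  have hφ : ∀ l, φ (l + 1) = s (φ l) + 1 := fun _ => rfl
  have hφm : StrictMono φ := strictMono_nat_of_lt_succ fun l => by
    rw [hφ]; exact (hs _).trans (Nat.lt_succ_self _)
  let N : ℕ → Set B := fun l => interior (K (φ (l + 1))) \ K (φ l)
  have hdisj : ∀ l l', l < l' → Disjoint (N l) (N l') := fun l l' h =>
    Set.disjoint_left.2 fun y hy hy' =>
      hy'.2 (K.subset (hφm.monotone (Nat.succ_le_of_lt h)) (interior_subset hy.1))
  obtain ⟨d', hd'⟩ := hpatch (fun l => x (φ l)) N (fun l => d (φ l))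
    (fun l => isOpen_interior.sdiff (K.isCompact _).isClosed)
    (fun l => ⟨by rw [hφ]; exact K.subset_interior_succ _ (hxs _), hx _⟩)
    (fun l l' h => by
      rcases lt_or_gt_of_ne h with h | h
      · exact hdisj l l' h
      · exact (hdisj l' l h).symm)
    (fun y => by
      obtain ⟨j, hj⟩ := K.exists_mem y
      refine ⟨interior (K (j + 1)), isOpen_interior.mem_nhds (K.subset_interior_succ j hj),
        (Set.finite_Iio (j + 1)).subset ?_⟩
      rintro l ⟨z, hz, hz'⟩
      by_contra hl
      exact hz.2 (K.subset ((not_lt.1 hl).trans hφm.le_apply) (interior_subset hz')))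
  obtain ⟨l, hl⟩ := hfin d'
  exact hdx (φ l) (hmono _ _ _ _ (hφm.le_apply.trans (le_max_left _ _)) (hd' l l (hl _)))

/-- Smooth functions can be patched together along a locally finite family. -/
theorem exists_smooth_patch {H : Type*} {EB : Type*} [NormedAddCommGroup EB] [NormedSpace ℝ EB]
    [FiniteDimensional ℝ EB] [TopologicalSpace H] (I : ModelWithCorners ℝ EB H) {B : Type*}
    [TopologicalSpace B] [ChartedSpace H B] [IsManifold I ∞ B] [T2Space B]
    [SecondCountableTopology B] {x : ℕ → B} {N : ℕ → Set B} (hN : ∀ l, IsOpen (N l))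
    (hx : ∀ l, x l ∈ N l) (hd : Pairwise (fun l l' => Disjoint (N l) (N l')))
    (hf : LocallyFinite N) (g : ℕ → C^∞⟮I, B; 𝓘(ℝ, ℝ), ℝ⟯) :
    ∃ g' : C^∞⟮I, B; 𝓘(ℝ, ℝ), ℝ⟯, ∀ l, g' =ᶠ[𝓝 (x l)] g l := by
  choose χ h1 h0 using fun l => exists_bump I ((hN l).mem_nhds (hx l))
  have hsub : ∀ l, Function.support (fun y => χ l y * g l y) ⊆ N l := fun l y hy =>
    h0 l (subset_tsupport _ (left_ne_zero_of_mul hy))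
  refine ⟨⟨fun y => ∑ᶠ l, χ l y * g l y, contMDiff_finsum
    (fun l => (χ l).contMDiff.mul (g l).contMDiff) (hf.subset hsub)⟩, fun l => ?_⟩
  filter_upwards [h1 l, (hN l).mem_nhds (hx l)] with y hy hyN
  show ∑ᶠ l, χ l y * g l y = g l y
  rw [finsum_eq_single _ l, hy, Pi.one_apply, one_mul]
  intro l' hl'
  by_contra h
  exact Set.disjoint_left.1 (hd hl') (hsub l' h) hyN

end Uniform

section UniformVF

set_option linter.unusedSectionVars false

variable {n m : ℕ} {M E : Type*}
  [TopologicalSpace M] [ChartedSpace (Rn n) M] [IsManifold (IB n) ∞ M]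
  [T2Space M] [SecondCountableTopology M]
  [TopologicalSpace E] [ChartedSpace (ModelProd (Rn n) (Rn m)) E]
  [IsManifold (IT n m) ∞ E] [T2Space E] [SecondCountableTopology E]
  {π : E → M} [hch : HasAdaptedCharts n m π]

theorem continuous_proj (h : ∀ e : E, ∃ c : AdaptedChart n m π, e ∈ c.total.source) :
    Continuous π :=
  continuous_iff_continuousAt.2 fun e => by
    obtain ⟨c, hc⟩ := h e
    exact (c.contMDiffAt_proj hc).continuousAt

/-- Locally finite sums of vector fields of uniformly bounded order. -/
theorem exists_vf_patch (k₀ : ℕ) {x : ℕ → E} {N : ℕ → Set E} (hN : ∀ l, IsOpen (N l))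
    (hx : ∀ l, x l ∈ N l) (hd : Pairwise (fun l l' => Disjoint (N l) (N l')))
    (hf : LocallyFinite N) (X : ℕ → VF n m π)
    (hX : ∀ l (f : smoothFc n m π) k e, OrdAt k f.1 e → OrdAt (k + k₀) (X l f).1 e) :
    ∃ X' : VF n m π,
      (∀ (f : smoothFc n m π) k e, OrdAt k f.1 e → OrdAt (k + k₀) (X' f).1 e) ∧
      ∀ l, ∃ W ∈ 𝓝 (x l), ∀ f (p : Efc n m π), p.1.pt ∈ W → (X' f).1 p = (X l f).1 p := by
  classical
  choose χ h1 h0 using fun l => exists_bump (IT n m) ((hN l).mem_nhds (hx l))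
  have hsub : ∀ l y, χ l y ≠ 0 → y ∈ N l := fun l y hy => h0 l (subset_tsupport _ hy)
  choose W hW hfin using hf
  have key : ∀ e (f : smoothFc n m π) (p : Efc n m π), p.1.pt ∈ W e →
      ((∑ l ∈ (hfin e).toFinset, (pullE (χ l) : smoothFc n m π) • X l : VF n m π) f).1 p =
        ∑ᶠ l, χ l p.1.pt * (X l f).1 p := by
    intro e f p hp
    rw [LocalFrame.sum_vf_apply, finsum_eq_sum_of_support_subset]
    · rfl
    · intro l hl
      have := hsub l _ (left_ne_zero_of_mul hl)
      simp only [Set.Finite.coe_toFinset, Set.mem_ofPred_eq]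
      exact ⟨_, this, hp⟩
  have hord : ∀ e (f : smoothFc n m π) k, OrdAt k f.1 e → OrdAt (k + k₀)
      ((∑ l ∈ (hfin e).toFinset, (pullE (χ l) : smoothFc n m π) • X l : VF n m π) f).1 e := by
    intro e f k hk
    obtain ⟨c, hc⟩ := hch.exists_chart e
    refine (OrdAt.sum (hfin e).toFinset hc (f := fun l p => χ l p.1.pt * (X l f).1 p)
      fun l _ => (ordAt_pullE (χ l) _ e).mul (hX l f k e hk)).congr (hW e) fun p hp => ?_
    exact LocalFrame.sum_vf_apply _ _ _ _
  let D : CompatibleFamily n m π :=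
    { S := fun e => ∑ l ∈ (hfin e).toFinset, (pullE (χ l) : smoothFc n m π) • X l
      N := W
      mem_nhds := hW
      agree := fun e e' f p h h' => (key e f p h).trans (key e' f p h').symm
      ord := fun f => by
        obtain ⟨k, hk⟩ := exists_ordAt hch.exists_chart f
        exact ⟨k + k₀, fun e => hord e f k (hk e)⟩ }
  refine ⟨D.glue, fun f k e hk => D.ordAt_glue_apply (hord e f k hk), fun l => ?_⟩
  refine ⟨W (x l) ∩ ({y | χ l y = 1} ∩ N l), Filter.inter_mem (hW _)
    (Filter.inter_mem (h1 l) ((hN l).mem_nhds (hx l))), fun f p hp => ?_⟩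
  rw [D.glue_apply hp.1]
  refine (key _ f p hp.1).trans ?_
  rw [finsum_eq_single _ l, hp.2.1, one_mul]
  intro l' hl'
  by_contra h
  exact Set.disjoint_left.1 (hd hl') (hsub l' _ (left_ne_zero_of_mul h)) hp.2.2

theorem ordAt_pM (g : C^∞⟮IB n, M; 𝓘(ℝ, ℝ), ℝ⟯) (k : ℕ) (e : E) :
    OrdAt k (pM g : smoothFc n m π).1 e := by
  have hs : ContMDiff (IT n m) 𝓘(ℝ, ℝ) ∞ fun e => g (π e) := fun e => by
    obtain ⟨c, hc⟩ := hch.exists_chart e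
    exact g.contMDiff.contMDiffAt.comp e (c.contMDiffAt_proj hc)
  exact ordAt_pullE ⟨_, hs⟩ k e

/-- The functions `X g`, for `g` a function on the base, are of uniformly bounded order. -/
theorem exists_ord_base (X : VF n m π) : ∃ k, ∀ g e, OrdAt k (X (pM g)).1 e := by
  have : LocallyCompactSpace M := Manifold.locallyCompact_of_finiteDimensional (IB n)
  obtain ⟨k, hk⟩ := exists_uniform_order (B := M)
    (fun k g x => ∀ e, π e = x → OrdAt k (X (pM g)).1 e)
    (fun k l g x hkl h e he => (h e he).mono hkl)
    (fun g => by
      obtain ⟨k, hk⟩ := exists_ordAt hch.exists_chart (X (pM g))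
      exact ⟨k, fun x e _ => hk e⟩)
    (fun x => by
      let ψ := chartAt (Rn n) x
      have hψ : ψ ∈ IsManifold.maximalAtlas (IB n) ∞ M := IsManifold.chart_mem_maximalAtlas x
      have hs : ψ.source ∈ 𝓝 x := ψ.open_source.mem_nhds (mem_chart_source (Rn n) x)
      have h1 : ∀ i : Fin n, ∃ b : C^∞⟮IB n, M; 𝓘(ℝ, ℝ), ℝ⟯, b =ᶠ[𝓝 x] fun y => ψ y i := by
        intro i
        refine exists_smooth_ext (IB n) ?_
        filter_upwards [hs] with y hy
        exact (contDiff_piLp_apply (p := 2) (i := i)).contDiffAt.contMDiffAt.comp y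
          (contMDiffAt_of_mem_maximalAtlas hψ hy)
      choose b hb using h1
      choose k hk using fun i => exists_ordAt hch.exists_chart (X (pM (b i)))
      refine ⟨Finset.univ.sup k, ?_⟩
      filter_upwards [(Filter.eventually_all.2 fun i => (hb i).eventuallyEq_nhds).eventually_nhds,
        ψ.open_source.mem_nhds (mem_chart_source (Rn n) x)] with y hy hys g e he
      have hd : ∀ᶠ y' in 𝓝 y, ContDiffAt ℝ ∞ (fun x => g (ψ.symm x)) (ψ y') := by
        filter_upwards [ψ.open_source.mem_nhds hys] with y' hy'
        rw [← contMDiffAt_iff_contDiffAt]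
        exact g.contMDiff.contMDiffAt.comp _
          (contMDiffAt_symm_of_mem_maximalAtlas hψ (ψ.map_source hy'))
      have h2 : ∀ i : Fin n, ∃ h : C^∞⟮IB n, M; 𝓘(ℝ, ℝ), ℝ⟯, h =ᶠ[𝓝 y]
          fun y' => fderiv ℝ (fun x => g (ψ.symm x)) (ψ y') (ex i) := by
        intro i
        refine exists_smooth_ext (IB n) ?_
        filter_upwards [hd, ψ.open_source.mem_nhds hys] with y' hy' hys'
        have h3 : ContDiffAt ℝ ∞ (fun x' => fderiv ℝ (fun x => g (ψ.symm x)) x' (ex i)) (ψ y') :=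
          (hy'.fderiv_right (m := ∞) (by simp)).clm_apply contDiffAt_const
        exact h3.contMDiffAt.comp y' (contMDiffAt_of_mem_maximalAtlas hψ hys')
      choose h hh using h2
      obtain ⟨W, hW, hWo, hyW⟩ := eventually_nhds_iff.1 ((hy.and
        (ψ.open_source.mem_nhds hys)).and (Filter.eventually_all.2 hh))
      obtain ⟨c, hc⟩ := hch.exists_chart e
      refine (OrdAt.sum Finset.univ hc (f := fun i p => h i (π p.1.pt) * (X (pM (b i))).1 p)
        fun i _ => ((ordAt_pM (h i) _ e)).mul ((hk i e).mono (Finset.le_sup (Finset.mem_univ i)))).congr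
        ((hWo.preimage (continuous_proj hch.exists_chart)).mem_nhds (by rw [Set.mem_preimage, he]; exact hyW))
        fun p hp => ?_
      obtain ⟨a, ha⟩ := exists_baseVec X p hψ (hW _ hp).1.2
      have h4 : ∀ i, (X (pM (b i))).1 p = a i := by
        intro i
        rw [ha]
        have h5 : (fun x => b i (ψ.symm x)) =ᶠ[𝓝 (ψ (π p.1.pt))] fun x => x i := by
          have hs' := (hW _ hp).1.2
          have hcs := ψ.continuousAt_symm (ψ.map_source hs')
          rw [ContinuousAt, ψ.left_inv hs'] at hcs
          filter_upwards [hcs.eventually ((hW _ hp).1.1 i), ψ.open_target.mem_nhds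
              (ψ.map_source hs')] with x' hx' hxt
          rw [hx', ψ.right_inv hxt]
        rw [h5.fderiv_eq]
        exact congrArg (fun L : Rn n →L[ℝ] ℝ => L a)
          (EuclideanSpace.proj i : Rn n →L[ℝ] ℝ).hasFDerivAt.fderiv
      rw [ha]
      conv_lhs => rw [← sum_ex a, map_sum]
      refine Finset.sum_congr rfl fun i _ => ?_
      rw [h4, (hW _ hp).2 i, ContinuousLinearMap.map_smul, smul_eq_mul, mul_comm])
    (fun x N g hN hx hd hf => by
      obtain ⟨g', hg'⟩ := exists_smooth_patch (IB n) hN hx hd hf g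
      refine ⟨g', fun l k h e he => ?_⟩
      obtain ⟨W, hW, hWo, hxW⟩ := eventually_nhds_iff.1 (hg' l)
      have hWe : π ⁻¹' W ∈ 𝓝 e := (hWo.preimage ((continuous_proj hch.exists_chart))).mem_nhds (by
        rw [Set.mem_preimage, he]; exact hxW)
      refine (h e he).congr hWe fun p hp => ?_
      refine X.congr_nhds ((hWo.preimage ((continuous_proj hch.exists_chart))).mem_nhds hp) fun q hq => ?_
      exact (hW _ hq).symm)
  exact ⟨k, fun g e => hk g _ e rfl⟩

end UniformVF


/-! ### The form of the connection -/

section FcForm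

set_option linter.unusedSectionVars false

variable {n m : ℕ} {M E : Type*}
  [TopologicalSpace M] [ChartedSpace (Rn n) M] [IsManifold (IB n) ∞ M]
  [T2Space M] [SecondCountableTopology M]
  [TopologicalSpace E] [ChartedSpace (ModelProd (Rn n) (Rn m)) E]
  [IsManifold (IT n m) ∞ E] [T2Space E] [SecondCountableTopology E]
  {π : E → M} [hch : HasAdaptedCharts n m π]

namespace LocalFrame

variable (F : LocalFrame n m π) {p : Efc n m π} {X Y : VF n m π}

/-- Near a point, the local expression of the form of the connection is intrinsic. -/
theorem proj_jet {A : LocalConnection n m π} {θ : E} (h : θ ∈ A.dom)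
    (hp : A.jet θ h ∈ Efc n m π) (hθ : θ ∈ F.N) {w : TangentSpace (IB n) (π θ)}
    (hw : ∀ g : C^∞⟮IB n, M; 𝓘(ℝ, ℝ), ℝ⟯,
      (X (res (pullM g))).1 ⟨A.jet θ h, hp⟩ =
        (mfderiv (IB n) 𝓘(ℝ, ℝ) g (π θ) : TangentSpace (IB n) (π θ) →L[ℝ] ℝ) w)
    (f : smoothJet n m π) :
    (F.proj X (res f)).1 ⟨A.jet θ h, hp⟩ = A.cartanDiff f θ (A.lift θ w) := by
  have hc := F.subset hθ
  rw [F.proj_apply (p := ⟨A.jet θ h, hp⟩) hθ, cartanDiff_eq_cd h hp hc, dT_lift h hp hc]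
  congr 2
  show ∑ i, (X (pM (F.b i))).1 ⟨A.jet θ h, hp⟩ • ex i = _
  rw [← sum_ex (F.c.dB (π θ) w)]
  refine Finset.sum_congr rfl fun i _ => ?_
  have h1 := cd_pM (p := ⟨A.jet θ h, hp⟩) (F.b i) hc (F.c.dB (π θ) w, 0)
  rw [F.cd_b (p := ⟨A.jet θ h, hp⟩) hθ] at h1
  have h2 := mfderiv_eq_fderiv_base (c := F.c) (F.b i) (F.c.map_source _ hc) w
  exact congrArg (· • ex i) (((hw (F.b i)).trans h2).trans h1.symm)

theorem proj_agree {F' : LocalFrame n m π} (hp : p.1.pt ∈ F.N) (hp' : p.1.pt ∈ F'.N)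
    (X : VF n m π) (f : smoothFc n m π) : (F.proj X f).1 p = (F'.proj X f).1 p := by
  obtain ⟨A, h, hpe, hpA⟩ := Efc.exists_eq_jet p
  have hb := F.c.map_source _ (F.subset hp)
  obtain ⟨f, rfl⟩ := exists_res f
  have hw : ∀ g : C^∞⟮IB n, M; 𝓘(ℝ, ℝ), ℝ⟯, (X (res (pullM g))).1 ⟨A.jet p.1.pt h, hpe⟩ =
      (mfderiv (IB n) 𝓘(ℝ, ℝ) g (π p.1.pt) : TangentSpace (IB n) (π p.1.pt) →L[ℝ] ℝ)
        (F.c.dBs (π p.1.pt) (F.vec X p).1) := fun g => by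
    rw [← hpA]
    refine (F.isBaseVec hp X g).trans ?_
    have := mfderiv_eq_fderiv_base (c := F.c) g hb (F.c.dBs (π p.1.pt) (F.vec X p).1)
    rw [AdaptedChart.dB_dBs hb] at this
    exact this.symm
  have h1 := (F.proj_jet h hpe hp hw f).trans (F'.proj_jet h hpe hp' hw f).symm
  rwa [← hpA] at h1

theorem proj_add (X Y : VF n m π) : F.proj (X + Y) = F.proj X + F.proj Y := by
  simp only [proj, Derivation.add_apply, add_smul, Finset.sum_add_distrib]

theorem proj_smul (a : smoothFc n m π) (X : VF n m π) : F.proj (a • X) = a • F.proj X := by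
  simp only [proj, Derivation.smul_apply, smul_eq_mul, mul_smul, Finset.smul_sum]

end LocalFrame

variable (n m π) in
/-- A choice of a frame around a point. -/
def frameAt (e : E) : LocalFrame n m π := (exists_localFrame e).choose

theorem mem_frameAt (e : E) : e ∈ (frameAt n m π e).N :=
  (exists_localFrame e).choose_spec

/-- The local projections `∑ X(b_i) X_i` of a vector field to the horizontal distribution. -/
def projFamily (X : VF n m π) : CompatibleFamily n m π where
  S e := (frameAt n m π e).proj X
  N e := (frameAt n m π e).N
  mem_nhds e := (frameAt n m π e).mem_nhds (mem_frameAt e)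
  agree _ _ f _ h h' := (frameAt n m π _).proj_agree h h' X f
  ord f := by
    obtain ⟨k, hk⟩ := exists_ordAt hch.exists_chart f
    obtain ⟨l, hl⟩ := exists_ord_base X
    refine ⟨max l (k + 1), fun e => ?_⟩
    obtain ⟨c, hc⟩ := hch.exists_chart e
    refine (OrdAt.sum Finset.univ hc (f := fun i p => (X (pM ((frameAt n m π e).b i))).1 p *
      ((frameAt n m π e).X i f).1 p) fun i _ => ((hl _ e).mono (le_max_left _ _)).mul
        (((frameAt n m π e).ordAt_X i f k e (hk e)).mono (le_max_right _ _))).congr Filter.univ_mem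
        fun p _ => (frameAt n m π e).proj_apply' X f p

theorem exists_isFcForm :
    ∃ U : VF n m π →ₗ[smoothFc n m π] VF n m π, IsFcForm U := by
  refine ⟨{ toFun := fun X => (projFamily X).glue
            map_add' := fun X Y => Derivation.ext fun f => Subtype.ext (funext fun p => ?_)
            map_smul' := fun a X => Derivation.ext fun f => Subtype.ext (funext fun p => ?_) }, ?_⟩
  · rw [CompatibleFamily.glue_apply_pt]
    show ((frameAt n m π p.1.pt).proj (X + Y) f).1 p = _
    rw [LocalFrame.proj_add]
    rfl
  · rw [CompatibleFamily.glue_apply_pt]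
    show ((frameAt n m π p.1.pt).proj (a • X) f).1 p = _
    rw [LocalFrame.proj_smul]
    rfl
  · intro X A θ h hp w hw f
    exact (frameAt n m π θ).proj_jet h hp (mem_frameAt θ) hw f

theorem isFcForm_fcForm : IsFcForm (fcForm n m π) := Classical.epsilon_spec exists_isFcForm

namespace LocalFrame

variable (F : LocalFrame n m π) {p : Efc n m π} {X Y : VF n m π}

theorem _root_.FlatConn.IsFcForm.eq_proj {U : VF n m π →ₗ[smoothFc n m π] VF n m π}
    (hU : IsFcForm U) (hp : p.1.pt ∈ F.N) (X : VF n m π) (f : smoothFc n m π) :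
    (U X f).1 p = (F.proj X f).1 p := by
  rw [hU.apply (F.subset hp) (F.isBaseVec hp X) f, F.proj_apply hp]

/-- The form of the connection, in a frame. -/
theorem fcForm_apply (hp : p.1.pt ∈ F.N) (X : VF n m π) (f : smoothFc n m π) :
    (fcForm n m π X f).1 p = ∑ i, (X (pM (F.b i))).1 p * (F.X i f).1 p := by
  rw [isFcForm_fcForm.eq_proj F hp, proj_apply']

end LocalFrame

theorem IsFcForm.eq_fcForm {U : VF n m π →ₗ[smoothFc n m π] VF n m π} (hU : IsFcForm U) :
    U = fcForm n m π :=
  LinearMap.ext fun X => Derivation.ext fun f => Subtype.ext (funext fun p =>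
    (hU.eq_proj (frameAt n m π p.1.pt) (mem_frameAt _) X f).trans
      (isFcForm_fcForm.eq_proj (frameAt n m π p.1.pt) (mem_frameAt _) X f).symm)

theorem fcForm_pM (X : VF n m π) (g : C^∞⟮IB n, M; 𝓘(ℝ, ℝ), ℝ⟯) :
    fcForm n m π X (pM g) = X (pM g) := by
  refine Subtype.ext (funext fun p => ?_)
  have hp := mem_frameAt (n := n) (m := m) (π := π) p.1.pt
  rw [isFcForm_fcForm.eq_proj _ hp, LocalFrame.proj_apply _ hp, cd_pM g (LocalFrame.subset _ hp),
    LocalFrame.isBaseVec _ hp X g]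
  rfl

theorem fcForm_of_isVertical {X : VF n m π} (hX : IsVertical X) : fcForm n m π X = 0 :=
  Derivation.ext fun f => Subtype.ext (funext fun p => by
    rw [(frameAt n m π p.1.pt).fcForm_apply (mem_frameAt p.1.pt)]
    refine Finset.sum_eq_zero fun i _ => ?_
    have : X (pM ((frameAt n m π p.1.pt).b i)) = 0 := hX _
    rw [this]
    exact zero_mul _)

theorem isCartan_fcForm (X : VF n m π) : IsCartan (fcForm n m π X) :=
  isCartan_of_exists_vec fun p => ⟨_, LocalFrame.subset _ (mem_frameAt p.1.pt), _, fun f => by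
    rw [isFcForm_fcForm.eq_proj _ (mem_frameAt p.1.pt), LocalFrame.proj_apply _ (mem_frameAt _)]⟩

/-- The value over a point of a horizontal vector-valued `1`-form depends only on the restriction of
its argument to functions on the base, near that point. -/
theorem apply_eq_of_eq_on (T : VF n m π →ₗ[smoothFc n m π] VF n m π) {X Y : VF n m π}
    {p : Efc n m π} {N : Set E} (hN : N ∈ 𝓝 p.1.pt)
    (hT : ∀ X, IsVertical X → T X = 0)
    (h : ∀ g (q : Efc n m π), q.1.pt ∈ N → (X (pM g)).1 q = (Y (pM g)).1 q) (f : smoothFc n m π) :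
    (T X f).1 p = (T Y f).1 p := by
  obtain ⟨χ, h1, h0⟩ := exists_bump (IT n m) hN
  have h2 : T ((pullE χ : smoothFc n m π) • (X - Y)) = 0 := by
    refine hT _ fun g => Subtype.ext (funext fun q => ?_)
    show χ q.1.pt * ((X (pM g)).1 q - (Y (pM g)).1 q) = 0
    by_cases hq : q.1.pt ∈ tsupport χ
    · rw [h g q (h0 hq), sub_self, mul_zero]
    · rw [image_eq_zero_of_notMem_tsupport hq, zero_mul]
  have h4 : T (X - Y) = T X - T Y := map_sub T X Y
  rw [map_smul, h4] at h2
  have h3 : χ p.1.pt * ((T X f).1 p - (T Y f).1 p) = 0 :=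
    congrFun (congrArg Subtype.val (congrArg (fun Z : VF n m π => Z f) h2)) p
  rw [h1.eq_of_nhds, Pi.one_apply, one_mul] at h3
  exact sub_eq_zero.1 h3

end FcForm


/-! ### Cartan vector fields along flat connections -/

section FlatPoints

set_option linter.unusedSectionVars false

variable {n m : ℕ} {M E : Type*}
  [TopologicalSpace M] [ChartedSpace (Rn n) M] [IsManifold (IB n) ∞ M]
  [T2Space M] [SecondCountableTopology M]
  [TopologicalSpace E] [ChartedSpace (ModelProd (Rn n) (Rn m)) E]
  [IsManifold (IT n m) ∞ E] [T2Space E] [SecondCountableTopology E]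
  {π : E → M} [hch : HasAdaptedCharts n m π]

namespace LocalFrame

variable (F : LocalFrame n m π) {p : Efc n m π} {X Y : VF n m π}
  {Φ : Rn n × Rn m → Rn m} {z : Rn n × Rn m}

/-- `Φ` is a submersion near the point with coordinates `z`, which belongs to the frame. -/
def IsOver (Φ : Rn n × Rn m → Rn m) (z : Rn n × Rn m) : Prop :=
  Subm F.c.total.target Φ z ∧ F.c.total.symm z ∈ F.N

variable {F}

theorem IsOver.nhds (h : F.IsOver Φ z) : ∀ᶠ ζ in 𝓝 z, F.IsOver Φ ζ :=
  (eventually_subm h.1).and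
    ((F.c.total.continuousAt_symm h.1.1).eventually (F.isOpen.mem_nhds h.2))

theorem IsOver.unit (h : F.IsOver Φ z) : IsUnit (vert Φ z) := h.1.2.2

theorem IsOver.contDiffAt (h : F.IsOver Φ z) : ContDiffAt ℝ ∞ Φ z := h.1.2.1.contDiffAt

theorem IsOver.contDiffAt_flatCoef (h : F.IsOver Φ z) : ContDiffAt ℝ ∞ (flatCoef Φ) z :=
  (h.1.smoothNear_flatCoef F.c.total.open_target).contDiffAt

theorem isOver_of_subm (h : Subm F.c.total.target Φ (F.c.total p.1.pt)) (hp : p.1.pt ∈ F.N) :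
    F.IsOver Φ (F.c.total p.1.pt) := ⟨h, by rwa [F.c.total.left_inv (F.subset hp)]⟩

variable (F)

/-- Identities between finitely many functions and their differentials along the Cartan planes can
be checked along flat connections. -/
theorem exists_isOver (hp : p.1.pt ∈ F.N) (s : Finset (smoothFc n m π)) :
    ∃ (Φ : Rn n × Rn m → Rn m) (h : F.IsOver Φ (F.c.total p.1.pt)), ∀ f ∈ s,
      f.1 p = f.1 (flatPt F.c Φ _ h.1) ∧ cd F.c p f = cd F.c (flatPt F.c Φ _ h.1) f := by
  obtain ⟨Φ, h, H⟩ := exists_flatPt_agree p (F.subset hp) s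
  refine ⟨Φ, isOver_of_subm h hp, fun f hf => ?_⟩
  rw [cd_flatPt, ← ev_eq]
  exact H f hf

/-- Functions which agree along all flat connections are equal. -/
theorem eq_of_ev {f g : smoothFc n m π} (h : ∀ Φ z, F.IsOver Φ z → ev F.c Φ f z = ev F.c Φ g z)
    (hp : p.1.pt ∈ F.N) : f.1 p = g.1 p := by
  classical
  obtain ⟨Φ, hΦ, H⟩ := F.exists_isOver hp {f, g}
  rw [(H f (by simp)).1, (H g (by simp)).1, ← ev_eq, ← ev_eq, h Φ _ hΦ]

/-- The components of `X` along the flat connection given by `Φ`. -/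
def evec (Φ : Rn n × Rn m → Rn m) (X : VF n m π) (z : Rn n × Rn m) : Rn n × Rn m :=
  (∑ i, ev F.c Φ (X (pM (F.b i))) z • ex i, ∑ α, ev F.c Φ (X (pullE (F.v α))) z • ex α)

variable {F}

theorem evec_eq_vec (X : VF n m π) (h : F.IsOver Φ z) :
    F.evec Φ X z = F.vec X (flatPt F.c Φ z h.1) := by
  simp only [evec, ev_eq _ h.1]
  rfl

theorem contDiffAt_evec (X : VF n m π) (h : F.IsOver Φ z) : ContDiffAt ℝ ∞ (F.evec Φ X) z :=
  ContDiffAt.prodMk (ContDiffAt.sum fun _ _ => (contDiffAt_ev _ h.1).smul contDiffAt_const)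
    (ContDiffAt.sum fun _ _ => (contDiffAt_ev _ h.1).smul contDiffAt_const)

theorem ev_apply (hX : IsCartan X) (h : F.IsOver Φ z) (f : smoothFc n m π) :
    ev F.c Φ (X f) z = fderiv ℝ (ev F.c Φ f) z (F.evec Φ X z) := by
  rw [ev_eq _ h.1, F.apply_eq_vec hX (p := flatPt F.c Φ z h.1) h.2, cd_flatPt, evec_eq_vec X h]

theorem fderiv_ev_b (h : F.IsOver Φ z) (i : Fin n) (ν : Rn n × Rn m) :
    fderiv ℝ (ev F.c Φ (pM (F.b i))) z ν = ν.1 i := by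
  rw [← cd_flatPt _ h.1, F.cd_b (p := flatPt F.c Φ z h.1) h.2]

theorem fderiv_ev_v (h : F.IsOver Φ z) (α : Fin m) (ν : Rn n × Rn m) :
    fderiv ℝ (ev F.c Φ (pullE (F.v α))) z ν = ν.2 α := by
  rw [← cd_flatPt _ h.1, F.cd_v (p := flatPt F.c Φ z h.1) h.2]

theorem hvec_flatPt (h : Subm F.c.total.target Φ z) (a : Rn n) :
    hvec F.c (flatPt F.c Φ z h) a = (a, flatCoef Φ z a) := by
  rw [hvec, coefJet_flatPt, val_jet]

theorem evec_X (h : F.IsOver Φ z) (i : Fin n) :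
    F.evec Φ (F.X i) z = (ex i, flatCoef Φ z (ex i)) := by
  rw [evec_eq_vec _ h, F.vec_eq (p := flatPt F.c Φ z h.1) h.2
    (fun f => F.X_apply i f (flatPt F.c Φ z h.1) h.2), hvec_flatPt]

/-- The components of a bracket are given by the bracket of the components. -/
theorem ev_lie (hX : IsCartan X) (hY : IsCartan Y) (h : F.IsOver Φ z) (f : smoothFc n m π) :
    ev F.c Φ (⁅X, Y⁆ f) z = fderiv ℝ (ev F.c Φ f) z
      (fderiv ℝ (F.evec Φ Y) z (F.evec Φ X z) - fderiv ℝ (F.evec Φ X) z (F.evec Φ Y z)) := by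
  have hf := contDiffAt_ev (c := F.c) f h.1
  have hs : IsSymmSndFDerivAt ℝ (ev F.c Φ f) z :=
    (eventually_contDiffAt_fin hf 2).self_of_nhds.isSymmSndFDerivAt (by simp)
  have key : ∀ {X Y : VF n m π}, IsCartan X → IsCartan Y → ev F.c Φ (X (Y f)) z =
      fderiv ℝ (fderiv ℝ (ev F.c Φ f)) z (F.evec Φ X z) (F.evec Φ Y z) +
        fderiv ℝ (ev F.c Φ f) z (fderiv ℝ (F.evec Φ Y) z (F.evec Φ X z)) := by
    intro X Y hX hY
    have h1 : ev F.c Φ (Y f) =ᶠ[𝓝 z] fun ζ => fderiv ℝ (ev F.c Φ f) ζ (F.evec Φ Y ζ) := by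
      filter_upwards [h.nhds] with ζ hζ using ev_apply hY hζ f
    rw [ev_apply hX h, h1.fderiv_eq, fderiv_clm_apply
      (differentiableAt_of_smooth (contDiffAt_fderiv hf))
      (differentiableAt_of_smooth (contDiffAt_evec Y h))]
    simp [add_comm]
  rw [Derivation.commutator_apply, ev_sub _ _ h.1, key hX hY, key hY hX,
    hs.eq (F.evec Φ X z) (F.evec Φ Y z), add_sub_add_left_eq_sub, map_sub]

theorem evec_lie (hX : IsCartan X) (hY : IsCartan Y) (h : F.IsOver Φ z) : F.evec Φ ⁅X, Y⁆ z =
    fderiv ℝ (F.evec Φ Y) z (F.evec Φ X z) - fderiv ℝ (F.evec Φ X) z (F.evec Φ Y z) := by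
  refine Prod.ext ?_ ?_
  · simp only [evec, ev_lie hX hY h, fderiv_ev_b h]
    exact sum_ex _
  · simp only [evec, ev_lie hX hY h, fderiv_ev_v h]
    exact sum_ex _

end LocalFrame

/-- The Cartan distribution is involutive. -/
theorem IsCartan.lie {X Y : VF n m π} (hX : IsCartan X) (hY : IsCartan Y) : IsCartan ⁅X, Y⁆ := by
  classical
  refine isCartan_of_exists_vec fun p => ?_
  have hp := mem_frameAt (n := n) (m := m) (π := π) p.1.pt
  refine ⟨_, LocalFrame.subset _ hp, (frameAt n m π p.1.pt).vec ⁅X, Y⁆ p, fun f => ?_⟩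
  set F := frameAt n m π p.1.pt
  obtain ⟨Φ, h, H⟩ := F.exists_isOver hp ({f, ⁅X, Y⁆ f} ∪
    (Finset.univ.image fun i => ⁅X, Y⁆ (pM (F.b i))) ∪
    (Finset.univ.image fun α => ⁅X, Y⁆ (pullE (F.v α))))
  have h1 : F.vec ⁅X, Y⁆ p = F.evec Φ ⁅X, Y⁆ (F.c.total p.1.pt) := by
    rw [LocalFrame.evec_eq_vec _ h]
    rw [LocalFrame.vec, LocalFrame.vec]
    congr 1
    · exact Finset.sum_congr rfl fun i _ => by rw [(H (⁅X, Y⁆ (pM (F.b i))) (by simp)).1]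
    · exact Finset.sum_congr rfl fun α _ => by rw [(H (⁅X, Y⁆ (pullE (F.v α))) (by simp)).1]
  rw [h1, LocalFrame.evec_lie hX hY h, (H f (by simp)).2, (H (⁅X, Y⁆ f) (by simp)).1, ← ev_eq,
    LocalFrame.ev_lie hX hY h, cd_flatPt]

theorem IsCartan.sub {X Y : VF n m π} (hX : IsCartan X) (hY : IsCartan Y) : IsCartan (X - Y) :=
  isCartan_of_exists_vec fun p => by
    have hc := LocalFrame.subset _ (mem_frameAt (n := n) (m := m) (π := π) p.1.pt)
    obtain ⟨ν, hν⟩ := hX.exists_vec hc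
    obtain ⟨ν', hν'⟩ := hY.exists_vec hc
    refine ⟨_, hc, ν - ν', fun f => ?_⟩
    rw [ContinuousLinearMap.map_sub, ← hν, ← hν']
    rfl

namespace LocalFrame

variable {F : LocalFrame n m π} {X Y : VF n m π} {Φ : Rn n × Rn m → Rn m} {z : Rn n × Rn m}

theorem ev_fcForm (h : F.IsOver Φ z) (X : VF n m π) (f : smoothFc n m π) :
    ev F.c Φ (fcForm n m π X f) z = fderiv ℝ (ev F.c Φ f) z
      ((F.evec Φ X z).1, flatCoef Φ z (F.evec Φ X z).1) := by
  rw [ev_eq _ h.1, isFcForm_fcForm.eq_proj F (p := flatPt F.c Φ z h.1) h.2,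
    F.proj_apply (p := flatPt F.c Φ z h.1) h.2, hvec_flatPt, cd_flatPt, evec_eq_vec _ h]

theorem evec_fcForm (h : F.IsOver Φ z) (X : VF n m π) : F.evec Φ (fcForm n m π X) z =
    ((F.evec Φ X z).1, flatCoef Φ z (F.evec Φ X z).1) := by
  refine Prod.ext ?_ ?_
  · simp only [evec, fcForm_pM]
  · rw [evec]
    simp only [ev_fcForm h, fderiv_ev_v h]
    exact sum_ex _

end LocalFrame

/-- The connection is flat: the bracket of horizontal vector fields is horizontal. -/
theorem fcForm_lie (X Y : VF n m π) : fcForm n m π ⁅fcForm n m π X, fcForm n m π Y⁆ =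
    ⁅fcForm n m π X, fcForm n m π Y⁆ := by
  refine Derivation.ext fun f => Subtype.ext (funext fun p => ?_)
  refine (frameAt n m π p.1.pt).eq_of_ev (fun Φ z h => ?_) (mem_frameAt p.1.pt)
  set F := frameAt n m π p.1.pt
  have hX := isCartan_fcForm X
  have hY := isCartan_fcForm Y
  rw [LocalFrame.ev_fcForm h, LocalFrame.ev_apply (hX.lie hY) h]
  congr 1
  refine Prod.ext rfl (eq_of_vert_eq h.unit ?_)
  set ν := F.evec Φ ⁅fcForm n m π X, fcForm n m π Y⁆ z with hν
  -- a vector is horizontal if and only if it is annihilated by the derivative of `Φ`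
  have key : ∀ X : VF n m π, ∀ ζ, F.IsOver Φ ζ →
      fderiv ℝ Φ ζ (F.evec Φ (fcForm n m π X) ζ) = 0 := fun X ζ hζ => by
    rw [LocalFrame.evec_fcForm hζ]
    exact nab_flatCoef hζ.unit _
  have key2 : ∀ X Y : VF n m π, fderiv ℝ Φ z (fderiv ℝ (F.evec Φ (fcForm n m π X)) z
      (F.evec Φ (fcForm n m π Y) z)) = - fderiv ℝ (fderiv ℝ Φ) z (F.evec Φ (fcForm n m π Y) z)
        (F.evec Φ (fcForm n m π X) z) := by
    intro X Y
    have h1 : (fun ζ => fderiv ℝ Φ ζ (F.evec Φ (fcForm n m π X) ζ)) =ᶠ[𝓝 z] fun _ => 0 := by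
      filter_upwards [h.nhds] with ζ hζ using key X ζ hζ
    have h2 := h1.fderiv_eq (𝕜 := ℝ)
    rw [fderiv_clm_apply (differentiableAt_of_smooth (contDiffAt_fderiv h.contDiffAt))
      (differentiableAt_of_smooth (LocalFrame.contDiffAt_evec _ h)), fderiv_fun_const] at h2
    have h3 := congrArg (fun L : Rn n × Rn m →L[ℝ] Rn m => L (F.evec Φ (fcForm n m π Y) z)) h2
    simp only [add_apply, ContinuousLinearMap.comp_apply, ContinuousLinearMap.flip_apply,
      Pi.zero_apply, zero_apply] at h3
    exact eq_neg_of_add_eq_zero_left h3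
  have hs : IsSymmSndFDerivAt ℝ Φ z :=
    (eventually_contDiffAt_fin h.contDiffAt 2).self_of_nhds.isSymmSndFDerivAt (by simp)
  have h4 : fderiv ℝ Φ z ν = 0 := by
    rw [hν, LocalFrame.evec_lie hX hY h, ContinuousLinearMap.map_sub, key2, key2, hs.eq, sub_self]
  have h5 := nab_flatCoef h.unit ν.1
  rw [nab, fderiv_apply_eq Φ z] at h5
  have h6 := (fderiv_apply_eq Φ z ν.1 ν.2).symm.trans h4
  exact add_left_cancel (h5.trans h6.symm)

end FlatPoints


/-! ### The Frölicher–Nijenhuis differential of a flat connection -/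

section Algebra

variable {A : Type*} [CommRing A] [Algebra ℝ A] {U L : Derivation ℝ A A →ₗ[A] Derivation ℝ A A}
  {B : Set A}

theorem apply_eq_of_eq_on_base (hL : ∀ X : Derivation ℝ A A, (∀ b ∈ B, X b = 0) → L X = 0)
    {X Y : Derivation ℝ A A} (h : ∀ b ∈ B, X b = Y b) : L X = L Y := by
  rw [← sub_eq_zero, ← map_sub]
  exact hL _ fun b hb => by rw [Derivation.sub_apply, h b hb, sub_self]

/-- The differential of a horizontal `1`-form with vertical values. -/
theorem fnBracket₁_eq (hU₁ : ∀ X, ∀ b ∈ B, U X b = X b) (hU₂ : ∀ X, (∀ b ∈ B, X b = 0) → U X = 0)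
    (hL₁ : ∀ X, ∀ b ∈ B, L X b = 0) (hL₂ : ∀ X, (∀ b ∈ B, X b = 0) → L X = 0)
    (X Y : Derivation ℝ A A) :
    fnBracket₁ U L X Y = ⁅U X, L Y⁆ - ⁅U Y, L X⁆ - L ⁅U X, U Y⁆ - U (⁅L X, Y⁆ - ⁅L Y, X⁆) := by
  have h1 : ∀ X, U (L X) = 0 := fun X => hU₂ _ (hL₁ X)
  have h2 : L ⁅U X, U Y⁆ = L (⁅U X, Y⁆ - ⁅U Y, X⁆ - U ⁅X, Y⁆) := by
    refine apply_eq_of_eq_on_base hL₂ fun b hb => ?_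
    simp only [Derivation.sub_apply, Derivation.commutator_apply, hU₁ _ b hb]
    abel
  rw [fnBracket₁, h1, h2, map_sub L _ (U ⁅X, Y⁆)]
  abel

theorem fnBracket₀_base (hU₁ : ∀ X, ∀ b ∈ B, U X b = X b) {S : Derivation ℝ A A}
    (hS : ∀ b ∈ B, S b = 0) (X : Derivation ℝ A A) : ∀ b ∈ B, fnBracket₀ U S X b = 0 := by
  intro b hb
  show (⁅U X, S⁆ - U ⁅X, S⁆) b = 0
  simp only [Derivation.sub_apply, Derivation.commutator_apply, hU₁ _ b hb, hS b hb, map_zero,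
    sub_self]

theorem fnBracket₀_of_vertical (hU₂ : ∀ X, (∀ b ∈ B, X b = 0) → U X = 0) {S : Derivation ℝ A A}
    (hS : ∀ b ∈ B, S b = 0) {X : Derivation ℝ A A} (hX : ∀ b ∈ B, X b = 0) :
    fnBracket₀ U S X = 0 := by
  show ⁅U X, S⁆ - U ⁅X, S⁆ = 0
  rw [hU₂ X hX, zero_lie, hU₂, sub_zero]
  intro b hb
  rw [Derivation.commutator_apply, hS b hb, hX b hb, map_zero, map_zero, sub_zero]

/-- For a flat connection, `[[U, [[U, S]]]] = 0` for vertical `S`. -/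
theorem fnBracket₁_fnBracket₀ (hU₁ : ∀ X, ∀ b ∈ B, U X b = X b)
    (hU₂ : ∀ X, (∀ b ∈ B, X b = 0) → U X = 0) (hU₃ : ∀ X Y, U ⁅U X, U Y⁆ = ⁅U X, U Y⁆)
    {S : Derivation ℝ A A} (hS : ∀ b ∈ B, S b = 0) (X Y : Derivation ℝ A A) :
    fnBracket₁ U (fnBracket₀ U S) X Y = 0 := by
  have e : ∀ X, fnBracket₀ U S X = ⁅U X, S⁆ - U ⁅X, S⁆ := fun _ => rfl
  have hUU : ∀ X, U (U X) = U X := fun X => apply_eq_of_eq_on_base hU₂ (hU₁ X)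
  rw [fnBracket₁_eq hU₁ hU₂]
  · have h1 : U (⁅U X, U ⁅Y, S⁆⁆ - ⁅U Y, U ⁅X, S⁆⁆ - ⁅⁅U X, U Y⁆, S⁆ +
        (⁅fnBracket₀ U S X, Y⁆ - ⁅fnBracket₀ U S Y, X⁆)) = U 0 := by
      refine apply_eq_of_eq_on_base hU₂ fun b hb => ?_
      simp only [e, Derivation.sub_apply, Derivation.add_apply, Derivation.commutator_apply,
        hU₁ _ b hb, hS b hb, map_zero, Derivation.zero_apply, map_sub]
      abel
    rw [map_zero, map_add, map_sub, map_sub, hU₃, hU₃] at h1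
    have h2 : ⁅⁅U X, U Y⁆, S⁆ = ⁅U X, ⁅U Y, S⁆⁆ - ⁅U Y, ⁅U X, S⁆⁆ := lie_lie _ _ _
    refine Eq.trans ?_ (neg_eq_zero.2 h1)
    rw [e ⁅U X, U Y⁆, hU₃, h2, e Y, e X]
    simp only [lie_sub, map_sub]
    abel
  · exact fun X b hb => fnBracket₀_base hU₁ hS X b hb
  · exact fun X hX => fnBracket₀_of_vertical hU₂ hS hX

theorem fnBracket₀_zero : fnBracket₀ U 0 = 0 :=
  LinearMap.ext fun X => by
    show ⁅U X, (0 : Derivation ℝ A A)⁆ - U ⁅X, 0⁆ = 0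
    rw [lie_zero, lie_zero, map_zero, sub_zero]

end Algebra

section Complex

set_option linter.unusedSectionVars false

variable {n m : ℕ} {M E : Type*}
  [TopologicalSpace M] [ChartedSpace (Rn n) M] [IsManifold (IB n) ∞ M]
  [T2Space M] [SecondCountableTopology M]
  [TopologicalSpace E] [ChartedSpace (ModelProd (Rn n) (Rn m)) E]
  [IsManifold (IT n m) ∞ E] [T2Space E] [SecondCountableTopology E]
  {π : E → M} [hch : HasAdaptedCharts n m π] {S : VF n m π}

theorem dfc₀_apply (S X : VF n m π) :
    dfc₀ S X = ⁅fcForm n m π X, S⁆ - fcForm n m π ⁅X, S⁆ := rfl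

/-- The functions coming from the base. -/
def baseFun (n m : ℕ) {M E : Type*} [TopologicalSpace M] [ChartedSpace (Rn n) M]
    [TopologicalSpace E] [ChartedSpace (ModelProd (Rn n) (Rn m)) E] (π : E → M) :
    Set (smoothFc n m π) := Set.range fun g => res (pullM g)

theorem isVertical_iff {X : VF n m π} : IsVertical X ↔ ∀ b ∈ baseFun n m π, X b = 0 :=
  ⟨fun h _ ⟨g, hg⟩ => hg ▸ h g, fun h g => h _ ⟨g, rfl⟩⟩

theorem fcForm_base (X : VF n m π) : ∀ b ∈ baseFun n m π, fcForm n m π X b = X b := by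
  rintro _ ⟨g, rfl⟩
  exact fcForm_pM X g

theorem fcForm_zero (X : VF n m π) (h : ∀ b ∈ baseFun n m π, X b = 0) : fcForm n m π X = 0 :=
  fcForm_of_isVertical (isVertical_iff.2 h)

theorem dfc₁_dfc₀ (hS : IsVertical S) (X Y : VF n m π) : dfc₁ (dfc₀ S) X Y = 0 :=
  fnBracket₁_fnBracket₀ (U := fcForm n m π) (B := baseFun n m π) fcForm_base fcForm_zero fcForm_lie
    (isVertical_iff.1 hS) X Y

theorem dfc₀_mem_V1 (hS : S ∈ V0 n m π) : dfc₀ S ∈ V1 n m π := by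
  have hS2 := isVertical_iff.1 hS.2
  refine ⟨fun X => ⟨?_, ?_⟩, fun X hX => ?_⟩
  · exact ((isCartan_fcForm X).lie hS.1).sub (isCartan_fcForm _)
  · exact isVertical_iff.2 (fnBracket₀_base (U := fcForm n m π) (B := baseFun n m π)
      fcForm_base hS2 X)
  · exact fnBracket₀_of_vertical (U := fcForm n m π) (B := baseFun n m π) fcForm_zero hS2
      (isVertical_iff.1 hX)

namespace LocalFrame

variable {F : LocalFrame n m π} {p : Efc n m π}

theorem fcForm_X (hp : p.1.pt ∈ F.N) (i : Fin n) (f : smoothFc n m π) :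
    (fcForm n m π (F.X i) f).1 p = (F.X i f).1 p := by
  rw [F.fcForm_apply hp]
  simp only [F.X_b hp]
  rw [Finset.sum_eq_single i]
  · simp [ex]
  · intro j _ hj
    simp [ex, hj]
  · simp

/-- Vector fields annihilate the derivatives of the coordinates along the frame. -/
theorem apply_X_b (hp : p.1.pt ∈ F.N) (X : VF n m π) (i j : Fin n) :
    (X (F.X i (pM (F.b j)))).1 p = 0 := by
  have h1 := X.congr_nhds (p := p) (g := algebraMap ℝ (smoothFc n m π) ((ex i : Rn n) j))
    (F.mem_nhds hp) (fun q hq => F.X_b hq i j)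
  rw [h1, Derivation.map_algebraMap]
  rfl

theorem lie_apply (X Y : VF n m π) (f : smoothFc n m π) (p : Efc n m π) :
    (⁅X, Y⁆ f).1 p = (X (Y f)).1 p - (Y (X f)).1 p := by
  rw [Derivation.commutator_apply]
  rfl

/-- The bracket of a vertical field with the frame is vertical. -/
theorem fcForm_lie_X (hS : IsVertical S) (hp : p.1.pt ∈ F.N) (i : Fin n) (f : smoothFc n m π) :
    (fcForm n m π ⁅F.X i, S⁆ f).1 p = 0 := by
  rw [F.fcForm_apply hp]
  refine Finset.sum_eq_zero fun j _ => ?_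
  have h1 : S (pM (F.b j)) = 0 := hS _
  rw [lie_apply, F.apply_X_b hp, h1, map_zero, sub_zero]
  exact zero_mul _

theorem lie_fcForm_X (hp : p.1.pt ∈ F.N) (i : Fin n) (f : smoothFc n m π) :
    (⁅fcForm n m π (F.X i), S⁆ f).1 p = (⁅F.X i, S⁆ f).1 p := by
  rw [lie_apply, lie_apply, F.fcForm_X hp,
    S.congr_nhds (F.mem_nhds hp) (fun q hq => F.fcForm_X hq i f)]

theorem dfc₀_X (hS : IsVertical S) (hp : p.1.pt ∈ F.N) (i : Fin n) (f : smoothFc n m π) :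
    (dfc₀ S (F.X i) f).1 p = (⁅F.X i, S⁆ f).1 p := by
  rw [dfc₀_apply, ← lie_fcForm_X hp]
  have h1 := fcForm_lie_X hS hp i f
  show (⁅fcForm n m π (F.X i), S⁆ f).1 p - (fcForm n m π ⁅F.X i, S⁆ f).1 p = _
  rw [h1, sub_zero]

variable {Φ : Rn n × Rn m → Rn m} {z : Rn n × Rn m}

theorem evec_fst (hS : IsVertical S) (h : F.IsOver Φ z) : (F.evec Φ S z).1 = 0 := by
  show ∑ i, ev F.c Φ (S (pM (F.b i))) z • ex i = (0 : Rn n)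
  refine Finset.sum_eq_zero fun i _ => ?_
  have h1 : S (pM (F.b i)) = 0 := hS _
  rw [ev_eq _ h.1, h1]
  exact zero_smul _ _

theorem evec_eq_snd (hS : IsVertical S) (h : F.IsOver Φ z) :
    F.evec Φ S z = (0, (F.evec Φ S z).2) := Prod.ext (evec_fst hS h) rfl

/-- The bracket of a vertical field with the frame, along a flat connection. -/
theorem evec_lie_X (hS : S ∈ V0 n m π) (h : F.IsOver Φ z) (i : Fin n) :
    F.evec Φ ⁅F.X i, S⁆ z = (0, fderiv ℝ (fun ζ => (F.evec Φ S ζ).2) z (ex i, flatCoef Φ z (ex i)) -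
      fderiv ℝ (flatCoef Φ) z (0, (F.evec Φ S z).2) (ex i)) := by
  have hd := differentiableAt_of_smooth (contDiffAt_evec S h)
  have h1 : F.evec Φ (F.X i) =ᶠ[𝓝 z] fun ζ => (ex i, flatCoef Φ ζ (ex i)) := by
    filter_upwards [h.nhds] with ζ hζ using evec_X hζ i
  have h2 : F.evec Φ S =ᶠ[𝓝 z] fun ζ => (0, (F.evec Φ S ζ).2) := by
    filter_upwards [h.nhds] with ζ hζ using evec_eq_snd hS.2 hζ
  have h3 : HasFDerivAt (fun ζ => (ex i, flatCoef Φ ζ (ex i))) (ContinuousLinearMap.prod 0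
      ((fderiv ℝ (flatCoef Φ) z).flip (ex i))) z :=
    (hasFDerivAt_const (ex i) z).prodMk (by
      have := (differentiableAt_of_smooth h.contDiffAt_flatCoef).hasFDerivAt.clm_apply
        (hasFDerivAt_const (ex i : Rn n) z)
      simpa using this)
  have h4 : HasFDerivAt (fun ζ => ((0 : Rn n), (F.evec Φ S ζ).2)) (ContinuousLinearMap.prod 0
      (fderiv ℝ (fun ζ => (F.evec Φ S ζ).2) z)) z :=
    (hasFDerivAt_const (0 : Rn n) z).prodMk hd.snd.hasFDerivAt
  rw [evec_lie (F.isCartan_X i) hS.1 h, h1.fderiv_eq, h2.fderiv_eq, h3.fderiv, h4.fderiv,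
    evec_X h, h2.eq_of_nhds]
  simp

/-- Vertical Cartan fields which commute with the horizontal fields are zero. -/
theorem eq_zero_of_lie_X (hn : 1 ≤ n) (hS : S ∈ V0 n m π) {N : Set E} (hN : IsOpen N)
    (hNF : N ⊆ F.N) (h : ∀ i f (p : Efc n m π), p.1.pt ∈ N → (⁅F.X i, S⁆ f).1 p = 0)
    (hp : p.1.pt ∈ N) (f : smoothFc n m π) : (S f).1 p = 0 := by
  have hO : IsOpen (F.c.total.target ∩ F.c.total.symm ⁻¹' N) :=
    F.c.total.isOpen_inter_preimage_symm hN
  have hover : ∀ {Φ z}, Subm (F.c.total.target ∩ F.c.total.symm ⁻¹' N) Φ z → F.IsOver Φ z :=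
    fun h => ⟨⟨h.1.1, h.2⟩, hNF h.1.2⟩
  obtain ⟨Φ, hΦ, H⟩ := F.exists_isOver (hNF hp) {S f}
  rw [(H _ (by simp)).1, ← ev_eq, ev_apply hS.1 hΦ, evec_eq_snd hS.2 hΦ]
  suffices h0 : (F.evec Φ S (F.c.total p.1.pt)).2 = 0 by
    rw [h0]
    exact ContinuousLinearMap.map_zero _
  refine eq_zero_of_commute (S := fun V z => ∑ α, along F.c (S (pullE (F.v α))) V z • ex α)
    ⟨0, hn⟩ hO ?_ ?_ ?_ ⟨⟨hΦ.1.1, ?_⟩, hΦ.1.2⟩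
  · intro V W z hVW
    simp only [along, jet_congr hVW]
  · exact fun Φ z hz => (differentiableAt_of_smooth (contDiffAt_evec S (hover hz))).snd
  · intro Φ z hz a
    have h1 : ∀ i, fderiv ℝ (fun ζ => (F.evec Φ S ζ).2) z (ex i, flatCoef Φ z (ex i)) =
        fderiv ℝ (flatCoef Φ) z (0, (F.evec Φ S z).2) (ex i) := by
      intro i
      have h2 := evec_lie_X hS (hover hz) i
      have h3 : F.evec Φ ⁅F.X i, S⁆ z = 0 := by
        have hpt : (flatPt F.c Φ z (hover hz).1).1.pt ∈ N := hz.1.2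
        rw [evec_eq_vec _ (hover hz), vec]
        simp only [h i _ _ hpt, zero_smul, Finset.sum_const_zero]
        rfl
      rw [h3] at h2
      exact (sub_eq_zero.1 (congrArg Prod.snd h2).symm)
    have h5 : ((fderiv ℝ (fun ζ => (F.evec Φ S ζ).2) z).comp
        ((ContinuousLinearMap.id ℝ (Rn n)).prod (flatCoef Φ z))) =
        fderiv ℝ (flatCoef Φ) z (0, (F.evec Φ S z).2) := by
      rw [clm_eq_sum (fderiv ℝ (flatCoef Φ) z (0, (F.evec Φ S z).2)), clm_eq_sum
        ((fderiv ℝ (fun ζ => (F.evec Φ S ζ).2) z).comp _)]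
      exact Finset.sum_congr rfl fun i _ => congrArg _ (h1 i)
    exact congrArg (fun L => L a) h5
  · rw [Set.mem_preimage, F.c.total.left_inv (F.subset (hNF hp))]
    exact hp

/-- The local form of acyclicity in degree zero. -/
theorem eq_zero_of_dfc₀ (hn : 1 ≤ n) (hS : S ∈ V0 n m π) {N : Set E} (hN : IsOpen N)
    (hNF : N ⊆ F.N) (h : ∀ X f (p : Efc n m π), p.1.pt ∈ N → (dfc₀ S X f).1 p = 0)
    (hp : p.1.pt ∈ N) (f : smoothFc n m π) : (S f).1 p = 0 :=
  F.eq_zero_of_lie_X hn hS hN hNF (fun i f _ hp => by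
    rw [← dfc₀_X hS.2 (hNF hp)]
    exact h _ f _ hp) hp f

end LocalFrame

theorem eq_zero_of_dfc₀_eq_zero (hn : 1 ≤ n) (hS : S ∈ V0 n m π) (h : dfc₀ S = 0) : S = 0 :=
  Derivation.ext fun f => Subtype.ext (funext fun p =>
    (frameAt n m π p.1.pt).eq_zero_of_dfc₀ hn hS (frameAt n m π p.1.pt).isOpen subset_rfl
      (fun X f p _ => by rw [h]; rfl) (mem_frameAt _) f)

theorem zero_mem_V0 : (0 : VF n m π) ∈ V0 n m π :=
  ⟨isCartan_of_exists_vec fun p => by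
    obtain ⟨c, hc⟩ := hch.exists_chart p.1.pt
    exact ⟨c, hc, 0, fun f => ((cd c p f).map_zero).symm⟩, fun g => rfl⟩

theorem dfc₀_zero : dfc₀ (0 : VF n m π) = 0 :=
  fnBracket₀_zero (U := fcForm n m π)

end Complex


/-! ### Local primitives -/

section LocalPrimitive

variable {n m k : ℕ} {O : Set (Rn n × Rn m)}
  {W : (Rn n × Rn m) × Jet k (Rn n × Rn m) (Rn n →L[ℝ] Rn m) → (Rn n →L[ℝ] Rn m)}

theorem bilin_ext {B B' : Rn n →L[ℝ] Rn n →L[ℝ] Rn m}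
    (h : ∀ i j, B (ex i) (ex j) = B' (ex i) (ex j)) : B = B' := by
  have h1 : ∀ i, B (ex i) = B' (ex i) := fun i => by
    rw [clm_eq_sum (B (ex i)), clm_eq_sum (B' (ex i))]
    exact Finset.sum_congr rfl fun j _ => by rw [h]
  rw [clm_eq_sum B, clm_eq_sum B']
  exact Finset.sum_congr rfl fun i _ => by rw [h1]

/-- A vertical `1`-form along flat connections whose components `W_i` satisfy
`[X_i, W_j] = [X_j, W_i]` is locally the differential of a vertical field. -/
theorem exists_local_primitive (hn : 2 ≤ n) (hO : IsOpen O) (hW : ContDiffOn ℝ ∞ W (O ×ˢ Set.univ))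
    (hcl : ∀ Φ z, Subm O Φ z → ∀ i j : Fin n,
      fderiv ℝ (fun ζ => W (ζ, jet k (flatCoef Φ) ζ)) z (ex i, flatCoef Φ z (ex i)) (ex j) -
        fderiv ℝ (flatCoef Φ) z (0, W (z, jet k (flatCoef Φ) z) (ex j)) (ex i) =
      fderiv ℝ (fun ζ => W (ζ, jet k (flatCoef Φ) ζ)) z (ex j, flatCoef Φ z (ex j)) (ex i) -
        fderiv ℝ (flatCoef Φ) z (0, W (z, jet k (flatCoef Φ) z) (ex i)) (ex j)) :
    ∃ S : (Rn n × Rn m) × Jet (k + 1 + (k + 1) + 1) (Rn n × Rn m) (Rn n →L[ℝ] Rn m) → Rn m,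
      (∀ p, p.1 ∈ O → ContDiffAt ℝ ∞ S p) ∧ ∀ Φ z, Subm O Φ z → ∀ a,
        fderiv ℝ (fun ζ => S (ζ, jet (k + 1 + (k + 1) + 1) (flatCoef Φ) ζ)) z
          (a, flatCoef Φ z a) - fderiv ℝ (flatCoef Φ) z
            (0, S (z, jet (k + 1 + (k + 1) + 1) (flatCoef Φ) z)) a =
          W (z, jet k (flatCoef Φ) z) a := by
  have hg := openGood_subm (n := n) (m := m) hO
  have hWat : ∀ z w, z ∈ O → ContDiffAt ℝ ∞ W (z, w) := fun z w hz =>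
    hW.contDiffAt ((hO.prod isOpen_univ).mem_nhds ⟨hz, trivial⟩)
  have hWs : ∀ Φ z, Subm O Φ z → ContDiffAt ℝ ∞ (fun ζ => W (ζ, jet k (flatCoef Φ) ζ)) z :=
    fun Φ z h => ContDiffAt.comp z (g := W) (f := fun ζ => (ζ, jet k (flatCoef Φ) ζ))
      (hWat z _ h.1) (contDiffAt_id.prodMk (contDiffAt_jet (h.smoothNear_flatCoef hO).contDiffAt))
  have h1 : IsJetOp (1 + k) (Subm O) (fun Φ z => W (z, jet k (flatCoef Φ) z)) :=
    IsJetOp.comp_op (Z := Rn n × Rn m) (T := Rn m) hg (N' := fun V z => W (z, jet k V z))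
      (good' := fun _ z => z ∈ O) ⟨W, fun V z hz => ⟨hWat z _ hz, rfl⟩⟩ isJetOp_flatCoef
      fun Φ z h => h.1
  have h2 : IsJetOp (k + 1) (Subm O)
      (fun Φ z => (vert Φ z).comp (W (z, jet k (flatCoef Φ) z))) :=
    ((isJetOp_vert.mono_good fun _ _ h => h.2.1).mono (by omega)).bilin (h1.mono (by omega))
      (ContinuousLinearMap.compL ℝ (Rn n) (Rn m) (Rn m))
  obtain ⟨G, hG⟩ := h2
  have hGe : ∀ Φ z, Subm O Φ z → (fun ζ => G (ζ, jet (k + 1) Φ ζ)) =ᶠ[𝓝 z]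
      fun ζ => (vert Φ ζ).comp (W (ζ, jet k (flatCoef Φ) ζ)) := fun Φ z h => by
    filter_upwards [hg.nhds h] with ζ hζ using (hG Φ ζ hζ).2.symm
  have hGd : ∀ Φ z, Subm O Φ z → ∀ a b, fderiv ℝ (fun ζ => G (ζ, jet (k + 1) Φ ζ)) z
      (a, flatCoef Φ z a) b = vert Φ z
        (fderiv ℝ (fun ζ => W (ζ, jet k (flatCoef Φ) ζ)) z (a, flatCoef Φ z a) b -
        fderiv ℝ (flatCoef Φ) z (0, W (z, jet k (flatCoef Φ) z) b) a) := by
    intro Φ z h a b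
    have hd := (differentiableAt_of_smooth (hWs Φ z h)).hasFDerivAt
    have h3 : HasFDerivAt (fun ζ => W (ζ, jet k (flatCoef Φ) ζ) b)
        ((fderiv ℝ (fun ζ => W (ζ, jet k (flatCoef Φ) ζ)) z).flip b) z := by
      simpa using hd.clm_apply (hasFDerivAt_const b z)
    have h4 := nab_vert hO h h3.differentiableAt a
    rw [h3.fderiv] at h4
    refine Eq.trans ?_ h4
    have h5 := ((differentiableAt_of_smooth h.2.1.vert.contDiffAt).clm_comp
      hd.differentiableAt).hasFDerivAt.clm_apply (hasFDerivAt_const b z)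
    rw [(hGe Φ z h).fderiv_eq, nab]
    refine Eq.trans ?_ (congrArg (fun L : Rn n × Rn m →L[ℝ] Rn m => L (a, flatCoef Φ z a)) h5.fderiv).symm
    simp
  have hcf : IsClosedFamily O G := by
    refine ⟨hO, fun Φ z h => (hG Φ z h).1, fun Φ z h a b => ?_, fun Φ z h κ hκ hu a => ?_⟩
    · rw [hGd Φ z h, hGd Φ z h]
      congr 1
      -- a bilinear form is symmetric if it is so on the coordinate vectors
      let D₁ : Rn n →L[ℝ] Rn n →L[ℝ] Rn m :=
        (fderiv ℝ (fun ζ => W (ζ, jet k (flatCoef Φ) ζ)) z).comp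
          ((ContinuousLinearMap.id ℝ (Rn n)).prod (flatCoef Φ z))
      let D₂ : Rn n →L[ℝ] Rn n →L[ℝ] Rn m := (fderiv ℝ (flatCoef Φ) z).comp
        ((ContinuousLinearMap.inr ℝ (Rn n) (Rn m)).comp (W (z, jet k (flatCoef Φ) z)))
      have h6 : D₁ - D₂.flip = (D₁ - D₂.flip).flip := bilin_ext fun i j => hcl Φ z h i j
      exact congrArg (fun B => B a b) h6
    · rw [← (hG _ z (h.comp hκ hu)).2, ← (hG Φ z h).2]
      have h7 : flatCoef (fun ζ => κ (Φ ζ)) =ᶠ[𝓝 z] flatCoef Φ := by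
        filter_upwards [hg.nhds h, h.2.1.contDiffAt.continuousAt.eventually
          (hκ.eventually_nhds.and ((Units.isOpen.mem_nhds hu |> fun hU =>
            (contDiffAt_fderiv hκ.contDiffAt).continuousAt.eventually hU)))] with ζ h8 h9
        exact flatCoef_comp h8 h9.1 h9.2
      show ((vert (fun ζ => κ (Φ ζ)) z).comp
        (W (z, jet k (flatCoef fun ζ => κ (Φ ζ)) z))) a = _
      rw [jet_congr h7, vert_comp (differentiableAt_of_smooth hκ.contDiffAt)
        (differentiableAt_of_smooth h.2.1.contDiffAt)]
      rfl
  obtain ⟨S, hS, hSG⟩ := exists_vertical_primitive hcf hn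
  refine ⟨S, hS, fun Φ z h a => eq_of_vert_eq h.2.2 ?_⟩
  have hSd : DifferentiableAt ℝ (fun ζ => S (ζ, jet (k + 1 + (k + 1) + 1) (flatCoef Φ) ζ)) z :=
    differentiableAt_of_smooth (ContDiffAt.comp z (g := S)
      (f := fun ζ => (ζ, jet (k + 1 + (k + 1) + 1) (flatCoef Φ) ζ)) (hS _ h.1)
      (contDiffAt_id.prodMk (contDiffAt_jet (h.smoothNear_flatCoef hO).contDiffAt)))
  rw [← nab_vert hO h hSd a, hSG Φ z h a, ← (hG Φ z h).2]
  rfl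

end LocalPrimitive


/-! ### Primitives of closed forms near a point -/

section PrimitiveNear

set_option linter.unusedSectionVars false

variable {n m : ℕ} {M E : Type*}
  [TopologicalSpace M] [ChartedSpace (Rn n) M] [IsManifold (IB n) ∞ M]
  [T2Space M] [SecondCountableTopology M]
  [TopologicalSpace E] [ChartedSpace (ModelProd (Rn n) (Rn m)) E]
  [IsManifold (IT n m) ∞ E] [T2Space E] [SecondCountableTopology E]
  {π : E → M} [hch : HasAdaptedCharts n m π] {Ω : VF n m π →ₗ[smoothFc n m π] VF n m π}

namespace LocalFrame

variable {F : LocalFrame n m π} {p : Efc n m π}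

/-- A horizontal `1`-form is determined by its values on a frame. -/
theorem apply_eq_sum {T : VF n m π →ₗ[smoothFc n m π] VF n m π} (hT : ∀ X, IsVertical X → T X = 0)
    (hp : p.1.pt ∈ F.N) (X : VF n m π) (f : smoothFc n m π) :
    (T X f).1 p = ∑ i, (X (pM (F.b i))).1 p * (T (F.X i) f).1 p := by
  have h1 : T (F.proj X) = ∑ i, X (pM (F.b i)) • T (F.X i) :=
    (map_sum T _ _).trans (Finset.sum_congr rfl fun i _ => map_smul T _ _)
  have h2 := apply_eq_of_eq_on (X := X) (Y := F.proj X) T (F.mem_nhds hp) hT (fun g q hq => by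
    rw [← isFcForm_fcForm.eq_proj F hq, fcForm_pM]) f
  rw [h2, h1, sum_vf_apply]
  rfl

/-- Closedness of a horizontal `1`-form with vertical values, in a frame. -/
theorem lie_X_symm (hΩ : Ω ∈ V1 n m π) (hd : ∀ X Y, dfc₁ Ω X Y = 0) (hp : p.1.pt ∈ F.N)
    (i j : Fin n) (f : smoothFc n m π) :
    (⁅F.X i, Ω (F.X j)⁆ f).1 p = (⁅F.X j, Ω (F.X i)⁆ f).1 p := by
  have h1 := fnBracket₁_eq (U := fcForm n m π) (L := Ω) (B := baseFun n m π) fcForm_base fcForm_zero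
    (fun X => isVertical_iff.1 (hΩ.1 X).2) (fun X hX => hΩ.2 X (isVertical_iff.2 hX)) (F.X i) (F.X j)
  have h2 := congrArg (fun Z : VF n m π => (Z f).1 p) (h1.symm.trans (hd (F.X i) (F.X j)))
  have h3 : (⁅fcForm n m π (F.X i), Ω (F.X j)⁆ f).1 p - (⁅fcForm n m π (F.X j), Ω (F.X i)⁆ f).1 p -
      (Ω ⁅fcForm n m π (F.X i), fcForm n m π (F.X j)⁆ f).1 p -
      (fcForm n m π (⁅Ω (F.X i), F.X j⁆ - ⁅Ω (F.X j), F.X i⁆) f).1 p = 0 := h2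
  have h4 : (Ω ⁅fcForm n m π (F.X i), fcForm n m π (F.X j)⁆ f).1 p = 0 := by
    rw [apply_eq_sum hΩ.2 hp]
    refine Finset.sum_eq_zero fun l _ => ?_
    rw [lie_apply, fcForm_pM, fcForm_pM, apply_X_b hp, apply_X_b hp, sub_zero, zero_mul]
  have hv : ∀ i j l, (⁅Ω (F.X i), F.X j⁆ (pM (F.b l))).1 p = 0 := fun i j l => by
    have h5 : Ω (F.X i) (pM (F.b l)) = 0 := (hΩ.1 _).2 _
    rw [lie_apply, apply_X_b hp, h5, map_zero, zero_sub]
    exact neg_zero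
  have h5 : (fcForm n m π (⁅Ω (F.X i), F.X j⁆ - ⁅Ω (F.X j), F.X i⁆) f).1 p = 0 := by
    rw [F.fcForm_apply hp]
    refine Finset.sum_eq_zero fun l _ => ?_
    have h6 : ((⁅Ω (F.X i), F.X j⁆ - ⁅Ω (F.X j), F.X i⁆ : VF n m π) (pM (F.b l))).1 p =
      (⁅Ω (F.X i), F.X j⁆ (pM (F.b l))).1 p - (⁅Ω (F.X j), F.X i⁆ (pM (F.b l))).1 p := rfl
    rw [h6, hv, hv, sub_zero, zero_mul]
  rw [h4, h5, sub_zero, sub_zero, lie_fcForm_X hp, lie_fcForm_X hp] at h3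
  exact sub_eq_zero.1 h3

/-- Closed horizontal `1`-forms with vertical values have primitives near each point. The order
of the primitive is controlled by that of the form. -/
theorem exists_primitive_near (hn : 2 ≤ n) (hΩ : Ω ∈ V1 n m π) (hd : ∀ X Y, dfc₁ Ω X Y = 0) {e : E}
    (he : e ∈ F.N) {k : ℕ} (hk : ∀ i α, OrdAt k (Ω (F.X i) (pullE (F.v α))).1 e) :
    ∃ T ∈ V0 n m π, (∃ N, IsOpen N ∧ e ∈ N ∧ N ⊆ F.N ∧
      ∀ X f (p : Efc n m π), p.1.pt ∈ N → (dfc₀ T X f).1 p = (Ω X f).1 p) ∧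
      ∀ f k' e', OrdAt k' f.1 e' → OrdAt (max (k + 1 + (k + 1) + 1) (k' + 1)) (T f).1 e' := by
  classical
  choose O' hO' heO' hsub G hG using fun i α => (hk i α).chart (F.subset he)
  set O : Set (Rn n × Rn m) := (⋂ i, ⋂ α, O' i α) ∩
    (F.c.total.target ∩ F.c.total.symm ⁻¹' F.N) with hOdef
  have hO : IsOpen O := (isOpen_iInter_of_finite fun i => isOpen_iInter_of_finite fun α =>
    hO' i α).inter (F.c.total.isOpen_inter_preimage_symm F.isOpen)
  have heO : F.c.total e ∈ O := ⟨Set.mem_iInter₂.2 fun i α => heO' i α, F.N_nhds_total he |>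
    fun h => mem_of_mem_nhds h⟩
  have hOO : ∀ {z}, z ∈ O → ∀ i α, z ∈ O' i α := fun hz i α => Set.mem_iInter₂.1 hz.1 i α
  have hover : ∀ {Φ z}, Subm O Φ z → F.IsOver Φ z := fun h => ⟨⟨h.1.2.1, h.2⟩, h.1.2.2⟩
  -- the form in coordinates, with the components `W(∂/∂x_i) = Ω(X_i)`
  let W : (Rn n × Rn m) × Jet k (Rn n × Rn m) (Rn n →L[ℝ] Rn m) → (Rn n →L[ℝ] Rn m) := fun p =>
    ∑ i, ContinuousLinearMap.smulRightL ℝ (Rn n) (Rn m) (EuclideanSpace.proj i : Rn n →L[ℝ] ℝ)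
      (∑ α, G i α p • ex α)
  have hW : ContDiffOn ℝ ∞ W (O ×ˢ Set.univ) := by
    refine ContDiffOn.sum fun i _ => ?_
    refine (ContinuousLinearMap.contDiff _).comp_contDiffOn (ContDiffOn.sum fun α _ => ?_)
    exact ((hG i α).1.mono (Set.prod_mono_left fun z hz => hOO hz i α)).smul contDiffOn_const
  have hWX : ∀ Φ z, Subm O Φ z → ∀ i,
      W (z, jet k (flatCoef Φ) z) (ex i) = (F.evec Φ (Ω (F.X i)) z).2 := by
    intro Φ z h i
    have h1 : W (z, jet k (flatCoef Φ) z) (ex i) =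
        ∑ α, G i α (z, jet k (flatCoef Φ) z) • ex α := by
      simp only [W, sum_apply, ContinuousLinearMap.smulRightL_apply_apply]
      rw [Finset.sum_eq_single i]
      · simp [ex]
      · intro j _ hj
        simp [ex, hj]
      · simp
    rw [h1, evec]
    refine Finset.sum_congr rfl fun α _ => ?_
    rw [ev_eq _ (hover h).1, (hG i α).apply_flatPt (hover h).1 (hOO h.1 i α)]
  have hWd : ∀ Φ z, Subm O Φ z → ∀ i u,
      fderiv ℝ (fun ζ => W (ζ, jet k (flatCoef Φ) ζ)) z u (ex i) =
        fderiv ℝ (fun ζ => (F.evec Φ (Ω (F.X i)) ζ).2) z u := by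
    intro Φ z h i u
    have h1 : ContDiffAt ℝ ∞ (fun ζ => W (ζ, jet k (flatCoef Φ) ζ)) z :=
      ContDiffAt.comp z (g := W) (f := fun ζ => (ζ, jet k (flatCoef Φ) ζ))
        (hW.contDiffAt ((hO.prod isOpen_univ).mem_nhds ⟨h.1, trivial⟩))
        (contDiffAt_id.prodMk (contDiffAt_jet (h.smoothNear_flatCoef hO).contDiffAt))
    have h2 := (differentiableAt_of_smooth h1).hasFDerivAt.clm_apply
      (hasFDerivAt_const (ex i : Rn n) z)
    have h3 : (fun ζ => (F.evec Φ (Ω (F.X i)) ζ).2) =ᶠ[𝓝 z]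
        fun ζ => W (ζ, jet k (flatCoef Φ) ζ) (ex i) := by
      filter_upwards [(openGood_subm hO).nhds h] with ζ hζ using (hWX Φ ζ hζ i).symm
    rw [h3.fderiv_eq, h2.fderiv]
    simp
  have hcl : ∀ Φ z, Subm O Φ z → ∀ i j : Fin n,
      fderiv ℝ (fun ζ => W (ζ, jet k (flatCoef Φ) ζ)) z (ex i, flatCoef Φ z (ex i)) (ex j) -
        fderiv ℝ (flatCoef Φ) z (0, W (z, jet k (flatCoef Φ) z) (ex j)) (ex i) =
      fderiv ℝ (fun ζ => W (ζ, jet k (flatCoef Φ) ζ)) z (ex j, flatCoef Φ z (ex j)) (ex i) -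
        fderiv ℝ (flatCoef Φ) z (0, W (z, jet k (flatCoef Φ) z) (ex i)) (ex j) := by
    intro Φ z h i j
    rw [hWd Φ z h, hWd Φ z h, hWX Φ z h, hWX Φ z h]
    have h1 := evec_lie_X (hΩ.1 (F.X j)) (hover h) i
    have h2 := evec_lie_X (hΩ.1 (F.X i)) (hover h) j
    have h3 : F.evec Φ ⁅F.X i, Ω (F.X j)⁆ z = F.evec Φ ⁅F.X j, Ω (F.X i)⁆ z := by
      rw [evec_eq_vec _ (hover h), evec_eq_vec _ (hover h), vec, vec]
      simp only [F.lie_X_symm hΩ hd (p := flatPt F.c Φ z (hover h).1) (hover h).2 i j]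
    exact congrArg Prod.snd (h1.symm.trans (h3.trans h2))
  obtain ⟨S, hS, hSW⟩ := exists_local_primitive hn hO hW hcl
  have hnhds : F.c.total.source ∩ F.c.total ⁻¹' O ∈ 𝓝 e :=
    (F.c.total.isOpen_inter_preimage hO).mem_nhds ⟨F.subset he, heO⟩
  obtain ⟨χ, h1, h0⟩ := exists_bump (IT n m) hnhds
  -- the cutoff is `1` near `e`; elsewhere the field plays no role
  let D : CartanField n m π :=
    { c := F.c
      O := O
      isOpen := hO
      χ := χ
      tsupport_subset := h0
      K := k + 1 + (k + 1) + 1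
      ν := fun p => (0, S p)
      smooth := fun p hp => (contDiffAt_const.prodMk (hS p hp.1)).contDiffWithinAt }
  have hTapp : ∀ f (p : Efc n m π), (D.toVF f).1 p = χ p.1.pt * cd F.c p f
      (0, S (F.c.total p.1.pt, p.1.coefJet F.c (k + 1 + (k + 1) + 1))) := D.toVF_apply
  have hT : D.toVF ∈ V0 n m π := by
    refine ⟨D.isCartan, fun g => Subtype.ext (funext fun p => ?_)⟩
    rw [hTapp]
    by_cases h : χ p.1.pt = 0
    · rw [h, zero_mul]
      rfl
    · have h2 := cd_pM g (D.mem_source h)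
        (0, S (F.c.total p.1.pt, p.1.coefJet F.c (k + 1 + (k + 1) + 1)))
      rw [ContinuousLinearMap.map_zero] at h2
      exact (congrArg (χ p.1.pt * ·) h2).trans (mul_zero _)
  obtain ⟨N, hN, hNo, heN⟩ := eventually_nhds_iff.1 (h1.and (Filter.eventually_mem_set.2 hnhds))
  have hNF : N ⊆ F.N := fun e' he' => by
    have := (hN e' he').2.2.2.2
    rwa [Set.mem_preimage, F.c.total.left_inv (hN e' he').2.1] at this
  have hTe : ∀ Φ z, Subm O Φ z → F.c.total.symm z ∈ N → F.evec Φ D.toVF z =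
      (0, S (z, jet (k + 1 + (k + 1) + 1) (flatCoef Φ) z)) := by
    intro Φ z h hz
    rw [evec_eq_vec _ (hover h)]
    refine F.vec_eq (p := flatPt F.c Φ z (hover h).1) (hover h).2 fun f => ?_
    rw [hTapp, coefJet_flatPt, pt_flatPt, F.c.total.right_inv h.1.2.1, (hN _ hz).1, Pi.one_apply,
      one_mul]
  have hTd : ∀ i f (p : Efc n m π), p.1.pt ∈ N →
      (⁅F.X i, D.toVF⁆ f).1 p = (Ω (F.X i) f).1 p := by
    intro i f p hp
    obtain ⟨Φ, h, H⟩ := F.exists_isOver (hNF hp) {f, ⁅F.X i, D.toVF⁆ f, Ω (F.X i) f}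
    rw [(H (⁅F.X i, D.toVF⁆ f) (by simp)).1, (H (Ω (F.X i) f) (by simp)).1, ← ev_eq, ← ev_eq,
      ev_apply ((F.isCartan_X i).lie hT.1) h, ev_apply (hΩ.1 _).1 h]
    congr 1
    set z := F.c.total p.1.pt with hz
    have hO2 : Subm O Φ z := ⟨(hN _ hp).2.2, h.1.2⟩
    have hzN : F.c.total.symm z ∈ N := by rwa [hz, F.c.total.left_inv (F.subset (hNF hp))]
    have h3 : (fun ζ => (F.evec Φ D.toVF ζ).2) =ᶠ[𝓝 z]
        fun ζ => S (ζ, jet (k + 1 + (k + 1) + 1) (flatCoef Φ) ζ) := by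
      filter_upwards [(openGood_subm hO).nhds hO2,
        (F.c.total.continuousAt_symm h.1.1).eventually (hNo.mem_nhds hzN)] with ζ h4 h5
      rw [hTe Φ ζ h4 h5]
    rw [evec_lie_X hT h, h3.fderiv_eq, h3.eq_of_nhds, hSW Φ z hO2, hWX Φ z hO2,
      ← evec_eq_snd (hΩ.1 _).2 h]
  refine ⟨D.toVF, hT, ⟨N, hNo, heN, hNF, fun X f p hp => ?_⟩, fun f k' e' hf => D.ordAt_toVF hf⟩
  rw [apply_eq_sum (dfc₀_mem_V1 hT).2 (hNF hp), apply_eq_sum hΩ.2 (hNF hp)]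
  refine Finset.sum_congr rfl fun i _ => ?_
  rw [dfc₀_X hT.2 (hNF hp), hTd i f p hp]

end LocalFrame

end PrimitiveNear


/-! ### Acyclicity in degree one -/

section GlobalPrimitive

theorem fnBracket₀_sub {A : Type*} [CommRing A] [Algebra ℝ A]
    {U : Derivation ℝ A A →ₗ[A] Derivation ℝ A A} (S S' : Derivation ℝ A A) :
    fnBracket₀ U (S - S') = fnBracket₀ U S - fnBracket₀ U S' :=
  LinearMap.ext fun X => by
    show ⁅U X, S - S'⁆ - U ⁅X, S - S'⁆ = (⁅U X, S⁆ - U ⁅X, S⁆) - (⁅U X, S'⁆ - U ⁅X, S'⁆)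
    rw [lie_sub, lie_sub, map_sub]
    abel

set_option linter.unusedSectionVars false

variable {n m : ℕ} {M E : Type*}
  [TopologicalSpace M] [ChartedSpace (Rn n) M] [IsManifold (IB n) ∞ M]
  [T2Space M] [SecondCountableTopology M]
  [TopologicalSpace E] [ChartedSpace (ModelProd (Rn n) (Rn m)) E]
  [IsManifold (IT n m) ∞ E] [T2Space E] [SecondCountableTopology E]
  {π : E → M} [hch : HasAdaptedCharts n m π] {Ω : VF n m π →ₗ[smoothFc n m π] VF n m π}
  {p : Efc n m π} {S S' : VF n m π}

theorem dfc₀_sub_apply (S S' X : VF n m π) (f : smoothFc n m π) (p : Efc n m π) :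
    (dfc₀ (S - S') X f).1 p = (dfc₀ S X f).1 p - (dfc₀ S' X f).1 p :=
  congrArg (fun L : VF n m π →ₗ[smoothFc n m π] VF n m π => (L X f).1 p)
    (fnBracket₀_sub (U := fcForm n m π) S S')

/-- The differential is a local operator. -/
theorem dfc₀_congr_nhds {N : Set E} (hN : IsOpen N)
    (h : ∀ f (q : Efc n m π), q.1.pt ∈ N → (S f).1 q = (S' f).1 q) (hp : p.1.pt ∈ N) (X : VF n m π)
    (f : smoothFc n m π) : (dfc₀ S X f).1 p = (dfc₀ S' X f).1 p := by
  have key : ∀ (Y : VF n m π) f, (⁅Y, S⁆ f).1 p = (⁅Y, S'⁆ f).1 p := fun Y f => by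
    rw [LocalFrame.lie_apply, LocalFrame.lie_apply, h _ p hp,
      Y.congr_nhds (hN.mem_nhds hp) (fun q hq => h f q hq)]
  have hF := mem_frameAt (n := n) (m := m) (π := π) p.1.pt
  have h1 : (fcForm n m π ⁅X, S⁆ f).1 p = (fcForm n m π ⁅X, S'⁆ f).1 p := by
    rw [LocalFrame.fcForm_apply _ hF, LocalFrame.fcForm_apply _ hF]
    exact Finset.sum_congr rfl fun i _ => by rw [key]
  show (⁅fcForm n m π X, S⁆ f).1 p - (fcForm n m π ⁅X, S⁆ f).1 p =
    (⁅fcForm n m π X, S'⁆ f).1 p - (fcForm n m π ⁅X, S'⁆ f).1 p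
  rw [key, h1]

/-- The order of a vertical Cartan field on functions of order zero is its order on the
coordinates of the fibers. -/
theorem LocalFrame.ordAt_apply_pullE (F : LocalFrame n m π) (hS : S ∈ V0 n m π) {e : E}
    (he : e ∈ F.N) {k : ℕ} (hk : ∀ α, OrdAt k (S (pullE (F.v α))).1 e)
    (g : C^∞⟮IT n m, E; 𝓘(ℝ, ℝ), ℝ⟯) : OrdAt k (S (pullE g)).1 e := by
  have hu : ∀ z ∈ F.c.total.target, ContDiffAt ℝ ∞ (fun z => g (F.c.total.symm z)) z := fun z hz => by
    rw [← contMDiffAt_iff_contDiffAt]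
    exact g.contMDiff.contMDiffAt.comp z (F.c.contMDiffAt_total_symm hz)
  have h1 : ∀ α : Fin m, ∃ h : C^∞⟮IT n m, E; 𝓘(ℝ, ℝ), ℝ⟯, h =ᶠ[𝓝 e]
      fun y => fderiv ℝ (fun z => g (F.c.total.symm z)) (F.c.total y) (0, ex α) := by
    intro α
    refine exists_smooth_ext (IT n m) ?_
    filter_upwards [F.mem_nhds he] with y hy
    have h3 : ContDiffAt ℝ ∞ (fun z' => fderiv ℝ (fun z => g (F.c.total.symm z)) z' (0, ex α))
        (F.c.total y) :=
      (contDiffAt_fderiv (hu _ (F.c.total.map_source (F.subset hy)))).clm_apply contDiffAt_const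
    exact h3.contMDiffAt.comp y (F.c.contMDiffAt_total (F.subset hy))
  choose h hh using h1
  refine (OrdAt.sum Finset.univ (F.subset he)
    (f := fun α p => h α p.1.pt * (S (pullE (F.v α))).1 p)
    fun α _ => (ordAt_pullE (h α) _ e).mul (hk α)).congr
    (Filter.inter_mem (F.mem_nhds he) (Filter.eventually_all.2 hh)) fun p hp => ?_
  have h2 : cd F.c p (pullE g) = _ := cd_of_base (u := fun z => g (F.c.total.symm z))
    (F.subset hp.1) Filter.univ_mem fun q hq _ => by rw [pullE_apply, F.c.total.left_inv hq]
  have h4 : F.vec S p = ∑ α, (S (pullE (F.v α))).1 p • ((0 : Rn n), (ex α : Rn m)) := by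
    refine Prod.ext ?_ ?_
    · rw [Prod.fst_sum]
      simp only [Prod.smul_fst, smul_zero, Finset.sum_const_zero]
      show ∑ i, (S (pM (F.b i))).1 p • ex i = (0 : Rn n)
      refine Finset.sum_eq_zero fun i _ => ?_
      have h5 : S (pM (F.b i)) = 0 := hS.2 _
      rw [h5]
      exact zero_smul _ _
    · rw [Prod.snd_sum]
      rfl
  rw [F.apply_eq_vec hS.1 hp.1, h2, h4, map_sum]
  refine Finset.sum_congr rfl fun α _ => ?_
  rw [ContinuousLinearMap.map_smul, smul_eq_mul, mul_comm]
  exact congrArg (· * _) (hp.2 α).symm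

/-- A horizontal `1`-form has bounded order on fields of order one and functions of order zero. -/
theorem exists_ord_form (hΩ : Ω ∈ V1 n m π) : ∃ k, ∀ X : VF n m π,
    (∀ (f : smoothFc n m π) k e, OrdAt k f.1 e → OrdAt (k + 1) (X f).1 e) →
      ∀ g e, OrdAt k (Ω X (pullE g)).1 e := by
  have : LocallyCompactSpace E := Manifold.locallyCompact_of_finiteDimensional (IT n m)
  obtain ⟨k, hk⟩ := exists_uniform_order (B := E)
    (D := {X : VF n m π // ∀ (f : smoothFc n m π) k e, OrdAt k f.1 e → OrdAt (k + 1) (X f).1 e} ×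
      C^∞⟮IT n m, E; 𝓘(ℝ, ℝ), ℝ⟯)
    (fun k d e => OrdAt k (Ω d.1.1 (pullE d.2)).1 e)
    (fun k l d e hkl h => h.mono hkl) (fun d => exists_ordAt hch.exists_chart _)
    (fun e => by
      have he := mem_frameAt (n := n) (m := m) (π := π) e
      set F := frameAt n m π e
      choose k hk using fun i α => exists_ordAt hch.exists_chart (Ω (F.X i) (pullE (F.v α)))
      refine ⟨max 1 (Finset.univ.sup fun i => Finset.univ.sup (k i)), ?_⟩
      filter_upwards [F.mem_nhds he] with y hy d
      refine (OrdAt.sum Finset.univ (F.subset hy)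
        (f := fun i p => (d.1.1 (pM (F.b i))).1 p * (Ω (F.X i) (pullE d.2)).1 p) fun i _ =>
        ((d.1.2 _ 0 y (ordAt_pM (F.b i) 0 y)).mono (le_max_left _ _)).mul
          (F.ordAt_apply_pullE (hΩ.1 _) hy (fun α => (hk i α y).mono ?_) d.2)).congr
        (F.mem_nhds hy) fun p hp => LocalFrame.apply_eq_sum hΩ.2 hp _ _
      exact ((Finset.le_sup (f := k i) (Finset.mem_univ α)).trans (Finset.le_sup
        (f := fun i => Finset.univ.sup (k i)) (Finset.mem_univ i))).trans (le_max_right _ _))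
    (fun x N d hN hx hd hf => by
      obtain ⟨X', hX', h1⟩ := exists_vf_patch 1 hN hx hd hf (fun l => (d l).1.1)
        fun l => (d l).1.2
      obtain ⟨g', hg'⟩ := exists_smooth_patch (IT n m) hN hx hd hf fun l => (d l).2
      refine ⟨(⟨X', hX'⟩, g'), fun l k h => ?_⟩
      obtain ⟨W, hW, hWX⟩ := h1 l
      refine h.congr (Filter.inter_mem (interior_mem_nhds.2 hW) (hg' l).eventuallyEq_nhds)
        fun p hp => ?_
      have h2 := apply_eq_of_eq_on Ω (isOpen_interior.mem_nhds hp.1) hΩ.2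
        (fun g q hq => hWX (pM g) q (interior_subset hq)) (pullE (d l).2)
      refine h2.symm.trans ?_
      exact VF.congr_nhds _ hp.2 fun q hq => hq.symm)
  exact ⟨k, fun X hX g e => hk (⟨X, hX⟩, g) e⟩

/-- Closed horizontal `1`-forms with vertical values are exact. -/
theorem exists_dfc₀_eq (hn : 2 ≤ n) (hΩ : Ω ∈ V1 n m π) (hd : ∀ X Y, dfc₁ Ω X Y = 0) :
    ∃ S ∈ V0 n m π, dfc₀ S = Ω := by
  obtain ⟨k, hk⟩ := exists_ord_form hΩ
  choose T hT hTΩ hord using fun e => (frameAt n m π e).exists_primitive_near hn hΩ hd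
    (mem_frameAt e) fun i α => hk _ ((frameAt n m π e).ordAt_X i) ((frameAt n m π e).v α) e
  choose N hN heN hNF hTΩ using hTΩ
  let D : CompatibleFamily n m π :=
    { S := T
      N := N
      mem_nhds := fun e => (hN e).mem_nhds (heN e)
      agree := fun e e' f p hp hp' => by
        -- the difference of two primitives is closed, hence zero
        refine sub_eq_zero.1 ((frameAt n m π e).eq_zero_of_dfc₀ (S := T e - T e')
          (by omega) ⟨(hT e).1.sub (hT e').1, fun g => ?_⟩ ((hN e).inter (hN e'))
          (fun y hy => hNF e hy.1) (fun X f q hq => ?_) ⟨hp, hp'⟩ f)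
        · rw [Derivation.sub_apply, (hT e).2, (hT e').2, sub_zero]
        · rw [dfc₀_sub_apply, hTΩ e X f q hq.1, hTΩ e' X f q hq.2, sub_self]
      ord := fun f => by
        obtain ⟨l, hl⟩ := exists_ordAt hch.exists_chart f
        exact ⟨_, fun e => hord e f l e (hl e)⟩ }
  refine ⟨D.glue, ⟨D.isCartan_glue fun e => (hT e).1, fun g => Subtype.ext (funext fun p => ?_)⟩,
    LinearMap.ext fun X => Derivation.ext fun f => Subtype.ext (funext fun p => ?_)⟩
  · rw [CompatibleFamily.glue_apply_pt]
    exact congrFun (congrArg Subtype.val ((hT p.1.pt).2 g)) p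
  · rw [dfc₀_congr_nhds (hN p.1.pt) (fun f q hq => D.glue_apply hq f) (heN _)]
    exact hTΩ _ X f p (heN _)

end GlobalPrimitive

end FlatConn

end

theorem theorem3p2 (n m : ℕ) (hn : 1 ≤ n) {M E F : Type*}
    [TopologicalSpace M] [ChartedSpace (FlatConn.Rn n) M] [IsManifold (FlatConn.IB n) ∞ M]
    [T2Space M] [SecondCountableTopology M]
    [TopologicalSpace E] [ChartedSpace (ModelProd (FlatConn.Rn n) (FlatConn.Rn m)) E]
    [IsManifold (FlatConn.IT n m) ∞ E] [T2Space E] [SecondCountableTopology E]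
    [TopologicalSpace F] [ChartedSpace (FlatConn.Rn m) F]
    [IsManifold (FlatConn.IB m) ∞ F]
    (π : E → M) (hπ : FlatConn.IsSmoothFiberBundle n m F π) :
    -- the vector-valued form of the connection `C_fc` on `E_fc` exists and is unique
    (FlatConn.IsFcForm (FlatConn.fcForm n m π) ∧
      ∀ U : FlatConn.VF n m π →ₗ[FlatConn.smoothFc n m π] FlatConn.VF n m π,
        FlatConn.IsFcForm U → U = FlatConn.fcForm n m π) ∧
    -- the complex is 0-acyclic
    {S ∈ FlatConn.V0 n m π | FlatConn.dfc₀ S = 0} = {0} ∧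
    -- the complex is 1-acyclic
    (2 ≤ n → FlatConn.dfc₀ '' FlatConn.V0 n m π =
      {Ω ∈ FlatConn.V1 n m π | ∀ X Y, FlatConn.dfc₁ Ω X Y = 0}) := by
  have hch : FlatConn.HasAdaptedCharts n m π := ⟨FlatConn.exists_adaptedChart hπ⟩
  refine ⟨⟨FlatConn.isFcForm_fcForm, fun U hU => hU.eq_fcForm⟩, ?_, fun hn2 => ?_⟩
  · ext S
    constructor
    · rintro ⟨hS, h⟩
      exact FlatConn.eq_zero_of_dfc₀_eq_zero hn hS h
    · rintro rfl
      exact ⟨FlatConn.zero_mem_V0, FlatConn.dfc₀_zero⟩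
  · ext Ω
    constructor
    · rintro ⟨S, hS, rfl⟩
      exact ⟨FlatConn.dfc₀_mem_V1 hS, FlatConn.dfc₁_dfc₀ hS.2⟩
    · rintro ⟨hΩ, hd⟩
      exact FlatConn.exists_dfc₀_eq hn2 hΩ hd
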